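/- Let $n\ge 3$ and $N=\frac{2n}{n-2}$. Let $\overline M$ be a compact smooth $n$-dimensional manifold with boundary $\partial M$, $M=\overline M\setminus\partial M$ its interior, and $\rho\ge 0$ a smooth function on $\overline M$ with $\rho^{-1}(0)=\partial M$ and $d\rho\ne 0$ on $\partial M$. Let $g$ be an asymptotically hyperbolic metric on $M$: $\rho^2 g$ extends to a Riemannian metric $\overline g$ of class $C^2$ on $\overline M$ (for instance of class $C^{l,\beta}$ with $l\ge2$, $0\le\beta<1$) such that $|d\rho|^2_{\overline g}=1$ on $\partial M$. For $r>0$ and $1\le p\le\infty$, let $X^{2,p}_0(M,\mathbb R)$ be the set of functions $u$ on $M$ that have weak derivatives up to order two and satisfy $\sup_{x\in M}\sum_{i=0}^{2}\big\|\,|\nabla^{(i)}u|_g\,\big\|_{L^p(B_r(x),\,d\mu^g)}<\infty$, where $B_r(x)\subset M$ is the ball of the Riemannian distance of $g$. For a Riemannian metric $k$ on $M$ whose coefficients are regular enough for its scalar curvature $\mathrm{Scal}^k$ to be defined through weak derivatives in local coordinates, let $W^{1,2}_0(M,k)$ be the space of functions $u\in L^2(M,d\mu^k)$ with weak differential $du$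 such that $|du|_k\in L^2(M,d\mu^k)$, and set $$G_k(u)=\int_M\Big[\tfrac{4(n-1)}{n-2}|du|_k^2+\mathrm{Scal}^k\,u^2\Big]d\mu^k .$$ For $V\subset M$ measurable let $\mathcal F_k(V)=\{u\in W^{1,2}_0(M,k):\ u=0\text{ a.e. on }M\setminus V\}$ and define the local Yamabe invariant $$\mathcal Y_k(V)=\inf_{u\in\mathcal F_k(V)\setminus\{0\}}\frac{G_k(u)}{\|u\|^2_{L^N(M,d\mu^k)}}\in[-\infty,+\infty],$$ with $\mathcal Y_k(V)=+\infty$ if $\mathcal F_k(V)=\{0\}$. Let $r>0$, $p\in(n/2,\infty]$, and let $\phi>0$ be a function on $M$ such that $\phi\in X^{2,p}_0(M,\mathbb R)$ and $\phi^{-1}\in X^{2,p}_0(M,\mathbb R)$. Let $h=\phi^{N-2}g$. Then $h$ has a scalar curvature in the weak sense, the integral defining $G_h(u)$ converges absolutely for every $u\in W^{1,2}_0(M,h)$, and for every (Lebesgue) measurable set $V\subset M$, $$\mathcal Y_g(V)=\mathcal Y_h(V).$$ -/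

import Mathlib

open MeasureTheory Set
open scoped Manifold ContDiff ENNReal Topology

noncomputable section

namespace LocalYamabe

/-! ### Linear algebra of a scalar product -/

/-- The `i`-th standard basis vector of `ℝⁿ`. -/
abbrev stdVec {n : ℕ} (i : Fin n) : EuclideanSpace ℝ (Fin n) := EuclideanSpace.single i 1

/-- The Gram matrix of a bilinear form in the standard basis. -/
def gram {n : ℕ} (B : EuclideanSpace ℝ (Fin n) →L[ℝ] EuclideanSpace ℝ (Fin n) →L[ℝ] ℝ) :
    Matrix (Fin n) (Fin n) ℝ :=
  Matrix.of fun i j => B (stdVec i) (stdVec j)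

/-- The squared norm `B^{ij} α_i α_j` of a covector (independent of the basis). -/
def covectorNormSq {n : ℕ} (B : EuclideanSpace ℝ (Fin n) →L[ℝ] EuclideanSpace ℝ (Fin n) →L[ℝ] ℝ)
    (α : EuclideanSpace ℝ (Fin n) →L[ℝ] ℝ) : ℝ :=
  ∑ i, ∑ j, (gram B)⁻¹ i j * α (stdVec i) * α (stdVec j)

/-- The squared norm `B^{ik} B^{jl} T_{ij} T_{kl}` of a 2-tensor (independent of the basis). -/
def tensorNormSq {n : ℕ} (B : EuclideanSpace ℝ (Fin n) →L[ℝ] EuclideanSpace ℝ (Fin n) →L[ℝ] ℝ)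
    (T : EuclideanSpace ℝ (Fin n) →L[ℝ] EuclideanSpace ℝ (Fin n) →L[ℝ] ℝ) : ℝ :=
  ∑ i, ∑ j, ∑ k, ∑ l, (gram B)⁻¹ i k * (gram B)⁻¹ j l *
    T (stdVec i) (stdVec j) * T (stdVec k) (stdVec l)

/-! ### Weak partial derivatives on open subsets of `ℝⁿ` -/

/-- `f'` is the weak derivative of `f` in the direction of the `i`-th coordinate, on the open
set `D`. -/
def HasWeakPartial {n : ℕ} (D : Set (EuclideanSpace ℝ (Fin n))) (i : Fin n)
    (f f' : EuclideanSpace ℝ (Fin n) → ℝ) : Prop :=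
  LocallyIntegrableOn f D ∧ LocallyIntegrableOn f' D ∧
    ∀ ψ : EuclideanSpace ℝ (Fin n) → ℝ, ContDiff ℝ ∞ ψ → HasCompactSupport ψ → tsupport ψ ⊆ D →
      ∫ y, f y * fderiv ℝ ψ y (stdVec i) = - ∫ y, f' y * ψ y

open Classical in
/-- The weak partial derivative of `f` on `D` (unique up to null sets), `0` if there is none. -/
def weakPartial {n : ℕ} (D : Set (EuclideanSpace ℝ (Fin n))) (i : Fin n)
    (f : EuclideanSpace ℝ (Fin n) → ℝ) : EuclideanSpace ℝ (Fin n) → ℝ :=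
  if h : ∃ f', HasWeakPartial D i f f' then h.choose else 0

/-! ### Tensor fields, in local coordinates

`M` is a manifold with boundary; all the objects below live on its interior. Functions and tensor
fields are indexed by all the points of `M`, and their values on the boundary play no role. -/

section Manifold

variable {n : ℕ} [NeZero n] {M : Type*} [TopologicalSpace M]
  [ChartedSpace (EuclideanHalfSpace n) M]

variable (n M) in
/-- Fields of covectors. -/
abbrev CovectorField : Type _ := (x : M) → TangentSpace (𝓡∂ n) x →L[ℝ] ℝ

variable (n M) in
/-- Fields of bilinear forms. Riemannian metrics are such fields. -/
abbrev BilinField : Type _ :=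
  (x : M) → TangentSpace (𝓡∂ n) x →L[ℝ] TangentSpace (𝓡∂ n) x →L[ℝ] ℝ

/-- The open subset of `ℝⁿ` on which the coordinates around `x₀` take their values, restricted to
interior points of the manifold. -/
def coordDomain (x₀ : M) : Set (EuclideanSpace ℝ (Fin n)) :=
  interior (extChartAt (𝓡∂ n) x₀).target

/-- The coordinate vector field `∂_i` of the chart around `x₀`, at the point of coordinates `y`. -/
def coordVec (x₀ : M) (y : EuclideanSpace ℝ (Fin n)) (i : Fin n) :
    TangentSpace (𝓡∂ n) ((extChartAt (𝓡∂ n) x₀).symm y) :=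
  mfderiv 𝓘(ℝ, EuclideanSpace ℝ (Fin n)) (𝓡∂ n) (extChartAt (𝓡∂ n) x₀).symm y (stdVec i)

/-- The component `α_i` of a covector field in the chart around `x₀`. -/
def covectorCoord (α : CovectorField n M) (x₀ : M) (i : Fin n) (y : EuclideanSpace ℝ (Fin n)) : ℝ :=
  α ((extChartAt (𝓡∂ n) x₀).symm y) (coordVec x₀ y i)

/-- The component `T_{ij}` of a field of bilinear forms in the chart around `x₀`. -/
def bilinCoord (T : BilinField n M) (x₀ : M) (i j : Fin n) (y : EuclideanSpace ℝ (Fin n)) : ℝ :=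
  T ((extChartAt (𝓡∂ n) x₀).symm y) (coordVec x₀ y i) (coordVec x₀ y j)

/-- The matrix `(g_{ij})` of a metric in the chart around `x₀`. -/
def metricMatrix (g : BilinField n M) (x₀ : M) (y : EuclideanSpace ℝ (Fin n)) :
    Matrix (Fin n) (Fin n) ℝ :=
  Matrix.of fun i j => bilinCoord g x₀ i j y

/-- The Christoffel symbol `Γ^k_{ij}` of a metric in the chart around `x₀`. -/
def christoffel (g : BilinField n M) (x₀ : M) (k i j : Fin n) (y : EuclideanSpace ℝ (Fin n)) : ℝ :=
  (1 / 2) * ∑ l, (metricMatrix g x₀ y)⁻¹ k l *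
    (weakPartial (coordDomain x₀) i (bilinCoord g x₀ j l) y
      + weakPartial (coordDomain x₀) j (bilinCoord g x₀ i l) y
      - weakPartial (coordDomain x₀) l (bilinCoord g x₀ i j) y)

/-- The component `Ric_{ij} = ∂_k Γ^k_{ij} - ∂_j Γ^k_{ik} + Γ^k_{kl} Γ^l_{ij} - Γ^k_{jl} Γ^l_{ik}`
of the Ricci tensor of a metric in the chart around `x₀`. -/
def ricciCoord (g : BilinField n M) (x₀ : M) (i j : Fin n) (y : EuclideanSpace ℝ (Fin n)) : ℝ :=
  ∑ k, (weakPartial (coordDomain x₀) k (christoffel g x₀ k i j) y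
      - weakPartial (coordDomain x₀) j (christoffel g x₀ k i k) y)
    + ∑ k, ∑ l, (christoffel g x₀ k k l y * christoffel g x₀ l i j y
      - christoffel g x₀ k j l y * christoffel g x₀ l i k y)

/-- `S` is the scalar curvature `g^{ij} Ric_{ij}` of the metric `g`. The metric need not be of class
`C²`: all derivatives are weak ones, and their existence is part of the definition. -/
def IsScalarCurvature (g : BilinField n M) (S : M → ℝ) : Prop :=
  ∀ x₀ : M,
    (∀ i j k, ∃ f', HasWeakPartial (coordDomain x₀) k (bilinCoord g x₀ i j) f') ∧
    (∀ k i j l, ∃ f', HasWeakPartial (coordDomain x₀) l (christoffel g x₀ k i j) f') ∧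
    ∀ᵐ y ∂(volume.restrict (coordDomain x₀)),
      S ((extChartAt (𝓡∂ n) x₀).symm y) =
        ∑ i, ∑ j, (metricMatrix g x₀ y)⁻¹ i j * ricciCoord g x₀ i j y

/-- The metric `g` is regular enough to have a scalar curvature. -/
def HasScalarCurvature (g : BilinField n M) : Prop := ∃ S : M → ℝ, IsScalarCurvature g S

open Classical in
/-- The scalar curvature of `g` (unique up to null sets), `0` if there is none. -/
def scal (g : BilinField n M) : M → ℝ :=
  if h : HasScalarCurvature g then h.choose else 0

/-- `α` is the weak differential of `u` on the interior of `M`. -/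
def IsWeakDifferential (u : M → ℝ) (α : CovectorField n M) : Prop :=
  ∀ (x₀ : M) (i : Fin n), HasWeakPartial (coordDomain x₀) i
    (u ∘ (extChartAt (𝓡∂ n) x₀).symm) (covectorCoord α x₀ i)

variable (n) in
/-- The function `u` has a weak differential on the interior of `M`. -/
def IsWeaklyDifferentiable (u : M → ℝ) : Prop := ∃ α : CovectorField n M, IsWeakDifferential u α

variable (n) in
open Classical in
/-- The weak differential `du` (unique up to null sets), `0` if there is none. -/
def weakDifferential (u : M → ℝ) : CovectorField n M :=
  if h : IsWeaklyDifferentiable n u then h.choose else fun _ => 0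

/-- `T` is the covariant derivative `∇α` of the covector field `α`, in the weak sense:
`∂_j α_i = T_{ij} + Γ^k_{ij} α_k`. For `α = du` this is the Hessian `∇^{(2)} u`. -/
def IsWeakCovariantDerivative (g : BilinField n M) (α : CovectorField n M) (T : BilinField n M) :
    Prop :=
  ∀ (x₀ : M) (i j : Fin n), HasWeakPartial (coordDomain x₀) j (covectorCoord α x₀ i)
    fun y => bilinCoord T x₀ i j y + ∑ k, christoffel g x₀ k i j y * covectorCoord α x₀ k y

/-- The pointwise norm `|α|_g`. -/
def covectorNorm (g : BilinField n M) (α : CovectorField n M) (x : M) : ℝ :=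
  Real.sqrt (covectorNormSq (g x) (α x))

/-- The pointwise norm `|T|_g`. -/
def tensorNorm (g : BilinField n M) (T : BilinField n M) (x : M) : ℝ :=
  Real.sqrt (tensorNormSq (g x) (T x))

/-! ### Riemannian distance and Riemannian measure -/

/-- The length, for the metric `g`, of a curve defined on `[0, 1]`. -/
def curveLength (g : BilinField n M) (γ : ℝ → M) : ℝ≥0∞ :=
  ∫⁻ t in Icc (0 : ℝ) 1, ENNReal.ofReal (Real.sqrt
    (g (γ t) (mfderiv 𝓘(ℝ, ℝ) (𝓡∂ n) γ t (1 : ℝ)) (mfderiv 𝓘(ℝ, ℝ) (𝓡∂ n) γ t (1 : ℝ))))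

/-- The Riemannian distance of the interior of `M`: the infimum of the lengths of `C¹` curves that
stay in the interior. -/
def riemDist (g : BilinField n M) (x y : M) : ℝ≥0∞ :=
  ⨅ (γ : ℝ → M) (_ : ContMDiffOn 𝓘(ℝ, ℝ) (𝓡∂ n) 1 γ (Icc 0 1) ∧
    (∀ t ∈ Icc (0 : ℝ) 1, γ t ∈ (𝓡∂ n).interior M) ∧ γ 0 = x ∧ γ 1 = y), curveLength g γ

/-- The ball of radius `r` centered at `x` in the interior of `M`. -/
def riemBall (g : BilinField n M) (x : M) (r : ℝ) : Set M :=
  {y | y ∈ (𝓡∂ n).interior M ∧ riemDist g x y < ENNReal.ofReal r}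

variable [MeasurableSpace M]

/-- The Riemannian measure of `g`, restricted to the domain of the chart around `x₀`: it is
`√det(g_{ij}) dy` in the coordinates `y`. -/
def chartVolume (g : BilinField n M) (x₀ : M) : Measure M :=
  (((volume.restrict (coordDomain x₀)).withDensity fun y =>
    ENNReal.ofReal (Real.sqrt (metricMatrix g x₀ y).det)).map (extChartAt (𝓡∂ n) x₀).symm)

/-- The Riemannian measure `μ^g` of the interior of `M`. The measures `chartVolume g x₀` are the
restrictions of a single measure to open sets that cover the interior; that measure is their
supremum in the lattice of measures. It does not charge the boundary. -/
def riemVolume (g : BilinField n M) : Measure M := ⨆ x₀ : M, chartVolume g x₀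

/-! ### Function spaces of weight zero -/

/-- The space `W^{1,2}_0(M, ℝ)` of the metric `g` (weight `δ = 0`, so that `ρ^{-δ} = 1`). -/
def MemW12 (g : BilinField n M) (u : M → ℝ) : Prop :=
  IsWeaklyDifferentiable n u ∧ MemLp u 2 (riemVolume g) ∧
    MemLp (covectorNorm g (weakDifferential n u)) 2 (riemVolume g)

/-- The weighted local Sobolev space `X^{2,p}_0(M, ℝ)` of the metric `g` (weight `δ = 0`), defined
with the balls of radius `r`: the `W^{2,p}` norms on these balls are bounded. -/
def MemX2 (g : BilinField n M) (r : ℝ) (p : ℝ≥0∞) (u : M → ℝ) : Prop :=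
  IsWeaklyDifferentiable n u ∧ ∃ T : BilinField n M,
    IsWeakCovariantDerivative g (weakDifferential n u) T ∧
    (⨆ x ∈ (𝓡∂ n).interior M,
      (eLpNorm u p ((riemVolume g).restrict (riemBall g x r))
        + eLpNorm (covectorNorm g (weakDifferential n u)) p
            ((riemVolume g).restrict (riemBall g x r))
        + eLpNorm (tensorNorm g T) p ((riemVolume g).restrict (riemBall g x r)))) < ⊤

/-! ### The local Yamabe invariant -/

variable (n) in
/-- The exponent `N = 2n / (n - 2)`. -/
def critExp : ℝ := 2 * n / (n - 2)

/-- The integrand `4(n-1)/(n-2) |du|² + Scal u²` of the functional `G_g`. -/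
def energyDensity (g : BilinField n M) (u : M → ℝ) (x : M) : ℝ :=
  4 * ((n : ℝ) - 1) / (n - 2) * covectorNorm g (weakDifferential n u) x ^ 2 + scal g x * u x ^ 2

/-- The functional `G_g`. -/
def energy (g : BilinField n M) (u : M → ℝ) : ℝ := ∫ x, energyDensity g u x ∂(riemVolume g)

/-- The Yamabe quotient `G_g(u) / ‖u‖²_{L^N}`. -/
def yamabeQuotient (g : BilinField n M) (u : M → ℝ) : ℝ :=
  energy g u / (eLpNorm u (ENNReal.ofReal (critExp n)) (riemVolume g)).toReal ^ 2

/-- The space `F(V)` of the functions of `W^{1,2}_0(M, ℝ)` that vanish almost everywhere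
outside `V`. -/
def sobolevOn (g : BilinField n M) (V : Set M) : Set (M → ℝ) :=
  {u | MemW12 g u ∧ ∀ᵐ x ∂(riemVolume g), x ∉ V → u x = 0}

/-- The local Yamabe invariant of `V`; it is `∞` if `F(V)` is reduced to `0`. -/
def localYamabe (g : BilinField n M) (V : Set M) : EReal :=
  ⨅ (u : M → ℝ) (_ : u ∈ sobolevOn g V ∧ ¬ u =ᵐ[riemVolume g] 0), (yamabeQuotient g u : EReal)

/-! ### Asymptotically hyperbolic metrics -/

variable (n) in
/-- `ρ` is a defining function for the boundary of `M`. -/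
structure IsDefiningFunction (ρ : M → ℝ) : Prop where
  smooth : ContMDiff (𝓡∂ n) 𝓘(ℝ, ℝ) ∞ ρ
  nonneg : ∀ x, 0 ≤ ρ x
  eq_zero_iff : ∀ x, ρ x = 0 ↔ x ∈ (𝓡∂ n).boundary M
  mfderiv_ne_zero : ∀ x ∈ (𝓡∂ n).boundary M, mfderiv (𝓡∂ n) 𝓘(ℝ, ℝ) ρ x ≠ 0

/-- The metric `g` on the interior of `M` is (`C²`-)asymptotically hyperbolic: `ρ² g` extends to a
Riemannian metric of class `C²` on `M`, for which `|dρ|² = 1` on the boundary. -/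
def IsAsymptoticallyHyperbolic [IsManifold (𝓡∂ n) ∞ M] (ρ : M → ℝ) (g : BilinField n M) : Prop :=
  ∃ gbar : Bundle.ContMDiffRiemannianMetric (𝓡∂ n) 2 (EuclideanSpace ℝ (Fin n))
      (fun x : M => TangentSpace (𝓡∂ n) x),
    (∀ x ∈ (𝓡∂ n).interior M, gbar.inner x = ρ x ^ 2 • g x) ∧
    ∀ x ∈ (𝓡∂ n).boundary M,
      covectorNormSq (gbar.inner x) (mfderiv (𝓡∂ n) 𝓘(ℝ, ℝ) ρ x) = 1

/-- The conformal metric `φ^{N-2} g`. -/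
def conformal (φ : M → ℝ) (g : BilinField n M) : BilinField n M :=
  fun x => φ x ^ (critExp n - 2) • g x

end Manifold

end LocalYamabe

end

set_option linter.unusedSectionVars false

open MeasureTheory Set
open scoped Manifold ContDiff ENNReal Topology
open Metric (ball closedBall)
open ENNReal (ofReal ofReal_ne_top)
open Finset (sum_congr mul_sum sum_mul sum_comm sum_add_distrib sum_sub_distrib sum_le_sum)

noncomputable section

namespace LocalYamabe

/-! ### Notation -/

-- The substitution `u ↦ φ u` identifies the two minimization problems. Write `c = 4(n-1)/(n-2)`.
-- For `h = φ^(N-2) g` one has `dμ^h = φ^N dμ^g`, `|du|_h² = φ^(-(N-2)) |du|_g²` and `Scal^h =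
-- φ^(-(N-2)) (Scal^g - c φ⁻¹ Δφ)`, where `Δ` is the trace of the Hessian. Hence `φ^N` times the
-- integrand of `G_h(u)` is the integrand of `G_g(φ u)` minus `c` times the divergence of `φ u² ∇φ`,
-- while `‖u‖` in `L^N(h)` equals `‖φ u‖` in `L^N(g)`. Vanishing outside `V` is preserved in both
-- directions, so the invariants agree once three points are settled: multiplication by `φ` and by
-- `φ⁻¹` preserves `W^{1,2}` (`IsW12.mul`); the formula for `Scal^h` holds in the weak sense
-- (`IsConfFactor.isScalarCurvature`); the divergence is integrable with integral zero
-- (`IsConfFactor.integral_divergence_eq_zero`). They are combined in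
-- `IsConfFactor.energy_conformal`.
--
-- These points rest on estimates that are uniform up to the boundary at infinity. Since `ρ² g`
-- extends to a `C²` metric, every point of the compact manifold has coordinates in which `g` is
-- comparable with `ρ⁻²` times the Euclidean metric, with Christoffel symbols `O(ρ⁻¹)` and their
-- derivatives `O(ρ⁻²)` (`IsPatch`). A Euclidean ball of radius `ε ρ(y)` around `y`, rescaled to
-- unit size, then has uniformly controlled geometry and lies in a Riemannian ball of radius `r`. On
-- it an `X^{2,p}` bound becomes a `W^{2,q}` bound for some `n/2 < q < n`; Sobolev's inequality
-- followed by Morrey's bounds the function uniformly, and its gradient in `L^n`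
-- (`IsPatch.exists_scale_bound`). Applied to `φ` and `φ⁻¹`, this places `φ` between two positive
-- constants almost everywhere.
--
-- Moreover `|dφ|²` and `|∇²φ|` are uniformly in `L^{n/2}` at these scales. For a potential `F` of
-- this kind, Hölder's inequality and the embedding of `W^{1,2}` in `L^N` on each rescaled ball give
-- `∫ F u² < ∞` for `u` in `W^{1,2}` (`IsConfCompact.lintegral_mul_sq_lt_top`). The local estimates
-- are added up by integrating over the centres of the balls
-- (`exists_lintegral_const_of_variable_balls`). Hence `|dφ| u` is in `L²` and `|∇²φ| u²` is in
-- `L¹`.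
--
-- No boundary term appears in the divergence theorem: since `|dρ|_g = O(ρ)`, the cutoffs `χ(kρ)`
-- have `g`-gradients bounded independently of `k`, and dominated convergence applies
-- (`IsConfCompact.integral_bilinTrace_eq_zero`).
--
-- The scalar curvature is defined by weak derivatives in every chart at once. Its existence for the
-- `C²` metric `g` therefore requires the tensoriality of the curvature
-- (`IsC2Metric.scalChart_transition`). For `h`, the formula is derived almost everywhere in each
-- chart from the algebraic identities `ricci_confDiff` and `trace_ricci_confDiff`.

notation:max "𝔼" n:max => EuclideanSpace ℝ (Fin n)
notation:max "𝔠" n:max => extChartAt (𝓡∂ n)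
notation:max "𝔻" n:max => coordDomain (n := n)
notation:max "𝔳" n:max o:max => volume.restrict (coordDomain (n := n) o)
notation:max "𝔹" n:max => EuclideanSpace ℝ (Fin n) →L[ℝ] EuclideanSpace ℝ (Fin n) →L[ℝ] ℝ
notation:max "𝔾" g:max o:max y:max => (metricMatrix g o y)⁻¹
notation:max "ê" => stdVec
notation:max "𝐃" f:max => fderiv ℝ f

variable {n : ℕ}

/-! ### Weak partial derivatives: first properties -/

section

variable {D : Set (𝔼 n)} {i : Fin n} {f f' f₁ f₁' f₂ f₂' : 𝔼 n → ℝ}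

lemma integrable_mul_test {ψ : 𝔼 n → ℝ} (hf : LocallyIntegrableOn f D) (hψ : Continuous ψ)
    (hc : HasCompactSupport ψ) (hs : tsupport ψ ⊆ D) : Integrable fun y => f y * ψ y := by
  have h1 : IntegrableOn f (tsupport ψ) := hf.integrableOn_compact_subset hs hc
  have h2 : IntegrableOn (fun y => f y * ψ y) (tsupport ψ) := h1.mul_continuousOn hψ.continuousOn hc
  refine (integrableOn_iff_integrable_of_support_subset ?_).1 h2
  intro y hy
  apply subset_tsupport
  intro h
  exact hy (by simp [h])

lemma integral_mul_test_congr {ψ : 𝔼 n → ℝ} (h : ∀ᵐ y ∂volume.restrict D, f₁ y = f₂ y)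
    (hD : MeasurableSet D) (hs : tsupport ψ ⊆ D) : ∫ y, f₁ y * ψ y = ∫ y, f₂ y * ψ y := by
  apply integral_congr_ae
  rw [ae_restrict_iff' hD] at h
  filter_upwards [h] with y hy
  by_cases hyD : y ∈ D
  · rw [hy hyD]
  · rw [image_eq_zero_of_notMem_tsupport fun h => hyD (hs h)]; simp

lemma locallyIntegrableOn_congr (h : ∀ᵐ y ∂volume.restrict D, f₁ y = f₂ y)
    (hf : LocallyIntegrableOn f₁ D) : LocallyIntegrableOn f₂ D := by
  intro x hx
  obtain ⟨U, hU, hUi⟩ := hf x hx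
  refine ⟨U ∩ D, Filter.inter_mem hU self_mem_nhdsWithin, ?_⟩
  refine (hUi.mono_set inter_subset_left).congr ?_
  exact ae_mono (Measure.restrict_mono inter_subset_right le_rfl) h

lemma tsupport_fderiv_apply_subset' (ψ : 𝔼 n → ℝ) (v : 𝔼 n) :
    tsupport (fun y => 𝐃 ψ y v) ⊆ tsupport ψ := (tsupport_fderiv_apply_subset ℝ v)

lemma HasWeakPartial.congr (hD : MeasurableSet D) (h : HasWeakPartial D i f₁ f₁')
    (h1 : ∀ᵐ y ∂volume.restrict D, f₁ y = f₂ y) (h2 : ∀ᵐ y ∂volume.restrict D, f₁' y = f₂' y) :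
    HasWeakPartial D i f₂ f₂' := by
  refine ⟨locallyIntegrableOn_congr h1 h.1, locallyIntegrableOn_congr h2 h.2.1, ?_⟩
  intro ψ hψ hc hs
  rw [← integral_mul_test_congr h1 hD ((tsupport_fderiv_apply_subset' ψ (ê i)).trans hs),
    ← integral_mul_test_congr h2 hD hs]
  exact h.2.2 ψ hψ hc hs

/-- The difference of the two candidates integrates to zero against every test function, so the
fundamental lemma of the calculus of variations applies. -/
lemma HasWeakPartial.ae_eq (hD : IsOpen D) (h1 : HasWeakPartial D i f f₁')
    (h2 : HasWeakPartial D i f f₂') : ∀ᵐ y ∂volume.restrict D, f₁' y = f₂' y := by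
  rw [ae_restrict_iff' hD.measurableSet]
  have := hD.ae_eq_zero_of_integral_contDiff_smul_eq_zero (h1.2.1.sub h2.2.1) (μ := volume) ?_
  · filter_upwards [this] with y hy hyD
    exact sub_eq_zero.1 (hy hyD)
  · intro ψ hψ hc hs
    have e1 := h1.2.2 ψ hψ hc hs
    have e2 := h2.2.2 ψ hψ hc hs
    have e3 : ∫ y, f₁' y * ψ y = ∫ y, f₂' y * ψ y := by linarith
    have i1 := integrable_mul_test h1.2.1 hψ.continuous hc hs
    have i2 := integrable_mul_test h2.2.1 hψ.continuous hc hs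
    have : ∫ y, (f₁' y * ψ y - f₂' y * ψ y) = 0 := by rw [integral_sub i1 i2, e3, sub_self]
    rw [← this]
    congr 1; ext y; simp [smul_eq_mul]; ring

/-- `weakPartial` is an unspecified choice. Through this lemma an explicit derivative takes its
place, almost everywhere, in the Christoffel symbols and in the Ricci tensor. -/
lemma HasWeakPartial.weakPartial_ae_eq (hD : IsOpen D) (h : HasWeakPartial D i f f') :
    ∀ᵐ y ∂volume.restrict D, weakPartial D i f y = f' y := by
  have hex : ∃ f', HasWeakPartial D i f f' := ⟨f', h⟩
  have : weakPartial D i f = hex.choose := by rw [weakPartial, dif_pos hex]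
  rw [this]
  exact HasWeakPartial.ae_eq hD hex.choose_spec h

lemma continuous_fderiv_const {ψ : 𝔼 n → ℝ} (hψ : ContDiff ℝ ∞ ψ) (v : 𝔼 n) :
    Continuous fun y => 𝐃 ψ y v := (hψ.continuous_fderiv (by simp)).clm_apply continuous_const

lemma integrable_mul_fderiv_test {ψ : 𝔼 n → ℝ} (hf : LocallyIntegrableOn f D) (hψ : ContDiff ℝ ∞ ψ)
    (hc : HasCompactSupport ψ) (hs : tsupport ψ ⊆ D) (v : 𝔼 n) :
    Integrable fun y => f y * 𝐃 ψ y v := by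
  have hcont := continuous_fderiv_const hψ v
  exact integrable_mul_test hf hcont (hc.fderiv_apply (𝕜 := ℝ) v)
      ((tsupport_fderiv_apply_subset' ψ v).trans hs)

lemma HasWeakPartial.add (h1 : HasWeakPartial D i f₁ f₁') (h2 : HasWeakPartial D i f₂ f₂') :
    HasWeakPartial D i (fun y => f₁ y + f₂ y) (fun y => f₁' y + f₂' y) := by
  refine ⟨h1.1.add h2.1, h1.2.1.add h2.2.1, ?_⟩
  intro ψ hψ hc hs
  simp only [add_mul]
  rw [integral_add (integrable_mul_fderiv_test h1.1 hψ hc hs _)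
      (integrable_mul_fderiv_test h2.1 hψ hc hs _),
    integral_add (integrable_mul_test h1.2.1 hψ.continuous hc hs)
      (integrable_mul_test h2.2.1 hψ.continuous hc hs), h1.2.2 ψ hψ hc hs, h2.2.2 ψ hψ hc hs]
  ring

lemma HasWeakPartial.const_mul (h1 : HasWeakPartial D i f₁ f₁') (c : ℝ) :
    HasWeakPartial D i (fun y => c * f₁ y) (fun y => c * f₁' y) := by
  refine ⟨h1.1.smul c, h1.2.1.smul c, ?_⟩
  intro ψ hψ hc hs
  simp only [mul_assoc, integral_const_mul, h1.2.2 ψ hψ hc hs]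
  ring

lemma HasWeakPartial.neg (h1 : HasWeakPartial D i f₁ f₁') :
    HasWeakPartial D i (fun y => - f₁ y) (fun y => - f₁' y) := by
  simpa using h1.const_mul (-1)

lemma HasWeakPartial.sub (h1 : HasWeakPartial D i f₁ f₁') (h2 : HasWeakPartial D i f₂ f₂') :
    HasWeakPartial D i (fun y => f₁ y - f₂ y) (fun y => f₁' y - f₂' y) := by
  simpa [sub_eq_add_neg] using h1.add h2.neg

lemma hasWeakPartial_zero : HasWeakPartial D i (fun _ => 0) (fun _ => 0) :=
  ⟨locallyIntegrableOn_zero, locallyIntegrableOn_zero, by simp⟩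

lemma HasWeakPartial.sum {ι : Type*} (s : Finset ι) {F F' : ι → 𝔼 n → ℝ}
    (h : ∀ a ∈ s, HasWeakPartial D i (F a) (F' a)) :
    HasWeakPartial D i (fun y => ∑ a ∈ s, F a y) (fun y => ∑ a ∈ s, F' a y) := by
  classical
  induction s using Finset.induction_on with
  | empty => simpa using hasWeakPartial_zero
  | insert a s ha ih =>
    simp only [Finset.sum_insert ha]
    exact (h a (Finset.mem_insert_self a s)).add
      (ih fun b hb => h b (Finset.mem_insert_of_mem hb))

lemma HasWeakPartial.mono {D' : Set (𝔼 n)} (h : HasWeakPartial D i f f') (hD : D' ⊆ D) :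
    HasWeakPartial D' i f f' :=
  ⟨h.1.mono_set hD, h.2.1.mono_set hD, fun ψ hψ hc hs => h.2.2 ψ hψ hc (hs.trans hD)⟩

lemma integral_mul_fderiv_of_contDiffOn (hD : IsOpen D) (hf : ContDiffOn ℝ 1 f D) {ψ : 𝔼 n → ℝ}
    (hψ : ContDiff ℝ ∞ ψ) (hc : HasCompactSupport ψ) (hs : tsupport ψ ⊆ D) (v : 𝔼 n) :
    ∫ y, f y * 𝐃 ψ y v = - ∫ y, 𝐃 f y v * ψ y := by
  have hf' : ContinuousOn (fun y => 𝐃 f y v) D :=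
    (hf.continuousOn_fderiv_of_isOpen hD le_rfl).clm_apply continuousOn_const
  apply integral_mul_fderiv_eq_neg_fderiv_mul_of_integrable
  · exact integrable_mul_test
      (hf'.locallyIntegrableOn hD.measurableSet) hψ.continuous hc hs
  · exact integrable_mul_fderiv_test
      (hf.continuousOn.locallyIntegrableOn hD.measurableSet) hψ hc hs v
  · exact integrable_mul_test
      (hf.continuousOn.locallyIntegrableOn hD.measurableSet) hψ.continuous hc hs
  · intro x hx
    exact (hf.differentiableOn one_ne_zero).differentiableAt (hD.mem_nhds (hs hx))
  · intro x _
    exact (hψ.differentiable (by simp)) x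

lemma hasWeakPartial_of_contDiffOn (hD : IsOpen D) (hf : ContDiffOn ℝ 1 f D) :
    HasWeakPartial D i f (fun y => 𝐃 f y (ê i)) := by
  refine ⟨hf.continuousOn.locallyIntegrableOn hD.measurableSet, ?_, ?_⟩
  · exact ((hf.continuousOn_fderiv_of_isOpen hD le_rfl).clm_apply
      continuousOn_const).locallyIntegrableOn hD.measurableSet
  · intro ψ hψ hc hs
    exact integral_mul_fderiv_of_contDiffOn hD hf hψ hc hs _

lemma integrable_test_mul {χ : 𝔼 n → ℝ} (hf : LocallyIntegrableOn f D) (hχ : Continuous χ)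
    (hc : HasCompactSupport χ) (hs : tsupport χ ⊆ D) : Integrable fun y => χ y * f y := by
  simpa only [mul_comm] using integrable_mul_test hf hχ hc hs

lemma HasWeakPartial.integrable_cutoff (h : HasWeakPartial D i f f') {χ : 𝔼 n → ℝ}
    (hχ : ContDiff ℝ ∞ χ) (hc : HasCompactSupport χ) (hs : tsupport χ ⊆ D) :
    Integrable (fun y => χ y * f' y) ∧ Integrable fun y => 𝐃 χ y (ê i) * f y :=
  ⟨integrable_test_mul h.2.1 hχ.continuous hc hs, integrable_test_mul h.1
    (continuous_fderiv_const hχ _) (hc.fderiv_apply (𝕜 := ℝ) _)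
    ((tsupport_fderiv_apply_subset' χ _).trans hs)⟩

/-- Multiplication by a cutoff function extends a weak derivative to the whole space. -/
lemma HasWeakPartial.mul_cutoff (h : HasWeakPartial D i f f') {χ : 𝔼 n → ℝ} (hχ : ContDiff ℝ ∞ χ)
    (hc : HasCompactSupport χ) (hs : tsupport χ ⊆ D) :
    HasWeakPartial univ i (fun y => χ y * f y) (fun y => χ y * f' y + 𝐃 χ y (ê i) * f y) := by
  have i1 := integrable_test_mul h.1 hχ.continuous hc hs
  obtain ⟨i2, i3⟩ := h.integrable_cutoff hχ hc hs
  refine ⟨i1.locallyIntegrable.locallyIntegrableOn _,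
    (i2.add i3).locallyIntegrable.locallyIntegrableOn _, ?_⟩
  intro ψ hψ hcψ _
  have hprod : ContDiff ℝ ∞ fun y => χ y * ψ y := hχ.mul hψ
  have hprodc : HasCompactSupport fun y => χ y * ψ y := hcψ.mul_left
  have hprods : tsupport (fun y => χ y * ψ y) ⊆ D := (tsupport_mul_subset_left).trans hs
  have key := h.2.2 _ hprod hprodc hprods
  have hd : ∀ y, 𝐃 (fun y => χ y * ψ y) y (ê i) = χ y * 𝐃 ψ y (ê i) + ψ y * 𝐃 χ y (ê i) := by
    intro y
    rw [fderiv_fun_mul (hχ.differentiable (by simp) y) (hψ.differentiable (by simp) y)]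
    simp
  simp only [hd] at key
  have j1 : Integrable fun y => χ y * f y * 𝐃 ψ y (ê i) := integrable_mul_fderiv_test
      (i1.locallyIntegrable.locallyIntegrableOn univ) hψ hcψ (subset_univ _) _
  have j2 : Integrable fun y => 𝐃 χ y (ê i) * f y * ψ y := integrable_mul_test
      (i3.locallyIntegrable.locallyIntegrableOn univ) hψ.continuous hcψ (subset_univ _)
  have j3 : Integrable fun y => χ y * f' y * ψ y := integrable_mul_test
      (i2.locallyIntegrable.locallyIntegrableOn univ) hψ.continuous hcψ (subset_univ _)
  have e1 : ∫ y, f y * (χ y * 𝐃 ψ y (ê i) + ψ y * 𝐃 χ y (ê i)) =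
      (∫ y, χ y * f y * 𝐃 ψ y (ê i)) + ∫ y, 𝐃 χ y (ê i) * f y * ψ y := by
    rw [← integral_add j1 j2]; congr 1; ext y; ring
  have e2 : ∫ y, f' y * (χ y * ψ y) = ∫ y, χ y * f' y * ψ y := by congr 1; ext y; ring
  have e3 : ∫ y, (χ y * f' y + 𝐃 χ y (ê i) * f y) * ψ y =
      (∫ y, χ y * f' y * ψ y) + ∫ y, 𝐃 χ y (ê i) * f y * ψ y := by
    rw [← integral_add j3 j2]; congr 1; ext y; ring
  rw [e3]
  rw [e1, e2] at key
  linarith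

/-- The value `1` is taken on a neighbourhood of `K`, so that the derivative of the cutoff vanishes
on `K`. Hence two intermediate compact sets: one for the region of value `1`, one for the support.
-/
lemma exists_cutoff {K : Set (𝔼 n)} (hK : IsCompact K) (hD : IsOpen D) (hKD : K ⊆ D) : ∃ χ : 𝔼 n →
    ℝ, ContDiff ℝ ∞ χ ∧ HasCompactSupport χ ∧ tsupport χ ⊆ D ∧ (∀ y, χ y ∈ Icc (0 : ℝ) 1) ∧ ∃ U,
    IsOpen U ∧ K ⊆ U ∧ ∀ y ∈ U, χ y = 1 := by
  obtain ⟨L, hL, hKL, hLD⟩ := exists_compact_between hK hD hKD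
  obtain ⟨L', hL', hKL', hL'L⟩ := exists_compact_between hK isOpen_interior hKL
  obtain ⟨χ, h1, h2, h3⟩ := exists_contMDiffMap_zero_one_of_isClosed (n := (⊤ : ℕ∞))
    𝓘(ℝ, 𝔼 n)
    (isOpen_interior (s := L)).isClosed_compl hL'.isClosed
    (disjoint_left.2 fun x hx hx' => hx (hL'L hx'))
  have hsupp : tsupport χ ⊆ L := by
    apply closure_minimal _ hL.isClosed
    intro x hx
    by_contra hxL
    exact hx (h1 fun h => hxL (interior_subset h))
  refine ⟨χ, χ.contMDiff.contDiff, HasCompactSupport.of_support_subset_isCompact hL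
    ((subset_tsupport _).trans hsupp), hsupp.trans hLD, h3, interior L', isOpen_interior, hKL',
    fun y hy => h2 (interior_subset hy)⟩

end

/-! ### Mollification -/

section

open ContinuousLinearMap Filter

variable {i : Fin n} {f f' : 𝔼 n → ℝ}

/-- A sequence of bump functions with shrinking supports. -/
def mollBump (n k : ℕ) : ContDiffBump (0 : 𝔼 n) where
  rIn := 1 / ((k : ℝ) + 1) / 2
  rOut := 1 / ((k : ℝ) + 1)
  rIn_pos := by positivity
  rIn_lt_rOut := half_lt_self (by positivity)

/-- The convolution of `f` with a normalized bump function. -/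
def mollify (k : ℕ) (f : 𝔼 n → ℝ) : 𝔼 n → ℝ :=
  MeasureTheory.convolution ((mollBump n k).normed volume) f (lsmul ℝ ℝ) volume

lemma contDiff_mollify (k : ℕ) (hf : Integrable f) : ContDiff ℝ ∞ (mollify k f) :=
  (mollBump n k).hasCompactSupport_normed.contDiff_convolution_left (n := ⊤) _
    (mollBump n k).contDiff_normed hf.locallyIntegrable

lemma hasCompactSupport_mollify (k : ℕ) (hf : HasCompactSupport f) :
    HasCompactSupport (mollify k f) := (mollBump n k).hasCompactSupport_normed.convolution _ hf

/-- Lebesgue differentiation; the required comparability of the inner and outer radii of the bumps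
holds with the constant `2`. -/
lemma ae_tendsto_mollify (hf : Integrable f) :
    ∀ᵐ x, Tendsto (fun k => mollify k f x) atTop (𝓝 (f x)) := by
  refine ContDiffBump.ae_convolution_tendsto_right_of_locallyIntegrable (K := 2)
    (φ := mollBump n) tendsto_one_div_add_atTop_nhds_zero_nat ?_ hf.locallyIntegrable
  refine .of_forall fun k => ?_
  show 1 / ((k : ℝ) + 1) ≤ 2 * (1 / ((k : ℝ) + 1) / 2)
  linarith

lemma mollify_eq_integral (k : ℕ) (x : 𝔼 n) :
    mollify k f x = ∫ t, f t * (mollBump n k).normed volume (x - t) := by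
  rw [mollify, convolution_eq_swap]
  simp only [lsmul_apply, smul_eq_mul, mul_comm]

/-- For fixed `x`, the reflected bump `t ↦ η (x - t)` is a test function. The sign coming from the
reflection cancels the sign of the integration by parts. -/
lemma fderiv_mollify (k : ℕ) (h : HasWeakPartial univ i f f') (hf : Integrable f) (x : 𝔼 n) :
    𝐃 (mollify k f) x (ê i) = mollify k f' x := by
  set η := (mollBump n k).normed (volume : Measure (𝔼 n)) with hη
  have hηs : ContDiff ℝ ∞ η := (mollBump n k).contDiff_normed (n := ⊤)
  have hηc : HasCompactSupport η := (mollBump n k).hasCompactSupport_normed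
  have e1 : mollify k f = MeasureTheory.convolution f η (lsmul ℝ ℝ).flip volume := by
    rw [mollify, ← convolution_flip]
  have h1 := hηc.hasFDerivAt_convolution_right (lsmul ℝ ℝ).flip hf.locallyIntegrable
    (hηs.of_le (by exact_mod_cast le_top)) x
  rw [e1, h1.fderiv, convolution_precompR_apply _ hf.locallyIntegrable (hηc.fderiv ℝ)
    (hηs.continuous_fderiv (by simp)), mollify_eq_integral, convolution_def]
  have hψ : ContDiff ℝ ∞ fun t => η (x - t) := hηs.comp (contDiff_const.sub contDiff_id)
  have hψc : HasCompactSupport fun t => η (x - t) := hηc.comp_homeomorph (Homeomorph.subLeft x)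
  have key := h.2.2 _ hψ hψc (subset_univ _)
  have hd : ∀ t, 𝐃 (fun t => η (x - t)) t (ê i) = - 𝐃 η (x - t) (ê i) := by
    intro t
    have := (((hηs.differentiable (by simp)) (x - t)).hasFDerivAt).comp t
      ((hasFDerivAt_id t).const_sub x)
    have e : (fun t => η (x - t)) = η ∘ (HSub.hSub x) := rfl
    rw [e, this.fderiv]; simp
  simp only [hd, mul_neg, integral_neg] at key
  rw [← hη, ← neg_inj, ← key]
  simp [mul_comm]

lemma enorm_mollify_le (k : ℕ) (x : 𝔼 n) :
    ‖mollify k f x‖ₑ ≤ ∫⁻ t, ‖f (x - t)‖ₑ * ‖(mollBump n k).normed volume t‖ₑ := by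
  rw [mollify, convolution_def]
  refine (enorm_integral_le_lintegral_enorm _).trans_eq ?_
  simp [enorm_mul, mul_comm]

lemma lintegral_enorm_mollBump (k : ℕ) :
    ∫⁻ t, ‖(mollBump n k).normed (volume : Measure (𝔼 n)) t‖ₑ = 1 := by
  rw [← ofReal_integral_norm_eq_lintegral_enorm (mollBump n k).integrable_normed]
  have : ∀ t, ‖(mollBump n k).normed (volume : Measure (𝔼 n)) t‖ =
      (mollBump n k).normed volume t := fun t =>
    Real.norm_of_nonneg ((mollBump n k).nonneg_normed t)
  simp [this, (mollBump n k).integral_normed]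

/-- The normalized bump is a probability density: on a probability space the `L¹` norm is at most
the `L^q` norm, and Tonelli's theorem with translation invariance integrates the resulting pointwise
bound. -/
lemma lintegral_rpow_mollify_le (k : ℕ) (hf : AEStronglyMeasurable f) {q : ℝ} (hq : 1 ≤ q) :
    ∫⁻ x, ‖mollify k f x‖ₑ ^ q ≤ ∫⁻ x, ‖f x‖ₑ ^ q := by
  set w : 𝔼 n → ℝ≥0∞ := fun t => ‖(mollBump n k).normed volume t‖ₑ with hw
  have hwm : Measurable w := (mollBump n k).continuous_normed.measurable.enorm
  have hw1 : ∫⁻ t, w t = 1 := lintegral_enorm_mollBump k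
  have hqm : Measurable fun p : 𝔼 n × 𝔼 n => p.1 - p.2 := measurable_fst.sub measurable_snd
  have hcomp : AEMeasurable (fun p : 𝔼 n × 𝔼 n => ‖f (p.1 - p.2)‖ₑ) (volume.prod volume) :=
    hf.enorm.comp_quasiMeasurePreserving
      (quasiMeasurePreserving_sub_of_right_invariant volume volume)
  have hsec : ∀ x, AEMeasurable (fun t => ‖f (x - t)‖ₑ) volume := fun x =>
    hf.enorm.comp_quasiMeasurePreserving (quasiMeasurePreserving_sub_left volume x)
  set ν : Measure (𝔼 n) := volume.withDensity w
  have hν : IsProbabilityMeasure ν := ⟨by simp [ν, hw1]⟩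
  have hac : ν ≪ volume := withDensity_absolutelyContinuous _ _
  have step : ∀ x, ‖mollify k f x‖ₑ ^ q ≤ ∫⁻ t, ‖f (x - t)‖ₑ ^ q * w t := by
    intro x
    have h1 : ‖mollify k f x‖ₑ ≤ ∫⁻ t, ‖f (x - t)‖ₑ ∂ν := by
      refine (enorm_mollify_le k x).trans_eq ?_
      rw [lintegral_withDensity_eq_lintegral_mul₀ hwm.aemeasurable (hsec x)]
      simp [mul_comm, hw]
    have h2 : ∫⁻ t, ‖f (x - t)‖ₑ ∂ν ≤ (∫⁻ t, ‖f (x - t)‖ₑ ^ q ∂ν) ^ (1 / q) := by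
      have hm : AEStronglyMeasurable (fun t => f (x - t)) ν :=
        (hf.comp_quasiMeasurePreserving (quasiMeasurePreserving_sub_left volume x)).mono_ac hac
      have := eLpNorm_le_eLpNorm_of_exponent_le (μ := ν) (f := fun t => f (x - t))
        (p := 1) (q := ofReal q) (by simpa using hq) hm
      rwa [eLpNorm_one_eq_lintegral_enorm, eLpNorm_eq_lintegral_rpow_enorm_toReal
        (by simp; linarith) (by simp), ENNReal.toReal_ofReal (by linarith)] at this
    calc ‖mollify k f x‖ₑ ^ q ≤ ((∫⁻ t, ‖f (x - t)‖ₑ ^ q ∂ν) ^ (1 / q)) ^ q := by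
          gcongr; exact h1.trans h2
      _ = ∫⁻ t, ‖f (x - t)‖ₑ ^ q ∂ν := by
          rw [← ENNReal.rpow_mul, one_div_mul_cancel (by linarith), ENNReal.rpow_one]
      _ = _ := by
          rw [lintegral_withDensity_eq_lintegral_mul₀ hwm.aemeasurable ((hsec x).pow_const q)]
          simp [mul_comm]
  calc ∫⁻ x, ‖mollify k f x‖ₑ ^ q ≤ ∫⁻ x, ∫⁻ t, ‖f (x - t)‖ₑ ^ q * w t :=
        lintegral_mono step
    _ = ∫⁻ t, ∫⁻ x, ‖f (x - t)‖ₑ ^ q * w t := by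
        refine lintegral_lintegral_swap ?_
        exact (hcomp.pow_const q).mul (hwm.comp measurable_snd).aemeasurable
    _ = ∫⁻ t, (∫⁻ x, ‖f x‖ₑ ^ q) * w t := by
        congr 1; ext t
        rw [lintegral_mul_const' _ _ (by simp [hw]),
          lintegral_sub_right_eq_self (fun x => ‖f x‖ₑ ^ q) t]
    _ = ∫⁻ x, ‖f x‖ₑ ^ q := by rw [lintegral_const_mul _ hwm, hw1, mul_one]

lemma eLpNorm_mollify_le (k : ℕ) (hf : AEStronglyMeasurable f) {q : ℝ≥0∞} (hq : 1 ≤ q) (hq' : q ≠ ⊤)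
    : eLpNorm (mollify k f) q volume ≤ eLpNorm f q volume := by
  have h0 : q ≠ 0 := (zero_lt_one.trans_le hq).ne'
  rw [eLpNorm_eq_lintegral_rpow_enorm_toReal h0 hq', eLpNorm_eq_lintegral_rpow_enorm_toReal h0 hq']
  refine ENNReal.rpow_le_rpow (lintegral_rpow_mollify_le k hf ?_) (by positivity)
  rw [← ENNReal.toReal_one]
  exact (ENNReal.toReal_le_toReal (by simp) hq').2 hq

/-- If `f k → f` almost everywhere and `‖f k‖₁ ≤ ‖f‖₁`, then `f k → f` in `L¹`. -/
lemma tendsto_lintegral_sub_of_ae_tendsto {α : Type*} [MeasurableSpace α] {μ : Measure α}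
    {F : ℕ → α → ℝ} {f : α → ℝ} (hF : ∀ k, AEStronglyMeasurable (F k) μ) (hf : Integrable f μ)
    (hle : ∀ k, ∫⁻ x, ‖F k x‖ₑ ∂μ ≤ ∫⁻ x, ‖f x‖ₑ ∂μ)
    (hlim : ∀ᵐ x ∂μ, Tendsto (fun k => F k x) atTop (𝓝 (f x))) :
    Tendsto (fun k => ∫⁻ x, ‖F k x - f x‖ₑ ∂μ) atTop (𝓝 0) := by
  set I := ∫⁻ x, ‖f x‖ₑ ∂μ with hI
  have hItop : I ≠ ⊤ := hf.2.ne
  have ha : ∀ k, AEMeasurable (fun x => ‖F k x - f x‖ₑ) μ := fun k => ((hF k).sub hf.1).enorm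
  have hb : ∀ k, AEMeasurable (fun x => ‖F k x‖ₑ + ‖f x‖ₑ) μ := fun k => (hF k).enorm.add hf.1.enorm
  have hab : ∀ k x, ‖F k x - f x‖ₑ ≤ ‖F k x‖ₑ + ‖f x‖ₑ := fun k x => enorm_sub_le
  have hle2 : ∀ k, ∫⁻ x, (‖F k x‖ₑ + ‖f x‖ₑ) ∂μ ≤ 2 * I := by
    intro k
    rw [lintegral_add_right' _ hf.1.enorm, two_mul]
    gcongr; exact hle k
  have hfin : ∀ k, ∫⁻ x, ‖F k x - f x‖ₑ ∂μ ≤ 2 * I := fun k =>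
    (lintegral_mono (hab k)).trans (hle2 k)
  have h2I : 2 * I ≠ ⊤ := ENNReal.mul_ne_top (by simp) hItop
  -- Fatou's lemma for the nonnegative functions `‖F k‖ + ‖f‖ - ‖F k - f‖`, which tend to `2 ‖f‖`:
  -- the mass `∫ ‖F k - f‖` lost in the limit must tend to zero.
  have fatou : 2 * I ≤ liminf (fun k => ∫⁻ x, (‖F k x‖ₑ + ‖f x‖ₑ - ‖F k x - f x‖ₑ) ∂μ) atTop := by
    refine le_trans ?_ (lintegral_liminf_le' fun k => (hb k).sub (ha k))
    rw [hI, ← lintegral_const_mul'' _ hf.1.enorm]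
    refine lintegral_mono_ae ?_
    filter_upwards [hlim] with x hx
    have t1 : Tendsto (fun k => ‖F k x‖ₑ + ‖f x‖ₑ - ‖F k x - f x‖ₑ) atTop
        (𝓝 (‖f x‖ₑ + ‖f x‖ₑ - ‖f x - f x‖ₑ)) := by
      refine ENNReal.Tendsto.sub (hx.enorm.add tendsto_const_nhds)
        (hx.sub tendsto_const_nhds).enorm (Or.inr (by simp))
    rw [t1.liminf_eq]
    simp [two_mul]
  have hsub : ∀ k, ∫⁻ x, (‖F k x‖ₑ + ‖f x‖ₑ - ‖F k x - f x‖ₑ) ∂μ ≤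
      2 * I - ∫⁻ x, ‖F k x - f x‖ₑ ∂μ := by
    intro k
    rw [lintegral_sub' (ha k) (ne_top_of_le_ne_top h2I (hfin k)) (.of_forall (hab k))]
    gcongr; exact hle2 k
  have fatou2 : 2 * I ≤ liminf (fun k => 2 * I - ∫⁻ x, ‖F k x - f x‖ₑ ∂μ) atTop :=
    fatou.trans (liminf_le_liminf (.of_forall hsub))
  rw [ENNReal.tendsto_nhds_zero]
  intro ε hε
  -- The strict inequality `2 * I - ε < 2 * I` in the second case requires `I ≠ 0`.
  by_cases hI0 : I = 0
  · refine .of_forall fun k => ?_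
    have := hfin k
    rw [hI0, mul_zero] at this
    exact this.trans (by simp)
  · have hlt : 2 * I - ε < liminf (fun k => 2 * I - ∫⁻ x, ‖F k x - f x‖ₑ ∂μ) atTop :=
      lt_of_lt_of_le (ENNReal.sub_lt_self h2I (by simp [hI0]) hε.ne') fatou2
    filter_upwards [eventually_lt_of_lt_liminf hlt] with k hk
    by_contra hcon
    push Not at hcon
    exact absurd hk (not_lt.2 (tsub_le_tsub_left hcon.le _))

lemma tendsto_lintegral_mollify_sub (hf : Integrable f) :
    Tendsto (fun k => ∫⁻ x, ‖mollify k f x - f x‖ₑ) atTop (𝓝 0) := by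
  refine tendsto_lintegral_sub_of_ae_tendsto
    (fun k => (contDiff_mollify k hf).continuous.aestronglyMeasurable) hf ?_ (ae_tendsto_mollify hf)
  intro k
  simpa using lintegral_rpow_mollify_le k hf.1 le_rfl

lemma abs_mollify_le (k : ℕ) {C : ℝ} (hC : ∀ x, |f x| ≤ C) (x : 𝔼 n) : |mollify k f x| ≤ C := by
  have h1 := enorm_mollify_le (f := f) k x
  have h2 : ∫⁻ t, ‖f (x - t)‖ₑ * ‖(mollBump n k).normed volume t‖ₑ ≤ ofReal C := by
    calc _ ≤ ∫⁻ t, ofReal C * ‖(mollBump n k).normed volume t‖ₑ := by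
          gcongr with t
          rw [← ofReal_norm]
          exact ENNReal.ofReal_le_ofReal (hC _)
      _ = _ := by rw [lintegral_const_mul' _ _ (by simp), lintegral_enorm_mollBump, mul_one]
  have h3 := h1.trans h2
  rw [← ofReal_norm] at h3
  exact (ENNReal.ofReal_le_ofReal_iff ((abs_nonneg _).trans (hC 0))).1 h3

end

/-! ### Chain rule and product rule for weak derivatives -/

section

open Filter

variable {D : Set (𝔼 n)} {i : Fin n} {f f' g g' : 𝔼 n → ℝ}

/-- Splitting `b k * a k = b k * (a k - a₀) + b k * a₀`, the first integral is small because `b k`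
is bounded and `a k → a₀` in `L¹`, and the second converges by dominated convergence. Identities
between mollified functions pass to the limit in this way. -/
lemma tendsto_integral_mul {α : Type*} [MeasurableSpace α] {μ : Measure α} {a b : ℕ → α → ℝ}
    {a₀ b₀ : α → ℝ} {C : ℝ} (ha : ∀ k, Integrable (a k) μ) (ha₀ : Integrable a₀ μ)
    (hlim : Tendsto (fun k => ∫⁻ x, ‖a k x - a₀ x‖ₑ ∂μ) atTop (𝓝 0))
    (hb : ∀ k, AEStronglyMeasurable (b k) μ) (hbC : ∀ k, ∀ᵐ x ∂μ, |b k x| ≤ C)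
    (hblim : ∀ᵐ x ∂μ, Tendsto (fun k => b k x) atTop (𝓝 (b₀ x))) :
    Tendsto (fun k => ∫ x, b k x * a k x ∂μ) atTop (𝓝 (∫ x, b₀ x * a₀ x ∂μ)) := by
  have hi1 : ∀ k, Integrable (fun x => b k x * (a k x - a₀ x)) μ := fun k =>
    ((ha k).sub ha₀).bdd_mul (hb k) (hbC k)
  have hi2 : ∀ k, Integrable (fun x => b k x * a₀ x) μ := fun k => ha₀.bdd_mul (hb k) (hbC k)
  have hsplit : ∀ k, ∫ x, b k x * a k x ∂μ =
      (∫ x, b k x * (a k x - a₀ x) ∂μ) + ∫ x, b k x * a₀ x ∂μ := by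
    intro k
    rw [← integral_add (hi1 k) (hi2 k)]
    congr 1; ext x; ring
  simp only [hsplit]
  have t2 : Tendsto (fun k => ∫ x, b k x * a₀ x ∂μ) atTop (𝓝 (∫ x, b₀ x * a₀ x ∂μ)) := by
    refine tendsto_integral_of_dominated_convergence (fun x => C * ‖a₀ x‖)
      (fun k => (hi2 k).1) (ha₀.norm.const_mul C) ?_ ?_
    · intro k
      filter_upwards [hbC k] with x hx
      rw [norm_mul]
      exact mul_le_mul_of_nonneg_right hx (norm_nonneg _)
    · filter_upwards [hblim] with x hx
      exact hx.mul tendsto_const_nhds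
  have t1 : Tendsto (fun k => ∫ x, b k x * (a k x - a₀ x) ∂μ) atTop (𝓝 0) := by
    have := tendsto_integral_of_L1 (μ := μ) (f := fun _ => (0 : ℝ)) (aestronglyMeasurable_const)
      (F := fun k x => b k x * (a k x - a₀ x)) (l := atTop)
      (.of_forall hi1) ?_
    · simpa using this
    · have h0 : Tendsto (fun k => ofReal C * ∫⁻ x, ‖a k x - a₀ x‖ₑ ∂μ) atTop (𝓝 0) := by
        have := ENNReal.Tendsto.const_mul hlim (Or.inr (ofReal_ne_top (r := C)))
        simpa using this
      refine tendsto_of_tendsto_of_tendsto_of_le_of_le tendsto_const_nhds h0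
        (fun k => zero_le) fun k => ?_
      show ∫⁻ x, ‖b k x * (a k x - a₀ x) - 0‖ₑ ∂μ ≤ _
      rw [← lintegral_const_mul' _ _ ofReal_ne_top]
      refine lintegral_mono_ae ?_
      filter_upwards [hbC k] with x hx
      rw [sub_zero, enorm_mul]
      gcongr
      rw [← ofReal_norm]
      exact ENNReal.ofReal_le_ofReal hx
  simpa using t1.add t2

lemma LocallyIntegrableOn.of_abs_le (hf : LocallyIntegrableOn f D)
    (hg : AEStronglyMeasurable g (volume.restrict D)) (h : ∀ᵐ y ∂volume.restrict D, |g y| ≤ |f y|) :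
    LocallyIntegrableOn g D := by
  intro x hx
  obtain ⟨U, hU, hUi⟩ := hf x hx
  refine ⟨U ∩ D, Filter.inter_mem hU self_mem_nhdsWithin, ?_⟩
  have hm := Measure.restrict_mono (inter_subset_right (s := U) (t := D))
    (le_refl (volume : Measure (𝔼 n)))
  exact Integrable.mono (hUi.mono_set inter_subset_left) (hg.mono_measure hm) (ae_mono hm h)

lemma abs_sub_le_of_abs_deriv_le {F : ℝ → ℝ} (hF : ContDiff ℝ 1 F) {C : ℝ}
    (hC : ∀ s, |deriv F s| ≤ C) (s t : ℝ) : |F s - F t| ≤ C * |s - t| :=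
  Convex.norm_image_sub_le_of_norm_deriv_le (s := univ)
    (fun x _ => hF.differentiable one_ne_zero x) (fun x _ => hC x) convex_univ
    (mem_univ t) (mem_univ s)

lemma tsupport_subset_of_forall_notMem {ψ : 𝔼 n → ℝ} (y : 𝔼 n) (hy : y ∉ tsupport ψ) :
    ψ y = 0 ∧ 𝐃 ψ y = 0 :=
  ⟨image_eq_zero_of_notMem_tsupport hy, by
    by_contra h
    exact hy (tsupport_fderiv_subset ℝ (subset_tsupport _ h))⟩

/-- Localization: on a neighbourhood of the support of a test function, a weakly differentiable
function agrees with an integrable, compactly supported one that is weakly differentiable on the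
whole space. -/
lemma HasWeakPartial.exists_global (hD : IsOpen D) (h : HasWeakPartial D i f f') {K : Set (𝔼 n)}
    (hK : IsCompact K) (hKD : K ⊆ D) : ∃ v v' : 𝔼 n → ℝ, HasWeakPartial univ i v v' ∧ Integrable v ∧
    Integrable v' ∧ (∀ y, |v y| ≤ |f y|) ∧ ∀ y ∈ K, v y = f y ∧ v' y = f' y := by
  obtain ⟨χ, h1, h2, h3, h4, U, hU, hKU, h5⟩ := exists_cutoff hK hD hKD
  obtain ⟨i1, i2⟩ := h.integrable_cutoff h1 h2 h3
  refine ⟨_, _, h.mul_cutoff h1 h2 h3, integrable_test_mul h.1 h1.continuous h2 h3, i1.add i2, ?_,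
    ?_⟩
  · intro y
    rw [abs_mul, abs_of_nonneg (h4 y).1]
    exact mul_le_of_le_one_left (abs_nonneg _) (h4 y).2
  · intro y hy
    have e1 : χ y = 1 := h5 y (hKU hy)
    have e2 : 𝐃 χ y = 0 := by
      have : χ =ᶠ[𝓝 y] fun _ => 1 := by
        filter_upwards [hU.mem_nhds (hKU hy)] with z hz using h5 z hz
      rw [this.fderiv_eq]; simp
    simp [e1, e2]

lemma integrable_mollify {w : 𝔼 n → ℝ} (hw : Integrable w) (k : ℕ) : Integrable (mollify k w) := by
  refine ⟨(contDiff_mollify k hw).continuous.aestronglyMeasurable, ?_⟩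
  have := lintegral_rpow_mollify_le k hw.1 le_rfl
  simp only [ENNReal.rpow_one] at this
  exact this.trans_lt hw.2

/-- The classical chain rule holds for the mollifications of a localized copy `v` of `f`. In the
limit, the mollified derivatives converge in `L¹` while `F'` of the mollified functions stays
bounded and converges almost everywhere. The condition `F 0 = 0` gives `|F s| ≤ C |s|`, hence the
integrability of `F ∘ v`. -/
lemma hasWeakPartial_comp_of_map_zero (hD : IsOpen D) (h : HasWeakPartial D i f f') {F : ℝ → ℝ}
    (hF : ContDiff ℝ 1 F) {C : ℝ} (hC : ∀ s, |deriv F s| ≤ C) (hF0 : F 0 = 0) :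
    HasWeakPartial D i (fun y => F (f y)) (fun y => deriv F (f y) * f' y) := by
  have hC0 : 0 ≤ C := (abs_nonneg _).trans (hC 0)
  have hFle : ∀ s, |F s| ≤ C * |s| := fun s => by
    simpa [hF0] using abs_sub_le_of_abs_deriv_le hF hC s 0
  have hF'c : Continuous (deriv F) := hF.continuous_deriv le_rfl
  have hfm := h.1.aestronglyMeasurable
  have hf'm := h.2.1.aestronglyMeasurable
  refine ⟨?_, ?_, ?_⟩
  · refine LocallyIntegrableOn.of_abs_le (f := fun y => C * f y) (h.1.smul C)
      (hF.continuous.comp_aestronglyMeasurable hfm) (.of_forall fun y => ?_)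
    simpa [abs_mul, abs_of_nonneg hC0] using hFle (f y)
  · refine LocallyIntegrableOn.of_abs_le (f := fun y => C * f' y) (h.2.1.smul C)
      ((hF'c.comp_aestronglyMeasurable hfm).mul hf'm) (.of_forall fun y => ?_)
    rw [abs_mul, abs_mul, abs_of_nonneg hC0]
    exact mul_le_mul_of_nonneg_right (hC _) (abs_nonneg _)
  intro ψ hψ hc hs
  obtain ⟨v, v', hv, hvi, hv'i, -, hvf⟩ := h.exists_global hD hc hs
  obtain ⟨M₁, hM₁⟩ := hc.exists_bound_of_continuous hψ.continuous
  have hcd := continuous_fderiv_const hψ (ê i)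
  obtain ⟨M₂, hM₂⟩ := (hc.fderiv_apply (𝕜 := ℝ) (ê i)).exists_bound_of_continuous hcd
  have hsm := fun k => contDiff_mollify k hvi
  have hsm' := fun k => contDiff_mollify k hv'i
  have hFv : Integrable (fun y => F (v y)) := by
    refine (hvi.const_mul C).mono (hF.continuous.comp_aestronglyMeasurable hvi.1)
      (.of_forall fun y => ?_)
    simpa [abs_mul, abs_of_nonneg hC0] using hFle (v y)
  have hFvk : ∀ k, Integrable (fun y => F (mollify k v y)) := by
    intro k
    refine ((integrable_mollify hvi k).const_mul C).mono
      (hF.continuous.comp_aestronglyMeasurable (integrable_mollify hvi k).1) (.of_forall fun y =>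
        ?_)
    simpa [abs_mul, abs_of_nonneg hC0] using hFle (mollify k v y)
  have t1 : Tendsto (fun k => ∫ y, 𝐃 ψ y (ê i) * F (mollify k v y)) atTop
      (𝓝 (∫ y, 𝐃 ψ y (ê i) * F (v y))) := by
    refine tendsto_integral_mul hFvk hFv ?_
      (fun _ => hcd.aestronglyMeasurable) (fun _ => .of_forall hM₂)
      (.of_forall fun _ => tendsto_const_nhds)
    have h0 : Tendsto (fun k => ofReal C * ∫⁻ x, ‖mollify k v x - v x‖ₑ) atTop (𝓝 0) := by
      have := ENNReal.Tendsto.const_mul (tendsto_lintegral_mollify_sub hvi)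
        (Or.inr (ofReal_ne_top (r := C)))
      simpa using this
    refine tendsto_of_tendsto_of_tendsto_of_le_of_le tendsto_const_nhds h0
      (fun k => zero_le) fun k => ?_
    show ∫⁻ x, _ ≤ _
    rw [← lintegral_const_mul' _ _ ofReal_ne_top]
    refine lintegral_mono fun x => ?_
    rw [← ofReal_norm, ← ofReal_norm, ← ENNReal.ofReal_mul hC0]
    exact ENNReal.ofReal_le_ofReal (abs_sub_le_of_abs_deriv_le hF hC _ _)
  have t2 : Tendsto (fun k => ∫ y, (deriv F (mollify k v y) * ψ y) * mollify k v' y) atTop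
      (𝓝 (∫ y, (deriv F (v y) * ψ y) * v' y)) := by
    refine tendsto_integral_mul (C := C * M₁) (integrable_mollify hv'i) hv'i
      (tendsto_lintegral_mollify_sub hv'i)
      (fun k => ((hF'c.comp (hsm k).continuous).mul hψ.continuous).aestronglyMeasurable)
      (fun k => .of_forall fun y => ?_) ?_
    · rw [abs_mul]
      exact mul_le_mul (hC _) (hM₁ _) (abs_nonneg _) hC0
    · filter_upwards [ae_tendsto_mollify hvi] with y hy
      exact ((hF'c.tendsto _).comp hy).mul tendsto_const_nhds
  have hk : ∀ k, ∫ y, 𝐃 ψ y (ê i) * F (mollify k v y) =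
      - ∫ y, (deriv F (mollify k v y) * ψ y) * mollify k v' y := by
    intro k
    have hcomp : ContDiff ℝ 1 fun y => F (mollify k v y) :=
      hF.comp ((hsm k).of_le (by exact_mod_cast le_top))
    have := integral_mul_fderiv_of_contDiffOn isOpen_univ hcomp.contDiffOn hψ hc (subset_univ _)
      (ê i)
    calc _ = ∫ y, F (mollify k v y) * 𝐃 ψ y (ê i) := by simp only [mul_comm]
      _ = _ := this
      _ = _ := by
        congr 2; ext y
        have hd : HasFDerivAt (fun y => F (mollify k v y))
            (deriv F (mollify k v y) • 𝐃 (mollify k v) y) y :=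
          ((hF.differentiable one_ne_zero (mollify k v y)).hasDerivAt).comp_hasFDerivAt y
            ((hsm k).differentiable (by simp) y).hasFDerivAt
        rw [hd.fderiv, smul_apply, fderiv_mollify k hv hvi, smul_eq_mul]
        ring
  have hlim := tendsto_nhds_unique (t1.congr hk) t2.neg
  have e1 : ∫ y, F (f y) * 𝐃 ψ y (ê i) = ∫ y, 𝐃 ψ y (ê i) * F (v y) := by
    congr 1; ext y
    by_cases hy : y ∈ tsupport ψ
    · rw [(hvf y hy).1, mul_comm]
    · simp [(tsupport_subset_of_forall_notMem y hy).2]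
  have e2 : ∫ y, deriv F (f y) * f' y * ψ y = ∫ y, (deriv F (v y) * ψ y) * v' y := by
    congr 1; ext y
    by_cases hy : y ∈ tsupport ψ
    · rw [(hvf y hy).1, (hvf y hy).2]; ring
    · simp [(tsupport_subset_of_forall_notMem y hy).1]
  rw [e1, e2, hlim]

lemma hasWeakPartial_const (hD : IsOpen D) (c : ℝ) :
    HasWeakPartial D i (fun _ => c) (fun _ => 0) := by
  simpa using hasWeakPartial_of_contDiffOn (i := i) hD (contDiffOn_const (c := c))

/-- Chain rule for weak derivatives. -/
lemma HasWeakPartial.comp (hD : IsOpen D) (h : HasWeakPartial D i f f') {F : ℝ → ℝ}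
    (hF : ContDiff ℝ 1 F) {C : ℝ} (hC : ∀ s, |deriv F s| ≤ C) :
    HasWeakPartial D i (fun y => F (f y)) (fun y => deriv F (f y) * f' y) := by
  have hd : ∀ s, deriv (fun s => F s - F 0) s = deriv F s := fun s => by simp
  have h1 := hasWeakPartial_comp_of_map_zero hD h (F := fun s => F s - F 0)
    (hF.sub contDiff_const) (C := C) (fun s => by rw [hd]; exact hC s) (by simp)
  have h2 := h1.add (hasWeakPartial_const (i := i) hD (F 0))
  simpa [hd] using h2

/-- Only `f` is localized and mollified: its mollification times `ψ` is then a test function for the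
weak derivative of `g`. The bound `C` on `f` survives both operations, which provides the domination
in the limit. -/
lemma hasWeakPartial_mul_of_bounded (hD : IsOpen D) (hf : HasWeakPartial D i f f')
    (hg : HasWeakPartial D i g g') {C : ℝ} (hfC : ∀ y, |f y| ≤ C) (hgC : ∀ y, |g y| ≤ C) :
    HasWeakPartial D i (fun y => f y * g y) (fun y => f' y * g y + f y * g' y) := by
  have hC0 : 0 ≤ C := (abs_nonneg _).trans (hfC 0)
  have hfm := hf.1.aestronglyMeasurable
  have hgm := hg.1.aestronglyMeasurable
  have bd : ∀ {a b : 𝔼 n → ℝ}, LocallyIntegrableOn a D →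
      AEStronglyMeasurable b (volume.restrict D) → (∀ y, |b y| ≤ C) →
      LocallyIntegrableOn (fun y => a y * b y) D := by
    intro a b ha hb hbC
    refine LocallyIntegrableOn.of_abs_le (f := fun y => C * a y) (ha.smul C)
      (ha.aestronglyMeasurable.mul hb) (.of_forall fun y => ?_)
    rw [abs_mul, abs_mul, abs_of_nonneg hC0, mul_comm]
    exact mul_le_mul_of_nonneg_right (hbC y) (abs_nonneg _)
  have l1 := bd hf.1 hgm hgC
  have l2 := bd hf.2.1 hgm hgC
  have l3 : LocallyIntegrableOn (fun y => f y * g' y) D := by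
    simpa only [mul_comm] using bd hg.2.1 hfm hfC
  refine ⟨l1, l2.add l3, ?_⟩
  intro ψ hψ hc hs
  obtain ⟨v, v', hv, hvi, hv'i, hvle, hvf⟩ := hf.exists_global hD hc hs
  have hvC : ∀ y, |v y| ≤ C := fun y => (hvle y).trans (hfC y)
  obtain ⟨M₁, hM₁⟩ := hc.exists_bound_of_continuous hψ.continuous
  have hsm := fun k => contDiff_mollify k hvi
  have i1 : Integrable fun y => g y * 𝐃 ψ y (ê i) := integrable_mul_fderiv_test hg.1 hψ hc hs _
  have i2 : Integrable fun y => g' y * ψ y := integrable_mul_test hg.2.1 hψ.continuous hc hs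
  have i3 : Integrable fun y => g y * ψ y := integrable_mul_test hg.1 hψ.continuous hc hs
  have conv0 : ∀ a : 𝔼 n → ℝ, Tendsto (fun _ : ℕ => ∫⁻ x, ‖a x - a x‖ₑ) atTop (𝓝 0) := by
    intro a; simp
  have bm : ∀ k, AEStronglyMeasurable (mollify k v) volume :=
    fun k => (hsm k).continuous.aestronglyMeasurable
  have t1 := tendsto_integral_mul (C := C) (fun _ => i1) i1 (conv0 _) bm
    (fun k => .of_forall (abs_mollify_le k hvC)) (ae_tendsto_mollify hvi)
  have t2 := tendsto_integral_mul (C := C) (fun _ => i2) i2 (conv0 _) bm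
    (fun k => .of_forall (abs_mollify_le k hvC)) (ae_tendsto_mollify hvi)
  have t3 := tendsto_integral_mul (C := C * M₁) (b := fun _ y => g y * ψ y)
    (b₀ := fun y => g y * ψ y) (integrable_mollify hv'i) hv'i
    (tendsto_lintegral_mollify_sub hv'i) (fun _ => i3.1)
    (fun k => .of_forall fun y => by
      rw [abs_mul]; exact mul_le_mul (hgC _) (hM₁ _) (abs_nonneg _) hC0)
    (.of_forall fun _ => tendsto_const_nhds)
  have hk : ∀ k, ∫ y, mollify k v y * (g y * 𝐃 ψ y (ê i)) =
      - (∫ y, mollify k v y * (g' y * ψ y)) - ∫ y, (g y * ψ y) * mollify k v' y := by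
    intro k
    have hp : ContDiff ℝ ∞ fun y => mollify k v y * ψ y := (hsm k).mul hψ
    have key := hg.2.2 _ hp hc.mul_left (tsupport_mul_subset_right.trans hs)
    have hd : ∀ y, 𝐃 (fun y => mollify k v y * ψ y) y (ê i) =
        mollify k v y * 𝐃 ψ y (ê i) + ψ y * mollify k v' y := by
      intro y
      rw [fderiv_fun_mul ((hsm k).differentiable (by simp) y) (hψ.differentiable (by simp) y)]
      simp [fderiv_mollify k hv hvi]
    simp only [hd] at key
    have j1 : Integrable fun y => mollify k v y * (g y * 𝐃 ψ y (ê i)) :=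
      i1.bdd_mul (bm k) (.of_forall (abs_mollify_le k hvC))
    have j2 : Integrable fun y => (g y * ψ y) * mollify k v' y :=
      (integrable_mollify hv'i k).bdd_mul (c := C * M₁) i3.1 (.of_forall fun y => by
        rw [Real.norm_eq_abs, abs_mul]; exact mul_le_mul (hgC _) (hM₁ _) (abs_nonneg _) hC0)
    have e1 : ∫ y, g y * (mollify k v y * 𝐃 ψ y (ê i) + ψ y * mollify k v' y) =
        (∫ y, mollify k v y * (g y * 𝐃 ψ y (ê i))) + ∫ y, (g y * ψ y) * mollify k v' y := by
      rw [← integral_add j1 j2]; congr 1; ext y; ring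
    have e2 : ∫ y, g' y * (mollify k v y * ψ y) = ∫ y, mollify k v y * (g' y * ψ y) := by
      congr 1; ext y; ring
    rw [e1, e2] at key
    linarith
  have hlim := tendsto_nhds_unique (t1.congr hk) (t2.neg.sub t3)
  have e1 : ∫ y, f y * g y * 𝐃 ψ y (ê i) = ∫ y, v y * (g y * 𝐃 ψ y (ê i)) := by
    congr 1; ext y
    by_cases hy : y ∈ tsupport ψ
    · rw [(hvf y hy).1]; ring
    · simp [(tsupport_subset_of_forall_notMem y hy).2]
  have e2 : ∫ y, (f' y * g y + f y * g' y) * ψ y =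
      (∫ y, v y * (g' y * ψ y)) + ∫ y, (g y * ψ y) * v' y := by
    rw [← integral_add]
    · congr 1; ext y
      by_cases hy : y ∈ tsupport ψ
      · rw [(hvf y hy).1, (hvf y hy).2]; ring
      · simp [(tsupport_subset_of_forall_notMem y hy).1]
    · exact i2.bdd_mul hvi.1 (.of_forall hvC)
    · exact hv'i.bdd_mul (c := C * M₁) i3.1 (.of_forall fun y => by
        rw [Real.norm_eq_abs, abs_mul]; exact mul_le_mul (hgC _) (hM₁ _) (abs_nonneg _) hC0)
  rw [e1, e2, hlim]
  ring

/-- A smooth truncation of the identity. -/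
def truncSin (k : ℕ) (s : ℝ) : ℝ := ((k : ℝ) + 1) * Real.sin (s / ((k : ℝ) + 1))

lemma contDiff_truncSin (k : ℕ) : ContDiff ℝ 1 (truncSin k) := by unfold truncSin; fun_prop

lemma deriv_truncSin (k : ℕ) (s : ℝ) : deriv (truncSin k) s = Real.cos (s / ((k : ℝ) + 1)) := by
  have hk : (k : ℝ) + 1 ≠ 0 := by positivity
  have : HasDerivAt (truncSin k)
      (((k : ℝ) + 1) * (Real.cos (s / ((k : ℝ) + 1)) * (1 / ((k : ℝ) + 1)))) s :=
    (((hasDerivAt_id s).div_const _).sin).const_mul _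
  rw [this.deriv]; field_simp

lemma abs_truncSin_le (k : ℕ) (s : ℝ) : |truncSin k s| ≤ |s| := by
  have hk : (0 : ℝ) < (k : ℝ) + 1 := by positivity
  rw [truncSin, abs_mul, abs_of_pos hk]
  calc _ ≤ ((k : ℝ) + 1) * |s / ((k : ℝ) + 1)| :=
        mul_le_mul_of_nonneg_left Real.abs_sin_le_abs hk.le
    _ = |s| := by rw [abs_div, abs_of_pos hk]; field_simp

lemma abs_truncSin_le' (k : ℕ) (s : ℝ) : |truncSin k s| ≤ (k : ℝ) + 1 := by
  have hk : (0 : ℝ) < (k : ℝ) + 1 := by positivity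
  rw [truncSin, abs_mul, abs_of_pos hk]
  exact mul_le_of_le_one_right hk.le (Real.abs_sin_le_one _)

lemma tendsto_div_add_one (s : ℝ) : Tendsto (fun k : ℕ => s / ((k : ℝ) + 1)) atTop (𝓝 0) := by
  have := (tendsto_one_div_add_atTop_nhds_zero_nat (𝕜 := ℝ)).const_mul s
  simpa [div_eq_mul_inv] using this

lemma tendsto_deriv_truncSin (s : ℝ) : Tendsto (fun k => deriv (truncSin k) s) atTop (𝓝 1) := by
  simp only [deriv_truncSin]
  have := (Real.continuous_cos.tendsto 0).comp (tendsto_div_add_one s)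
  simpa [Function.comp_def] using this

lemma tendsto_truncSin (s : ℝ) : Tendsto (fun k => truncSin k s) atTop (𝓝 s) := by
  by_cases hs : s = 0
  · simp [truncSin, hs]
  have h1 : Tendsto (fun k : ℕ => s / ((k : ℝ) + 1)) atTop (𝓝[≠] 0) :=
    tendsto_nhdsWithin_iff.2 ⟨tendsto_div_add_one s, .of_forall fun k => by
      have : (k : ℝ) + 1 ≠ 0 := by positivity
      simp [hs, this]⟩
  have h2 := (hasDerivAt_iff_tendsto_slope.1 (Real.hasDerivAt_sin 0)).comp h1
  have h3 := h2.const_mul s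
  simp only [Real.cos_zero, mul_one] at h3
  refine h3.congr fun k => ?_
  have : (k : ℝ) + 1 ≠ 0 := by positivity
  simp [slope_def_field, truncSin]
  field_simp

/-- Product rule for weak derivatives, whenever the products are locally integrable. -/
lemma HasWeakPartial.mul (hD : IsOpen D) (hf : HasWeakPartial D i f f')
    (hg : HasWeakPartial D i g g') (l1 : LocallyIntegrableOn (fun y => f y * g y) D)
    (l2 : LocallyIntegrableOn (fun y => f' y * g y) D)
    (l3 : LocallyIntegrableOn (fun y => f y * g' y) D) :
    HasWeakPartial D i (fun y => f y * g y) (fun y => f' y * g y + f y * g' y) := by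
  refine ⟨l1, l2.add l3, ?_⟩
  intro ψ hψ hc hs
  have hd1 : ∀ k s, |deriv (truncSin k) s| ≤ 1 := fun k s => by
    rw [deriv_truncSin]; exact Real.abs_cos_le_one _
  -- Both factors are truncated. Since the truncations satisfy `|truncSin k s| ≤ |s|` and have
  -- derivatives bounded by `1`, the three products assumed locally integrable dominate all the
  -- terms as `k → ∞`.
  have hk : ∀ k, _ := fun k => (hasWeakPartial_mul_of_bounded hD
    (hf.comp hD (contDiff_truncSin k) (hd1 k)) (hg.comp hD (contDiff_truncSin k) (hd1 k))
    (fun y => abs_truncSin_le' k (f y)) (fun y => abs_truncSin_le' k (g y)))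
  have hk2 := fun k => (hk k).2.2 ψ hψ hc hs
  have hcd := continuous_fderiv_const hψ (ê i)
  have t1 : Tendsto (fun k => ∫ y, truncSin k (f y) * truncSin k (g y) *
      𝐃 ψ y (ê i)) atTop (𝓝 (∫ y, f y * g y * 𝐃 ψ y (ê i))) := by
    refine tendsto_integral_of_dominated_convergence
      (fun y => ‖f y * g y * 𝐃 ψ y (ê i)‖)
      (fun k => (integrable_mul_fderiv_test (hk k).1 hψ hc hs _).1)
      (integrable_mul_fderiv_test l1 hψ hc hs _).norm ?_ ?_
    · intro k
      refine .of_forall fun y => ?_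
      simp only [norm_mul, Real.norm_eq_abs]
      exact mul_le_mul_of_nonneg_right (mul_le_mul (abs_truncSin_le _ _) (abs_truncSin_le _ _)
        (abs_nonneg _) (abs_nonneg _)) (abs_nonneg _)
    · refine .of_forall fun y => ?_
      exact ((tendsto_truncSin _).mul (tendsto_truncSin _)).mul tendsto_const_nhds
  have t2 : Tendsto (fun k => ∫ y, (deriv (truncSin k) (f y) * f' y * truncSin k (g y) +
      truncSin k (f y) * (deriv (truncSin k) (g y) * g' y)) * ψ y) atTop
      (𝓝 (∫ y, (f' y * g y + f y * g' y) * ψ y)) := by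
    refine tendsto_integral_of_dominated_convergence
      (fun y => ‖f' y * g y * ψ y‖ + ‖f y * g' y * ψ y‖)
      (fun k => (integrable_mul_test (hk k).2.1 hψ.continuous hc hs).1)
      ((integrable_mul_test l2 hψ.continuous hc hs).norm.add
        (integrable_mul_test l3 hψ.continuous hc hs).norm) ?_ ?_
    · intro k
      refine .of_forall fun y => ?_
      rw [add_mul]
      refine (norm_add_le _ _).trans (add_le_add ?_ ?_)
      · simp only [norm_mul, Real.norm_eq_abs]
        exact mul_le_mul_of_nonneg_right (mul_le_mul
          (mul_le_of_le_one_left (abs_nonneg _) (hd1 _ _)) (abs_truncSin_le _ _)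
          (abs_nonneg _) (abs_nonneg _)) (abs_nonneg _)
      · simp only [norm_mul, Real.norm_eq_abs]
        exact mul_le_mul_of_nonneg_right (mul_le_mul (abs_truncSin_le _ _)
          (mul_le_of_le_one_left (abs_nonneg _) (hd1 _ _))
          (by positivity) (abs_nonneg _)) (abs_nonneg _)
    · refine .of_forall fun y => ?_
      have := ((((tendsto_deriv_truncSin (f y)).mul_const (f' y)).mul (tendsto_truncSin (g y))).add
        ((tendsto_truncSin (f y)).mul ((tendsto_deriv_truncSin (g y)).mul_const (g' y)))).mul_const
        (ψ y)
      simpa using this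
  exact tendsto_nhds_unique (t1.congr hk2) t2.neg

/-- Chain rule for a function with values in a compact interval on which the outer function is of
class `C¹`. -/
lemma HasWeakPartial.comp_Icc (hD : IsOpen D) (h : HasWeakPartial D i f f') {F F' : ℝ → ℝ} {a b : ℝ}
    (hab : a ≤ b) (hF : ∀ s ∈ Icc a b, HasDerivAt F (F' s) s) (hF' : ContinuousOn F' (Icc a b))
    (hf : ∀ᵐ y ∂volume.restrict D, f y ∈ Icc a b) :
    HasWeakPartial D i (fun y => F (f y)) (fun y => F' (f y) * f' y) := by
  -- `F'` is extended by its endpoint values. The primitive `W` of the extension is `C¹` on the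
  -- whole line with bounded derivative, and it agrees with `F` on `Icc a b`.
  set w : ℝ → ℝ := fun s => F' (projIcc a b hab s) with hw
  have hwc : Continuous w := (continuousOn_iff_continuous_domRestrict.1 hF').comp continuous_projIcc
  obtain ⟨C, hC⟩ := isCompact_Icc.exists_bound_of_continuousOn hF'
  set W : ℝ → ℝ := fun s => F a + ∫ t in a..s, w t with hW
  have hWd : ∀ s, HasDerivAt W (w s) s := fun s =>
    (intervalIntegral.integral_hasDerivAt_right (hwc.intervalIntegrable _ _)
      (hwc.stronglyMeasurableAtFilter _ _) hwc.continuousAt).const_add _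
  have hWd' : deriv W = w := funext fun s => (hWd s).deriv
  have hW1 : ContDiff ℝ 1 W := contDiff_one_iff_deriv.2
    ⟨fun s => (hWd s).differentiableAt, by rw [hWd']; exact hwc⟩
  have hwF : ∀ s ∈ Icc a b, w s = F' s := fun s hs => by simp [hw, projIcc_of_mem hab hs]
  have hWF : ∀ s ∈ Icc a b, W s = F s := by
    intro s hs
    have : ∫ t in a..s, w t = F s - F a := by
      refine intervalIntegral.integral_eq_sub_of_hasDerivAt ?_ (hwc.intervalIntegrable _ _)
      intro t ht
      rw [uIcc_of_le hs.1] at ht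
      have ht' : t ∈ Icc a b := ⟨ht.1, ht.2.trans hs.2⟩
      rw [hwF t ht']
      exact hF t ht'
    simp only [hW, this]; ring
  have key := h.comp hD hW1 (C := C) (fun s => by rw [hWd']; exact hC _ (projIcc a b hab s).2)
  rw [hWd'] at key
  refine key.congr hD.measurableSet ?_ ?_
  · filter_upwards [hf] with y hy using hWF _ hy
  · filter_upwards [hf] with y hy
    rw [hwF _ hy]

end

/-! ### Sobolev and Morrey inequalities -/

section

open Filter
open scoped NNReal

lemma norm_clm_le_sum_stdVec (L : 𝔼 n →L[ℝ] ℝ) : ‖L‖ ≤ ∑ i, |L (ê i)| := by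
  refine L.opNorm_le_bound (by positivity) fun x => ?_
  have hx : x = ∑ i, x i • (ê i : 𝔼 n) := by ext j; simp [Finset.sum_apply, Pi.single_apply]
  have h1 : L x = ∑ i, x i * L (ê i) := by
    conv_lhs => rw [hx]
    simp
  rw [h1, sum_mul]
  refine (norm_sum_le _ _).trans (sum_le_sum fun i _ => ?_)
  rw [norm_mul, mul_comm]
  exact mul_le_mul_of_nonneg_left (PiLp.norm_apply_le x i) (abs_nonneg _)

lemma eLpNorm_fderiv_le_sum {v : 𝔼 n → ℝ} (hv : ContDiff ℝ 1 v) {q : ℝ≥0∞} (hq : 1 ≤ q) :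
    eLpNorm (𝐃 v) q volume ≤ ∑ i, eLpNorm (fun x => 𝐃 v x (ê i)) q volume := by
  have hc : ∀ i, Continuous fun x => 𝐃 v x (ê i) := fun i =>
    (hv.continuous_fderiv one_ne_zero).clm_apply continuous_const
  calc eLpNorm (𝐃 v) q volume
      ≤ eLpNorm (∑ i, fun x => |𝐃 v x (ê i)|) q volume := by
        refine eLpNorm_mono_real fun x => ?_
        simpa using norm_clm_le_sum_stdVec (𝐃 v x)
    _ ≤ ∑ i, eLpNorm (fun x => |𝐃 v x (ê i)|) q volume :=
        eLpNorm_sum_le (fun i _ => (hc i).abs.aestronglyMeasurable) hq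
    _ = _ := by
        refine sum_congr rfl fun i _ => ?_
        exact eLpNorm_norm (fun x => 𝐃 v x (ê i))

/-- The Sobolev inequality for weakly differentiable functions with compact support. -/
lemma exists_sobolev_const (hn : 0 < n) {q q' : ℝ≥0} (hq : 1 ≤ q)
    (hq' : (q' : ℝ)⁻¹ = (q : ℝ)⁻¹ - (n : ℝ)⁻¹) : ∃ C : ℝ≥0, ∀ (v : 𝔼 n → ℝ) (v' : Fin n → 𝔼 n → ℝ),
    (∀ i, HasWeakPartial univ i v (v' i)) → Integrable v → (∀ i, Integrable (v' i)) →
    HasCompactSupport v → eLpNorm v q' volume ≤ C * ∑ i, eLpNorm (v' i) q volume := by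
  refine ⟨SNormLESNormFDerivOfEqConst ℝ (volume : Measure (𝔼 n)) q, ?_⟩
  intro v v' hw hv hv' hc
  have hsm := fun k => contDiff_mollify k hv
  -- Lower semicontinuity of the norm along almost everywhere convergence: it suffices to bound the
  -- mollifications, which are smooth with compact support, by the right hand side.
  refine (Lp.eLpNorm_lim_le_liminf_eLpNorm (f := fun k => mollify k v)
    (fun k => (hsm k).continuous.aestronglyMeasurable) v (ae_tendsto_mollify hv)).trans ?_
  refine liminf_le_of_le (by isBoundedDefault) fun b hb => ?_
  obtain ⟨k, hk⟩ := hb.exists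
  refine hk.trans ?_
  have h1 : ContDiff ℝ 1 (mollify k v) := (hsm k).of_le (by exact_mod_cast le_top)
  have := eLpNorm_le_eLpNorm_fderiv_of_eq volume h1 (hasCompactSupport_mollify k hc) hq
    (by simpa using hn) (p' := q') (by simpa using hq')
  refine this.trans ?_
  gcongr
  refine (eLpNorm_fderiv_le_sum h1 (by exact_mod_cast hq)).trans ?_
  refine sum_le_sum fun i _ => ?_
  have e : (fun x => 𝐃 (mollify k v) x (ê i)) = mollify k (v' i) :=
    funext fun x => fderiv_mollify k (hw i) hv x
  rw [e]
  exact eLpNorm_mollify_le k (hv' i).1 (by exact_mod_cast hq) (by simp)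

lemma lintegral_comp_add_smul (h : 𝔼 n → ℝ≥0∞) (hh : Measurable h) (x : 𝔼 n) {t : ℝ} (ht : 0 < t) :
    ∫⁻ z, h (x + t • z) = ofReal (t ^ (-(n : ℝ))) * ∫⁻ z, h z := by
  have h1 : ∫⁻ z, h (x + t • z) = ∫⁻ w, h (x + w) ∂(Measure.map (t • ·) volume) := by
    exact (lintegral_map (hh.comp (measurable_const_add x)) (measurable_const_smul t)).symm
  rw [h1, Measure.map_addHaar_smul _ ht.ne', lintegral_smul_measure, lintegral_add_left_eq_self]
  rw [finrank_euclideanSpace_fin, abs_of_pos (by positivity), Real.rpow_neg ht.le,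
    Real.rpow_natCast, smul_eq_mul]

lemma enorm_le_add_lintegral_segment {v : 𝔼 n → ℝ} (hv : ContDiff ℝ 1 v) (x z : 𝔼 n)
    (hz : z ∈ ball (0 : 𝔼 n) 1) :
    ‖v x‖ₑ ≤ ‖v (x + z)‖ₑ + ∫⁻ t in Ioo (0 : ℝ) 1, ‖𝐃 v (x + t • z)‖ₑ := by
  have hz1 : ‖z‖ ≤ 1 := by simpa using (mem_ball_zero_iff.1 hz).le
  have hd : ∀ t : ℝ, HasDerivAt (fun t : ℝ => v (x + t • z)) (𝐃 v (x + t • z) z) t := by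
    intro t
    have h1 : HasDerivAt (fun t : ℝ => x + t • z) z t := by
      simpa using ((hasDerivAt_id t).smul_const z).const_add x
    exact ((hv.differentiable one_ne_zero _).hasFDerivAt).comp_hasDerivAt t h1
  have hc : Continuous fun t : ℝ => 𝐃 v (x + t • z) z :=
    ((hv.continuous_fderiv one_ne_zero).comp (by fun_prop)).clm_apply continuous_const
  have hftc : ∫ t in (0 : ℝ)..1, 𝐃 v (x + t • z) z = v (x + z) - v x := by
    have := intervalIntegral.integral_eq_sub_of_hasDerivAt (fun t _ => hd t)
      (hc.intervalIntegrable 0 1)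
    simpa using this
  have h2 : v x = v (x + z) - ∫ t in (0 : ℝ)..1, 𝐃 v (x + t • z) z := by rw [hftc]; ring
  rw [h2]
  refine enorm_sub_le.trans (add_le_add le_rfl ?_)
  rw [intervalIntegral.integral_of_le zero_le_one, integral_Ioc_eq_integral_Ioo]
  refine (enorm_integral_le_lintegral_enorm _).trans (lintegral_mono fun t => ?_)
  rw [← ofReal_norm, ← ofReal_norm]
  refine ENNReal.ofReal_le_ofReal ((𝐃 v (x + t • z)).le_opNorm z |>.trans ?_)
  exact mul_le_of_le_one_right (norm_nonneg _) hz1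

/-- Morrey's inequality for functions of class `C¹`. -/
lemma exists_morrey_const_smooth {s : ℝ≥0} (hs : (n : ℝ) < s) (hs1' : 1 ≤ s) : ∃ C : ℝ≥0∞, C ≠ ⊤ ∧
    ∀ v : 𝔼 n → ℝ, ContDiff ℝ 1 v → ∀ x, ‖v x‖ₑ ≤ C * (eLpNorm v 1 volume + eLpNorm (𝐃 v) s volume)
    := by
  set B := ball (0 : 𝔼 n) 1 with hB
  have hs0 : (0 : ℝ) < s := lt_of_le_of_lt (Nat.cast_nonneg n) hs
  have hB0 : volume B ≠ 0 := (Metric.isOpen_ball.measure_pos _ ⟨0, by simp⟩).ne'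
  have hBt : volume B ≠ ⊤ := measure_ball_lt_top.ne
  have hs1 : (1 : ℝ≥0∞) ≤ s := by exact_mod_cast hs1'
  -- The condition `n < s` enters here: it makes `t ^ (-n / s)` integrable near `0`.
  set J : ℝ≥0∞ := ∫⁻ t in Ioo (0 : ℝ) 1, ofReal (t ^ (-(n : ℝ) / s)) with hJ
  have hJt : J ≠ ⊤ := by
    have : IntegrableOn (fun t : ℝ => t ^ (-(n : ℝ) / s)) (Ioo 0 1) := by
      rw [intervalIntegral.integrableOn_Ioo_rpow_iff zero_lt_one, neg_div, neg_lt_neg_iff,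
        div_lt_one hs0]
      exact hs
    have h2 := this.2
    rw [hasFiniteIntegral_iff_enorm] at h2
    refine (lt_of_le_of_lt (lintegral_mono fun t => ?_) h2).ne
    exact Real.ofReal_le_enorm _
  set P : ℝ≥0∞ := volume B ^ (1 - 1 / (s : ℝ)) with hP
  have hPt : P ≠ ⊤ := ENNReal.rpow_ne_top_of_ne_zero hB0 hBt
  refine ⟨(volume B)⁻¹ * (1 + J * P), ENNReal.mul_ne_top (ENNReal.inv_ne_top.2 hB0)
    (ENNReal.add_ne_top.2 ⟨by simp, ENNReal.mul_ne_top hJt hPt⟩), ?_⟩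
  intro v hv x
  have hcd : Continuous (𝐃 v) := hv.continuous_fderiv one_ne_zero
  -- The bound along the segments from `x` to `x + z` is averaged over `z` in the unit ball.
  have h1 : ∫⁻ _ in B, ‖v x‖ₑ ≤ ∫⁻ z in B, (‖v (x + z)‖ₑ +
      ∫⁻ t in Ioo (0 : ℝ) 1, ‖𝐃 v (x + t • z)‖ₑ) :=
    setLIntegral_mono' measurableSet_ball fun z hz => enorm_le_add_lintegral_segment hv x z hz
  have hvm : Measurable fun z => ‖v (x + z)‖ₑ :=
    (hv.continuous.measurable.comp (measurable_const_add x)).enorm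
  rw [lintegral_const, Measure.restrict_apply_univ, lintegral_add_left hvm] at h1
  have h2 : ∫⁻ z in B, ‖v (x + z)‖ₑ ≤ eLpNorm v 1 volume := by
    rw [eLpNorm_one_eq_lintegral_enorm, ← lintegral_add_left_eq_self (fun z => ‖v z‖ₑ) x]
    exact setLIntegral_le_lintegral _ _
  -- Hölder's inequality in `z`, then the substitution `z ↦ x + t z`: its Jacobian factor `t ^
  -- (-n)`, under the root of order `s`, becomes `t ^ (-n / s)`.
  have hslice : ∀ t ∈ Ioo (0 : ℝ) 1, ∫⁻ z in B, ‖𝐃 v (x + t • z)‖ₑ ≤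
      ofReal (t ^ (-(n : ℝ) / s)) * (eLpNorm (𝐃 v) s volume * P) := by
    intro t ht
    have hm : Measurable fun z => ‖𝐃 v z‖ₑ ^ (s : ℝ) := by fun_prop
    have hcz : Continuous fun z => 𝐃 v (x + t • z) := hcd.comp (by fun_prop)
    have h3 := eLpNorm_le_eLpNorm_mul_rpow_measure_univ (μ := volume.restrict B) (p := 1)
      (q := (s : ℝ≥0∞)) (f := fun z => 𝐃 v (x + t • z)) hs1
      hcz.aestronglyMeasurable
    rw [eLpNorm_one_eq_lintegral_enorm, Measure.restrict_apply_univ] at h3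
    simp only [ENNReal.toReal_one, ENNReal.coe_toReal, div_one] at h3
    refine h3.trans ?_
    rw [← mul_assoc]
    gcongr
    have hs' : (s : ℝ≥0∞) ≠ 0 := by exact_mod_cast (by rintro rfl; simp at hs0 : s ≠ 0)
    rw [eLpNorm_eq_lintegral_rpow_enorm_toReal hs' (by simp),
      eLpNorm_eq_lintegral_rpow_enorm_toReal hs' (by simp), ENNReal.coe_toReal]
    calc _ ≤ (∫⁻ z, ‖𝐃 v (x + t • z)‖ₑ ^ (s : ℝ)) ^ (1 / (s : ℝ)) :=
          ENNReal.rpow_le_rpow (setLIntegral_le_lintegral _ _) (by positivity)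
      _ = _ := by
          rw [lintegral_comp_add_smul _ hm x ht.1, ENNReal.mul_rpow_of_nonneg _ _ (by positivity),
            ENNReal.ofReal_rpow_of_nonneg (Real.rpow_nonneg ht.1.le _) (by positivity),
            ← Real.rpow_mul ht.1.le]
          congr 3; ring
  have h4 : ∫⁻ z in B, ∫⁻ t in Ioo (0 : ℝ) 1, ‖𝐃 v (x + t • z)‖ₑ ≤
      J * (eLpNorm (𝐃 v) s volume * P) := by
    have hjc : Continuous fun p : 𝔼 n × ℝ => 𝐃 v (x + p.2 • p.1) := hcd.comp (by fun_prop)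
    rw [lintegral_lintegral_swap
      (f := fun z t => ‖𝐃 v (x + t • z)‖ₑ) hjc.measurable.enorm.aemeasurable]
    refine (setLIntegral_mono' measurableSet_Ioo hslice).trans_eq ?_
    rw [lintegral_mul_const _ (by fun_prop)]
  have h5 : ‖v x‖ₑ * volume B ≤ (1 + J * P) * (eLpNorm v 1 volume + eLpNorm (𝐃 v) s volume) := by
    refine h1.trans ((add_le_add h2 h4).trans ?_)
    rw [add_mul, one_mul]
    have : J * (eLpNorm (𝐃 v) s volume * P) ≤
        J * P * (eLpNorm v 1 volume + eLpNorm (𝐃 v) s volume) := by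
      rw [mul_assoc, mul_comm _ P]
      gcongr
      exact le_add_self
    refine add_le_add le_self_add this
  calc ‖v x‖ₑ = (volume B)⁻¹ * (‖v x‖ₑ * volume B) := by
        rw [mul_comm ‖v x‖ₑ, ← mul_assoc, ENNReal.inv_mul_cancel hB0 hBt, one_mul]
    _ ≤ _ := by rw [mul_assoc]; gcongr

/-- Morrey's inequality for weakly differentiable functions. -/
lemma exists_morrey_const {s : ℝ≥0} (hs : (n : ℝ) < s) (hs1 : 1 ≤ s) : ∃ C : ℝ≥0∞, C ≠ ⊤ ∧
    ∀ (v : 𝔼 n → ℝ) (v' : Fin n → 𝔼 n → ℝ), (∀ i, HasWeakPartial univ i v (v' i)) → Integrable v →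
    (∀ i, Integrable (v' i)) → ∀ᵐ x, ‖v x‖ₑ ≤ C *
    (eLpNorm v 1 volume + ∑ i, eLpNorm (v' i) s volume) := by
  obtain ⟨C, hC, h⟩ := exists_morrey_const_smooth hs hs1
  refine ⟨C, hC, ?_⟩
  intro v v' hw hv hv'
  filter_upwards [ae_tendsto_mollify hv] with x hx
  refine le_of_tendsto hx.enorm (.of_forall fun k => ?_)
  have h1 : ContDiff ℝ 1 (mollify k v) := (contDiff_mollify k hv).of_le (by exact_mod_cast le_top)
  refine (h _ h1 x).trans ?_
  gcongr
  · exact eLpNorm_mollify_le k hv.1 le_rfl (by simp)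
  · refine (eLpNorm_fderiv_le_sum h1 (by exact_mod_cast hs1)).trans ?_
    refine sum_le_sum fun i _ => ?_
    have e : (fun x => 𝐃 (mollify k v) x (ê i)) = mollify k (v' i) :=
      funext fun x => fderiv_mollify k (hw i) hv x
    rw [e]
    exact eLpNorm_mollify_le k (hv' i).1 (by exact_mod_cast hs1) (by simp)

end

/-! ### Interior estimates on concentric balls -/

section

open Filter
open scoped NNReal

local notation:max "𝔟" r:max => volume.restrict (ball 0 r)

lemma exists_cutoff_ball {r R : ℝ} (hrR : r < R) : ∃ χ : 𝔼 n → ℝ, ContDiff ℝ ∞ χ ∧ HasCompactSupport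
    χ ∧ tsupport χ ⊆ ball 0 R ∧ (∀ y, χ y ∈ Icc (0 : ℝ) 1) ∧ ∀ y ∈ ball (0 : 𝔼 n) r, χ y = 1 := by
  obtain ⟨χ, h1, h2, h3, h4, U, -, hU, h5⟩ := exists_cutoff
    (isCompact_closedBall (0 : 𝔼 n) r) Metric.isOpen_ball
    (Metric.closedBall_subset_ball hrR)
  exact ⟨χ, h1, h2, h3, h4, fun y hy => h5 y (hU (Metric.ball_subset_closedBall hy))⟩

lemma eLpNorm_mul_le_of_tsupport_subset {χ w : 𝔼 n → ℝ} {R : ℝ} (hs : tsupport χ ⊆ ball 0 R) {m : ℝ}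
    (hm : ∀ y, |χ y| ≤ m) {q : ℝ≥0∞} :
    eLpNorm (fun y => χ y * w y) q volume ≤ ofReal m * eLpNorm w q (𝔟 R) := by
  have hind : (fun y => χ y * w y) = (ball 0 R).indicator (fun y => χ y * w y) := by
    ext y
    by_cases hy : y ∈ ball (0 : 𝔼 n) R
    · rw [indicator_of_mem hy]
    · rw [indicator_of_notMem hy, image_eq_zero_of_notMem_tsupport fun h => hy (hs h), zero_mul]
  rw [hind, eLpNorm_indicator_eq_eLpNorm_restrict measurableSet_ball]
  refine eLpNorm_le_mul_eLpNorm_of_ae_le_mul (.of_forall fun y => ?_) q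
  rw [norm_mul]
  exact mul_le_mul_of_nonneg_right (hm y) (norm_nonneg _)

/-- Data of a cutoff function together with bounds for the localized derivatives. -/
lemma exists_cutoff_bound {r R : ℝ} (hrR : r < R) : ∃ χ : 𝔼 n → ℝ, ∃ m : ℝ≥0, ContDiff ℝ ∞ χ ∧
    HasCompactSupport χ ∧ tsupport χ ⊆ ball 0 R ∧ (∀ y ∈ ball (0 : 𝔼 n) r, χ y = 1) ∧ (∀ (w : 𝔼 n →
      ℝ) (q : ℝ≥0∞), eLpNorm (fun y => χ y * w y) q volume ≤ m * eLpNorm w q (𝔟 R)) ∧ ∀ (i : Fin n)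
        (w w' : 𝔼 n → ℝ) (q : ℝ≥0∞), 1 ≤ q → HasWeakPartial (ball 0 R) i w w' →
    eLpNorm (fun y => χ y * w' y + 𝐃 χ y (ê i) * w y) q volume ≤ m *
    (eLpNorm w q (𝔟 R) + eLpNorm w' q (𝔟 R)) := by
  obtain ⟨χ, h1, h2, h3, h4, h5⟩ := exists_cutoff_ball (n := n) hrR
  obtain ⟨m, hm⟩ := (h2.fderiv ℝ).exists_bound_of_continuous (h1.continuous_fderiv (by simp))
  have hm0 : 0 ≤ m := (norm_nonneg _).trans (hm 0)
  have hb1 : ∀ y, |χ y| ≤ m + 1 := fun y => by rw [abs_of_nonneg (h4 y).1]; linarith [(h4 y).2]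
  have hb2 : ∀ i : Fin n, ∀ y, |𝐃 χ y (ê i)| ≤ m + 1 := fun i y => by
    have := (𝐃 χ y).le_opNorm (ê i)
    simp only [stdVec, EuclideanSpace.norm_single, norm_one, mul_one, Real.norm_eq_abs] at this
    linarith [hm y]
  have hmul : ∀ (w : 𝔼 n → ℝ) (q : ℝ≥0∞), eLpNorm (fun y => χ y * w y) q volume ≤
        (Real.toNNReal (m + 1) : ℝ≥0∞) * eLpNorm w q (𝔟 R) :=
    fun w q => eLpNorm_mul_le_of_tsupport_subset h3 hb1
  refine ⟨χ, Real.toNNReal (m + 1), h1, h2, h3, h5, hmul, ?_⟩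
  intro i w w' q hq hw
  have hsd := (tsupport_fderiv_apply_subset' χ (ê i)).trans h3
  obtain ⟨i2, i3⟩ := hw.integrable_cutoff h1 h2 h3
  refine (eLpNorm_add_le i2.1 i3.1 hq).trans ?_
  rw [mul_add, add_comm]
  exact add_le_add (eLpNorm_mul_le_of_tsupport_subset hsd (hb2 i)) (hmul w' q)

/-- The Sobolev inequality on concentric balls. -/
lemma exists_interior_sobolev_const (hn : 0 < n) {q q' : ℝ≥0} (hq : 1 ≤ q)
    (hq' : (q' : ℝ)⁻¹ = (q : ℝ)⁻¹ - (n : ℝ)⁻¹) {r R : ℝ} (hrR : r < R) : ∃ C : ℝ≥0, ∀ (w : 𝔼 n → ℝ)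
    (w' : Fin n → 𝔼 n → ℝ), (∀ i, HasWeakPartial (ball 0 R) i w (w' i)) → eLpNorm w q' (𝔟 r) ≤ C *
    (eLpNorm w q (𝔟 R) + ∑ i, eLpNorm (w' i) q (𝔟 R)) := by
  obtain ⟨C, hC⟩ := exists_sobolev_const hn hq hq'
  obtain ⟨χ, m, h1, h2, h3, h4, h5, h6⟩ := exists_cutoff_bound (n := n) hrR
  refine ⟨C * (m * n), ?_⟩
  intro w w' hw
  have hi := fun i => (hw i).integrable_cutoff h1 h2 h3
  have key := hC (fun y => χ y * w y)
    (fun i y => χ y * w' i y + 𝐃 χ y (ê i) * w y)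
    (fun i => (hw i).mul_cutoff h1 h2 h3)
    (integrable_test_mul (hw ⟨0, hn⟩).1 h1.continuous h2 h3)
    (fun i => (hi i).1.add (hi i).2) h2.mul_right
  calc eLpNorm w q' (𝔟 r)
      = eLpNorm (fun y => χ y * w y) q' (𝔟 r) := by
        refine eLpNorm_congr_ae ?_
        filter_upwards [ae_restrict_mem measurableSet_ball] with y hy
        rw [h4 y hy, one_mul]
    _ ≤ eLpNorm (fun y => χ y * w y) q' volume := eLpNorm_mono_measure _ Measure.restrict_le_self
    _ ≤ _ := key
    _ ≤ C * ∑ i : Fin n, m * (eLpNorm w q (𝔟 R) +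
          ∑ i, eLpNorm (w' i) q (𝔟 R)) := by
        gcongr with i
        refine (h6 i w (w' i) q (by exact_mod_cast hq) (hw i)).trans ?_
        gcongr
        exact Finset.single_le_sum (f := fun i => eLpNorm (w' i) q
          (𝔟 R)) (fun _ _ => zero_le) (Finset.mem_univ i)
    _ = _ := by
        rw [Finset.sum_const, Finset.card_univ, Fintype.card_fin, nsmul_eq_mul]
        push_cast
        ring

/-- Second order interior estimate: a function with two weak derivatives in `L^q`, `n/2 < q < n`,
is bounded and its gradient is in `L^n`. -/
lemma exists_interior_second_order_const (hn : 2 ≤ n) {q : ℝ≥0} (hq1 : (n : ℝ) / 2 < q)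
    (hq2 : (q : ℝ) < n) : ∃ C : ℝ≥0∞, C ≠ ⊤ ∧ ∀ (f : 𝔼 n → ℝ) (f₁ : Fin n → 𝔼 n → ℝ)
    (f₂ : Fin n → Fin n → 𝔼 n → ℝ) (K : ℝ≥0∞), (∀ i, HasWeakPartial (ball 0 1) i f (f₁ i)) →
    (∀ i j, HasWeakPartial (ball 0 1) j (f₁ i) (f₂ i j)) → eLpNorm f q (𝔟 1) ≤ K →
    (∀ i, eLpNorm (f₁ i) q (𝔟 1) ≤ K) → (∀ i j, eLpNorm (f₂ i j) q (𝔟 1) ≤ K) →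
    (∀ᵐ y ∂𝔟 (1 / 2), ‖f y‖ₑ ≤ C * K) ∧ ∀ i, eLpNorm (f₁ i) n (𝔟 (1 / 2)) ≤ C * K := by
  have hn0 : 0 < n := by omega
  have hnR : (2 : ℝ) ≤ n := by exact_mod_cast hn
  have hq0 : (0 : ℝ) < q := by linarith
  have hq1' : (1 : ℝ≥0) ≤ q := by
    have : (1 : ℝ) ≤ q := by linarith
    exact_mod_cast this
  -- The Sobolev exponent of `q`, with `1/s = 1/q - 1/n`. It is finite because `q < n`, and larger
  -- than `n` because `q > n/2`.
  set s : ℝ≥0 := Real.toNNReal ((q : ℝ)⁻¹ - (n : ℝ)⁻¹)⁻¹ with hs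
  have hpos : 0 < (q : ℝ)⁻¹ - (n : ℝ)⁻¹ := sub_pos.2 (inv_strictAnti₀ hq0 hq2)
  have hsR : (s : ℝ) = ((q : ℝ)⁻¹ - (n : ℝ)⁻¹)⁻¹ := Real.coe_toNNReal _ (by positivity)
  have hsinv : (s : ℝ)⁻¹ = (q : ℝ)⁻¹ - (n : ℝ)⁻¹ := by rw [hsR, inv_inv]
  have hns : (n : ℝ) < s := by
    rw [hsR, lt_inv_comm₀ (by linarith) hpos]
    have : (q : ℝ)⁻¹ < 2 * (n : ℝ)⁻¹ := by
      rw [inv_lt_comm₀ hq0 (by positivity), mul_inv, inv_inv]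
      linarith
    linarith
  have hs1 : (1 : ℝ≥0) ≤ s := by
    have : (1 : ℝ) ≤ s := by linarith
    exact_mod_cast this
  obtain ⟨C₁, hC₁⟩ := exists_interior_sobolev_const (n := n) hn0 hq1' hsinv
    (show (3 / 4 : ℝ) < 1 by norm_num)
  obtain ⟨C₂, hC₂t, hC₂⟩ := exists_morrey_const (n := n) hns hs1
  obtain ⟨χ, m, h1, h2, h3, h4, h5, h6⟩ := exists_cutoff_bound (n := n)
    (show (1 / 2 : ℝ) < 3 / 4 by norm_num)
  set B1 := ball (0 : 𝔼 n) 1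
  set B3 := ball (0 : 𝔼 n) (3 / 4)
  set B2 := ball (0 : 𝔼 n) (1 / 2)
  set A : ℝ≥0∞ := C₁ * (1 + n) with hA
  have hAt : A ≠ ⊤ := by simp [hA, ENNReal.mul_eq_top]
  -- Hölder factors: `W` passes from `L^s` to `L¹` on the ball of radius `3/4`, and `W'` from `L^s`
  -- to `L^n` on the ball of radius `1/2`.
  set W : ℝ≥0∞ := volume B3 ^ (1 - 1 / (s : ℝ)) with hW
  set W' : ℝ≥0∞ := volume B2 ^ (1 / (n : ℝ) - 1 / (s : ℝ)) with hW'
  have hWt : W ≠ ⊤ := ENNReal.rpow_ne_top_of_nonneg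
    (by rw [sub_nonneg, div_le_one (by linarith)]; linarith) measure_ball_lt_top.ne
  have hW't : W' ≠ ⊤ := ENNReal.rpow_ne_top_of_nonneg
    (by rw [sub_nonneg]; exact one_div_le_one_div_of_le (by linarith) hns.le)
    measure_ball_lt_top.ne
  set C : ℝ≥0∞ := C₂ * (m * (A * W) + n * (m * (A + A))) + A * W' with hC
  have hCt : C ≠ ⊤ := by
    refine ENNReal.add_ne_top.2 ⟨ENNReal.mul_ne_top hC₂t (ENNReal.add_ne_top.2
      ⟨ENNReal.mul_ne_top (by simp) (ENNReal.mul_ne_top hAt hWt),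
      ENNReal.mul_ne_top (by simp) (ENNReal.mul_ne_top (by simp)
        (ENNReal.add_ne_top.2 ⟨hAt, hAt⟩))⟩), ENNReal.mul_ne_top hAt hW't⟩
  refine ⟨C, hCt, ?_⟩
  intro f f₁ f₂ K hf hf₁ k0 k1 k2
  have est : ∀ (w : 𝔼 n → ℝ) (w' : Fin n → 𝔼 n → ℝ),
      (∀ i, HasWeakPartial B1 i w (w' i)) → eLpNorm w q (volume.restrict B1) ≤ K →
      (∀ i, eLpNorm (w' i) q (volume.restrict B1) ≤ K) →
      eLpNorm w s (volume.restrict B3) ≤ A * K := by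
    intro w w' hw hk hk'
    refine (hC₁ w w' hw).trans ?_
    rw [hA, mul_assoc]
    gcongr
    rw [add_mul, one_mul]
    refine add_le_add hk ((sum_le_sum fun i _ => hk' i).trans_eq ?_)
    simp
  have e0 := est f f₁ hf k0 k1
  have e1 := fun i => est (f₁ i) (f₂ i) (hf₁ i) (k1 i) (k2 i)
  have hB31 : B3 ⊆ B1 := Metric.ball_subset_ball (by norm_num)
  have hB23 : B2 ⊆ B3 := Metric.ball_subset_ball (by norm_num)
  have hfB3 : ∀ i, HasWeakPartial B3 i f (f₁ i) := fun i => (hf i).mono hB31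
  refine ⟨?_, ?_⟩
  -- The Sobolev step has used the room between the radii `1` and `3/4`; Morrey's inequality,
  -- applied to `χ f`, uses the room between `3/4` and `1/2`.
  · have hi := fun i => (hfB3 i).integrable_cutoff h1 h2 h3
    have key := hC₂ (fun y => χ y * f y)
      (fun i y => χ y * f₁ i y + 𝐃 χ y (ê i) * f y)
      (fun i => (hfB3 i).mul_cutoff h1 h2 h3)
      (integrable_test_mul (hfB3 ⟨0, hn0⟩).1 h1.continuous h2 h3)
      (fun i => (hi i).1.add (hi i).2)
    have b0 : eLpNorm (fun y => χ y * f y) 1 volume ≤ m * (A * W) * K := by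
      refine (h5 f 1).trans ?_
      rw [mul_assoc]
      gcongr
      have := eLpNorm_le_eLpNorm_mul_rpow_measure_univ (μ := volume.restrict B3) (p := 1)
        (q := (s : ℝ≥0∞)) (f := f) (by exact_mod_cast hs1)
        ((hfB3 ⟨0, hn0⟩).1.aestronglyMeasurable)
      simp only [Measure.restrict_apply_univ, ENNReal.toReal_one, ENNReal.coe_toReal,
        div_one] at this
      refine this.trans ?_
      rw [mul_right_comm]
      gcongr
    have b1 : ∀ i, eLpNorm (fun y => χ y * f₁ i y + 𝐃 χ y (ê i) * f y) s volume ≤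
        (m * (A + A)) * K := by
      intro i
      refine (h6 i f (f₁ i) s (by exact_mod_cast hs1) (hfB3 i)).trans ?_
      rw [mul_assoc, add_mul]
      gcongr
      exact e1 i
    have hbig : eLpNorm (fun y => χ y * f y) 1 volume +
        ∑ i, eLpNorm (fun y => χ y * f₁ i y + 𝐃 χ y (ê i) * f y) s volume ≤
        (m * (A * W) + n * (m * (A + A))) * K := by
      rw [add_mul]
      refine add_le_add b0 ((sum_le_sum fun i _ => b1 i).trans_eq ?_)
      simp [mul_assoc]
    filter_upwards [ae_restrict_of_ae key, ae_restrict_mem measurableSet_ball] with y hy hyB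
    rw [h4 y hyB, one_mul] at hy
    refine hy.trans ?_
    refine (mul_le_mul_right hbig _).trans ?_
    rw [← mul_assoc, hC]
    gcongr
    exact le_self_add
  · intro i
    have := eLpNorm_le_eLpNorm_mul_rpow_measure_univ (μ := volume.restrict B2) (p := (n : ℝ≥0∞))
      (q := (s : ℝ≥0∞)) (f := f₁ i) (by
        have : (n : ℝ≥0) ≤ s := by exact_mod_cast hns.le
        exact_mod_cast this)
      ((hf₁ i ⟨0, hn0⟩).mono (hB23.trans hB31)).1.aestronglyMeasurable
    simp only [Measure.restrict_apply_univ, ENNReal.coe_toReal, ENNReal.toReal_natCast] at this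
    refine this.trans ?_
    calc _ ≤ (A * K) * W' := by
          gcongr
          exact (eLpNorm_mono_measure _ (Measure.restrict_mono hB23 le_rfl)).trans (e1 i)
      _ = A * W' * K := by ring
      _ ≤ C * K := by
          gcongr
          exact le_add_self

/-- The local estimate behind the integrability of `f u²`, for `f` in `L^{n/2}` and `u` in
`W^{1,2}`. -/
lemma exists_interior_mul_sq_const (hn : 3 ≤ n) : ∃ C : ℝ≥0∞, C ≠ ⊤ ∧ ∀ (F : 𝔼 n → ℝ≥0∞)
    (u : 𝔼 n → ℝ) (u' : Fin n → 𝔼 n → ℝ), (∀ i, HasWeakPartial (ball 0 1) i u (u' i)) →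
    AEMeasurable F (𝔟 (1 / 2)) → ∫⁻ y in ball 0 (1 / 2), F y * ‖u y‖ₑ ^ 2 ≤ C *
    (∫⁻ y in ball 0 (1 / 2), F y ^ ((n : ℝ) / 2)) ^ (2 / (n : ℝ)) * ∫⁻ y in ball 0 1,
    (‖u y‖ₑ ^ 2 + ∑ i, ‖u' i y‖ₑ ^ 2) := by
  have hn0 : 0 < n := by omega
  have hnR : (3 : ℝ) ≤ n := by exact_mod_cast hn
  set N : ℝ≥0 := Real.toNNReal (2 * n / (n - 2)) with hN
  have hNR : (N : ℝ) = 2 * n / (n - 2) := Real.coe_toNNReal _ (by apply div_nonneg <;> linarith)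
  have hNinv : (N : ℝ)⁻¹ = ((2 : ℝ≥0) : ℝ)⁻¹ - (n : ℝ)⁻¹ := by
    rw [hNR]
    have : (n : ℝ) - 2 ≠ 0 := by linarith
    have : (n : ℝ) ≠ 0 := by linarith
    simp only [NNReal.coe_ofNat]
    field_simp
  have hN0 : (0 : ℝ) < N := by rw [hNR]; apply div_pos <;> linarith
  obtain ⟨C₁, hC₁⟩ := exists_interior_sobolev_const (n := n) hn0 (q := 2) (by norm_num) hNinv
    (show (1 / 2 : ℝ) < 1 by norm_num)
  refine ⟨(C₁ * (1 + n)) ^ 2, by simp [ENNReal.mul_eq_top], ?_⟩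
  intro F u u' hu hF
  set B1 := ball (0 : 𝔼 n) 1
  set B2 := ball (0 : 𝔼 n) (1 / 2)
  set J : ℝ≥0∞ := ∫⁻ y in B1, (‖u y‖ₑ ^ 2 + ∑ i, ‖u' i y‖ₑ ^ 2) with hJ
  have hB : B2 ⊆ B1 := Metric.ball_subset_ball (by norm_num)
  have hum : AEStronglyMeasurable u (volume.restrict B2) :=
    ((hu ⟨0, hn0⟩).mono hB).1.aestronglyMeasurable
  have l2 : ∀ w : 𝔼 n → ℝ, (∀ y, ‖w y‖ₑ ^ 2 ≤ ‖u y‖ₑ ^ 2 + ∑ i, ‖u' i y‖ₑ ^ 2) →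
      eLpNorm w (2 : ℝ≥0) (volume.restrict B1) ≤ J ^ (1 / 2 : ℝ) := by
    intro w hw
    rw [eLpNorm_eq_lintegral_rpow_enorm_toReal (by simp) (by simp)]
    simp only [ENNReal.coe_ofNat, ENNReal.toReal_ofNat, ENNReal.rpow_ofNat]
    exact ENNReal.rpow_le_rpow (lintegral_mono hw) (by norm_num)
  have sob : eLpNorm u N (volume.restrict B2) ≤ C₁ * (1 + n) * J ^ (1 / 2 : ℝ) := by
    refine (hC₁ u u' hu).trans ?_
    rw [mul_assoc]
    gcongr
    rw [add_mul, one_mul]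
    refine add_le_add (l2 u fun y => le_self_add) ?_
    refine (sum_le_sum fun i _ => l2 (u' i) fun y => ?_).trans_eq ?_
    · exact (Finset.single_le_sum (f := fun i => ‖u' i y‖ₑ ^ 2) (fun _ _ => zero_le)
        (Finset.mem_univ i)).trans le_add_self
    · simp
  -- Hölder with the exponents `n/2` and `n/(n-2)`: since `2 n/(n-2) = N`, the factor that contains
  -- `u²` is the square of the `L^N` norm of `u`.
  have hconj : ((n : ℝ) / 2).HolderConjugate ((n : ℝ) / (n - 2)) := by
    rw [Real.holderConjugate_iff]
    refine ⟨by linarith, ?_⟩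
    have : (n : ℝ) - 2 ≠ 0 := by linarith
    have : (n : ℝ) ≠ 0 := by linarith
    field_simp
    ring
  have hold := ENNReal.lintegral_mul_le_Lp_mul_Lq (volume.restrict B2) hconj hF
    (hum.enorm.pow_const 2)
  simp only [Pi.mul_apply] at hold
  refine hold.trans ?_
  have e1 : (1 : ℝ) / (n / 2) = 2 / n := by field_simp
  have e2 : (∫⁻ a in B2, (‖u a‖ₑ ^ 2) ^ ((n : ℝ) / (n - 2))) ^ (1 / ((n : ℝ) / (n - 2))) =
      eLpNorm u N (volume.restrict B2) ^ 2 := by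
    rw [eLpNorm_eq_lintegral_rpow_enorm_toReal (by
      have : N ≠ 0 := by rintro h; simp [h] at hN0
      exact_mod_cast this) (by simp), ENNReal.coe_toReal, ← ENNReal.rpow_natCast _ 2,
      ← ENNReal.rpow_mul]
    congr 1
    · congr 1; ext a
      rw [← ENNReal.rpow_natCast _ 2, ← ENNReal.rpow_mul]
      congr 1
      rw [hNR]; push_cast; ring
    · rw [hNR]; push_cast
      have : (n : ℝ) - 2 ≠ 0 := by linarith
      have : (n : ℝ) ≠ 0 := by linarith
      field_simp
  rw [e1, e2]
  calc _ ≤ (∫⁻ y in B2, F y ^ ((n : ℝ) / 2)) ^ (2 / (n : ℝ)) *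
        (C₁ * (1 + n) * J ^ (1 / 2 : ℝ)) ^ 2 := by gcongr
    _ = _ := by
      rw [mul_pow _ (J ^ (1 / 2 : ℝ)), ← ENNReal.rpow_natCast (J ^ (1 / 2 : ℝ)) 2,
        ← ENNReal.rpow_mul]
      norm_num
      ring

end

/-! ### Linear algebra: change of basis -/

/-- The matrix of an endomorphism of `ℝⁿ` in the standard basis. -/
def stdMat (J : 𝔼 n →L[ℝ] 𝔼 n) : Matrix (Fin n) (Fin n) ℝ := Matrix.of fun i j => J (ê j) i

lemma eq_sum_stdVec (x : 𝔼 n) : x = ∑ i, x i • (ê i : 𝔼 n) := by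
  ext j; simp [Finset.sum_apply, Pi.single_apply]

lemma apply_stdVec_eq_sum (J : 𝔼 n →L[ℝ] 𝔼 n) (j : Fin n) :
    J (ê j) = ∑ i, stdMat J i j • (ê i : 𝔼 n) := eq_sum_stdVec _

lemma stdMat_eq_toMatrix (J : 𝔼 n →L[ℝ] 𝔼 n) :
    stdMat J = LinearMap.toMatrix (EuclideanSpace.basisFun (Fin n) ℝ).toBasis
    (EuclideanSpace.basisFun (Fin n) ℝ).toBasis (J : 𝔼 n →ₗ[ℝ] _) := by
  ext i j
  simp [stdMat, LinearMap.toMatrix_apply]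

lemma det_stdMat (J : 𝔼 n →L[ℝ] 𝔼 n) : (stdMat J).det = J.det := by
  rw [stdMat_eq_toMatrix, LinearMap.det_toMatrix]

lemma isUnit_det_stdMat {J : 𝔼 n →L[ℝ] 𝔼 n} (hJ : J.IsInvertible) : IsUnit (stdMat J).det := by
  obtain ⟨e, rfl⟩ := hJ
  rw [stdMat_eq_toMatrix, LinearMap.det_toMatrix]
  exact (e.toLinearEquiv).isUnit_det'

lemma gram_bilinearComp (B : 𝔹 n) (J : 𝔼 n →L[ℝ] 𝔼 n) :
    gram (B.bilinearComp J J) = (stdMat J).transpose * gram B * stdMat J := by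
  ext i j
  simp only [gram, Matrix.of_apply, ContinuousLinearMap.bilinearComp_apply, Matrix.mul_apply,
    Matrix.transpose_apply]
  rw [apply_stdVec_eq_sum J i, apply_stdVec_eq_sum J j]
  simp only [map_sum, map_smul, sum_apply, smul_apply, smul_eq_mul, mul_sum, sum_mul]
  refine sum_congr rfl fun a _ => sum_congr rfl fun b _ => ?_
  ring

lemma inv_gram_bilinearComp (B : 𝔹 n) (J : 𝔼 n →L[ℝ] 𝔼 n) :
    (gram (B.bilinearComp J J))⁻¹ = (stdMat J)⁻¹ * (gram B)⁻¹ * ((stdMat J)⁻¹).transpose := by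
  rw [gram_bilinearComp, Matrix.mul_inv_rev, Matrix.mul_inv_rev, Matrix.transpose_nonsing_inv,
    Matrix.mul_assoc]

/-- The scalar product of two covectors. -/
def covectorInner (B : 𝔹 n) (α β : 𝔼 n →L[ℝ] ℝ) : ℝ := ∑ i, ∑ j, (gram B)⁻¹ i j * α (ê i) * β (ê j)

/-- The trace of a bilinear form with respect to a scalar product. -/
def bilinTrace (B T : 𝔹 n) : ℝ := ∑ i, ∑ j, (gram B)⁻¹ i j * T (ê i) (ê j)

lemma bilinTrace_eq_trace (B T : 𝔹 n) :
    bilinTrace B T = ((gram B)⁻¹ * (gram T).transpose).trace := by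
  simp [bilinTrace, Matrix.trace, Matrix.mul_apply, gram]

/-- Under a change of basis both Gram matrices undergo a congruence, so the product `(gram B)⁻¹
(gram T)ᵀ` is conjugated and its trace is unchanged. Thus the invariants on `M`, written in the
standard basis of the tangent space, are computed from components in any chart. -/
lemma bilinTrace_bilinearComp (B T : 𝔹 n) {J : 𝔼 n →L[ℝ] 𝔼 n} (hJ : J.IsInvertible) :
    bilinTrace (B.bilinearComp J J) (T.bilinearComp J J) = bilinTrace B T := by
  have hu := isUnit_det_stdMat hJ
  have hut : IsUnit (stdMat J).transpose.det := by rwa [Matrix.det_transpose]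
  rw [bilinTrace_eq_trace, bilinTrace_eq_trace, inv_gram_bilinearComp, gram_bilinearComp]
  simp only [Matrix.transpose_mul, Matrix.transpose_transpose, Matrix.transpose_nonsing_inv]
  have : (stdMat J)⁻¹ * (gram B)⁻¹ * ((stdMat J).transpose)⁻¹ *
      ((stdMat J).transpose * ((gram T).transpose * stdMat J)) =
      (stdMat J)⁻¹ * (((gram B)⁻¹ * (gram T).transpose) * stdMat J) := by
    simp only [Matrix.mul_assoc]
    congr 2
    rw [← Matrix.mul_assoc (stdMat J).transpose⁻¹, Matrix.nonsing_inv_mul _ hut, Matrix.one_mul]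
  rw [this, Matrix.trace_mul_comm, Matrix.mul_assoc, Matrix.mul_nonsing_inv _ hu, Matrix.mul_one]

/-- The bilinear form `(v, w) ↦ α v * β w`. -/
def covectorMul (α β : 𝔼 n →L[ℝ] ℝ) : 𝔹 n := (ContinuousLinearMap.mul ℝ ℝ).bilinearComp α β

lemma covectorInner_eq_bilinTrace (B : 𝔹 n) (α β : 𝔼 n →L[ℝ] ℝ) :
    covectorInner B α β = bilinTrace B (covectorMul α β) := by
  simp [covectorInner, bilinTrace, covectorMul, mul_assoc]

lemma covectorInner_bilinearComp (B : 𝔹 n) (α β : 𝔼 n →L[ℝ] ℝ) {J : 𝔼 n →L[ℝ] 𝔼 n}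
    (hJ : J.IsInvertible) :
    covectorInner (B.bilinearComp J J) (α.comp J) (β.comp J) = covectorInner B α β := by
  rw [covectorInner_eq_bilinTrace, covectorInner_eq_bilinTrace, ← bilinTrace_bilinearComp B _ hJ]
  rfl

lemma covectorInner_self (B : 𝔹 n) (α : 𝔼 n →L[ℝ] ℝ) :
    covectorInner B α α = covectorNormSq B α := rfl

/-! ### Rescaling -/

section

variable {D : Set (𝔼 n)} {i : Fin n} {f f' : 𝔼 n → ℝ}

/-- The affine map `z ↦ y + s z`. -/
def dilate (y : 𝔼 n) (s : ℝ) (z : 𝔼 n) : 𝔼 n := y + s • z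

lemma continuous_dilate (y : 𝔼 n) (s : ℝ) : Continuous (dilate y s) := by unfold dilate; fun_prop

lemma dilate_inv (y : 𝔼 n) {s : ℝ} (hs : s ≠ 0) (x : 𝔼 n) : dilate y s (s⁻¹ • (x - y)) = x := by
  simp [dilate, smul_smul, hs]

lemma inv_dilate (y : 𝔼 n) {s : ℝ} (hs : s ≠ 0) (z : 𝔼 n) : s⁻¹ • (dilate y s z - y) = z := by
  simp [dilate, smul_smul, hs]

lemma dilate_injective (y : 𝔼 n) {s : ℝ} (hs : s ≠ 0) :
    Function.Injective (dilate y s) := fun a b h => by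
  rw [← inv_dilate y hs a, h, inv_dilate y hs b]

lemma measurableEmbedding_dilate (y : 𝔼 n) {s : ℝ} (hs : s ≠ 0) :
    MeasurableEmbedding (dilate y s) :=
  (continuous_dilate y s).measurableEmbedding (dilate_injective y hs)

lemma dilate_mem_ball (y : 𝔼 n) {s : ℝ} (hs : 0 < s) (R : ℝ) (z : 𝔼 n) :
    dilate y s z ∈ ball y (s * R) ↔ z ∈ ball 0 R := by
  rw [Metric.mem_ball, dist_eq_norm, dilate, add_sub_cancel_left, norm_smul, Metric.mem_ball,
    dist_zero_right, Real.norm_of_nonneg hs.le, mul_lt_mul_iff_right₀ hs]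

lemma map_dilate (y : 𝔼 n) {s : ℝ} (hs : 0 < s) :
    Measure.map (dilate y s) volume = ofReal (s ^ n)⁻¹ • volume := by
  have h1 : dilate y s = (fun x => y + x) ∘ (fun z => s • z) := rfl
  rw [h1, ← Measure.map_map (by fun_prop) (by fun_prop), Measure.map_addHaar_smul _ hs.ne',
    Measure.map_smul, map_add_left_eq_self, finrank_euclideanSpace_fin, abs_of_pos (by positivity)]

lemma map_dilate_restrict (y : 𝔼 n) {s : ℝ} (hs : 0 < s) (R : ℝ) : Measure.map (dilate y s)
    (volume.restrict (ball 0 R)) = ofReal (s ^ n)⁻¹ • volume.restrict (ball y (s * R)) := by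
  have h : ball (0 : 𝔼 n) R = dilate y s ⁻¹' ball y (s * R) := by
    ext z; rw [mem_preimage, dilate_mem_ball y hs]
  rw [h, ← (measurableEmbedding_dilate y hs.ne').restrict_map, map_dilate y hs,
    Measure.restrict_smul]

lemma ae_dilate {P : 𝔼 n → Prop} (y : 𝔼 n) {s : ℝ} (hs : 0 < s) (R : ℝ) :
    (∀ᵐ z ∂(volume.restrict (ball 0 R)), P (dilate y s z)) ↔
    ∀ᵐ x ∂(volume.restrict (ball y (s * R))), P x := by
  rw [← (measurableEmbedding_dilate y hs.ne').ae_map_iff, map_dilate_restrict y hs,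
    Measure.ae_ennreal_smul_measure_iff (by simpa using pow_pos hs n)]

lemma setLIntegral_dilate (F : 𝔼 n → ℝ≥0∞) (y : 𝔼 n) {s : ℝ} (hs : 0 < s) (R : ℝ) :
    ∫⁻ z in ball 0 R, F (dilate y s z) = ofReal (s ^ n)⁻¹ * ∫⁻ x in ball y (s * R), F x := by
  rw [← (measurableEmbedding_dilate y hs.ne').lintegral_map, map_dilate_restrict y hs,
    lintegral_smul_measure, smul_eq_mul]

lemma integral_comp_dilate (F : 𝔼 n → ℝ) (y : 𝔼 n) {s : ℝ} (hs : 0 < s) :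
    ∫ z, F (dilate y s z) = (s ^ n)⁻¹ * ∫ x, F x := by
  rw [← (measurableEmbedding_dilate y hs.ne').integral_map, map_dilate y hs,
    integral_smul_measure, ENNReal.toReal_ofReal (by positivity), smul_eq_mul]

lemma locallyIntegrableOn_comp_dilate (hD : IsOpen D) (hf : LocallyIntegrableOn f D) (y : 𝔼 n)
    {s : ℝ} (hs : 0 < s) : LocallyIntegrableOn (fun z => f (dilate y s z)) (dilate y s ⁻¹' D) := by
  rw [locallyIntegrableOn_iff (hD.preimage (continuous_dilate y s)).isLocallyClosed]
  intro K hKD hK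
  have h1 : IntegrableOn f (dilate y s '' K) :=
    hf.integrableOn_compact_subset (image_subset_iff.2 hKD) (hK.image (continuous_dilate y s))
  have h2 : IntegrableOn f (dilate y s '' K) (Measure.map (dilate y s) volume) := by
    rw [map_dilate y hs, IntegrableOn, Measure.restrict_smul]
    exact h1.smul_measure ofReal_ne_top
  rw [(measurableEmbedding_dilate y hs.ne').integrableOn_map_iff,
    preimage_image_eq _ (dilate_injective y hs.ne')] at h2
  exact h2

/-- A test function on the preimage is carried back by the inverse dilation. When `s` is of the
order of `ρ`, the factor `s` compensates the weight `ρ⁻¹` that relates covector components to the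
norm of `g`. -/
lemma HasWeakPartial.comp_dilate (hD : IsOpen D) (h : HasWeakPartial D i f f') (y : 𝔼 n) {s : ℝ}
    (hs : 0 < s) : HasWeakPartial (dilate y s ⁻¹' D) i (fun z => f (dilate y s z))
    (fun z => s * f' (dilate y s z)) := by
  refine ⟨locallyIntegrableOn_comp_dilate hD h.1 y hs,
    (locallyIntegrableOn_comp_dilate hD h.2.1 y hs).smul s, fun ψ hψ hc hsupp => ?_⟩
  set e : 𝔼 n ≃ₜ 𝔼 n :=
    { toFun := dilate y s
      invFun := fun x => s⁻¹ • (x - y)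
      left_inv := inv_dilate y hs.ne'
      right_inv := dilate_inv y hs.ne'
      continuous_toFun := continuous_dilate y s
      continuous_invFun := by fun_prop } with he
  set η : 𝔼 n → ℝ := fun x => ψ (s⁻¹ • (x - y)) with hη
  have hη' : η = ψ ∘ e.symm := rfl
  have hηs : ContDiff ℝ ∞ η := hψ.comp (by fun_prop)
  have hηc : HasCompactSupport η := hc.comp_homeomorph e.symm
  have hηD : tsupport η ⊆ D := by
    rw [hη', tsupport_comp_eq_preimage]
    intro x hx
    have := hsupp hx
    rwa [mem_preimage, show dilate y s (e.symm x) = x from e.apply_symm_apply x] at this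
  have hder : ∀ z, 𝐃 ψ z (ê i) = s * 𝐃 η (dilate y s z) (ê i) := by
    intro z
    have hd : HasFDerivAt (fun x : 𝔼 n => s⁻¹ • (x - y))
        (s⁻¹ • ContinuousLinearMap.id ℝ (𝔼 n)) (dilate y s z) :=
      ((hasFDerivAt_id _).sub_const y).const_smul s⁻¹
    have hψd : HasFDerivAt ψ (𝐃 ψ z) (s⁻¹ • (dilate y s z - y)) := by
      rw [inv_dilate y hs.ne']
      exact (hψ.differentiable (by simp) z).hasFDerivAt
    have := (hψd.comp (dilate y s z) hd).fderiv
    rw [show η = ψ ∘ (fun x => s⁻¹ • (x - y)) from rfl, this]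
    simp [hs.ne']
  have key := h.2.2 η hηs hηc hηD
  have e1 : ∫ z, f (dilate y s z) * 𝐃 ψ z (ê i) =
      ∫ z, (fun x => s * (f x * 𝐃 η x (ê i))) (dilate y s z) := by
    congr 1; ext z; rw [hder z]; ring
  have e2 : ∫ z, s * f' (dilate y s z) * ψ z = ∫ z, (fun x => s * (f' x * η x)) (dilate y s z) := by
    congr 1; ext z; rw [hη]; simp only [inv_dilate y hs.ne']; ring
  rw [e1, e2, integral_comp_dilate (fun x => s * (f x * 𝐃 η x (ê i))) y hs,
    integral_comp_dilate (fun x => s * (f' x * η x)) y hs, integral_const_mul,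
    integral_const_mul, key]
  ring

end

/-! ### Smoothness of determinants and inverse matrices, and norms of 2-tensors -/

lemma contDiffOn_matrix_det {E : Type*} [NormedAddCommGroup E] [NormedSpace ℝ E] {s : Set E}
    {k : WithTop ℕ∞} {A : E → Matrix (Fin n) (Fin n) ℝ}
    (hA : ∀ i j, ContDiffOn ℝ k (fun y => A y i j) s) : ContDiffOn ℝ k (fun y => (A y).det) s := by
  simp only [Matrix.det_apply']
  exact ContDiffOn.sum fun σ _ => contDiffOn_const.mul (contDiffOn_prod fun i _ => hA _ _)

lemma contDiffOn_matrix_inv {E : Type*} [NormedAddCommGroup E] [NormedSpace ℝ E] {s : Set E}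
    {k : WithTop ℕ∞} {A : E → Matrix (Fin n) (Fin n) ℝ}
    (hA : ∀ i j, ContDiffOn ℝ k (fun y => A y i j) s) (hdet : ∀ y ∈ s, (A y).det ≠ 0) (i j : Fin n)
    : ContDiffOn ℝ k (fun y => (A y)⁻¹ i j) s := by
  simp only [Matrix.inv_def, Ring.inverse_eq_inv', Matrix.smul_apply, smul_eq_mul,
    Matrix.adjugate_apply]
  refine ((contDiffOn_matrix_det hA).inv hdet).mul (contDiffOn_matrix_det fun a b => ?_)
  by_cases h : a = j
  · subst h
    simp only [Matrix.updateRow_self]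
    exact contDiffOn_const
  · simp only [Matrix.updateRow_ne h]
    exact hA a b

/-- In this form invariance under a change of basis is a cancellation of inverse matrices and the
cyclicity of the trace. -/
lemma tensorNormSq_eq_trace (B T : 𝔹 n) :
    tensorNormSq B T = ((gram B)⁻¹.transpose * gram T * (gram B)⁻¹ * (gram T).transpose).trace := by
  simp only [tensorNormSq, Matrix.trace, Matrix.mul_apply, Matrix.transpose_apply,
    Matrix.diag_apply, sum_mul]
  rw [Finset.sum_comm' (t' := Finset.univ) (s' := fun _ => Finset.univ) (by simp)]
  conv_lhs => enter [2, j]; rw [sum_comm]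
  rw [sum_comm]
  refine sum_congr rfl fun k _ => ?_
  conv_lhs => enter [2, j]; rw [sum_comm]
  rw [sum_comm]
  refine sum_congr rfl fun l _ => ?_
  refine sum_congr rfl fun j _ => ?_
  refine sum_congr rfl fun i _ => ?_
  simp only [gram, Matrix.of_apply]
  ring

lemma tensorNormSq_bilinearComp (B T : 𝔹 n) {J : 𝔼 n →L[ℝ] 𝔼 n} (hJ : J.IsInvertible) :
    tensorNormSq (B.bilinearComp J J) (T.bilinearComp J J) = tensorNormSq B T := by
  have hu := isUnit_det_stdMat hJ
  have hut : IsUnit (stdMat J).transpose.det := by rwa [Matrix.det_transpose]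
  rw [tensorNormSq_eq_trace, tensorNormSq_eq_trace, inv_gram_bilinearComp, gram_bilinearComp]
  simp only [Matrix.transpose_mul, Matrix.transpose_transpose, Matrix.transpose_nonsing_inv]
  have e1 : ∀ X : Matrix (Fin n) (Fin n) ℝ,
      (stdMat J).transpose⁻¹ * ((stdMat J).transpose * X) = X := fun X => by
    rw [← Matrix.mul_assoc, Matrix.nonsing_inv_mul _ hut, Matrix.one_mul]
  have e2 : ∀ X : Matrix (Fin n) (Fin n) ℝ, stdMat J * ((stdMat J)⁻¹ * X) = X := fun X => by
    rw [← Matrix.mul_assoc, Matrix.mul_nonsing_inv _ hu, Matrix.one_mul]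
  simp only [Matrix.mul_assoc, e1, e2]
  rw [Matrix.trace_mul_comm]
  simp only [Matrix.mul_assoc, Matrix.mul_nonsing_inv _ hu, Matrix.mul_one]

/-! ### Linear algebra of positive definite forms -/

section

variable {B : 𝔹 n}

lemma posDef_gram (hsymm : ∀ v w, B v w = B w v) (hpos : ∀ v, v ≠ 0 → 0 < B v v) :
    (gram B).PosDef := by
  refine Matrix.PosDef.of_dotProduct_mulVec_pos ?_ fun v hv => ?_
  · ext i j
    simp [gram, hsymm (ê i)]
  · have := hpos (WithLp.toLp 2 v) (by simpa using hv)
    refine lt_of_lt_of_eq this ?_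
    conv_lhs => rw [eq_sum_stdVec (WithLp.toLp 2 v)]
    simp only [dotProduct, Matrix.mulVec, gram, Matrix.of_apply, map_sum, map_smul,
      sum_apply, smul_apply, smul_eq_mul, mul_sum]
    refine sum_congr rfl fun i _ => sum_congr rfl fun j _ => ?_
    rw [hsymm]
    rw [Pi.star_apply, star_trivial]; ring

open scoped MatrixOrder Matrix.Norms.L2Operator in
/-- A basis in which a scalar product becomes the standard one. -/
lemma exists_isInvertible_gram_eq_one (hsymm : ∀ v w, B v w = B w v) (hpos : ∀ v, v ≠ 0 → 0 < B v v)
    : ∃ J : 𝔼 n →L[ℝ] 𝔼 n, J.IsInvertible ∧ gram (B.bilinearComp J J) = 1 := by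
  have hG := (posDef_gram hsymm hpos).inv
  -- With `(gram B)⁻¹ = Pᵀ P`, the map of matrix `Pᵀ` has the required property: `P (gram B) Pᵀ = P
  -- P⁻¹ (Pᵀ)⁻¹ Pᵀ = 1`.
  obtain ⟨P, hP⟩ := CStarAlgebra.nonneg_iff_eq_star_mul_self.1 hG.posSemidef.nonneg
  rw [Matrix.star_eq_conjTranspose] at hP
  have hGu : IsUnit (gram B).det := (posDef_gram hsymm hpos).isUnit.map Matrix.detMonoidHom
  have hPu : IsUnit P.det := by
    have := congrArg Matrix.det hP
    rw [Matrix.det_mul, Matrix.det_conjTranspose] at this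
    have h2 : IsUnit ((gram B)⁻¹).det := Matrix.isUnit_nonsing_inv_det _ hGu
    rw [this] at h2
    exact isUnit_of_mul_isUnit_right h2
  rw [Matrix.conjTranspose_eq_transpose_of_trivial] at hP
  set L : 𝔼 n →ₗ[ℝ] 𝔼 n := Matrix.toLin (EuclideanSpace.basisFun (Fin n) ℝ).toBasis
      (EuclideanSpace.basisFun (Fin n) ℝ).toBasis P.transpose with hL
  have hLm : stdMat (LinearMap.toContinuousLinearMap L) = P.transpose := by
    rw [stdMat_eq_toMatrix]
    simp [hL]
  have hdet : IsUnit (LinearMap.det L) := by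
    rw [hL, LinearMap.det_toLin, Matrix.det_transpose]; exact hPu
  refine ⟨LinearMap.toContinuousLinearMap L,
    ⟨(LinearEquiv.ofIsUnitDet (v := (EuclideanSpace.basisFun (Fin n) ℝ).toBasis)
      (v' := (EuclideanSpace.basisFun (Fin n) ℝ).toBasis) (f := L) ?_).toContinuousLinearEquiv, ?_⟩,
        ?_⟩
  · rw [LinearMap.det_toMatrix]; exact hdet
  · ext1 v; rfl
  · have hPt : IsUnit P.transpose.det := by rwa [Matrix.det_transpose]
    have hGinv : gram B = P⁻¹ * P.transpose⁻¹ := by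
      rw [← Matrix.mul_inv_rev, ← hP, Matrix.nonsing_inv_nonsing_inv _ hGu]
    rw [gram_bilinearComp, hLm, Matrix.transpose_transpose, hGinv, ← Matrix.mul_assoc,
      Matrix.mul_nonsing_inv _ hPu, Matrix.one_mul, Matrix.nonsing_inv_mul _ hPt]

lemma covectorNormSq_nonneg (hsymm : ∀ v w, B v w = B w v) (hpos : ∀ v, v ≠ 0 → 0 < B v v)
    (α : 𝔼 n →L[ℝ] ℝ) : 0 ≤ covectorNormSq B α := by
  obtain ⟨J, hJ, h1⟩ := exists_isInvertible_gram_eq_one hsymm hpos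
  rw [← covectorInner_self, ← covectorInner_bilinearComp B α α hJ, covectorInner, h1]
  simp only [inv_one, Matrix.one_apply, ite_mul, one_mul, zero_mul, Finset.sum_ite_eq,
    Finset.mem_univ, if_true]
  exact Finset.sum_nonneg fun i _ => mul_self_nonneg _

lemma apply_self_eq_sum_sq (h1 : gram B = 1) (v : 𝔼 n) : B v v = ∑ i, v i ^ 2 := by
  conv_lhs => rw [eq_sum_stdVec v]
  have hij : ∀ i j, B (ê i) (ê j) = (1 : Matrix (Fin n) (Fin n) ℝ) i j := fun i j => by
    rw [← h1]; rfl
  simp only [map_sum, map_smul, sum_apply, smul_apply, smul_eq_mul, hij, Matrix.one_apply]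
  simp [pow_two]

/-- Cauchy–Schwarz in a basis orthonormal for `B`. It bounds the components of a covector by its
norm. -/
lemma sq_apply_le (hsymm : ∀ v w, B v w = B w v) (hpos : ∀ v, v ≠ 0 → 0 < B v v) (α : 𝔼 n →L[ℝ] ℝ)
    (v : 𝔼 n) : α v ^ 2 ≤ covectorNormSq B α * B v v := by
  obtain ⟨J, hJ, h1⟩ := exists_isInvertible_gram_eq_one hsymm hpos
  obtain ⟨w, rfl⟩ : ∃ w, J w = v := by obtain ⟨e, rfl⟩ := hJ; exact e.surjective v
  have e1 : covectorNormSq B α = ∑ i, (α (J (ê i))) ^ 2 := by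
    rw [← covectorInner_self, ← covectorInner_bilinearComp B α α hJ, covectorInner, h1]
    simp only [inv_one, Matrix.one_apply, ite_mul, one_mul, zero_mul, Finset.sum_ite_eq,
      Finset.mem_univ, if_true, ContinuousLinearMap.comp_apply, pow_two]
  have e2 : B (J w) (J w) = ∑ i, w i ^ 2 := apply_self_eq_sum_sq (B := B.bilinearComp J J) h1 w
  have e3 : α (J w) = ∑ i, α (J (ê i)) * w i := by
    conv_lhs => rw [eq_sum_stdVec w]
    simp only [map_sum, map_smul, smul_eq_mul]
    exact sum_congr rfl fun i _ => mul_comm _ _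
  rw [e1, e2, e3]
  exact Finset.sum_mul_sq_le_sq_mul_sq _ _ _

lemma sq_apply_apply_le (hsymm : ∀ v w, B v w = B w v) (hpos : ∀ v, v ≠ 0 → 0 < B v v) (T : 𝔹 n)
    (v w : 𝔼 n) : T v w ^ 2 ≤ tensorNormSq B T * (B v v * B w w) := by
  obtain ⟨J, hJ, h1⟩ := exists_isInvertible_gram_eq_one hsymm hpos
  obtain ⟨a, rfl⟩ : ∃ w, J w = v := by obtain ⟨e, rfl⟩ := hJ; exact e.surjective v
  obtain ⟨b, rfl⟩ : ∃ b, J b = w := by obtain ⟨e, rfl⟩ := hJ; exact e.surjective w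
  have e1 : tensorNormSq B T = ∑ p : Fin n × Fin n, (T (J (ê p.1)) (J (ê p.2))) ^ 2 := by
    rw [← tensorNormSq_bilinearComp B T hJ, tensorNormSq, h1, Fintype.sum_prod_type]
    simp only [inv_one, Matrix.one_apply, ite_mul, mul_ite, one_mul, zero_mul, mul_zero, mul_one,
      Finset.sum_ite_eq, Finset.mem_univ, if_true, ContinuousLinearMap.bilinearComp_apply, pow_two]
  have e2 : ∀ w, B (J w) (J w) = ∑ i, w i ^ 2 := apply_self_eq_sum_sq (B := B.bilinearComp J J) h1
  have e3 : T (J a) (J b) = ∑ p : Fin n × Fin n, T (J (ê p.1)) (J (ê p.2)) * (a p.1 * b p.2) := by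
    conv_lhs => rw [eq_sum_stdVec a, eq_sum_stdVec b]
    simp only [map_sum, map_smul, smul_eq_mul, sum_apply, smul_apply, Fintype.sum_prod_type]
    rw [sum_comm]
    refine sum_congr rfl fun i _ => ?_
    simp only [mul_sum]
    refine sum_congr rfl fun j _ => ?_
    ring
  have e4 : (∑ i, a i ^ 2) * (∑ i, b i ^ 2) = ∑ p : Fin n × Fin n, (a p.1 * b p.2) ^ 2 := by
    rw [Fintype.sum_prod_type, Finset.sum_mul_sum]
    simp only [mul_pow]
  rw [e1, e2, e2, e3, e4]
  exact Finset.sum_mul_sq_le_sq_mul_sq _ _ _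

end

lemma abs_apply_stdVec_le (L : 𝔼 n →L[ℝ] ℝ) (i : Fin n) : |L (ê i)| ≤ ‖L‖ := by
  have := L.le_opNorm (ê i)
  simpa using this

lemma abs_bilin_le (B : 𝔹 n) {c : ℝ} (hB : ∀ i j, |B (ê i) (ê j)| ≤ c) (v : 𝔼 n) :
    B v v ≤ (n : ℝ) ^ 2 * (c * ‖v‖ ^ 2) := by
  have hv : ∀ i, |v i| ≤ ‖v‖ := fun i => by simpa using PiLp.norm_apply_le v i
  conv_lhs => rw [eq_sum_stdVec v]
  simp only [map_sum, map_smul, sum_apply, smul_apply, smul_eq_mul, mul_sum]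
  calc ∑ i, ∑ j, v i * (v j * B (ê j) (ê i))
      ≤ ∑ _i : Fin n, ∑ _j : Fin n, c * ‖v‖ ^ 2 := by
        refine sum_le_sum fun i _ => sum_le_sum fun j _ => ?_
        refine (le_abs_self _).trans ?_
        rw [abs_mul, abs_mul]
        calc |v i| * (|v j| * |B (ê j) (ê i)|)
            ≤ ‖v‖ * (‖v‖ * c) := mul_le_mul (hv i) (mul_le_mul (hv j) (hB j i) (abs_nonneg _)
              (norm_nonneg _)) (by positivity) (norm_nonneg _)
          _ = c * ‖v‖ ^ 2 := by ring
    _ = (n : ℝ) ^ 2 * (c * ‖v‖ ^ 2) := by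
        simp only [Finset.sum_const, Finset.card_univ, Fintype.card_fin, nsmul_eq_mul]; ring

/-! ### Derivatives of bilinear maps depending on a point -/

section

variable {E F : Type*} [NormedAddCommGroup E] [NormedSpace ℝ E] [NormedAddCommGroup F]
  [NormedSpace ℝ F]

lemma contDiffOn_smul_const {k : WithTop ℕ∞} {s : Set E} {f : E → ℝ} (hf : ContDiffOn ℝ k f s)
    (c : F) : ContDiffOn ℝ k (fun x => f x • c) s := hf.smul contDiffOn_const

lemma hasFDerivAt_bilin_apply {B : E → E →L[ℝ] E →L[ℝ] F} {y : E} (hB : DifferentiableAt ℝ B y)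
    (v w : E) : HasFDerivAt (fun y => B y v w) (((𝐃 B y).flip v).flip w) y := by
  refine ((hB.hasFDerivAt.clm_apply (hasFDerivAt_const v y)).clm_apply
    (hasFDerivAt_const w y)).congr_fderiv ?_
  ext x
  simp

lemma fderiv_bilin_apply {B : E → E →L[ℝ] E →L[ℝ] F} {y : E} (hB : DifferentiableAt ℝ B y)
    (v w x : E) : 𝐃 (fun y => B y v w) y x = 𝐃 B y x v w := by
  rw [(hasFDerivAt_bilin_apply hB v w).fderiv]; rfl

lemma hasFDerivAt_bilin_comp {B : E → E →L[ℝ] E →L[ℝ] F} {τ : E → E} {y : E}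
    (hB : DifferentiableAt ℝ B (τ y)) (hτ : DifferentiableAt ℝ τ y)
    (hτ' : DifferentiableAt ℝ (𝐃 τ) y) (v w : E) : ∃ L : E →L[ℝ] F,
    HasFDerivAt (fun y => B (τ y) (𝐃 τ y v) (𝐃 τ y w)) L y ∧ ∀ x, L x = 𝐃 B (τ y) (𝐃 τ y x)
    (𝐃 τ y v) (𝐃 τ y w) + B (τ y) (𝐃 (𝐃 τ) y x v) (𝐃 τ y w) + B (τ y) (𝐃 τ y v) (𝐃 (𝐃 τ) y x w)
    := by
  have hA := fun v => hτ'.hasFDerivAt.clm_apply (hasFDerivAt_const v y)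
  refine ⟨_, ((hB.hasFDerivAt.comp y hτ.hasFDerivAt).clm_apply (hA v)).clm_apply (hA w),
    fun x => ?_⟩
  simp only [ContinuousLinearMap.comp_zero, zero_add, add_apply, ContinuousLinearMap.flip_apply,
    ContinuousLinearMap.comp_apply]
  abel

lemma hasFDerivAt_apply_bilin {B : E → E →L[ℝ] E →L[ℝ] E} {A : E → E →L[ℝ] F} {y : E}
    (hA : DifferentiableAt ℝ A y) (hB : DifferentiableAt ℝ B y) (v w : E) : ∃ L : E →L[ℝ] F,
    HasFDerivAt (fun y => A y (B y v w)) L y ∧ ∀ x, L x = 𝐃 A y x (B y v w) + A y (𝐃 B y x v w)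
    := by
  refine ⟨_, hA.hasFDerivAt.clm_apply (hasFDerivAt_bilin_apply hB v w), fun x => ?_⟩
  simp only [add_apply, ContinuousLinearMap.flip_apply, ContinuousLinearMap.comp_apply]
  abel

/-- The derivative of a pulled back family of bilinear forms. -/
lemma fderiv_of_eventually_eq_pullback {B₀ B₁ : E → E →L[ℝ] E →L[ℝ] F} {τ : E → E} {y : E}
    (hB₀ : DifferentiableAt ℝ B₀ y) (hB₁ : DifferentiableAt ℝ B₁ (τ y))
    (hτ : DifferentiableAt ℝ τ y) (hτ' : DifferentiableAt ℝ (𝐃 τ) y)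
    (h : ∀ᶠ z in 𝓝 y, ∀ v w, B₀ z v w = B₁ (τ z) (𝐃 τ z v) (𝐃 τ z w)) (x v w : E) :
    𝐃 B₀ y x v w = 𝐃 B₁ (τ y) (𝐃 τ y x) (𝐃 τ y v) (𝐃 τ y w) + B₁ (τ y) (𝐃 (𝐃 τ) y x v) (𝐃 τ y w) +
    B₁ (τ y) (𝐃 τ y v) (𝐃 (𝐃 τ) y x w) := by
  obtain ⟨L, hL, hLx⟩ := hasFDerivAt_bilin_comp hB₁ hτ hτ' v w
  have hev : (fun y => B₀ y v w) =ᶠ[𝓝 y]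
    fun y => B₁ (τ y) (𝐃 τ y v) (𝐃 τ y w) := h.mono fun z hz => hz v w
  rw [← fderiv_bilin_apply hB₀, hev.fderiv_eq, hL.fderiv, hLx]

/-- The derivative of the transformation rule of a connection. -/
lemma fderiv_of_eventually_eq_connection {Γ₀ Γ₁ : E → E →L[ℝ] E →L[ℝ] E} {τ : E → E} {y : E}
    (hΓ₀ : DifferentiableAt ℝ Γ₀ y) (hΓ₁ : DifferentiableAt ℝ Γ₁ (τ y))
    (hτ : DifferentiableAt ℝ τ y) (hτ' : DifferentiableAt ℝ (𝐃 τ) y)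
    (hτ'' : DifferentiableAt ℝ (𝐃 (𝐃 τ)) y)
    (h : ∀ᶠ z in 𝓝 y, ∀ v w, 𝐃 τ z (Γ₀ z v w) = Γ₁ (τ z) (𝐃 τ z v) (𝐃 τ z w) + 𝐃 (𝐃 τ) z v w)
    (x v w : E) : 𝐃 (𝐃 τ) y x (Γ₀ y v w) + 𝐃 τ y (𝐃 Γ₀ y x v w) = 𝐃 Γ₁ (τ y) (𝐃 τ y x) (𝐃 τ y v)
    (𝐃 τ y w) + Γ₁ (τ y) (𝐃 (𝐃 τ) y x v) (𝐃 τ y w) + Γ₁ (τ y) (𝐃 τ y v) (𝐃 (𝐃 τ) y x w) +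
    𝐃 (𝐃 (𝐃 τ)) y x v w := by
  obtain ⟨L, hL, hLx⟩ := hasFDerivAt_bilin_comp hΓ₁ hτ hτ' v w
  obtain ⟨L', hL', hLx'⟩ := hasFDerivAt_apply_bilin hτ' hΓ₀ v w
  have hev : (fun y => 𝐃 τ y (Γ₀ y v w)) =ᶠ[𝓝 y]
    fun y => Γ₁ (τ y) (𝐃 τ y v) (𝐃 τ y w) + 𝐃 (𝐃 τ) y v w := h.mono fun z hz => hz v w
  have h1 := hL'.congr_of_eventuallyEq hev.symm
  have h2 := hL.add (hasFDerivAt_bilin_apply hτ'' v w)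
  have h3 := congrArg (fun L => L x) (h1.unique h2)
  rw [← hLx', h3, ← hLx]
  rfl

end

/-! ### Components of bilinear maps and the algebra of the curvature -/

/-- The bilinear form `(v, w) ↦ v i * w j`. -/
def dualForm (i j : Fin n) : 𝔹 n := covectorMul (EuclideanSpace.proj i) (EuclideanSpace.proj j)

lemma dualForm_apply (i j : Fin n) (v w : 𝔼 n) : dualForm i j v w = v i * w j := rfl

lemma eq_sum_dualForm (B : 𝔹 n) : B = ∑ i, ∑ j, B (ê i) (ê j) • dualForm i j := by
  ext1 v; ext1 w
  conv_lhs => rw [eq_sum_stdVec v, eq_sum_stdVec w]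
  simp only [map_sum, map_smul, sum_apply, smul_apply, smul_eq_mul, dualForm_apply, mul_sum]
  rw [sum_comm]
  refine sum_congr rfl fun i _ => sum_congr rfl fun j _ => ?_
  ring

lemma eq_of_stdVec {L₁ L₂ : 𝔼 n →L[ℝ] ℝ} (h : ∀ i, L₁ (ê i) = L₂ (ê i)) (v : 𝔼 n) :
    L₁ v = L₂ v := by
  rw [eq_sum_stdVec v]
  simp only [map_sum, map_smul, h]

/-- The bilinear map `(v, w) ↦ v i * w j • e_k`. -/
def vecForm (k i j : Fin n) : 𝔼 n →L[ℝ] 𝔼 n →L[ℝ] 𝔼 n :=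
  (EuclideanSpace.proj i : 𝔼 n →L[ℝ] ℝ).smulRight
    ((EuclideanSpace.proj j : 𝔼 n →L[ℝ] ℝ).smulRight (ê k))

lemma vecForm_apply (k i j : Fin n) (v w : 𝔼 n) : vecForm k i j v w = v i • w j • (ê k : 𝔼 n) := rfl

/-- The endomorphism `x ↦ R(x, w) u` defined by a connection `Γ` with derivative `dΓ`. -/
def curvEnd (Γ : 𝔼 n →L[ℝ] 𝔼 n →L[ℝ] 𝔼 n) (dΓ : 𝔼 n →L[ℝ] 𝔼 n →L[ℝ] 𝔼 n →L[ℝ] 𝔼 n) (w u : 𝔼 n) :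
    𝔼 n →L[ℝ] 𝔼 n := (dΓ.flip w).flip u - (dΓ w).flip u + Γ.flip (Γ w u) - (Γ w).comp (Γ.flip u)

lemma curvEnd_apply (Γ : 𝔼 n →L[ℝ] 𝔼 n →L[ℝ] 𝔼 n) (dΓ : 𝔼 n →L[ℝ] 𝔼 n →L[ℝ] 𝔼 n →L[ℝ] 𝔼 n)
    (w u x : 𝔼 n) : curvEnd Γ dΓ w u x = dΓ x w u - dΓ w x u + Γ x (Γ w u) - Γ w (Γ x u) := rfl

lemma sum_apply_stdVec_eq_trace (A : 𝔼 n →L[ℝ] 𝔼 n) :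
    ∑ k, A (ê k) k = LinearMap.trace ℝ _ (A : 𝔼 n →ₗ[ℝ] _) := by
  rw [LinearMap.trace_eq_matrix_trace ℝ (EuclideanSpace.basisFun (Fin n) ℝ).toBasis,
    ← stdMat_eq_toMatrix]
  rfl

lemma sum_apply_stdVec_conj {A₀ A₁ J : 𝔼 n →L[ℝ] 𝔼 n} (hJ : J.IsInvertible)
    (h : ∀ x, J (A₀ x) = A₁ (J x)) : ∑ k, A₀ (ê k) k = ∑ k, A₁ (ê k) k := by
  obtain ⟨e, rfl⟩ := hJ
  rw [sum_apply_stdVec_eq_trace, sum_apply_stdVec_eq_trace,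
    ← LinearMap.trace_conj' _ e.toLinearEquiv]
  congr 1
  ext1 x
  rw [LinearEquiv.conj_apply_apply]
  have := h (e.symm x)
  simp only [ContinuousLinearEquiv.coe_coe, ContinuousLinearEquiv.apply_symm_apply] at this
  exact this

/-- The curvature is tensorial. -/
lemma curvEnd_transform {a : 𝔼 n →L[ℝ] 𝔼 n} {Γ₀ Γ₁ b : 𝔼 n →L[ℝ] 𝔼 n →L[ℝ] 𝔼 n}
    {dΓ₀ dΓ₁ c : 𝔼 n →L[ℝ] 𝔼 n →L[ℝ] 𝔼 n →L[ℝ] 𝔼 n} (hb : ∀ x w, b x w = b w x)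
    (hc : ∀ x w u, c x w u = c w x u) (h0 : ∀ w u, a (Γ₀ w u) = Γ₁ (a w) (a u) + b w u) (h1 :
    ∀ x w u, b x (Γ₀ w u) + a (dΓ₀ x w u) = dΓ₁ (a x) (a w) (a u) + Γ₁ (b x w) (a u) + Γ₁ (a w)
    (b x u) + c x w u) (w u x : 𝔼 n) :
    a (curvEnd Γ₀ dΓ₀ w u x) = curvEnd Γ₁ dΓ₁ (a w) (a u) (a x) := by
  rw [curvEnd_apply, curvEnd_apply, map_sub, map_add, map_sub, h0 x, h0 w (Γ₀ x u), h0 w u, h0 x u,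
    map_add, map_add]
  have e1 := h1 x w u
  have e2 := h1 w x u
  -- By symmetry of `b` and `c`, the terms in `b x w` and in `c` drop out when `x` and `w` are
  -- antisymmetrized. The other terms in `b` cancel against those that `h0` produces in the
  -- quadratic part.
  rw [hc w x u, hb w x] at e2
  have e3 : a (dΓ₀ x w u) = dΓ₁ (a x) (a w) (a u) + Γ₁ (b x w) (a u)
      + Γ₁ (a w) (b x u) + c x w u - b x (Γ₀ w u) := by rw [← e1]; abel
  have e4 : a (dΓ₀ w x u) = dΓ₁ (a w) (a x) (a u) + Γ₁ (b x w) (a u)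
      + Γ₁ (a x) (b w u) + c x w u - b w (Γ₀ x u) := by rw [← e2]; abel
  rw [e3, e4]
  abel

/-- The trace of the curvature, as a function of the last two arguments. -/
def curvTrace (Γ : 𝔼 n →L[ℝ] 𝔼 n →L[ℝ] 𝔼 n) (dΓ : 𝔼 n →L[ℝ] 𝔼 n →L[ℝ] 𝔼 n →L[ℝ] 𝔼 n) (u w : 𝔼 n) :
    ℝ := ∑ k, curvEnd Γ dΓ w u (ê k) k

/-- Bilinearity of the trace, one argument at a time: with the other argument fixed it is a sum of
continuous linear maps, determined by its values on the basis. -/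
lemma curvTrace_eq_sum (Γ : 𝔼 n →L[ℝ] 𝔼 n →L[ℝ] 𝔼 n) (dΓ : 𝔼 n →L[ℝ] 𝔼 n →L[ℝ] 𝔼 n →L[ℝ] 𝔼 n)
    (u w : 𝔼 n) :
    curvTrace Γ dΓ u w = (∑ i, ∑ j, curvTrace Γ dΓ (ê i) (ê j) • dualForm i j) u w := by
  set T : 𝔹 n := ∑ i, ∑ j, curvTrace Γ dΓ (ê i) (ê j) • dualForm i j with hT
  have hTij : ∀ i j, T (ê i) (ê j) = curvTrace Γ dΓ (ê i) (ê j) := by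
    intro i j
    simp [hT, dualForm_apply, sum_apply]
  have h1 : ∀ i, curvTrace Γ dΓ (ê i) w = T (ê i) w := by
    intro i
    refine Eq.trans ?_ (eq_of_stdVec (L₁ := ∑ k, (EuclideanSpace.proj k).comp
      ((dΓ (ê k)).flip (ê i) - (dΓ.flip (ê k)).flip (ê i)
        + (Γ (ê k)).comp (Γ.flip (ê i)) - Γ.flip (Γ (ê k) (ê i))))
      (L₂ := T (ê i)) (fun j => ?_) w)
    · simp only [curvTrace, curvEnd_apply, sum_apply, ContinuousLinearMap.comp_apply]
      rfl
    · rw [hTij]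
      simp only [curvTrace, curvEnd_apply, sum_apply, ContinuousLinearMap.comp_apply]
      rfl
  refine Eq.trans ?_ (eq_of_stdVec (L₁ := ∑ k, (EuclideanSpace.proj k).comp
      (dΓ (ê k) w - dΓ w (ê k) + (Γ (ê k)).comp (Γ w) - (Γ w).comp (Γ (ê k))))
      (L₂ := T.flip w) (fun i => ?_) u)
  · simp only [curvTrace, curvEnd_apply, sum_apply, ContinuousLinearMap.comp_apply]
    rfl
  · rw [ContinuousLinearMap.flip_apply, ← h1]
    simp only [curvTrace, curvEnd_apply, sum_apply, ContinuousLinearMap.comp_apply]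
    rfl

lemma abs_apply_le {B : 𝔹 n} (hsymm : ∀ v w, B v w = B w v) (hpos : ∀ v, v ≠ 0 → 0 < B v v)
    (α : 𝔼 n →L[ℝ] ℝ) (v : 𝔼 n) : |α v| ≤ √(covectorNormSq B α) * √(B v v) := by
  rw [← Real.sqrt_mul (covectorNormSq_nonneg hsymm hpos _)]
  exact Real.abs_le_sqrt (sq_apply_le hsymm hpos _ _)

lemma abs_apply_apply_le {B : 𝔹 n} (hsymm : ∀ v w, B v w = B w v) (hpos : ∀ v, v ≠ 0 → 0 < B v v)
    (T : 𝔹 n) (v w : 𝔼 n) : |T v w| ≤ √(tensorNormSq B T) * √(B v v * B w w) := by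
  have h0 : ∀ v, 0 ≤ B v v := fun v => by
    by_cases h : v = 0
    · simp [h]
    · exact (hpos v h).le
  rw [← Real.sqrt_mul' _ (mul_nonneg (h0 v) (h0 w))]
  exact Real.abs_le_sqrt (sq_apply_apply_le hsymm hpos _ _ _)

lemma eLpNorm_le_of_abs_le {X : Type*} [MeasurableSpace X] {μ : Measure X} {q : ℝ≥0∞} (hq : 1 ≤ q)
    {f a b : X → ℝ} {c : ℝ} (ha : AEStronglyMeasurable a μ) (hb : AEStronglyMeasurable b μ)
    (h : ∀ᵐ x ∂μ, |f x| ≤ c * (a x + b x)) :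
    eLpNorm f q μ ≤ ofReal |c| * (eLpNorm a q μ + eLpNorm b q μ) := by
  refine (eLpNorm_mono_ae (g := c • (a + b)) ?_).trans ?_
  · filter_upwards [h] with x hx
    rw [Real.norm_eq_abs, Real.norm_eq_abs]
    exact hx.trans (le_abs_self _)
  · rw [eLpNorm_const_smul, ← Real.norm_eq_abs, ofReal_norm]
    gcongr
    exact eLpNorm_add_le ha hb hq

/-! ### Integration of local estimates over balls of variable radius -/

/-- Tonelli's theorem on the set of pairs with `dist x y < w y`: the points of a ball are exchanged
with its centre. -/
lemma lintegral_mul_setLIntegral_ball {m a : 𝔼 n → ℝ≥0∞} {w : 𝔼 n → ℝ} (hm : Measurable m)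
    (ha : Measurable a) (hw : Measurable w) :
    ∫⁻ y, m y * ∫⁻ x in ball y (w y), a x = ∫⁻ x, a x * ∫⁻ y in {y | dist x y < w y}, m y := by
  set S : Set (𝔼 n × 𝔼 n) := {q | dist q.2 q.1 < w q.1} with hS
  have hSm : MeasurableSet S :=
    measurableSet_lt (measurable_snd.dist measurable_fst) (hw.comp measurable_fst)
  have h1 : ∀ y, m y * ∫⁻ x in ball y (w y), a x =
      ∫⁻ x, S.indicator (fun q => m q.1 * a q.2) (y, x) := by
    intro y
    rw [← lintegral_const_mul _ ha, ← lintegral_indicator measurableSet_ball]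
    rfl
  have h2 : ∀ x, a x * ∫⁻ y in {y | dist x y < w y}, m y =
      ∫⁻ y, S.indicator (fun q => m q.1 * a q.2) (y, x) := by
    intro x
    have hms : MeasurableSet {y | dist x y < w y} :=
      measurableSet_lt (measurable_const.dist measurable_id) hw
    rw [mul_comm, ← lintegral_mul_const _ hm, ← lintegral_indicator hms]
    rfl
  simp only [h1, h2]
  exact lintegral_lintegral_swap ((((hm.comp measurable_fst).mul
    (ha.comp measurable_snd)).indicator hSm).aemeasurable)

/-- The local inequality is integrated over the centres `y` with the weight `w(y)^(-2n)`, and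
centres and points are exchanged. Since `w` varies at most by a factor `2` on the balls, the centres
whose ball contains `x` fill a volume comparable with `w(x)^n`, so the inner integral is comparable
with `w(x)^(-n)`. This averaging plays the role of a covering with bounded overlap. -/
lemma exists_lintegral_const_of_variable_balls {Ω₁ Ω₂ Ω₃ : Set (𝔼 n)} (h1 : MeasurableSet Ω₁)
    (h2 : MeasurableSet Ω₂) (h3 : MeasurableSet Ω₃) (h12 : Ω₁ ⊆ Ω₂) (h23 : Ω₂ ⊆ Ω₃) {w : 𝔼 n → ℝ}
    {ε : ℝ} (hε : 0 < ε) (hw : Measurable w) (hpos : ∀ y ∈ Ω₃, 0 < w y)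
    (hb2 : ∀ y ∈ Ω₁, ball y (ε * w y) ⊆ Ω₂) (hb3 : ∀ y ∈ Ω₂, ball y (ε * w y) ⊆ Ω₃)
    (hcomp : ∀ y ∈ Ω₂, ∀ z ∈ ball y (ε * w y), w y ≤ 2 * w z ∧ w z ≤ 2 * w y) : ∃ K : ℝ≥0∞, K ≠ ⊤ ∧
    ∀ a b : 𝔼 n → ℝ≥0∞, Measurable a → Measurable b → ∀ c : ℝ≥0∞, c ≠ ⊤ →
    (∀ y ∈ Ω₂, ∫⁻ x in ball y (ε / 2 * w y), a x ≤ c * ∫⁻ x in ball y (ε * w y), b x) → ∫⁻ x in Ω₁,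
    ofReal (w x ^ n)⁻¹ * a x ≤ K * c * ∫⁻ x in Ω₃, ofReal (w x ^ n)⁻¹ * b x := by
  obtain ⟨V, hV⟩ : ∃ V, V = volume (ball (0 : 𝔼 n) 1) := ⟨_, rfl⟩
  have hV0 : V ≠ 0 := hV ▸ (Metric.measure_ball_pos _ _ one_pos).ne'
  have hVt : V ≠ ⊤ := hV ▸ measure_ball_lt_top.ne
  have hvol : ∀ (x : 𝔼 n) (t : ℝ), 0 < t → volume (ball x t) = ofReal (t ^ n) * V := by
    intro x t ht
    rw [Measure.addHaar_ball_of_pos _ _ ht, finrank_euclideanSpace_fin, hV]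
  obtain ⟨m, hmdef⟩ : ∃ m : 𝔼 n → ℝ≥0∞,
    m = Ω₂.indicator fun y => ofReal (w y ^ (2 * n))⁻¹ := ⟨_, rfl⟩
  have hm : Measurable m := hmdef ▸ ((hw.pow_const _).inv.ennreal_ofReal.indicator h2)
  -- In both constants `4 ^ n` compares `w(y)^(2n)` with `w(x)^(2n)`. The ball of radius `ε/4 w(x)`
  -- around `x` lies among the centres counted from below, and the ball of radius `2 ε w(x)`
  -- contains those counted from above.
  obtain ⟨c1, hc1⟩ : ∃ c1 : ℝ, c1 = (4 ^ n : ℝ)⁻¹ * (ε / 4) ^ n := ⟨_, rfl⟩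
  obtain ⟨c2, hc2⟩ : ∃ c2 : ℝ, c2 = 4 ^ n * (2 * ε) ^ n := ⟨_, rfl⟩
  have hc1p : 0 < c1 := by rw [hc1]; positivity
  have hc2p : 0 < c2 := by rw [hc2]; positivity
  have low : ∀ x ∈ Ω₁, ofReal c1 * V * ofReal (w x ^ n)⁻¹ ≤
      ∫⁻ y in {y | dist x y < ε / 2 * w y}, m y := by
    intro x hx
    have hxp := hpos x (h23 (h12 hx))
    have hsub : ball x (ε / 4 * w x) ⊆ ball x (ε * w x) := Metric.ball_subset_ball (by nlinarith)
    have hsub2 : ball x (ε / 4 * w x) ⊆ {y | dist x y < ε / 2 * w y} := by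
      intro y hy
      have := (hcomp x (h12 hx) y (hsub hy)).1
      rw [Metric.mem_ball, dist_comm] at hy
      refine lt_of_lt_of_le hy ?_
      nlinarith
    calc _ = ofReal ((4 ^ n * w x ^ (2 * n))⁻¹) * volume (ball x (ε / 4 * w x)) := by
          rw [hvol x _ (by positivity), mul_right_comm, ← mul_assoc,
            ← ENNReal.ofReal_mul hc1p.le, ← ENNReal.ofReal_mul (by positivity)]
          congr 2
          rw [hc1, mul_pow, pow_mul', pow_two]
          field_simp
      _ = ∫⁻ _ in ball x (ε / 4 * w x), ofReal ((4 ^ n * w x ^ (2 * n))⁻¹) := by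
          rw [setLIntegral_const]
      _ ≤ ∫⁻ y in ball x (ε / 4 * w x), m y := by
          refine setLIntegral_mono' measurableSet_ball fun y hy => ?_
          have hy2 := hb2 x hx (hsub hy)
          have hyp := hpos y (h23 hy2)
          rw [hmdef, indicator_of_mem hy2]
          refine ENNReal.ofReal_le_ofReal ?_
          gcongr
          have := (hcomp x (h12 hx) y (hsub hy)).2
          calc w y ^ (2 * n) ≤ (2 * w x) ^ (2 * n) := by gcongr
            _ = _ := by rw [mul_pow, pow_mul 2 2 n]; norm_num
      _ ≤ _ := lintegral_mono_set hsub2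
  have up : ∀ x, ∫⁻ y in {y | dist x y < ε * w y}, m y ≤
      Ω₃.indicator (fun x => ofReal c2 * V * ofReal (w x ^ n)⁻¹) x := by
    intro x
    have e : ∫⁻ y in {y | dist x y < ε * w y}, m y =
        ∫⁻ y in {y | dist x y < ε * w y} ∩ Ω₂, ofReal (w y ^ (2 * n))⁻¹ := by
      rw [hmdef, setLIntegral_indicator h2, inter_comm]
    rw [e]
    by_cases hne : ({y | dist x y < ε * w y} ∩ Ω₂).Nonempty
    · obtain ⟨y₀, hy₀, hy₀2⟩ := hne
      have hx3 : x ∈ Ω₃ := hb3 y₀ hy₀2 hy₀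
      have hxp := hpos x hx3
      rw [indicator_of_mem hx3]
      have hcm : ∀ y ∈ {y | dist x y < ε * w y} ∩ Ω₂, w y ≤ 2 * w x ∧ w x ≤ 2 * w y := fun y hy =>
        hcomp y hy.2 x hy.1
      calc _ ≤ ∫⁻ _ in {y | dist x y < ε * w y} ∩ Ω₂, ofReal (4 ^ n * (w x ^ (2 * n))⁻¹) := by
            refine setLIntegral_mono' ((measurableSet_lt (measurable_const.dist measurable_id)
              (hw.const_mul ε)).inter h2) fun y hy => ENNReal.ofReal_le_ofReal ?_
            have hyp := hpos y (h23 hy.2)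
            have h := (hcm y hy).2
            rw [inv_le_comm₀ (by positivity) (by positivity), mul_inv, inv_inv,
              inv_mul_le_iff₀ (by positivity)]
            calc w x ^ (2 * n) ≤ (2 * w y) ^ (2 * n) := by gcongr
              _ = _ := by rw [mul_pow, pow_mul 2 2 n]; norm_num
        _ ≤ ∫⁻ _ in ball x (2 * ε * w x), ofReal (4 ^ n * (w x ^ (2 * n))⁻¹) := by
            refine lintegral_mono_set fun y hy => ?_
            have h := (hcm y hy).1
            rw [Metric.mem_ball, dist_comm]
            refine lt_of_lt_of_le hy.1 ?_
            nlinarith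
        _ = _ := by
            rw [setLIntegral_const, hvol x _ (by positivity), ← mul_assoc,
              ← ENNReal.ofReal_mul (by positivity), mul_right_comm (ofReal c2),
              ← ENNReal.ofReal_mul hc2p.le]
            congr 2
            rw [hc2, mul_pow _ (w x), pow_mul', pow_two]
            field_simp
    · rw [not_nonempty_iff_eq_empty.1 hne]; simp
  have hA0 : ofReal c1 * V ≠ 0 := mul_ne_zero (by simpa using hc1p) hV0
  have hAt : ofReal c1 * V ≠ ⊤ := ENNReal.mul_ne_top ofReal_ne_top hVt
  refine ⟨(ofReal c1 * V)⁻¹ * (ofReal c2 * V),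
    ENNReal.mul_ne_top (ENNReal.inv_ne_top.2 hA0) (by finiteness), ?_⟩
  intro a b ha hb c hc hab
  have hwn : Measurable fun x => ofReal (w x ^ n)⁻¹ := (hw.pow_const n).inv.ennreal_ofReal
  have s1 : ofReal c1 * V * ∫⁻ x in Ω₁, ofReal (w x ^ n)⁻¹ * a x ≤
      ∫⁻ y, m y * ∫⁻ x in ball y (ε / 2 * w y), a x := by
    rw [lintegral_mul_setLIntegral_ball hm ha (hw.const_mul _),
      ← lintegral_const_mul _ (f := fun x => ofReal (w x ^ n)⁻¹ * a x) (hwn.mul ha)]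
    refine le_trans ?_ (setLIntegral_le_lintegral Ω₁ _)
    refine setLIntegral_mono' h1 fun x hx => ?_
    rw [← mul_assoc, mul_comm (a x)]
    gcongr
    exact low x hx
  have s2 : ∫⁻ y, m y * ∫⁻ x in ball y (ε / 2 * w y), a x ≤
      c * ∫⁻ y, m y * ∫⁻ x in ball y (ε * w y), b x := by
    have : ∀ y, m y * ∫⁻ x in ball y (ε / 2 * w y), a x ≤
        m y * (c * ∫⁻ x in ball y (ε * w y), b x) := by
      intro y
      by_cases hy : y ∈ Ω₂
      · gcongr; exact hab y hy
      · rw [hmdef, indicator_of_notMem hy]; simp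
    refine (lintegral_mono this).trans (le_of_eq ?_)
    simp only [mul_left_comm _ c]
    exact lintegral_const_mul' c _ hc
  have s3 : ∫⁻ y, m y * ∫⁻ x in ball y (ε * w y), b x ≤
      ofReal c2 * V * ∫⁻ x in Ω₃, ofReal (w x ^ n)⁻¹ * b x := by
    rw [lintegral_mul_setLIntegral_ball hm hb (hw.const_mul _),
      ← lintegral_const_mul _ (f := fun x => ofReal (w x ^ n)⁻¹ * b x) (hwn.mul hb),
      ← lintegral_indicator h3]
    refine lintegral_mono fun x => ?_
    refine (mul_le_mul_right (up x) (b x)).trans (le_of_eq ?_)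
    by_cases hx : x ∈ Ω₃
    · rw [indicator_of_mem hx, indicator_of_mem hx]; ring
    · rw [indicator_of_notMem hx, indicator_of_notMem hx, mul_zero]
  calc _ = (ofReal c1 * V)⁻¹ *
        (ofReal c1 * V * ∫⁻ x in Ω₁, ofReal (w x ^ n)⁻¹ * a x) := by
        rw [← mul_assoc, ENNReal.inv_mul_cancel hA0 hAt, one_mul]
    _ ≤ (ofReal c1 * V)⁻¹ * (c * (ofReal c2 * V *
        ∫⁻ x in Ω₃, ofReal (w x ^ n)⁻¹ * b x)) := by
        exact mul_le_mul_right (s1.trans (s2.trans (mul_le_mul_right s3 c))) _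
    _ = _ := by ring

/-- The difference of the Christoffel symbols of two conformal metrics. -/
def confDiff (G : Fin n → Fin n → ℝ) (f F : Fin n → ℝ) (k i j : Fin n) : ℝ :=
  (if k = j then f i else 0) + (if k = i then f j else 0) - G i j * F k

/-! ### Conformal change of the scalar curvature: algebra -/

section

variable {G I : Fin n → Fin n → ℝ} {dG : Fin n → Fin n → Fin n → ℝ} {f F : Fin n → ℝ} {df dF :
  Fin n → Fin n → ℝ} {Γ : Fin n → Fin n → Fin n → ℝ}

lemma sum_mul_confDiff (A : Fin n → ℝ) (i j : Fin n) :
    ∑ l, A l * confDiff G f F l i j = A j * f i + A i * f j - G i j * ∑ l, A l * F l := by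
  simp only [confDiff, mul_sub, mul_add, mul_ite, mul_zero, sum_sub_distrib,
    sum_add_distrib, Finset.sum_ite_eq', Finset.mem_univ, if_true, mul_sum, mul_left_comm]

lemma sum_confDiff_self (hG : ∀ i j, G i j = G j i) (hF : ∀ i, ∑ k, G i k * F k = f i) (l : Fin n) :
    ∑ k, confDiff G f F k k l = n * f l := by
  have h : ∑ k, G k l * F k = f l := by simp only [hG _ l, hF]
  simp only [confDiff, sum_sub_distrib, sum_add_distrib, h, if_true,
    Finset.sum_const, Finset.card_univ, Fintype.card_fin, nsmul_eq_mul, Finset.sum_ite_eq',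
    Finset.mem_univ]
  ring

lemma sum_sum_confDiff_mul (B : Fin n → Fin n → ℝ) (j : Fin n) : ∑ k, ∑ l, confDiff G f F k j l *
    B l k = (∑ k, B k k) * f j + ∑ l, f l * B l j - ∑ k, ∑ l, G j l * F k * B l k := by
  simp only [confDiff, sub_mul, add_mul, ite_mul, zero_mul, sum_sub_distrib,
    sum_add_distrib, Finset.sum_ite_eq, Finset.mem_univ, if_true]
  congr 2
  · rw [sum_mul]; simp only [mul_comm]
  · rw [sum_comm]
    simp only [Finset.sum_ite_eq', Finset.mem_univ, if_true]

/-- The algebra of the Ricci tensor of `e^{2σ} g`, with `f = dσ` and `F` its gradient. The analysis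
enters only through `hdG`, which is the compatibility of `Γ` with the metric, and `hdF`, which is
the derivative of `G F = f`. -/
lemma ricci_confDiff (hG : ∀ i j, G i j = G j i) (hΓ : ∀ k i j, Γ k i j = Γ k j i)
    (hdG : ∀ m i j, dG m i j = ∑ a, (Γ a m i * G a j + Γ a m j * G a i))
    (hF : ∀ i, ∑ k, G i k * F k = f i)
    (hdF : ∀ i m, ∑ k, (dG m i k * F k + G i k * dF k m) = df i m) (i j : Fin n) :
    ∑ k, (((if k = j then df i k else 0) + (if k = i then df j k else 0) - (dG k i j * F k + G i j *
    dF k k)) - ((if k = k then df i j else 0) + (if k = i then df k j else 0) - (dG j i k * F k +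
    G i k * dF k j))) + ∑ k, ∑ l, ((Γ k k l + confDiff G f F k k l) * (Γ l i j +
    confDiff G f F l i j) - (Γ k j l + confDiff G f F k j l) * (Γ l i k + confDiff G f F l i k)) =
    ∑ k, ∑ l, (Γ k k l * Γ l i j - Γ k j l * Γ l i k) + (df i j + df j i - n * df i j + (n - 2) *
    ∑ l, Γ l i j * f l - G i j * (∑ k, dF k k + ∑ l, (∑ k, Γ k k l) * F l) + (n - 2) * (f i * f j -
    G i j * ∑ l, f l * F l)) := by
  have hB := hdF i j
  have t1 : ∑ k, (((if k = j then df i k else 0) + (if k = i then df j k else 0)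
        - (dG k i j * F k + G i j * dF k k))
      - ((if k = k then df i j else 0) + (if k = i then df k j else 0)
        - (dG j i k * F k + G i k * dF k j))) =
      df i j + df j i - n * df i j - ∑ k, dG k i j * F k - G i j * ∑ k, dF k k := by
    simp only [sum_sub_distrib, sum_add_distrib, Finset.sum_ite_eq',
      Finset.mem_univ, if_true, Finset.sum_const, Finset.card_univ, Fintype.card_fin,
      nsmul_eq_mul, mul_sum] at hB ⊢
    linarith
  have t2 : ∑ k, ∑ l, ((Γ k k l + confDiff G f F k k l) * (Γ l i j + confDiff G f F l i j)
      - (Γ k j l + confDiff G f F k j l) * (Γ l i k + confDiff G f F l i k)) =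
      ∑ k, ∑ l, (Γ k k l * Γ l i j - Γ k j l * Γ l i k)
      + ((∑ l, (∑ k, Γ k k l) * confDiff G f F l i j + ∑ l, (∑ k, confDiff G f F k k l) * Γ l i j
        + ∑ l, (∑ k, confDiff G f F k k l) * confDiff G f F l i j)
      - (∑ k, ∑ l, Γ k j l * confDiff G f F l i k + ∑ k, ∑ l, confDiff G f F k j l * Γ l i k
        + ∑ k, ∑ l, confDiff G f F k j l * confDiff G f F l i k)) := by
    have e : ∀ A B : Fin n → Fin n → ℝ, ∀ D : Fin n → ℝ,
        ∑ l, (∑ k, A k l) * D l = ∑ k, ∑ l, A k l * D l := fun A B D => by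
      simp only [sum_mul]; exact sum_comm
    rw [e (fun k l => Γ k k l) 0, e (fun k l => confDiff G f F k k l) 0,
      e (fun k l => confDiff G f F k k l) 0]
    simp only [← sum_add_distrib, ← sum_sub_distrib]
    exact sum_congr rfl fun k _ => sum_congr rfl fun l _ => by ring
  have hs := sum_confDiff_self hG hF
  have t3 : ∑ k, ∑ l, Γ k j l * confDiff G f F l i k =
      (∑ k, Γ k k j) * f i + ∑ k, Γ k j i * f k - ∑ k, ∑ l, Γ k j l * (G i k * F l) := by
    simp only [sum_mul_confDiff, sum_sub_distrib, sum_add_distrib, sum_mul,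
      mul_sum, hΓ _ j, mul_left_comm (G i _)]
  have t4 : ∑ k, ∑ l, confDiff G f F k j l * confDiff G f F l i k =
      (n + 2) * (f i * f j) - 2 * (G i j * ∑ l, f l * F l) := by
    have e1 : ∑ k, confDiff G f F k i k = n * f i := by
      rw [← hs i]
      exact sum_congr rfl fun k _ => by simp only [confDiff, hG i k]; ring
    have e2 : ∑ k, ∑ l, G j l * F k * confDiff G f F l i k = G i j * ∑ l, f l * F l := by
      have : ∀ k, ∑ l, G j l * F k * confDiff G f F l i k =
          F k * (G j k * f i + G j i * f k - G i k * f j) := by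
        intro k
        rw [← hF j, ← sum_mul_confDiff (fun l => G j l), mul_sum]
        exact sum_congr rfl fun l _ => by ring
      simp only [this]
      have a1 : ∑ k, F k * (G j k * f i + G j i * f k - G i k * f j) =
          (∑ k, G j k * F k) * f i + G i j * ∑ k, f k * F k - (∑ k, G i k * F k) * f j := by
        simp only [sum_mul, mul_sum, ← sum_add_distrib, ← sum_sub_distrib]
        exact sum_congr rfl fun k _ => by rw [hG j i]; ring
      rw [a1, hF, hF]; ring
    rw [sum_sum_confDiff_mul, e1, e2, sum_mul_confDiff]
    ring
  -- Metric compatibility splits the remaining derivative of `G` into the two sums that cancel the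
  -- last term of `t3` and the last term of the expansion of `confDiff` against `Γ`.
  have t5 : ∑ k, dG k i j * F k = ∑ k, ∑ l, Γ k j l * (G i k * F l)
      + ∑ k, ∑ l, G j l * F k * Γ l i k := by
    rw [sum_comm, ← sum_add_distrib]
    refine sum_congr rfl fun k _ => ?_
    rw [hdG, sum_mul, ← sum_add_distrib]
    refine sum_congr rfl fun a _ => ?_
    rw [hΓ a k i, hΓ a k j, hG a j, hG a i]; ring
  rw [t1, t2, t3, t4, sum_mul_confDiff, sum_sum_confDiff_mul, t5]
  simp only [hs]
  have t6 : ∑ l, ↑n * f l * Γ l i j = n * ∑ l, Γ l i j * f l := by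
    rw [mul_sum]; exact sum_congr rfl fun l _ => by ring
  have t7 : ∑ l, ↑n * f l * confDiff G f F l i j =
      n * (2 * (f i * f j) - G i j * ∑ l, f l * F l) := by
    rw [sum_mul_confDiff, mul_sum (a := G i j), mul_sub, mul_sum, mul_sum]
    congr 1
    · ring
    · exact sum_congr rfl fun l _ => by ring
  have t8 : ∑ k, Γ k j i * f k = ∑ l, Γ l i j * f l := by simp only [hΓ _ j i]
  have t9 : ∑ l, f l * Γ l i j = ∑ l, Γ l i j * f l := by simp only [mul_comm]
  have t10 : ∑ k, Γ k i k = ∑ k, Γ k k i := by simp only [hΓ _ i]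
  rw [t6, t7, t8, t9, t10]
  ring

/-- The trace of `ricci_confDiff`. -/
lemma trace_ricci_confDiff (hI : ∀ i j, I i j = I j i)
    (hIG : ∀ i k, ∑ j, I i j * G j k = if i = k then 1 else 0) (hG : ∀ i j, G i j = G j i)
    (hΓ : ∀ k i j, Γ k i j = Γ k j i)
    (hdG : ∀ m i j, dG m i j = ∑ a, (Γ a m i * G a j + Γ a m j * G a i))
    (hf : ∀ i, F i = ∑ k, I i k * f k) (hF : ∀ i, ∑ k, G i k * F k = f i)
    (hdF : ∀ i m, ∑ k, (dG m i k * F k + G i k * dF k m) = df i m) : ∑ i, ∑ j, I i j * (df i j +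
    df j i - n * df i j + (n - 2) * ∑ l, Γ l i j * f l - G i j * (∑ k, dF k k + ∑ l, (∑ k,
    Γ k k l) * F l) + (n - 2) * (f i * f j - G i j * ∑ l, f l * F l)) = -(2 * (n - 1)) * ∑ i, ∑ j,
    I i j * (df i j - ∑ k, Γ k i j * f k) - (n - 1) * (n - 2) * ∑ i, ∑ j, I i j * f i * f j := by
  -- The derivative of the gradient is the raised Hessian minus a Christoffel term: `hdF` is solved
  -- for `dF` with the inverse matrix `I`.
  have hdFk : ∀ k m, dF k m = ∑ i, I k i * (df i m - ∑ a, Γ a i m * f a) - ∑ a, Γ k m a * F a := by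
    intro k m
    have h1 : ∀ i, ∑ b, G i b * dF b m =
        (df i m - ∑ a, Γ a i m * f a) - ∑ a, G i a * ∑ b, Γ a m b * F b := by
      intro i
      have e1 : ∑ b, dG m i b * F b = ∑ a, Γ a i m * f a + ∑ a, G i a * ∑ b, Γ a m b * F b := by
        simp only [hdG, ← hF, mul_sum, sum_mul]
        rw [sum_comm, ← sum_add_distrib]
        refine sum_congr rfl fun a _ => ?_
        rw [← sum_add_distrib]
        refine sum_congr rfl fun b _ => ?_
        rw [hΓ a m i, hG a i]; ring
      have := hdF i m
      rw [sum_add_distrib, e1] at this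
      linarith
    have h2 : ∀ D : Fin n → ℝ, ∑ i, I k i * ∑ b, G i b * D b = D k := by
      intro D
      simp only [mul_sum]
      rw [sum_comm]
      have : ∀ b, ∑ i, I k i * (G i b * D b) = (if k = b then 1 else 0) * D b := fun b => by
        rw [← hIG k b, sum_mul]; exact sum_congr rfl fun i _ => by ring
      simp [this]
    have h3 := h2 fun b => dF b m
    simp only [h1, mul_sub, sum_sub_distrib] at h3
    have h4 := h2 fun a => ∑ b, Γ a m b * F b
    simp only [mul_sub, sum_sub_distrib]
    rw [h4] at h3
    exact h3.symm
  -- Two expressions of the Laplacian of `σ`: the divergence of the gradient and the trace of the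
  -- Hessian.
  have hdiv : ∑ k, dF k k + ∑ l, (∑ k, Γ k k l) * F l =
      ∑ i, ∑ j, I i j * (df i j - ∑ k, Γ k i j * f k) := by
    simp only [hdFk, sum_sub_distrib, sum_mul]
    rw [sum_comm (f := fun l k => Γ k k l * F l), sub_add_cancel, sum_comm]
    exact sum_congr rfl fun i _ => sum_congr rfl fun j _ => by rw [hI j i]
  have htr : ∑ i, ∑ j, I i j * G i j = n := by
    have : ∀ i, ∑ j, I i j * G i j = 1 := fun i => by
      have := hIG i i
      simp only [if_true, hG _ i] at this
      exact this
    simp [this]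
  have hff : ∑ l, f l * F l = ∑ i, ∑ j, I i j * f i * f j := by
    simp only [hf, mul_sum]
    exact sum_congr rfl fun i _ => sum_congr rfl fun j _ => by ring
  have hsw : ∑ i, ∑ j, I i j * df j i = ∑ i, ∑ j, I i j * df i j := by
    rw [sum_comm]
    exact sum_congr rfl fun i _ => sum_congr rfl fun j _ => by rw [hI]
  rw [hdiv, hff]
  have hsub : ∑ i, ∑ j, I i j * (df i j - ∑ k, Γ k i j * f k) =
      ∑ i, ∑ j, I i j * df i j - ∑ i, ∑ j, I i j * ∑ k, Γ k i j * f k := by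
    simp only [mul_sub, sum_sub_distrib]
  obtain ⟨X, hX⟩ : ∃ X, X = ∑ i, ∑ j, I i j * (df i j - ∑ k, Γ k i j * f k) := ⟨_, rfl⟩
  obtain ⟨Y, hY⟩ : ∃ Y, Y = ∑ i, ∑ j, I i j * f i * f j := ⟨_, rfl⟩
  rw [← hX, ← hY]
  have hexp : ∑ i, ∑ j, I i j * (df i j + df j i - n * df i j + (n - 2) * ∑ l, Γ l i j * f l
        - G i j * X + (n - 2) * (f i * f j - G i j * Y)) =
      (1 - n) * ∑ i, ∑ j, I i j * df i j + ∑ i, ∑ j, I i j * df j i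
        + (n - 2) * ∑ i, ∑ j, I i j * ∑ k, Γ k i j * f k
        + (n - 2) * ∑ i, ∑ j, I i j * f i * f j
        - (X + (n - 2) * Y) * ∑ i, ∑ j, I i j * G i j := by
    simp only [mul_sum (s := Finset.univ) (f := fun i => ∑ j, _),
      ← sum_add_distrib, ← sum_sub_distrib]
    refine sum_congr rfl fun i _ => ?_
    rw [mul_sum, mul_sum, mul_sum, mul_sum]
    simp only [← sum_add_distrib, ← sum_sub_distrib]
    exact sum_congr rfl fun j _ => by ring
  rw [hexp, htr, hsw, ← hY]
  rw [← hX] at hsub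
  linear_combination (n - 2 : ℝ) * hsub

end

/-! ### Local integrability, inequalities for covectors, and the cutoff profile -/

lemma LocallyIntegrableOn.bdd_mul {D : Set (𝔼 n)} {f m : 𝔼 n → ℝ} (hf : LocallyIntegrableOn f D)
    (hm : AEStronglyMeasurable m (volume.restrict D)) {K : ℝ}
    (hK : ∀ᵐ y ∂volume.restrict D, |m y| ≤ K) : LocallyIntegrableOn (fun y => m y * f y) D := by
  refine LocallyIntegrableOn.of_abs_le (hf.smul K) (hm.mul hf.aestronglyMeasurable) ?_
  filter_upwards [hK] with y hy
  rw [Pi.smul_apply, smul_eq_mul, abs_mul, abs_mul]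
  exact mul_le_mul_of_nonneg_right (hy.trans (le_abs_self K)) (abs_nonneg _)

lemma HasWeakPartial.mul_contDiffOn {D : Set (𝔼 n)} {i : Fin n} {f f' c : 𝔼 n → ℝ} (hD : IsOpen D)
    (h : HasWeakPartial D i f f') (hc : ContDiffOn ℝ 1 c D) :
    HasWeakPartial D i (fun y => f y * c y) (fun y => f' y * c y + f y * 𝐃 c y (ê i)) :=
  h.mul hD (hasWeakPartial_of_contDiffOn hD hc)
    (h.1.mul_continuousOn hc.continuousOn hD.isLocallyClosed)
    (h.2.1.mul_continuousOn hc.continuousOn hD.isLocallyClosed)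
    (h.1.mul_continuousOn ((hc.continuousOn_fderiv_of_isOpen hD le_rfl).clm_apply
      continuousOn_const) hD.isLocallyClosed)

section

variable {B : 𝔹 n}

lemma covectorInner_comm (hsymm : ∀ v w, B v w = B w v) (α β : 𝔼 n →L[ℝ] ℝ) :
    covectorInner B α β = covectorInner B β α := by
  have h : (gram B)⁻¹.transpose = (gram B)⁻¹ := by
    rw [Matrix.transpose_nonsing_inv]
    congr 1
    ext i j
    exact hsymm _ _
  rw [covectorInner, covectorInner, sum_comm]
  refine sum_congr rfl fun i _ => sum_congr rfl fun j _ => ?_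
  rw [← h, Matrix.transpose_apply, h]
  ring

lemma covectorNormSq_smul_add_smul (hsymm : ∀ v w, B v w = B w v) (s t : ℝ) (α β : 𝔼 n →L[ℝ] ℝ) :
    covectorNormSq B (s • α + t • β) = s ^ 2 * covectorNormSq B α + 2 *
    (s * t * covectorInner B α β) + t ^ 2 * covectorNormSq B β := by
  have h : covectorNormSq B (s • α + t • β) = s ^ 2 * covectorNormSq B α
      + s * t * (covectorInner B α β + covectorInner B β α) + t ^ 2 * covectorNormSq B β := by
    simp only [covectorNormSq, covectorInner, mul_sum, ← sum_add_distrib]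
    refine sum_congr rfl fun i _ => sum_congr rfl fun j _ => ?_
    simp only [add_apply, smul_apply, smul_eq_mul]
    ring
  rw [h, covectorInner_comm hsymm β α]
  ring

/-- Nonnegativity of the squared norms of `s α + t β` and `s α - t β`. -/
lemma two_mul_abs_covectorInner_le (hsymm : ∀ v w, B v w = B w v) (hpos : ∀ v, v ≠ 0 → 0 < B v v)
    (s t : ℝ) (α β : 𝔼 n →L[ℝ] ℝ) : 2 * |s * t * covectorInner B α β| ≤ s ^ 2 * covectorNormSq B α +
    t ^ 2 * covectorNormSq B β := by
  have h1 := covectorNormSq_nonneg hsymm hpos (s • α + t • β)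
  have h2 := covectorNormSq_nonneg hsymm hpos (s • α + (-t) • β)
  rw [covectorNormSq_smul_add_smul hsymm] at h1 h2
  rcases abs_cases (s * t * covectorInner B α β) with h | h <;> rw [h.1] <;> nlinarith

lemma abs_bilinTrace_le (hsymm : ∀ v w, B v w = B w v) (hpos : ∀ v, v ≠ 0 → 0 < B v v) (T : 𝔹 n) :
    |bilinTrace B T| ≤ n * √(tensorNormSq B T) := by
  obtain ⟨J, hJ, h1⟩ := exists_isInvertible_gram_eq_one hsymm hpos
  have hB : ∀ i, B (J (ê i)) (J (ê i)) = 1 := fun i => by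
    simpa [gram] using congrFun (congrFun h1 i) i
  have e : bilinTrace B T = ∑ i, T (J (ê i)) (J (ê i)) := by
    rw [← bilinTrace_bilinearComp B T hJ, bilinTrace, h1]
    simp only [inv_one, Matrix.one_apply, ite_mul, one_mul, zero_mul, Finset.sum_ite_eq,
      Finset.mem_univ, if_true, ContinuousLinearMap.bilinearComp_apply]
  rw [e]
  refine (Finset.abs_sum_le_sum_abs _ _).trans ?_
  refine (Finset.sum_le_card_nsmul _ _ (√(tensorNormSq B T)) fun i _ => ?_).trans_eq ?_
  · simpa [hB] using abs_apply_apply_le hsymm hpos T (J (ê i)) (J (ê i))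
  · rw [Finset.card_univ, Fintype.card_fin, nsmul_eq_mul]

end

/-- Jacobi's formula. The determinant is multilinear in the rows, and the determinant with one row
replaced by its derivative is expanded by Cramer's rule. -/
lemma hasFDerivAt_matrix_det {E : Type*} [NormedAddCommGroup E] [NormedSpace ℝ E]
    {A : E → Matrix (Fin n) (Fin n) ℝ} {A' : Fin n → Fin n → E →L[ℝ] ℝ} {y : E}
    (h : ∀ i j, HasFDerivAt (fun y => A y i j) (A' i j) y) :
    HasFDerivAt (fun y => (A y).det) (∑ i, ∑ j, (A y).adjugate j i • A' i j) y := by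
  let f : ContinuousMultilinearMap ℝ (fun _ : Fin n => Fin n → ℝ) ℝ :=
    ⟨(Matrix.detRowAlternating (n := Fin n) (R := ℝ)).toMultilinearMap,
      (Continuous.matrix_det continuous_id : Continuous fun A : Matrix (Fin n) (Fin n) ℝ => A.det)⟩
  have h1 : ∀ i, HasFDerivAt (fun y => A y i) (ContinuousLinearMap.pi (A' i)) y := fun i =>
    hasFDerivAt_pi.2 (h i)
  have h2 := HasFDerivAt.multilinear_comp (f := f) h1
  refine h2.congr_fderiv ?_
  ext v
  simp only [sum_apply, ContinuousLinearMap.comp_apply, smul_apply, smul_eq_mul]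
  refine sum_congr rfl fun i _ => ?_
  change ((A y).updateRow i (fun j => A' i j v)).det = _
  rw [← Matrix.cramer_transpose_apply, Matrix.cramer_eq_adjugate_mulVec,
    ← Matrix.adjugate_transpose]
  rfl

lemma abs_covectorInner_le {B : 𝔹 n} (hsymm : ∀ v w, B v w = B w v) (hpos : ∀ v, v ≠ 0 → 0 < B v v)
    (α β : 𝔼 n →L[ℝ] ℝ) :
    |covectorInner B α β| ≤ √(covectorNormSq B α) * √(covectorNormSq B β) := by
  rw [← Real.sqrt_mul (covectorNormSq_nonneg hsymm hpos _)]
  refine Real.abs_le_sqrt ?_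
  obtain ⟨J, hJ, h1⟩ := exists_isInvertible_gram_eq_one hsymm hpos
  have e : ∀ α β : 𝔼 n →L[ℝ] ℝ, covectorInner B α β =
      ∑ i, α (J (ê i)) * β (J (ê i)) := fun α β => by
    rw [← covectorInner_bilinearComp B α β hJ, covectorInner, h1]
    simp only [inv_one, Matrix.one_apply, ite_mul, one_mul, zero_mul, Finset.sum_ite_eq,
      Finset.mem_univ, if_true, ContinuousLinearMap.comp_apply]
  rw [← covectorInner_self, ← covectorInner_self, e, e, e]
  simpa only [pow_two] using Finset.sum_mul_sq_le_sq_mul_sq Finset.univ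
    (fun i => α (J (ê i))) (fun i => β (J (ê i)))

/-- A smooth function that vanishes on `(-∞, 1]` and is equal to `1` on `[2, ∞)`. -/
def smoothStep (t : ℝ) : ℝ := Real.smoothTransition (t - 1)

lemma contDiff_smoothStep : ContDiff ℝ ∞ smoothStep :=
  Real.smoothTransition.contDiff.comp (contDiff_id.sub contDiff_const)

lemma deriv_smoothStep_of_lt {t : ℝ} (h : 2 < t) : deriv smoothStep t = 0 := by
  have : smoothStep =ᶠ[𝓝 t] fun _ => 1 := by
    filter_upwards [Ioi_mem_nhds h] with s hs
    exact Real.smoothTransition.one_of_one_le (by linarith [mem_Ioi.1 hs])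
  rw [this.deriv_eq, deriv_const]

/-- The derivative vanishes off `[1, 2]`. The bound concerns `t χ'(t)` because this quantity, at `t
= k ρ`, controls the gradient of `χ(k ρ)` independently of `k` when `|dρ|_g = O(ρ)`. -/
lemma exists_abs_mul_deriv_smoothStep_le : ∃ C, ∀ t, |t * deriv smoothStep t| ≤ C := by
  have hc : Continuous fun t => |t * deriv smoothStep t| :=
    (continuous_id.mul (contDiff_smoothStep.continuous_deriv (by simp))).abs
  obtain ⟨C, hC⟩ := (isCompact_Icc (a := (1 : ℝ)) (b := 2)).bddAbove_image hc.continuousOn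
  refine ⟨max C 0, fun t => ?_⟩
  by_cases h1 : t < 1
  · have : smoothStep =ᶠ[𝓝 t] fun _ => 0 := by
      filter_upwards [Iio_mem_nhds h1] with s hs
      exact Real.smoothTransition.zero_of_nonpos (by linarith [mem_Iio.1 hs])
    rw [this.deriv_eq, deriv_const]
    simp
  by_cases h2 : 2 < t
  · rw [deriv_smoothStep_of_lt h2]; simp
  · exact (hC ⟨t, ⟨not_lt.1 h1, not_lt.1 h2⟩, rfl⟩).trans (le_max_left _ _)

/-- The covariant derivative of `t s w` for functions `s`, `t` of differentials `α`, `κ`, if `T` is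
the covariant derivative of `w`. -/
def mulForm (w α κ : 𝔼 n →L[ℝ] ℝ) (T : 𝔹 n) (s t : ℝ) : 𝔹 n :=
  covectorMul w (s • κ + t • α) + (t * s) • T

lemma bilinTrace_mulForm (B : 𝔹 n) (w α κ : 𝔼 n →L[ℝ] ℝ) (T : 𝔹 n) (s t : ℝ) :
    bilinTrace B (mulForm w α κ T s t) = s * covectorInner B w κ + t * covectorInner B w α + t * s *
    bilinTrace B T := by
  simp only [bilinTrace, covectorInner, mul_sum, ← sum_add_distrib]
  refine sum_congr rfl fun i _ => sum_congr rfl fun j _ => ?_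
  simp only [mulForm, covectorMul, add_apply, smul_apply, smul_eq_mul,
    ContinuousLinearMap.bilinearComp_apply, ContinuousLinearMap.mul_apply']
  ring

lemma covectorInner_smul_add_smul (B : 𝔹 n) (w α : 𝔼 n →L[ℝ] ℝ) (s t : ℝ) :
    covectorInner B w (s • w + t • α) = s * covectorNormSq B w + t * covectorInner B w α := by
  simp only [covectorInner, covectorNormSq, mul_sum, ← sum_add_distrib]
  refine sum_congr rfl fun i _ => sum_congr rfl fun j _ => ?_
  simp only [add_apply, smul_apply, smul_eq_mul]
  ring

lemma covectorNormSq_smul (B : 𝔹 n) (s : ℝ) (α : 𝔼 n →L[ℝ] ℝ) :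
    covectorNormSq B (s • α) = s ^ 2 * covectorNormSq B α := by
  simp only [covectorNormSq, mul_sum, smul_apply, smul_eq_mul]
  exact sum_congr rfl fun i _ => sum_congr rfl fun j _ => by ring

lemma LocallyIntegrableOn.sum {ι : Type*} {D : Set (𝔼 n)} (s : Finset ι) {F : ι → 𝔼 n → ℝ}
    (h : ∀ i ∈ s, LocallyIntegrableOn (F i) D) :
    LocallyIntegrableOn (fun y => ∑ i ∈ s, F i y) D := by
  rw [← Finset.sum_fn]
  exact Finset.sum_induction F (LocallyIntegrableOn · D) (fun _ _ => .add)
    (locallyIntegrable_zero.locallyIntegrableOn D) h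

/-! ### Functions, metrics and measures in coordinates -/

variable [NeZero n] {M : Type*} [TopologicalSpace M] [ChartedSpace (EuclideanHalfSpace n) M]
  {ρ u φ ζ f η u' v : M → ℝ} {g T S k : BilinField n M} {α β w κ : CovectorField n M} {o x₁ x : M}
  {y : 𝔼 n} {r R C ε a b K : ℝ} {p : ℝ≥0∞}

lemma isOpen_domain (o : M) : IsOpen (𝔻 n o) := isOpen_interior

lemma ae_mem_domain (o : M) : ∀ᵐ y ∂𝔳 n o, y ∈ 𝔻 n o :=
  ae_restrict_mem (isOpen_domain o).measurableSet

lemma domain_subset_target (o : M) : 𝔻 n o ⊆ (𝔠 n o).target := interior_subset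

lemma target_eq_inter (o : M) :
    (𝔠 n o).target = (𝓡∂ n).symm ⁻¹' (chartAt (EuclideanHalfSpace n) o).target ∩ range (𝓡∂ n) := by
  rw [extChartAt_target]

lemma coordDomain_eq (o : M) : 𝔻 n o = (𝔠 n o).target ∩ {y | 0 < y 0} := by
  have hopen : IsOpen ((𝓡∂ n).symm ⁻¹' (chartAt (EuclideanHalfSpace n) o).target) :=
    (chartAt (EuclideanHalfSpace n) o).open_target.preimage (𝓡∂ n).continuous_symm
  rw [coordDomain, target_eq_inter, interior_inter, hopen.interior_eq,
    interior_range_modelWithCornersEuclideanHalfSpace, inter_assoc]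
  congr 1
  ext y
  simp only [mem_ofPred_eq, mem_inter_iff, range_modelWithCornersEuclideanHalfSpace]
  exact ⟨fun h => ⟨h.le, h⟩, fun h => h.2⟩

lemma symm_mem_source (hy : y ∈ coordDomain o) :
    (𝔠 n o).symm y ∈ (𝔠 n o).source := (𝔠 n o).map_target (domain_subset_target o hy)

lemma extChartAt_symm_apply (hy : y ∈ coordDomain o) :
    𝔠 n o ((𝔠 n o).symm y) = y := (𝔠 n o).right_inv (domain_subset_target o hy)

lemma continuousOn_symm_coordDomain (o : M) : ContinuousOn (𝔠 n o).symm (coordDomain o) :=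
  (continuousOn_extChartAt_symm o).mono (domain_subset_target o)

/-- The part of the interior of `M` covered by the chart around `o`. -/
def coordImage (o : M) : Set M := (𝔠 n o).symm '' coordDomain o

notation:max "𝕌" n:max => coordImage (n := n)

lemma coordImage_eq (o : M) : 𝕌 n o = (𝔠 n o).source ∩ 𝔠 n o ⁻¹' coordDomain o := by
  ext x
  constructor
  · rintro ⟨y, hy, rfl⟩
    exact ⟨symm_mem_source hy, by rw [mem_preimage, extChartAt_symm_apply hy]; exact hy⟩
  · rintro ⟨h1, h2⟩
    exact ⟨_, h2, (𝔠 n o).left_inv h1⟩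

lemma isOpen_coordImage (o : M) : IsOpen (𝕌 n o) := by
  rw [coordImage_eq]
  exact (continuousOn_extChartAt o).isOpen_inter_preimage (isOpen_extChartAt_source o)
    (isOpen_domain o)

/-- The derivative of the inverse chart around `o`, as an endomorphism of `ℝⁿ`. -/
def coordLin (o : M) (y : 𝔼 n) : 𝔼 n →L[ℝ] 𝔼 n := mfderiv 𝓘(ℝ, 𝔼 n) (𝓡∂ n) (𝔠 n o).symm y

lemma coordLin_eq_mfderivWithin (hy : y ∈ coordDomain o) :
    coordLin o y = mfderivWithin 𝓘(ℝ, 𝔼 n) (𝓡∂ n) (𝔠 n o).symm (range (𝓡∂ n)) y := by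
  have : range (𝓡∂ n) ∈ 𝓝 y :=
    Filter.mem_of_superset (mem_interior_iff_mem_nhds.1 hy) (extChartAt_target_subset_range o)
  rw [mfderivWithin_of_mem_nhds this]; rfl

/-- A field of bilinear forms, read in the chart around `o`. -/
def coordForm (k : BilinField n M) (o : M) (y : 𝔼 n) : 𝔹 n :=
  ContinuousLinearMap.bilinearComp (σ₁₃ := RingHom.id ℝ) (σ₂₃ := RingHom.id ℝ)
    (E := 𝔼 n) (F := 𝔼 n)
    (k ((𝔠 n o).symm y) : 𝔹 n)
    (coordLin o y) (coordLin o y)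

lemma metricMatrix_eq (k : BilinField n M) (o : M) (y : 𝔼 n) :
    metricMatrix k o y = gram (coordForm k o y) := rfl

/-- The change of coordinates from the chart around `o` to the chart around `x₁`. -/
def transition (o x₁ : M) (y : 𝔼 n) : 𝔼 n := 𝔠 n x₁ ((𝔠 n o).symm y)

/-- The domain of the change of coordinates. -/
def transDomain (o x₁ : M) : Set (𝔼 n) := coordDomain o ∩ (𝔠 n o).symm ⁻¹' 𝕌 n x₁

lemma isOpen_transDomain (o x₁ : M) : IsOpen (transDomain (n := n) o x₁) :=
  (continuousOn_symm_coordDomain o).isOpen_inter_preimage (isOpen_domain o)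
    (isOpen_coordImage x₁)

lemma transition_mem (hy : y ∈ transDomain o x₁) : transition o x₁ y ∈ coordDomain x₁ := by
  have := hy.2
  rw [mem_preimage, coordImage_eq] at this
  exact this.2

lemma symm_transition (hy : y ∈ transDomain o x₁) :
    (𝔠 n x₁).symm (transition o x₁ y) = (𝔠 n o).symm y := by
  have := hy.2
  rw [mem_preimage, coordImage_eq] at this
  exact (𝔠 n x₁).left_inv this.1

lemma transition_transition (hy : y ∈ transDomain o x₁) :
    transition x₁ o (transition o x₁ y) = y := by
  rw [transition, symm_transition hy, extChartAt_symm_apply hy.1]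

/-- The density of the Riemannian measure in the chart around `o`. -/
def volDensity (k : BilinField n M) (o : M) (y : 𝔼 n) : ℝ := √(metricMatrix k o y).det

lemma measurableSet_inter_preimage_symm [MeasurableSpace M] [BorelSpace M] (o : M) {S : Set M}
    (hS : MeasurableSet S) : MeasurableSet (𝔻 n o ∩ (𝔠 n o).symm ⁻¹' S) := by
  have h1 : Measurable ((𝔻 n o).domRestrict (𝔠 n o).symm) :=
    (continuousOn_iff_continuous_domRestrict.1 (continuousOn_symm_coordDomain o)).measurable
  have h2 := (isOpen_domain (n := n) o).measurableSet.subtype_image (h1 hS)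
  convert h2 using 1
  ext y
  simp [-extChartAt, and_comm]

lemma aemeasurable_symm [MeasurableSpace M] [BorelSpace M] (o : M) :
    AEMeasurable (𝔠 n o).symm (𝔳 n o) :=
  (continuousOn_symm_coordDomain o).aemeasurable (isOpen_domain o).measurableSet

lemma chartVolume_eq_map [MeasurableSpace M] (k : BilinField n M) (o : M) : chartVolume k o =
    ((𝔳 n o).withDensity fun y => ofReal (volDensity k o y)).map (𝔠 n o).symm := rfl

lemma chartVolume_apply [MeasurableSpace M] [BorelSpace M] (k : BilinField n M) (o : M) {S : Set M}
    (hS : MeasurableSet S) :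
    chartVolume k o S = ∫⁻ y in coordDomain o ∩ (𝔠 n o).symm ⁻¹' S, ofReal (volDensity k o y) := by
  have hac := withDensity_absolutelyContinuous (𝔳 n o)
    (fun y => ofReal (volDensity k o y))
  rw [chartVolume_eq_map, Measure.map_apply_of_aemeasurable ((aemeasurable_symm o).mono_ac hac) hS]
  have hm := measurableSet_inter_preimage_symm (n := n) o hS
  rw [← Measure.restrict_restrict_of_subset (s := coordDomain o ∩
    (𝔠 n o).symm ⁻¹' S) (t := coordDomain o) inter_subset_left, ← withDensity_apply _ hm]
  refine measure_congr (hac.ae_eq ?_)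
  filter_upwards [ae_mem_domain o] with y hy
  exact propext ⟨fun h => ⟨hy, h⟩, fun h => h.2⟩

lemma chartVolume_compl_coordImage [MeasurableSpace M] [BorelSpace M] (k : BilinField n M) (o : M) :
    chartVolume k o (𝕌 n o)ᶜ = 0 := by
  rw [chartVolume_apply k o (isOpen_coordImage o).measurableSet.compl]
  have : coordDomain o ∩ (𝔠 n o).symm ⁻¹' (𝕌 n o)ᶜ = ∅ := by
    ext y
    simp only [mem_inter_iff, mem_preimage, mem_compl_iff, mem_empty_iff_false, iff_false,
      not_and, not_not]
    exact fun hy => ⟨y, hy, rfl⟩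
  rw [this, Measure.restrict_empty, lintegral_zero_measure]

/-- The exceptional set is enlarged to a measurable null set of coordinates, which the chart pulls
back to a measurable set; the points outside the chart are not charged. -/
lemma ae_chartVolume_of_ae [MeasurableSpace M] [BorelSpace M] (k : BilinField n M) (o : M)
    {P : M → Prop} (h : ∀ᵐ y ∂𝔳 n o, P ((𝔠 n o).symm y)) : ∀ᵐ x ∂(chartVolume k o), P x := by
  rw [ae_iff] at h ⊢
  set N := toMeasurable (𝔳 n o)
    {y | ¬ P ((𝔠 n o).symm y)} with hN
  have hNm : MeasurableSet N := measurableSet_toMeasurable _ _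
  have hN0 : 𝔳 n o N = 0 := by rw [hN, measure_toMeasurable, h]
  have hW := (isOpen_coordImage (n := n) o).measurableSet
  have hem : Measurable ((𝕌 n o).domRestrict (𝔠 n o)) :=
    (continuousOn_iff_continuous_domRestrict.1 ((continuousOn_extChartAt o).mono (by
      rw [coordImage_eq]; exact inter_subset_left))).measurable
  set S' := 𝕌 n o ∩ 𝔠 n o ⁻¹' N with hS'
  have hS'm : MeasurableSet S' := by
    convert hW.subtype_image (hem hNm) using 1
    ext x; simp [hS', -extChartAt, and_comm]
  have h1 : chartVolume k o S' = 0 := by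
    rw [chartVolume_apply k o hS'm]
    have hnull : volume (coordDomain o ∩ (𝔠 n o).symm ⁻¹' S') = 0 := by
      refine measure_mono_null (t := N ∩ coordDomain o) ?_ ?_
      · rintro y ⟨hy, hy'⟩
        refine ⟨?_, hy⟩
        have := hy'.2
        rwa [mem_preimage, extChartAt_symm_apply hy] at this
      · rwa [Measure.restrict_apply hNm] at hN0
    rw [Measure.restrict_eq_zero.2 hnull, lintegral_zero_measure]
  refine measure_mono_null (t := S' ∪ (𝕌 n o)ᶜ) ?_
    (measure_union_null h1 (chartVolume_compl_coordImage k o))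
  intro x hx
  by_cases hxW : x ∈ 𝕌 n o
  · left
    refine ⟨hxW, subset_toMeasurable _ _ ?_⟩
    rw [coordImage_eq] at hxW
    show ¬ P ((𝔠 n o).symm (𝔠 n o x))
    rw [(𝔠 n o).left_inv hxW.1]
    exact hx
  · exact Or.inr hxW

lemma aestronglyMeasurable_chartVolume [MeasurableSpace M] [BorelSpace M] {F : M → ℝ}
    (k : BilinField n M) (o : M) (h : AEStronglyMeasurable (fun y => F ((𝔠 n o).symm y)) (𝔳 n o)) :
    AEStronglyMeasurable F (chartVolume k o) := by
  have he : AEMeasurable (𝔠 n o) (chartVolume k o) := by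
    have hr : (chartVolume k o).restrict (𝕌 n o) = chartVolume k o :=
      Measure.restrict_eq_self_of_ae_mem (by rw [ae_iff]; exact chartVolume_compl_coordImage k o)
    rw [← hr]
    exact ((continuousOn_extChartAt o).mono (by
      rw [coordImage_eq]; exact inter_subset_left)).aemeasurable (isOpen_coordImage o).measurableSet
  refine ⟨_, (h.stronglyMeasurable_mk.comp_measurable he.measurable_mk), ?_⟩
  have h1 : ∀ᵐ x ∂(chartVolume k o), F x = h.mk _ (𝔠 n o x) := by
    apply ae_chartVolume_of_ae
    filter_upwards [h.ae_eq_mk, ae_mem_domain o]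
      with y hy hyD
    rw [extChartAt_symm_apply hyD]
    exact hy
  filter_upwards [h1, he.ae_eq_mk] with x hx hx'
  rw [hx, Function.comp_apply, hx']

/-- A function on `M`, read in the chart around `o`. -/
def funCoord (ρ : M → ℝ) (o : M) (y : 𝔼 n) : ℝ := ρ ((𝔠 n o).symm y)

/-- The Christoffel symbols, defined through classical derivatives. -/
def chris (g : BilinField n M) (o : M) (k i j : Fin n) (y : 𝔼 n) : ℝ :=
  (1 / 2) * ∑ l, 𝔾 g o y k l * (𝐃 (bilinCoord g o j l) y (ê i) + 𝐃 (bilinCoord g o i l) y (ê j)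
      - 𝐃 (bilinCoord g o i j) y (ê l))

/-- The part of a ball around the coordinates of `o` which lies in the open half space. -/
def halfBall (o : M) (R : ℝ) : Set (𝔼 n) := ball (𝔠 n o o) R ∩ {y | 0 < y 0}

notation:max "ℍ" n:max => halfBall (n := n)

lemma isOpen_halfBall (o : M) (R : ℝ) : IsOpen (ℍ n o R) :=
  Metric.isOpen_ball.inter (isOpen_lt continuous_const (by fun_prop))

lemma halfBall_mono (o : M) {R R' : ℝ} (h : R ≤ R') : ℍ n o R ⊆ halfBall o R' :=
  inter_subset_inter_left _ (Metric.ball_subset_ball h)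

/-- A region of coordinates around `o` on which the metric `g` is uniformly comparable with
`ρ⁻²` times the Euclidean one, together with its derivatives, at scale `ε ρ`. -/
structure IsPatch (ρ : M → ℝ) (g : BilinField n M) (r : ℝ) (o : M) (R C ε : ℝ) : Prop where
  R_pos : 0 < R
  one_le_C : 1 ≤ C
  ε_pos : 0 < ε
  dom : ℍ n o (3 * R) ⊆ coordDomain o
  rho_pos : ∀ y ∈ ℍ n o (3 * R), 0 < funCoord ρ o y
  metric_le : ∀ y ∈ ℍ n o (3 * R), ∀ i j,
    |bilinCoord g o i j y| ≤ C * (funCoord ρ o y ^ 2)⁻¹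
  inv_le : ∀ y ∈ ℍ n o (3 * R), ∀ i j,
    |𝔾 g o y i j| ≤ C * funCoord ρ o y ^ 2
  dens_le : ∀ y ∈ ℍ n o (3 * R), volDensity g o y ≤ C * (funCoord ρ o y ^ n)⁻¹
  le_dens : ∀ y ∈ ℍ n o (3 * R), (funCoord ρ o y ^ n)⁻¹ ≤ C * volDensity g o y
  -- The weights of the symbols and of their derivatives are those for which dilation by `ε ρ`
  -- leaves bounds independent of the point.
  chris_le : ∀ y ∈ ℍ n o (3 * R), ∀ k i j,
    |chris g o k i j y| ≤ C * (funCoord ρ o y)⁻¹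
  dchris_le : ∀ y ∈ ℍ n o (3 * R), ∀ k i j l,
    |𝐃 (chris g o k i j) y (ê l)| ≤ C * (funCoord ρ o y ^ 2)⁻¹
  -- Three nested half balls are needed: averaging over centres passes once from the radius `R` to
  -- `2 R` and once from `2 R` to `3 R`.
  ball_subset : ∀ y ∈ ℍ n o (2 * R), ball y (ε * funCoord ρ o y) ⊆ halfBall o (3 * R)
  ball_subset' : ∀ y ∈ ℍ n o R, ball y (ε * funCoord ρ o y) ⊆ halfBall o (2 * R)
  compar : ∀ y ∈ ℍ n o (2 * R), ∀ z ∈ ball y (ε * funCoord ρ o y),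
    funCoord ρ o y ≤ 2 * funCoord ρ o z ∧ funCoord ρ o z ≤ 2 * funCoord ρ o y
  riem : ∀ y ∈ ℍ n o (2 * R), ∀ z ∈ ball y (ε * funCoord ρ o y),
    (𝔠 n o).symm z ∈ riemBall g ((𝔠 n o).symm y) r

/-- A metric of class `C²` on the interior of `M`. -/
structure IsC2Metric (g : BilinField n M) : Prop where
  symm : ∀ x ∈ (𝓡∂ n).interior M, ∀ v w : TangentSpace (𝓡∂ n) x, g x v w = g x w v
  pos : ∀ x ∈ (𝓡∂ n).interior M, ∀ v : TangentSpace (𝓡∂ n) x, v ≠ 0 → 0 < g x v v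
  contDiffOn : ∀ (o : M) (i j : Fin n), ContDiffOn ℝ 2 (bilinCoord g o i j) (coordDomain o)

lemma rho_pos_of_mem_interior (hρ : IsDefiningFunction n ρ) (hx : x ∈ (𝓡∂ n).interior M) :
    0 < ρ x := by
  refine lt_of_le_of_ne (hρ.nonneg x) fun h => ?_
  have := (hρ.eq_zero_iff x).1 h.symm
  rw [← (𝓡∂ n).compl_interior] at this
  exact this hx

/-- The Christoffel symbols as a bilinear map. -/
def gammaForm (g : BilinField n M) (o : M) (y : 𝔼 n) : 𝔼 n →L[ℝ] 𝔼 n →L[ℝ] 𝔼 n :=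
  ∑ k, ∑ i, ∑ j, chris g o k i j y • vecForm k i j

lemma gammaForm_stdVec (g : BilinField n M) (o : M) (y : 𝔼 n) (i j k : Fin n) :
    gammaForm g o y (ê i) (ê j) k = chris g o k i j y := by
  simp [gammaForm, vecForm_apply, Pi.single_apply, sum_apply, Finset.sum_apply]

/-- The Ricci tensor, defined through classical derivatives. -/
def ric (g : BilinField n M) (o : M) (i j : Fin n) (y : 𝔼 n) : ℝ :=
  ∑ k, (𝐃 (chris g o k i j) y (ê k) - 𝐃 (chris g o k i k) y (ê j))
    + ∑ k, ∑ l, (chris g o k k l y * chris g o l i j y - chris g o k j l y * chris g o l i k y)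

/-- The scalar curvature in a chart, defined through classical derivatives. -/
def scalChart (g : BilinField n M) (o : M) (y : 𝔼 n) : ℝ := ∑ i, ∑ j, 𝔾 g o y i j * ric g o i j y

lemma coordForm_eq_sum (g : BilinField n M) (o : M) (y : 𝔼 n) :
    coordForm g o y = ∑ i, ∑ j, bilinCoord g o i j y • dualForm i j := eq_sum_dualForm _

lemma IsC2Metric.contDiffOn_coordForm (hg : IsC2Metric g) (o : M) :
    ContDiffOn ℝ 2 (coordForm g o) (coordDomain o) := by
  have : coordForm g o = fun y => ∑ i, ∑ j, bilinCoord g o i j y • dualForm i j :=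
    funext fun y => coordForm_eq_sum g o y
  rw [this]
  exact ContDiffOn.sum fun i _ => ContDiffOn.sum fun j _ =>
    contDiffOn_smul_const (hg.contDiffOn o i j) _

lemma IsC2Metric.fderiv_bilinCoord (hg : IsC2Metric g) (hy : y ∈ coordDomain o) (i j : Fin n)
    (v : 𝔼 n) : 𝐃 (bilinCoord g o i j) y v = 𝐃 (coordForm g o) y v (ê i) (ê j) := by
  have hd : DifferentiableAt ℝ (coordForm g o) y :=
    ((hg.contDiffOn_coordForm o).contDiffAt ((isOpen_domain o).mem_nhds
      hy)).differentiableAt (by simp)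
  exact fderiv_bilin_apply hd _ _ _

variable [IsManifold (𝓡∂ n) ∞ M]
  {gbar : Bundle.ContMDiffRiemannianMetric (𝓡∂ n) 2 (𝔼 n) (fun x : M => TangentSpace (𝓡∂ n) x)}

/-! ### Charts -/

lemma coordImage_eq_inter_interior (o : M) : 𝕌 n o = (𝔠 n o).source ∩ (𝓡∂ n).interior M := by
  rw [coordImage_eq]
  ext x
  refine and_congr_right fun hx => ?_
  have hx' : x ∈ (chartAt (EuclideanHalfSpace n) o).source := by rwa [extChartAt_source] at hx
  have h1 := (𝓡∂ n).isInteriorPoint_iff_of_mem_atlas (M := M) (n := ∞) (by simp)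
    (chart_mem_atlas (EuclideanHalfSpace n) o) hx'
  have h2 : x ∈ (𝓡∂ n).interior M ↔ (𝓡∂ n).IsInteriorPoint x := Iff.rfl
  rw [h2, h1]
  exact Iff.rfl

lemma symm_mem_interior (hy : y ∈ coordDomain o) : (𝔠 n o).symm y ∈ (𝓡∂ n).interior M := by
  have : (𝔠 n o).symm y ∈ 𝕌 n o := ⟨y, hy, rfl⟩
  rw [coordImage_eq_inter_interior] at this
  exact this.2

lemma mem_coordDomain (h1 : x ∈ (𝔠 n o).source) (h2 : x ∈ (𝓡∂ n).interior M) : 𝔠 n o x ∈ 𝔻 n o := by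
  have : x ∈ 𝕌 n o := by rw [coordImage_eq_inter_interior]; exact ⟨h1, h2⟩
  rw [coordImage_eq] at this
  exact this.2

lemma mdifferentiableAt_symm (hy : y ∈ coordDomain o) :
    MDifferentiableAt 𝓘(ℝ, 𝔼 n) (𝓡∂ n) (𝔠 n o).symm y :=
  (mdifferentiableOn_extChartAt_symm y (domain_subset_target o hy)).mdifferentiableAt
    (mem_interior_iff_mem_nhds.1 hy)

lemma isInvertible_coordLin (hy : y ∈ coordDomain o) : (coordLin o y).IsInvertible := by
  rw [coordLin_eq_mfderivWithin hy]
  exact isInvertible_mfderivWithin_extChartAt_symm (domain_subset_target o hy)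

lemma bilinTrace_coord (k T : BilinField n M) (hy : y ∈ coordDomain o) :
    bilinTrace (k ((𝔠 n o).symm y)) (T ((𝔠 n o).symm y)) = ∑ i, ∑ j, (metricMatrix k o y)⁻¹ i j *
    bilinCoord T o i j y := (bilinTrace_bilinearComp _ _ (isInvertible_coordLin hy)).symm

lemma covectorInner_coord (k : BilinField n M) (α β : CovectorField n M) (hy : y ∈ coordDomain o) :
    covectorInner (k ((𝔠 n o).symm y)) (α ((𝔠 n o).symm y)) (β ((𝔠 n o).symm y)) = ∑ i, ∑ j,
    (metricMatrix k o y)⁻¹ i j * covectorCoord α o i y * covectorCoord β o j y :=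
  (covectorInner_bilinearComp _ _ _ (isInvertible_coordLin hy)).symm

lemma contDiffOn_transition (o x₁ : M) :
    ContDiffOn ℝ ∞ (transition o x₁) (transDomain (n := n) o x₁) := by
  have h1 : ContMDiffOn 𝓘(ℝ, 𝔼 n) (𝓡∂ n) ∞ (𝔠 n o).symm (transDomain (n := n) o x₁) :=
    (contMDiffOn_extChartAt_symm o).mono (inter_subset_left.trans (domain_subset_target o))
  have h2 : ContMDiffOn (𝓡∂ n) 𝓘(ℝ, 𝔼 n) ∞ (𝔠 n x₁)
      (chartAt (EuclideanHalfSpace n) x₁).source := contMDiffOn_extChartAt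
  refine contMDiffOn_iff_contDiffOn.1 (h2.comp h1 ?_)
  intro y hy
  have := hy.2
  rw [mem_preimage, coordImage_eq, extChartAt_source] at this
  exact this.1

lemma coordLin_eq_comp (hy : y ∈ transDomain o x₁) :
    coordLin o y = (coordLin x₁ (transition o x₁ y)).comp (𝐃 (transition o x₁) y) := by
  have hev : (𝔠 n o).symm =ᶠ[𝓝 y] (𝔠 n x₁).symm ∘ transition o x₁ := by
    filter_upwards [(isOpen_transDomain o x₁).mem_nhds hy] with z hz
    exact (symm_transition hz).symm
  have hd : DifferentiableAt ℝ (transition o x₁) y :=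
    ((contDiffOn_transition o x₁).differentiableOn (by simp)).differentiableAt
      ((isOpen_transDomain o x₁).mem_nhds hy)
  have h1 := (mdifferentiableAt_symm (transition_mem hy)).hasMFDerivAt.comp y
    hd.hasFDerivAt.hasMFDerivAt
  exact (h1.congr_of_eventuallyEq hev).mfderiv

lemma coordForm_eq_bilinearComp (k : BilinField n M) (hy : y ∈ transDomain o x₁) :
    coordForm k o y = (coordForm k x₁ (transition o x₁ y)).bilinearComp (𝐃 (transition o x₁) y)
    (𝐃 (transition o x₁) y) := by
  ext v w
  simp only [coordForm, ContinuousLinearMap.bilinearComp_apply]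
  rw [symm_transition hy, coordLin_eq_comp hy]
  rfl

lemma isInvertible_fderiv_transition (hy : y ∈ transDomain o x₁) :
    (𝐃 (transition o x₁) y).IsInvertible := by
  have h0 := isInvertible_coordLin hy.1
  have h1 := isInvertible_coordLin (transition_mem hy)
  rw [coordLin_eq_comp hy] at h0
  obtain ⟨a, ha⟩ := h0
  obtain ⟨b, hb⟩ := h1
  refine ⟨a.trans b.symm, ?_⟩
  ext1 v
  have := congrArg (fun L => L v) ha
  rw [← hb] at this
  simp only [ContinuousLinearEquiv.coe_coe, ContinuousLinearMap.comp_apply] at this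
  simp [this]

variable (n M) in
lemma exists_finset_cover [CompactSpace M] : ∃ t : Finset M, (𝓡∂ n).interior M ⊆ ⋃ o ∈ t,
    coordImage (n := n) o := by
  obtain ⟨t, ht⟩ := isCompact_univ.elim_finite_subcover
    (fun o : M => (𝔠 n o).source) (fun o => isOpen_extChartAt_source o)
    (fun x _ => mem_iUnion.2 ⟨x, mem_extChartAt_source x⟩)
  refine ⟨t, fun x hx => ?_⟩
  obtain ⟨o, hx₀, hxs⟩ := mem_iUnion₂.1 (ht (mem_univ x))
  refine mem_iUnion₂.2 ⟨o, hx₀, ?_⟩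
  rw [coordImage_eq_inter_interior]
  exact ⟨hxs, hx⟩

lemma volDensity_transition (k : BilinField n M) (hy : y ∈ transDomain o x₁) :
    volDensity k o y = |(𝐃 (transition o x₁) y).det| * volDensity k x₁ (transition o x₁ y) := by
  rw [volDensity, volDensity, metricMatrix_eq, metricMatrix_eq, coordForm_eq_bilinearComp k hy,
    gram_bilinearComp, Matrix.det_mul, Matrix.det_mul, Matrix.det_transpose, det_stdMat]
  rw [mul_right_comm, Real.sqrt_mul (mul_self_nonneg _), Real.sqrt_mul_self_eq_abs]

/-- The coordinate frame of the chart around `o`, as a field on `M`. -/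
def chartFrame (o : M) (i : Fin n) (x : M) : TangentSpace (𝓡∂ n) x :=
  (trivializationAt (𝔼 n) (TangentSpace (𝓡∂ n)) o).symmL ℝ x (ê i)

lemma contMDiffOn_chartFrame (o : M) (i : Fin n) : ContMDiffOn (𝓡∂ n)
    ((𝓡∂ n).prod 𝓘(ℝ, 𝔼 n)) 2 (fun x => Bundle.TotalSpace.mk' (𝔼 n) x (chartFrame o i x))
    (chartAt (EuclideanHalfSpace n) o).source := by
  have : IsManifold (𝓡∂ n) (2 + 1) M := IsManifold.of_le (n := ∞) (by norm_cast)
  have := ((trivializationAt (𝔼 n)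
    (TangentSpace (𝓡∂ n) (M := M)) o).contMDiffOn_section_baseSet_iff (IB := 𝓡∂ n) (n := 2)
      (s := chartFrame o i)).2
  refine this ?_
  refine (contMDiffOn_const (c := (ê i : 𝔼 n))).congr fun x hx => ?_
  rw [chartFrame, Bundle.Trivialization.symmL_apply, Bundle.Trivialization.apply_mk_symm]
  all_goals exact hx

/-- The frame of the tangent bundle trivialization is smooth up to the boundary, which is needed for
uniform bounds. At interior coordinates it is the frame used to define components. -/
lemma chartFrame_symm (hy : y ∈ coordDomain o) (i : Fin n) :
    chartFrame o i ((𝔠 n o).symm y) = coordVec o y i := by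
  have : IsManifold (𝓡∂ n) 1 M := IsManifold.of_le (n := ∞) (by norm_cast)
  have h1 := symm_mem_source hy
  rw [extChartAt_source] at h1
  rw [chartFrame, TangentBundle.symmL_trivializationAt h1, extChartAt_symm_apply hy]
  have := coordLin_eq_mfderivWithin hy
  rw [← this]
  rfl

/-! ### Coordinates up to the boundary -/

section

variable (gbar)

/-- The components of a metric of class `C²` up to the boundary. -/
def barCoord (o : M) (i j : Fin n) (y : 𝔼 n) : ℝ :=
  gbar.inner ((𝔠 n o).symm y) (chartFrame o i ((𝔠 n o).symm y))
    (chartFrame o j ((𝔠 n o).symm y))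

lemma contDiffOn_barCoord (o : M) (i j : Fin n) :
    ContDiffOn ℝ 2 (barCoord gbar o i j) (𝔠 n o).target := by
  have h1 : ContMDiffOn (𝓡∂ n) 𝓘(ℝ, ℝ) 2 (fun x => gbar.inner x (chartFrame o i x)
      (chartFrame o j x)) (chartAt (EuclideanHalfSpace n) o).source := by
    intro x hx
    have h := ContMDiffWithinAt.clm_bundle_apply₂ (b := fun x : M => x)
      (E₁ := fun x : M => TangentSpace (𝓡∂ n) x) (E₂ := fun x : M => TangentSpace (𝓡∂ n) x)
      (E₃ := Bundle.Trivial M ℝ) (F₃ := ℝ)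
      (ψ := gbar.inner) (gbar.contMDiff x).contMDiffWithinAt
      (contMDiffOn_chartFrame o i x hx) (contMDiffOn_chartFrame o j x hx)
    simp only [Bundle.contMDiffWithinAt_totalSpace] at h
    exact h.2
  have h2 : ContMDiffOn 𝓘(ℝ, 𝔼 n) (𝓡∂ n) 2 (𝔠 n o).symm (𝔠 n o).target :=
    (contMDiffOn_extChartAt_symm (n := ∞) o).of_le (by norm_cast)
  refine contMDiffOn_iff_contDiffOn.1 (h1.comp h2 fun y hy => ?_)
  have := (𝔠 n o).map_target hy
  rwa [extChartAt_source] at this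

/-- The Gram matrix of a metric, up to the boundary. -/
def barMatrix (o : M) (y : 𝔼 n) : Matrix (Fin n) (Fin n) ℝ :=
  Matrix.of fun i j => barCoord gbar o i j y

lemma barCoord_comm (o : M) (i j : Fin n) (y : 𝔼 n) :
    barCoord gbar o i j y = barCoord gbar o j i y := gbar.symm _ _ _

lemma linearIndependent_chartFrame (hx : x ∈ (chartAt (EuclideanHalfSpace n) o).source) {v : 𝔼 n}
    (hv : v ≠ 0) : ∑ i, v i • chartFrame o i x ≠ 0 := by
  intro h
  have h' : (trivializationAt (𝔼 n) (TangentSpace (𝓡∂ n)) o).symmL ℝ x v = 0 := by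
    conv_lhs => rw [eq_sum_stdVec v]
    rw [map_sum, ← h]
    exact sum_congr rfl fun i _ => map_smul _ _ _
  have hb : x ∈ (trivializationAt (𝔼 n) (TangentSpace (𝓡∂ n) (M := M)) o).baseSet := hx
  have := (trivializationAt (𝔼 n)
    (TangentSpace (𝓡∂ n) (M := M)) o).continuousLinearMapAt_symmL (R := ℝ) hb v
  rw [h', map_zero] at this
  exact hv this.symm

lemma sum_barCoord_pos (hy : y ∈ (𝔠 n o).target) {v : 𝔼 n} (hv : v ≠ 0) :
    0 < ∑ i, ∑ j, barCoord gbar o i j y * v i * v j := by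
  have hx := (𝔠 n o).map_target hy
  rw [extChartAt_source] at hx
  have := gbar.pos _ _ (linearIndependent_chartFrame hx hv)
  convert this using 1
  simp only [map_sum, map_smul, sum_apply, smul_apply, smul_eq_mul, barCoord]
  refine sum_congr rfl fun i _ => ?_
  rw [mul_sum]
  refine sum_congr rfl fun j _ => ?_
  rw [gbar.symm _ (chartFrame o i _)]
  ring

lemma posDef_barMatrix (hy : y ∈ (𝔠 n o).target) : (barMatrix gbar o y).PosDef := by
  refine Matrix.PosDef.of_dotProduct_mulVec_pos ?_ fun v hv => ?_
  · ext i j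
    simp [barMatrix, barCoord_comm gbar o i j]
  · have := sum_barCoord_pos gbar hy (v := WithLp.toLp 2 v) (by simpa using hv)
    refine lt_of_lt_of_eq this ?_
    simp only [dotProduct, Matrix.mulVec, barMatrix, Matrix.of_apply, mul_sum]
    refine sum_congr rfl fun i _ => sum_congr rfl fun j _ => ?_
    rw [Pi.star_apply, star_trivial]; ring

end

/-! ### Asymptotically hyperbolic metrics in coordinates -/

lemma contDiffOn_funCoord (hρ : ContMDiff (𝓡∂ n) 𝓘(ℝ, ℝ) ∞ ρ) (o : M) :
    ContDiffOn ℝ ∞ (funCoord (n := n) ρ o) (𝔠 n o).target :=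
  contMDiffOn_iff_contDiffOn.1 (hρ.comp_contMDiffOn (contMDiffOn_extChartAt_symm o))

lemma funCoord_pos (hρ : IsDefiningFunction n ρ) (hy : y ∈ coordDomain o) : 0 < funCoord ρ o y := by
  have := rho_pos_of_mem_interior hρ (symm_mem_interior hy)
  exact this

lemma funCoord_eq_zero (hρ : IsDefiningFunction n ρ) (hy : y ∈ (𝔠 n o).target) (h0 : y 0 ≤ 0) :
    funCoord ρ o y = 0 := by
  refine (hρ.eq_zero_iff _).2 ?_
  rw [← (𝓡∂ n).compl_interior]
  intro h
  have := mem_coordDomain ((𝔠 n o).map_target hy) h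
  rw [(𝔠 n o).right_inv hy, coordDomain_eq] at this
  exact absurd this.2 (not_lt.2 h0)

/-- The metric `g` is `ρ⁻²` times a metric of class `C²` up to the boundary. -/
structure IsConfCompact (ρ : M → ℝ) (g : BilinField n M)
    (gbar : Bundle.ContMDiffRiemannianMetric (𝓡∂ n) 2 (𝔼 n) (fun x : M => TangentSpace (𝓡∂ n) x)) :
    Prop where
  rho : IsDefiningFunction n ρ
  eq : ∀ x ∈ (𝓡∂ n).interior M, gbar.inner x = ρ x ^ 2 • g x

namespace IsConfCompact

lemma metric_apply (H : IsConfCompact ρ g gbar) (hx : x ∈ (𝓡∂ n).interior M)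
    (v w : TangentSpace (𝓡∂ n) x) : g x v w = (ρ x ^ 2)⁻¹ * gbar.inner x v w := by
  rw [H.eq x hx]
  have := (rho_pos_of_mem_interior H.rho hx).ne'
  change _ = (ρ x ^ 2)⁻¹ * (ρ x ^ 2 * g x v w)
  field_simp

lemma bilinCoord_eq (H : IsConfCompact ρ g gbar) (hy : y ∈ coordDomain o) (i j : Fin n) :
    bilinCoord g o i j y = (funCoord ρ o y ^ 2)⁻¹ * barCoord gbar o i j y := by
  rw [bilinCoord, H.metric_apply (symm_mem_interior hy), barCoord, chartFrame_symm hy,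
    chartFrame_symm hy]
  rfl

lemma metricMatrix_eq (H : IsConfCompact ρ g gbar) (hy : y ∈ coordDomain o) :
    metricMatrix g o y = (funCoord ρ o y ^ 2)⁻¹ • barMatrix gbar o y := by
  ext i j
  simp [metricMatrix, barMatrix, H.bilinCoord_eq hy]

lemma inv_metricMatrix_eq (H : IsConfCompact ρ g gbar) (hy : y ∈ coordDomain o) : 𝔾 g o y =
    funCoord ρ o y ^ 2 • (barMatrix gbar o y)⁻¹ := by
  have hp := funCoord_pos H.rho hy
  have hd : IsUnit (barMatrix gbar o y).det :=
    (posDef_barMatrix gbar (domain_subset_target o hy)).det_pos.ne'.isUnit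
  apply Matrix.inv_eq_left_inv
  rw [H.metricMatrix_eq hy, Matrix.smul_mul, Matrix.mul_smul, smul_smul,
    Matrix.nonsing_inv_mul _ hd, mul_inv_cancel₀ (by positivity), one_smul]

lemma volDensity_eq (H : IsConfCompact ρ g gbar) (hy : y ∈ coordDomain o) :
    volDensity g o y = (funCoord ρ o y ^ n)⁻¹ * √(barMatrix gbar o y).det := by
  have hp := funCoord_pos H.rho hy
  rw [volDensity, H.metricMatrix_eq hy, Matrix.det_smul, Fintype.card_fin,
    show ((funCoord ρ o y ^ 2)⁻¹ ^ n) = ((funCoord ρ o y ^ n)⁻¹) ^ 2 by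
      rw [inv_pow, inv_pow, pow_right_comm], Real.sqrt_mul (by positivity),
    Real.sqrt_sq (by positivity)]

lemma isC2Metric (H : IsConfCompact ρ g gbar) : IsC2Metric g where
  symm x hx v w := by rw [H.metric_apply hx, H.metric_apply hx, gbar.symm]
  pos x hx v hv := by
    rw [H.metric_apply hx]
    have := rho_pos_of_mem_interior H.rho hx
    have := gbar.pos x v hv
    positivity
  contDiffOn o i j := by
    have h1 : ContDiffOn ℝ 2 (funCoord (n := n) ρ o) (coordDomain o) :=
      ((contDiffOn_funCoord H.rho.smooth o).of_le (by norm_cast)).mono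
        (domain_subset_target o)
    have h2 := (contDiffOn_barCoord gbar o i j).mono (domain_subset_target o)
    refine (((h1.pow 2).inv fun y hy => ?_).mul h2).congr fun y hy => H.bilinCoord_eq hy i j
    exact pow_ne_zero _ (funCoord_pos H.rho hy).ne'

end IsConfCompact

variable (ρ gbar) in
/-- The function `ρ Γ^k_{ij}`, which extends to the boundary. -/
def barChris (o : M) (k i j : Fin n) (y : 𝔼 n) : ℝ :=
  (1 / 2) * ∑ l, (barMatrix gbar o y)⁻¹ k l * (funCoord ρ o y *
      (fderivWithin ℝ (barCoord gbar o j l) (𝔠 n o).target y (ê i)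
        + fderivWithin ℝ (barCoord gbar o i l) (𝔠 n o).target y (ê j)
        - fderivWithin ℝ (barCoord gbar o i j) (𝔠 n o).target y (ê l))
      - 2 * (fderivWithin ℝ (funCoord ρ o) (𝔠 n o).target y (ê i) * barCoord gbar o j l y
          + fderivWithin ℝ (funCoord ρ o) (𝔠 n o).target y (ê j)
            * barCoord gbar o i l y
          - fderivWithin ℝ (funCoord ρ o) (𝔠 n o).target y (ê l)
            * barCoord gbar o i j y))

lemma contDiffOn_inv_barMatrix (o : M) (i j : Fin n) :
    ContDiffOn ℝ 2 (fun y => (barMatrix gbar o y)⁻¹ i j) (𝔠 n o).target :=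
  contDiffOn_matrix_inv (fun i j => contDiffOn_barCoord gbar o i j)
    (fun _ hy => (posDef_barMatrix gbar hy).det_pos.ne') i j

lemma contDiffOn_fderivWithin_barCoord (o : M) (i j l : Fin n) : ContDiffOn ℝ 1
    (fun y => fderivWithin ℝ (barCoord gbar o i j) (𝔠 n o).target y (ê l)) (𝔠 n o).target :=
  ((contDiffOn_barCoord gbar o i j).fderivWithin (uniqueDiffOn_extChartAt_target o)
    (by norm_num)).clm_apply contDiffOn_const

lemma contDiffOn_fderivWithin_funCoord (hρ : ContMDiff (𝓡∂ n) 𝓘(ℝ, ℝ) ∞ ρ) (o : M) (l : Fin n) :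
    ContDiffOn ℝ 1 (fun y => fderivWithin ℝ (funCoord ρ o) (𝔠 n o).target y (ê l)) (𝔠 n o).target :=
  ((contDiffOn_funCoord hρ o).fderivWithin (uniqueDiffOn_extChartAt_target o)
    (by norm_cast)).clm_apply contDiffOn_const

lemma contDiffOn_barChris (hρ : ContMDiff (𝓡∂ n) 𝓘(ℝ, ℝ) ∞ ρ) (o : M) (k i j : Fin n) :
    ContDiffOn ℝ 1 (barChris ρ gbar o k i j) (𝔠 n o).target := by
  have h1 : ContDiffOn ℝ 1 (funCoord (n := n) ρ o) (𝔠 n o).target :=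
    (contDiffOn_funCoord hρ o).of_le (by norm_cast)
  have h2 := fun i j => (contDiffOn_barCoord gbar o i j).of_le (m := 1) (by norm_num)
  have h3 := contDiffOn_fderivWithin_funCoord hρ o
  have h4 := contDiffOn_fderivWithin_barCoord (gbar := gbar) o
  refine contDiffOn_const.mul (ContDiffOn.sum fun l _ => ?_)
  refine ((contDiffOn_inv_barMatrix o k l).of_le (by norm_num)).mul ?_
  refine (h1.mul (((h4 _ _ _).add (h4 _ _ _)).sub (h4 _ _ _))).sub (contDiffOn_const.mul ?_)
  exact (((h3 _).mul (h2 _ _)).add ((h3 _).mul (h2 _ _))).sub ((h3 _).mul (h2 _ _))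

/-- The derivative of `ρ⁻² ḡ` consists of terms of order `ρ⁻²` and `ρ⁻³`, and the inverse metric is
`ρ² ḡ⁻¹`. The product is `ρ⁻¹` times a function that is `C¹` up to the boundary, whence the bounds
on patches. -/
lemma IsConfCompact.chris_eq (H : IsConfCompact ρ g gbar) (hy : y ∈ coordDomain o) (k i j : Fin n) :
    chris g o k i j y = (funCoord ρ o y)⁻¹ * barChris ρ gbar o k i j y := by
  have hp := funCoord_pos H.rho hy
  have hnhds : (𝔠 n o).target ∈ 𝓝 y := mem_interior_iff_mem_nhds.1 hy
  have hd1 : DifferentiableAt ℝ (funCoord (n := n) ρ o) y :=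
    ((contDiffOn_funCoord H.rho.smooth o).contDiffAt hnhds).differentiableAt (by simp)
  have hd2 : ∀ a b, DifferentiableAt ℝ (barCoord gbar o a b) y := fun a b =>
    ((contDiffOn_barCoord gbar o a b).contDiffAt hnhds).differentiableAt (by simp)
  have key : ∀ a b v, 𝐃 (bilinCoord g o a b) y v =
      (funCoord ρ o y ^ 2)⁻¹ * 𝐃 (barCoord gbar o a b) y v
      - 2 * (funCoord ρ o y ^ 3)⁻¹ * 𝐃 (funCoord ρ o) y v * barCoord gbar o a b y := by
    intro a b v
    have hev : bilinCoord g o a b =ᶠ[𝓝 y]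
        fun y => (funCoord ρ o y ^ 2)⁻¹ * barCoord gbar o a b y := by
      filter_upwards [(isOpen_domain o).mem_nhds hy] with z hz
      exact H.bilinCoord_eq hz a b
    have h0 : HasDerivAt (fun s : ℝ => (s ^ 2)⁻¹) (-2 * (funCoord ρ o y ^ 3)⁻¹)
        (funCoord ρ o y) := by
      have := (hasDerivAt_pow 2 (funCoord ρ o y)).fun_inv (pow_ne_zero 2 hp.ne')
      refine this.congr_deriv ?_
      field_simp
      norm_num
      ring
    have h1 := (h0.comp_hasFDerivAt y hd1.hasFDerivAt).mul (hd2 a b).hasFDerivAt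
    rw [hev.fderiv_eq]
    have h1' := h1.fderiv
    have : (fun y => (funCoord ρ o y ^ 2)⁻¹ * barCoord gbar o a b y) =
      (((fun s : ℝ => (s ^ 2)⁻¹) ∘ funCoord ρ o) * barCoord gbar o a b) := rfl
    rw [this, h1']
    simp only [add_apply, smul_apply, smul_eq_mul, Function.comp_apply]
    ring
  rw [chris, barChris]
  simp only [fderivWithin_of_mem_nhds hnhds, key, H.inv_metricMatrix_eq hy, Matrix.smul_apply,
    smul_eq_mul]
  rw [mul_left_comm (funCoord ρ o y)⁻¹, mul_sum _ _ (funCoord ρ o y)⁻¹]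
  congr 1
  refine sum_congr rfl fun l _ => ?_
  field_simp
  ring

lemma exists_common_bound {E ι F : Type*} [TopologicalSpace E] [Fintype ι]
    [SeminormedAddCommGroup F] {K : Set E} (hK : IsCompact K) {f : ι → E → F}
    (hf : ∀ a, ContinuousOn (f a) K) : ∃ C : ℝ, 0 ≤ C ∧ ∀ a, ∀ y ∈ K, ‖f a y‖ ≤ C := by
  choose C hC using fun a => hK.exists_bound_of_continuousOn (hf a)
  refine ⟨∑ a, |C a|, Finset.sum_nonneg fun _ _ => abs_nonneg _, fun a y hy => ?_⟩
  exact ((hC a y hy).trans (le_abs_self _)).trans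
    (Finset.single_le_sum (f := fun a => |C a|) (fun _ _ => abs_nonneg _) (Finset.mem_univ a))

/-- A segment of small Euclidean length is short. -/
lemma riemDist_symm_le {y z : 𝔼 n} {L : ℝ} (hL : 0 ≤ L)
    (hseg : ∀ t ∈ Icc (0 : ℝ) 1, y + t • (z - y) ∈ coordDomain o)
    (hle : ∀ t ∈ Icc (0 : ℝ) 1, coordForm g o (y + t • (z - y)) (z - y) (z - y) ≤ L ^ 2) :
    riemDist g ((𝔠 n o).symm y) ((𝔠 n o).symm z) ≤ ofReal L := by
  set c : ℝ → 𝔼 n := fun t => y + t • (z - y) with hc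
  have hcs : ContDiff ℝ ∞ c := by fun_prop
  have hcd : ∀ t, HasFDerivAt c (ContinuousLinearMap.toSpanSingleton ℝ (z - y)) t := by
    intro t
    have : HasDerivAt c (z - y) t := by
      have h := ((hasDerivAt_id t).smul_const (z - y)).const_add y
      rw [one_smul] at h
      exact h
    exact this.hasFDerivAt
  refine iInf₂_le_of_le ((𝔠 n o).symm ∘ c) ⟨?_, ?_, ?_, ?_⟩ ?_
  · have h1 : ContMDiffOn 𝓘(ℝ, 𝔼 n) (𝓡∂ n) 1 (𝔠 n o).symm (coordDomain o) :=
      ((contMDiffOn_extChartAt_symm (n := ∞) o).of_le (by norm_cast)).mono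
        (domain_subset_target o)
    have h2 : ContMDiffOn 𝓘(ℝ, ℝ) 𝓘(ℝ, 𝔼 n) 1 c (Icc 0 1) :=
      (hcs.of_le (by norm_cast)).contMDiff.contMDiffOn
    exact h1.comp h2 fun t ht => hseg t ht
  · exact fun t ht => symm_mem_interior (hseg t ht)
  · simp [hc, -extChartAt]
  · simp [hc, -extChartAt]
  · have hcl : curveLength g ((𝔠 n o).symm ∘ c) ≤ ∫⁻ _t in Icc (0 : ℝ) 1, ofReal L := by
      refine setLIntegral_mono' measurableSet_Icc fun t ht => ENNReal.ofReal_le_ofReal ?_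
      refine Real.sqrt_le_iff.2 ⟨hL, ?_⟩
      have hm := ((mdifferentiableAt_symm (hseg t ht)).hasMFDerivAt.comp t
        (hcd t).hasMFDerivAt).mfderiv
      have hm1 : mfderiv 𝓘(ℝ, ℝ) (𝓡∂ n) ((𝔠 n o).symm ∘ c) t (1 : ℝ) =
          coordLin o (c t) (z - y) := by
        rw [hm]
        change coordLin o (c t) (ContinuousLinearMap.toSpanSingleton ℝ (z - y) (1 : ℝ)) = _
        rw [ContinuousLinearMap.toSpanSingleton_apply, one_smul]
      rw [hm1]
      exact hle t ht
    refine hcl.trans ?_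
    simp

/-- At the scale of a Lipschitz function that vanishes on the boundary of the half space, balls do
not meet the boundary, and the function is almost constant on them. -/
lemma ball_subset_of_lipschitz {f : 𝔼 n → ℝ} {c : 𝔼 n} {R C ε s : ℝ} (hC : 0 < C) (hε : 0 < ε)
    (hε1 : C * ε ≤ 1 / 2) (hε2 : ε * C ≤ R) (hs : s ≤ 2 * R)
    (hpos : ∀ y ∈ ball c (3 * R), 0 < y 0 → 0 < f y) (hle : ∀ y ∈ ball c (3 * R), 0 < y 0 → f y ≤ C)
    (hzero : ∀ y ∈ closedBall c (3 * R), y 0 = 0 → f y = 0) (hlip :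
    ∀ y ∈ closedBall c (3 * R), 0 ≤ y 0 → ∀ z ∈ closedBall c (3 * R), 0 ≤ z 0 → |f z - f y| ≤ C *
    ‖z - y‖) {y z : 𝔼 n} (hy : y ∈ ball c s) (hy0 : 0 < y 0) (hz : z ∈ ball y (ε * f y)) :
    (z ∈ ball c (s + R) ∧ 0 < z 0) ∧ f y ≤ 2 * f z ∧ f z ≤ 2 * f y := by
  have hR : 0 ≤ R := le_trans (by positivity) hε2
  have hy3 : y ∈ ball c (3 * R) := Metric.ball_subset_ball (by linarith only [hs, hR]) hy
  have hfy := hpos y hy3 hy0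
  have hzy : ‖z - y‖ < ε * f y := by rw [← dist_eq_norm]; exact hz
  have hzyR : ‖z - y‖ < R :=
    hzy.trans_le (le_trans (mul_le_mul_of_nonneg_left (hle y hy3 hy0) hε.le) hε2)
  have hys : ‖y - c‖ < s := by rw [← dist_eq_norm]; exact hy
  -- Because `C ε ≤ 1/2`, a displacement of length `ε f(y)` changes `f` by less than half of `f(y)`.
  have hsmall : C * ‖z - y‖ < f y / 2 := by
    calc C * ‖z - y‖ < C * (ε * f y) := mul_lt_mul_of_pos_left hzy hC
      _ = (C * ε) * f y := by ring
      _ ≤ 1 / 2 * f y := mul_le_mul_of_nonneg_right hε1 hfy.le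
      _ = f y / 2 := by ring
  have hball : ∀ w, ‖w - y‖ ≤ ‖z - y‖ → dist w c < s + R := fun w hw => by
    have := dist_triangle w y c
    rw [dist_eq_norm w y, dist_eq_norm y c] at this
    linarith only [this, hw, hzyR, hys]
  have hzc := hball z le_rfl
  -- Otherwise the segment from `y` to `z` would meet the hyperplane `w 0 = 0`, where `f` vanishes,
  -- and the Lipschitz bound would give `f y ≤ C ‖w - y‖ < f y / 2`.
  have hz0 : 0 < z 0 := by
    by_contra hz0
    have hz0' : z 0 ≤ 0 := not_lt.1 hz0
    have hden : 0 < y 0 - z 0 := by linarith only [hy0, hz0']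
    set t := y 0 / (y 0 - z 0) with ht
    have ht0 : 0 ≤ t := by positivity
    have ht1 : t ≤ 1 := by rw [ht, div_le_one hden]; linarith only [hz0']
    set w := y + t • (z - y) with hw
    have hw0 : w 0 = 0 := by
      have e1 : w 0 = y 0 + t * (z 0 - y 0) := rfl
      have e2 : t * (y 0 - z 0) = y 0 := div_mul_cancel₀ _ hden.ne'
      rw [e1]; linarith only [e2]
    have hwy : ‖w - y‖ ≤ ‖z - y‖ := by
      rw [hw, add_sub_cancel_left, norm_smul, Real.norm_of_nonneg ht0]
      exact mul_le_of_le_one_left (norm_nonneg _) ht1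
    have hwK : w ∈ closedBall c (3 * R) := by
      rw [Metric.mem_closedBall]; linarith only [hball w hwy, hs]
    have := hlip y (Metric.ball_subset_closedBall hy3) hy0.le w hwK hw0.ge
    rw [hzero w hwK hw0, zero_sub, abs_neg, abs_of_pos hfy] at this
    have h3 := mul_le_mul_of_nonneg_left hwy hC.le
    linarith only [this, h3, hsmall, hfy]
  have hzK : z ∈ closedBall c (3 * R) := by rw [Metric.mem_closedBall]; linarith only [hzc, hs]
  have h4 := abs_le.1 ((hlip y (Metric.ball_subset_closedBall hy3) hy0.le z hzK hz0.le).trans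
    hsmall.le)
  exact ⟨⟨hzc, hz0⟩, by linarith only [h4.1, hfy], by linarith only [h4.2, hfy]⟩

/-- Uniform bounds on a neighbourhood of `o` of the quantities that extend to the boundary. -/
structure IsBarBound (ρ : M → ℝ)
    (gbar : Bundle.ContMDiffRiemannianMetric (𝓡∂ n) 2 (𝔼 n) (fun x : M => TangentSpace (𝓡∂ n) x))
    (o : M) (K : Set (𝔼 n)) (D : ℝ) : Prop where
  one_le : 1 ≤ D
  subset : K ⊆ (𝔠 n o).target
  rho : ∀ y ∈ K, |funCoord ρ o y| ≤ D
  drho : ∀ y ∈ K, ‖fderivWithin ℝ (funCoord ρ o) (𝔠 n o).target y‖ ≤ D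
  metric : ∀ y ∈ K, ∀ i j, |barCoord gbar o i j y| ≤ D
  inv : ∀ y ∈ K, ∀ i j, |(barMatrix gbar o y)⁻¹ i j| ≤ D
  dens : ∀ y ∈ K, √(barMatrix gbar o y).det ≤ D
  inv_dens : ∀ y ∈ K, (√(barMatrix gbar o y).det)⁻¹ ≤ D
  chris : ∀ y ∈ K, ∀ k i j, |barChris ρ gbar o k i j y| ≤ D
  dchris : ∀ y ∈ K, ∀ k i j, ‖fderivWithin ℝ (barChris ρ gbar o k i j) (𝔠 n o).target y‖ ≤ D

lemma exists_isBarBound (hρ : ContMDiff (𝓡∂ n) 𝓘(ℝ, ℝ) ∞ ρ) {K : Set (𝔼 n)} (hKc : IsCompact K)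
    (hKT : K ⊆ (𝔠 n o).target) : ∃ D, IsBarBound ρ gbar o K D := by
  have hu : UniqueDiffOn ℝ (𝔠 n o).target := uniqueDiffOn_extChartAt_target o
  have hrs := contDiffOn_funCoord hρ o
  have hbs := contDiffOn_barCoord gbar o
  have hA := contDiffOn_barChris (gbar := gbar) hρ o
  have hdetc : ContinuousOn (fun y => √(barMatrix gbar o y).det) K :=
    ((contDiffOn_matrix_det (fun i j => hbs i j)).continuousOn.mono hKT).sqrt
  have hdetp : ∀ y ∈ K, 0 < √(barMatrix gbar o y).det := fun y hy =>
    Real.sqrt_pos.2 (posDef_barMatrix gbar (hKT hy)).det_pos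
  obtain ⟨C₁, h₁, b₁⟩ := exists_common_bound (ι := Unit) hKc
    (f := fun _ => funCoord ρ o) (fun _ => hrs.continuousOn.mono hKT)
  obtain ⟨C₂, h₂, b₂⟩ := exists_common_bound (ι := Unit) hKc
    (f := fun _ => fderivWithin ℝ (funCoord ρ o) (𝔠 n o).target)
    (fun _ => (hrs.continuousOn_fderivWithin hu (by simp)).mono hKT)
  obtain ⟨C₃, h₃, b₃⟩ := exists_common_bound (ι := Fin n × Fin n) hKc
    (f := fun p => barCoord gbar o p.1 p.2) (fun p => (hbs p.1 p.2).continuousOn.mono hKT)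
  obtain ⟨C₄, h₄, b₄⟩ := exists_common_bound (ι := Fin n × Fin n) hKc
    (f := fun p y => (barMatrix gbar o y)⁻¹ p.1 p.2)
    (fun p => (contDiffOn_inv_barMatrix o p.1 p.2).continuousOn.mono hKT)
  obtain ⟨C₅, h₅, b₅⟩ := exists_common_bound (ι := Unit) hKc (fun _ => hdetc)
  obtain ⟨C₆, h₆, b₆⟩ := exists_common_bound (ι := Unit) hKc
    (fun _ => hdetc.inv₀ fun y hy => (hdetp y hy).ne')
  obtain ⟨C₇, h₇, b₇⟩ := exists_common_bound (ι := Fin n × Fin n × Fin n) hKc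
    (f := fun p => barChris ρ gbar o p.1 p.2.1 p.2.2)
    (fun p => (hA p.1 p.2.1 p.2.2).continuousOn.mono hKT)
  obtain ⟨C₈, h₈, b₈⟩ := exists_common_bound (ι := Fin n × Fin n × Fin n) hKc
    (f := fun p => fderivWithin ℝ (barChris ρ gbar o p.1 p.2.1 p.2.2) (𝔠 n o).target)
    (fun p => ((hA p.1 p.2.1 p.2.2).continuousOn_fderivWithin hu le_rfl).mono hKT)
  refine ⟨1 + C₁ + C₂ + C₃ + C₄ + C₅ + C₆ + C₇ + C₈,
    by linarith only [h₁, h₂, h₃, h₄, h₅, h₆, h₇, h₈], hKT,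
    fun y hy => (b₁ () y hy).trans ?_, fun y hy => (b₂ () y hy).trans ?_,
    fun y hy i j => (b₃ (i, j) y hy).trans ?_, fun y hy i j => (b₄ (i, j) y hy).trans ?_,
    fun y hy => ((le_abs_self _).trans (b₅ () y hy)).trans ?_,
    fun y hy => ((le_abs_self _).trans (b₆ () y hy)).trans ?_,
    fun y hy k i j => (b₇ (k, i, j) y hy).trans ?_, fun y hy k i j => (b₈ (k, i, j) y hy).trans ?_⟩
  all_goals linarith only [h₁, h₂, h₃, h₄, h₅, h₆, h₇, h₈]

/-! ### Existence of patches -/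

section

variable {K : Set (𝔼 n)} {D : ℝ}

lemma IsBarBound.abs_fderiv_funCoord_le (hB : IsBarBound ρ gbar o K D) (hyK : y ∈ K)
    (hy : y ∈ coordDomain o) (i : Fin n) : |𝐃 (funCoord ρ o) y (ê i)| ≤ D := by
  rw [← fderivWithin_of_mem_nhds (mem_interior_iff_mem_nhds.1 hy)]
  exact (abs_apply_stdVec_le _ i).trans (hB.drho y hyK)

/-- Product rule for `ρ⁻¹ barChris`; since `ρ ≤ D` on `K`, the term of order `ρ⁻¹` is absorbed by
the weight `ρ⁻²`. -/
lemma IsBarBound.abs_fderiv_chris_le (hB : IsBarBound ρ gbar o K D) (H : IsConfCompact ρ g gbar)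
    (hyK : y ∈ K) (hy : y ∈ coordDomain o) (k i j l : Fin n) :
    |𝐃 (LocalYamabe.chris g o k i j) y (ê l)| ≤ 2 * D ^ 2 * (funCoord ρ o y ^ 2)⁻¹ := by
  have hp := funCoord_pos H.rho hy
  have hn : (𝔠 n o).target ∈ 𝓝 y := mem_interior_iff_mem_nhds.1 hy
  have hD : 0 ≤ D := zero_le_one.trans hB.one_le
  have hev : LocalYamabe.chris g o k i j =ᶠ[𝓝 y]
      (Inv.inv ∘ funCoord ρ o) * barChris ρ gbar o k i j := by
    filter_upwards [(isOpen_domain o).mem_nhds hy] with z hz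
    exact H.chris_eq hz k i j
  have hd1 : DifferentiableAt ℝ (funCoord (n := n) ρ o) y :=
    ((contDiffOn_funCoord H.rho.smooth o).contDiffAt hn).differentiableAt (by simp)
  have hd2 : DifferentiableAt ℝ (barChris ρ gbar o k i j) y :=
    ((contDiffOn_barChris H.rho.smooth o k i j).contDiffAt hn).differentiableAt (by simp)
  have h1 := (((hasDerivAt_inv hp.ne').comp_hasFDerivAt y hd1.hasFDerivAt).mul
    hd2.hasFDerivAt).fderiv
  have e : 𝐃 (LocalYamabe.chris g o k i j) y (ê l) =
      (funCoord ρ o y)⁻¹ * 𝐃 (barChris ρ gbar o k i j) y (ê l)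
      - (funCoord ρ o y ^ 2)⁻¹ * (𝐃 (funCoord ρ o) y (ê l) * barChris ρ gbar o k i j y) := by
    rw [hev.fderiv_eq, h1]
    simp only [add_apply, smul_apply, smul_eq_mul, Function.comp_apply]
    ring
  have hdA : |𝐃 (barChris ρ gbar o k i j) y (ê l)| ≤ D := by
    rw [← fderivWithin_of_mem_nhds hn]
    exact (abs_apply_stdVec_le _ l).trans (hB.dchris y hyK k i j)
  have hr2 : (funCoord ρ o y)⁻¹ ≤ D * (funCoord ρ o y ^ 2)⁻¹ := by
    rw [← div_eq_mul_inv, le_div_iff₀ (by positivity)]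
    calc (funCoord ρ o y)⁻¹ * funCoord ρ o y ^ 2 = funCoord ρ o y := by field_simp
      _ ≤ D := (le_abs_self _).trans (hB.rho y hyK)
  rw [e]
  calc _ ≤ (funCoord ρ o y)⁻¹ * D + (funCoord ρ o y ^ 2)⁻¹ * (D * D) := by
        refine (abs_sub _ _).trans (add_le_add ?_ ?_)
        · rw [abs_mul, abs_of_pos (inv_pos.2 hp)]
          exact mul_le_mul_of_nonneg_left hdA (inv_pos.2 hp).le
        · rw [abs_mul, abs_mul, abs_of_pos (inv_pos.2 (pow_pos hp 2))]
          exact mul_le_mul_of_nonneg_left (mul_le_mul (hB.abs_fderiv_funCoord_le hyK hy l)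
            (hB.chris y hyK k i j) (abs_nonneg _) hD) (inv_pos.2 (pow_pos hp 2)).le
    _ ≤ D * (funCoord ρ o y ^ 2)⁻¹ * D + (funCoord ρ o y ^ 2)⁻¹ * (D * D) :=
        add_le_add_left (mul_le_mul_of_nonneg_right hr2 hD) _
    _ = 2 * D ^ 2 * (funCoord ρ o y ^ 2)⁻¹ := by ring

lemma IsBarBound.one_le_mul_sqrt_det (hB : IsBarBound ρ gbar o K D) (hyK : y ∈ K) :
    1 ≤ D * √(barMatrix gbar o y).det := by
  have h2 : 0 < √(barMatrix gbar o y).det :=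
    Real.sqrt_pos.2 (posDef_barMatrix gbar (hB.subset hyK)).det_pos
  calc (1 : ℝ) = (√(barMatrix gbar o y).det)⁻¹ *
        √(barMatrix gbar o y).det := (inv_mul_cancel₀ h2.ne').symm
    _ ≤ _ := mul_le_mul_of_nonneg_right (hB.inv_dens y hyK) h2.le

/-- The image of a small Euclidean ball is contained in a Riemannian ball. -/
lemma symm_mem_riemBall (hr : 0 < r) (hC : 1 ≤ C) (hε : 0 < ε) (hε3 : 4 * C * n * ε ≤ r)
    {f : 𝔼 n → ℝ} {z : 𝔼 n} (hz : z ∈ ball y (ε * f y)) (hball : ∀ w ∈ ball y (ε * f y), w ∈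
    coordDomain o ∧ 0 < f w ∧ f y ≤ 2 * f w ∧ ∀ i j, |bilinCoord g o i j w| ≤ C * (f w ^ 2)⁻¹) :
    (𝔠 n o).symm z ∈ riemBall g ((𝔠 n o).symm y) r := by
  have hn : (1 : ℝ) ≤ n := by exact_mod_cast NeZero.one_le
  refine ⟨symm_mem_interior (hball z hz).1, ?_⟩
  have hzy : ‖z - y‖ < ε * f y := by rw [← dist_eq_norm]; exact hz
  have hsegb : ∀ t ∈ Icc (0 : ℝ) 1, y + t • (z - y) ∈ ball y (ε * f y) := by
    intro t ht
    rw [Metric.mem_ball, dist_eq_norm, add_sub_cancel_left, norm_smul, Real.norm_of_nonneg ht.1]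
    exact lt_of_le_of_lt (mul_le_of_le_one_left (norm_nonneg _) ht.2) hzy
  have hC0 : 0 < C := by linarith only [hC]
  refine lt_of_le_of_lt (riemDist_symm_le (L := 2 * C * n * ε) (by positivity)
    (fun t ht => (hball _ (hsegb t ht)).1) fun t ht => ?_) ?_
  · obtain ⟨-, hpw, hcw, hmetric⟩ := hball _ (hsegb t ht)
    refine (abs_bilin_le _ hmetric _).trans ?_
    generalize y + t • (z - y) = w at *
    have h1 : (f w ^ 2)⁻¹ * ‖z - y‖ ^ 2 ≤ (2 * ε) ^ 2 := by
      rw [inv_mul_le_iff₀ (by positivity), ← mul_pow]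
      refine pow_le_pow_left₀ (norm_nonneg _) (hzy.le.trans ?_) 2
      linarith only [mul_le_mul_of_nonneg_left hcw hε.le]
    calc (n : ℝ) ^ 2 * (C * (f w ^ 2)⁻¹ * ‖z - y‖ ^ 2)
        = (n : ℝ) ^ 2 * C * ((f w ^ 2)⁻¹ * ‖z - y‖ ^ 2) := by ring
      _ ≤ (n : ℝ) ^ 2 * C * (2 * ε) ^ 2 := mul_le_mul_of_nonneg_left h1 (by positivity)
      _ ≤ (n : ℝ) ^ 2 * (C * C) * (2 * ε) ^ 2 := by
          refine mul_le_mul_of_nonneg_right (mul_le_mul_of_nonneg_left ?_ (by positivity))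
            (by positivity)
          nlinarith only [hC]
      _ = (2 * C * n * ε) ^ 2 := by ring
  · rw [ENNReal.ofReal_lt_ofReal_iff hr]
    have : 0 < C * n * ε := by positivity
    linarith only [this, hε3]

/-- The quantities attached to `ρ² g` are continuous up to the boundary, hence bounded on a compact
half ball around `o`; the explicit powers of `ρ` then give the estimates for `g`. Balls of radius `ε
ρ` avoid the boundary because `ρ` is Lipschitz and vanishes there. -/
lemma IsConfCompact.exists_isPatch (H : IsConfCompact ρ g gbar) (hr : 0 < r) (o : M) : ∃ R C ε : ℝ,
    IsPatch ρ g r o R C ε := by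
  obtain ⟨R₀, hR₀, hball⟩ := Metric.mem_nhdsWithin_iff.1
    (extChartAt_target_mem_nhdsWithin (I := 𝓡∂ n) o)
  obtain ⟨R, hR, hRlt⟩ : ∃ R : ℝ, 0 < R ∧ 3 * R < R₀ := ⟨R₀ / 4, by positivity, by linarith⟩
  obtain ⟨K, hKdef⟩ : ∃ K, K = closedBall (𝔠 n o o) (3 * R) ∩
    range (𝓡∂ n) := ⟨_, rfl⟩
  have hKc : IsCompact K := by
    rw [hKdef]; exact (isCompact_closedBall _ _).inter_right (𝓡∂ n).isClosed_range
  have hKT : K ⊆ (𝔠 n o).target := fun y hy => by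
    rw [hKdef] at hy; exact hball ⟨lt_of_le_of_lt hy.1 hRlt, hy.2⟩
  have hKmem : ∀ y ∈ closedBall (𝔠 n o o) (3 * R), 0 ≤ y 0 → y ∈ K :=
    fun y hy hy0 => by
      rw [hKdef]; refine ⟨hy, ?_⟩
      rw [range_modelWithCornersEuclideanHalfSpace]; exact hy0
  have hKconv : Convex ℝ K := by
    rw [hKdef]
    refine (convex_closedBall _ _).inter ?_
    rw [range_modelWithCornersEuclideanHalfSpace]
    exact convex_halfSpace_ge (𝕜 := ℝ) (f := fun y : 𝔼 n => y 0)
      ⟨fun _ _ => rfl, fun _ _ => rfl⟩ 0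
  obtain ⟨D, hB⟩ := exists_isBarBound (gbar := gbar) H.rho.smooth hKc hKT
  have hHK : ℍ n o (3 * R) ⊆ K := fun y hy =>
    hKmem y (Metric.ball_subset_closedBall hy.1) (le_of_lt hy.2)
  have hdom : ℍ n o (3 * R) ⊆ coordDomain o := fun y hy => by
    rw [coordDomain_eq]; exact ⟨hKT (hHK hy), hy.2⟩
  have hlip : ∀ y ∈ K, ∀ z ∈ K, |funCoord ρ o z - funCoord ρ o y| ≤ D * ‖z - y‖ := by
    intro y hy z hz
    refine hKconv.norm_image_sub_le_of_norm_hasFDerivWithin_le (𝕜 := ℝ)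
      (fun x hx => ?_) (fun x hx => hB.drho x hx) hy hz
    exact (((contDiffOn_funCoord H.rho.smooth o).differentiableOn (by simp) x
      (hKT hx)).hasFDerivWithinAt).mono hKT
  have hpos : ∀ y ∈ ℍ n o (3 * R), 0 < funCoord ρ o y := fun y hy => funCoord_pos H.rho (hdom hy)
  -- The bound for the derivatives of the Christoffel symbols; it dominates the other constants
  -- since `1 ≤ D`.
  obtain ⟨C, hC⟩ : ∃ C, C = 2 * D ^ 2 := ⟨_, rfl⟩
  have hD1 := hB.one_le
  have hDC : D ≤ C := by rw [hC]; nlinarith only [hD1]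
  have hC0 : 0 < C := by linarith only [hD1, hDC]
  have hn : (1 : ℝ) ≤ n := by exact_mod_cast NeZero.one_le
  -- The first entry keeps `ρ` within a factor `2` on the balls, the second keeps the balls in the
  -- next half ball, and the third keeps them in Riemannian balls of radius `r`.
  obtain ⟨ε, hεdef⟩ : ∃ ε, ε = min (1 / (2 * C)) (min (R / C) (r / (4 * C * n))) := ⟨_, rfl⟩
  have hε : 0 < ε := by
    rw [hεdef]; exact lt_min (by positivity) (lt_min (by positivity) (by positivity))
  have hε1 : C * ε ≤ 1 / 2 := by
    calc C * ε ≤ C * (1 / (2 * C)) :=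
          mul_le_mul_of_nonneg_left (hεdef ▸ min_le_left _ _) hC0.le
      _ = 1 / 2 := by field_simp
  have hε2 : ε * C ≤ R := (le_div_iff₀ hC0).1 (hεdef ▸ (min_le_right _ _).trans (min_le_left _ _))
  have hε3 : 4 * C * n * ε ≤ r := by
    rw [mul_comm]
    exact (le_div_iff₀ (by positivity)).1 (hεdef ▸ (min_le_right _ _).trans (min_le_right _ _))
  have hgeom : ∀ s : ℝ, s ≤ 2 * R → ∀ y ∈ ℍ n o s,
      ∀ z ∈ ball y (ε * funCoord ρ o y), z ∈ halfBall o (s + R) ∧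
        funCoord ρ o y ≤ 2 * funCoord ρ o z ∧ funCoord ρ o z ≤ 2 * funCoord ρ o y := by
    intro s hs y hy z hz
    exact ball_subset_of_lipschitz hC0 hε hε1 hε2 hs (fun y h1 h2 => hpos y ⟨h1, h2⟩)
      (fun y h1 h2 => (le_abs_self _).trans ((hB.rho y (hHK ⟨h1, h2⟩)).trans hDC))
      (fun y h1 h2 => funCoord_eq_zero H.rho (hKT (hKmem y h1 h2.ge)) h2.le)
      (fun y h1 h2 z h3 h4 => (hlip y (hKmem y h1 h2) z (hKmem z h3 h4)).trans
        (mul_le_mul_of_nonneg_right hDC (norm_nonneg _))) hy.1 hy.2 hz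
  have hsub3 : ∀ y ∈ ℍ n o (2 * R),
      ball y (ε * funCoord ρ o y) ⊆ halfBall o (3 * R) := fun y hy z hz => by
    have := (hgeom (2 * R) le_rfl y hy z hz).1
    rwa [show 2 * R + R = 3 * R by ring] at this
  have hmetric : ∀ y ∈ ℍ n o (3 * R), ∀ i j,
      |bilinCoord g o i j y| ≤ C * (funCoord ρ o y ^ 2)⁻¹ := by
    intro y hy i j
    have hp := inv_pos.2 (pow_pos (hpos y hy) 2)
    rw [H.bilinCoord_eq (hdom hy), abs_mul, abs_of_pos hp, mul_comm]
    exact mul_le_mul_of_nonneg_right ((hB.metric y (hHK hy) i j).trans hDC) hp.le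
  refine ⟨R, C, ε, hR, hD1.trans hDC, hε, hdom, hpos, hmetric, fun y hy i j => ?_, fun y hy => ?_,
    fun y hy => ?_, fun y hy k i j => ?_,
    fun y hy k i j l => ?_, hsub3, fun y hy z hz => ?_,
    fun y hy z hz => (hgeom (2 * R) le_rfl y hy z hz).2, fun y hy z hz => ?_⟩
  · rw [H.inv_metricMatrix_eq (hdom hy), Matrix.smul_apply, smul_eq_mul, abs_mul,
      abs_of_nonneg (sq_nonneg _), mul_comm]
    exact mul_le_mul_of_nonneg_right ((hB.inv y (hHK hy) i j).trans hDC) (sq_nonneg _)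
  · rw [H.volDensity_eq (hdom hy), mul_comm]
    exact mul_le_mul_of_nonneg_right ((hB.dens y (hHK hy)).trans hDC)
      (inv_pos.2 (pow_pos (hpos y hy) n)).le
  · rw [H.volDensity_eq (hdom hy)]
    have h3 := inv_pos.2 (pow_pos (hpos y hy) n)
    have h4 := (hB.one_le_mul_sqrt_det (hHK hy)).trans
      (mul_le_mul_of_nonneg_right hDC (Real.sqrt_nonneg _))
    linarith only [mul_le_mul_of_nonneg_left h4 h3.le]
  · have hp := inv_pos.2 (hpos y hy)
    rw [H.chris_eq (hdom hy), abs_mul, abs_of_pos hp, mul_comm]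
    exact mul_le_mul_of_nonneg_right ((hB.chris y (hHK hy) k i j).trans hDC) hp.le
  · rw [hC]; exact hB.abs_fderiv_chris_le H (hHK hy) (hdom hy) k i j l
  · have := (hgeom R (by linarith only [hR]) y hy z hz).1
    rwa [show R + R = 2 * R by ring] at this
  · exact symm_mem_riemBall hr (hD1.trans hDC) hε hε3 hz fun w hw =>
      ⟨hdom (hsub3 y hy hw), hpos w (hsub3 y hy hw), (hgeom (2 * R) le_rfl y hy w hw).2.1,
        hmetric w (hsub3 y hy hw)⟩

end

/-! ### Invariance of the scalar curvature under changes of coordinates -/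

lemma IsC2Metric.coordForm_symm (hg : IsC2Metric g) (hy : y ∈ coordDomain o) (v w : 𝔼 n) :
    coordForm g o y v w = coordForm g o y w v := hg.symm _ (symm_mem_interior hy) _ _

lemma IsC2Metric.coordForm_pos (hg : IsC2Metric g) (hy : y ∈ coordDomain o) {v : 𝔼 n} (hv : v ≠ 0) :
    0 < coordForm g o y v v := by
  refine hg.pos _ (symm_mem_interior hy) _ fun h => hv ?_
  obtain ⟨e, he⟩ := isInvertible_coordLin hy
  rw [← he] at h
  exact e.map_eq_zero_iff.1 h

lemma IsC2Metric.posDef_metricMatrix (hg : IsC2Metric g) (hy : y ∈ coordDomain o) :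
    (metricMatrix g o y).PosDef :=
  posDef_gram (B := coordForm g o y) (fun v w => hg.coordForm_symm hy v w) fun _ hv =>
    hg.coordForm_pos hy hv

lemma IsC2Metric.isUnit_det (hg : IsC2Metric g) (hy : y ∈ coordDomain o) :
    IsUnit (metricMatrix g o y).det := (hg.posDef_metricMatrix hy).det_pos.ne'.isUnit

lemma IsC2Metric.contDiffOn_inv (hg : IsC2Metric g) (o : M) (i j : Fin n) :
    ContDiffOn ℝ 2 (fun y => 𝔾 g o y i j) (coordDomain o) :=
  contDiffOn_matrix_inv (fun i j => hg.contDiffOn o i j)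
    (fun _ hy => (hg.posDef_metricMatrix hy).det_pos.ne') i j

lemma IsC2Metric.contDiffOn_fderiv (hg : IsC2Metric g) (o : M) (i j l : Fin n) :
    ContDiffOn ℝ 1 (fun y => 𝐃 (bilinCoord g o i j) y (ê l)) (coordDomain o) :=
  ((hg.contDiffOn o i j).fderiv_of_isOpen (isOpen_domain o) (by norm_num)).clm_apply
    contDiffOn_const

lemma IsC2Metric.contDiffOn_chris (hg : IsC2Metric g) (o : M) (k i j : Fin n) :
    ContDiffOn ℝ 1 (chris g o k i j) (coordDomain o) := by
  have h1 := hg.contDiffOn_fderiv o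
  refine contDiffOn_const.mul (ContDiffOn.sum fun l _ => ?_)
  exact ((hg.contDiffOn_inv o k l).of_le (by norm_num)).mul
    (((h1 _ _ _).add (h1 _ _ _)).sub (h1 _ _ _))

lemma IsC2Metric.contDiffOn_gammaForm (hg : IsC2Metric g) (o : M) :
    ContDiffOn ℝ 1 (gammaForm g o) (coordDomain o) :=
  ContDiffOn.sum fun _ _ => ContDiffOn.sum fun _ _ => ContDiffOn.sum fun _ _ =>
    contDiffOn_smul_const (hg.contDiffOn_chris o _ _ _) _

/-- The Koszul formula. -/
lemma IsC2Metric.koszul (hg : IsC2Metric g) (hy : y ∈ coordDomain o) (v w u : 𝔼 n) :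
    coordForm g o y (gammaForm g o y v w) u = (1 / 2) *
    (𝐃 (coordForm g o) y v w u + 𝐃 (coordForm g o) y w v u - 𝐃 (coordForm g o) y u v w) := by
  have key : ∀ i j m, coordForm g o y (gammaForm g o y (ê i) (ê j)) (ê m) =
      (1 / 2) * (𝐃 (coordForm g o) y (ê i) (ê j) (ê m) + 𝐃 (coordForm g o) y (ê j) (ê i) (ê m)
      - 𝐃 (coordForm g o) y (ê m) (ê i) (ê j)) := by
    intro i j m
    rw [eq_sum_stdVec (gammaForm g o y (ê i) (ê j))]
    simp only [gammaForm_stdVec, map_sum, map_smul, sum_apply, smul_apply, smul_eq_mul]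
    simp only [chris, hg.fderiv_bilinCoord hy]
    set X : Fin n → ℝ := fun l => 𝐃 (coordForm g o) y (ê i) (ê j) (ê l)
      + 𝐃 (coordForm g o) y (ê j) (ê i) (ê l)
      - 𝐃 (coordForm g o) y (ê l) (ê i) (ê j) with hX
    have h1 : ∀ k, coordForm g o y (ê k) (ê m) = metricMatrix g o y m k := fun k => by
      rw [hg.coordForm_symm hy]; rfl
    have h2 : (metricMatrix g o y).mulVec ((metricMatrix g o y)⁻¹.mulVec X) m = X m := by
      rw [Matrix.mulVec_mulVec, Matrix.mul_nonsing_inv _ (hg.isUnit_det hy), Matrix.one_mulVec]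
    change ∑ k, (1 / 2) * (∑ l, 𝔾 g o y k l * X l) * _ = (1 / 2) * X m
    rw [← h2]
    simp only [Matrix.mulVec, dotProduct, h1, mul_sum]
    refine sum_congr rfl fun k _ => ?_
    rw [sum_mul]
    refine sum_congr rfl fun l _ => ?_
    ring
  have key1 : ∀ i j, coordForm g o y (gammaForm g o y (ê i) (ê j)) u =
      (1 / 2) * (𝐃 (coordForm g o) y (ê i) (ê j) u + 𝐃 (coordForm g o) y (ê j) (ê i) u
      - 𝐃 (coordForm g o) y u (ê i) (ê j)) := fun i j =>
    eq_of_stdVec (L₁ := coordForm g o y (gammaForm g o y (ê i) (ê j)))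
      (L₂ := (1 / 2 : ℝ) • (𝐃 (coordForm g o) y (ê i) (ê j) + 𝐃 (coordForm g o) y (ê j) (ê i)
        - ((𝐃 (coordForm g o) y).flip (ê i)).flip (ê j))) (key i j) u
  have key2 : ∀ i, coordForm g o y (gammaForm g o y (ê i) w) u =
      (1 / 2) * (𝐃 (coordForm g o) y (ê i) w u + 𝐃 (coordForm g o) y w (ê i) u
      - 𝐃 (coordForm g o) y u (ê i) w) := fun i =>
    eq_of_stdVec (L₁ := ((coordForm g o y).flip u).comp (gammaForm g o y (ê i)))
      (L₂ := (1 / 2 : ℝ) • ((𝐃 (coordForm g o) y (ê i)).flip u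
        + ((𝐃 (coordForm g o) y).flip (ê i)).flip u
        - 𝐃 (coordForm g o) y u (ê i))) (key1 i) w
  exact eq_of_stdVec (L₁ := ((coordForm g o y).flip u).comp ((gammaForm g o y).flip w))
      (L₂ := (1 / 2 : ℝ) • (((𝐃 (coordForm g o) y).flip w).flip u + (𝐃 (coordForm g o) y w).flip u
        - (𝐃 (coordForm g o) y u).flip w)) key2 v

/-- The transformation rule of the Christoffel symbols. -/
lemma IsC2Metric.gammaForm_transition (hg : IsC2Metric g) (hy : y ∈ transDomain o x₁) (v w : 𝔼 n) :
    𝐃 (transition o x₁) y (gammaForm g o y v w) = gammaForm g x₁ (transition o x₁ y)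
    (𝐃 (transition o x₁) y v) (𝐃 (transition o x₁) y w) + 𝐃 (𝐃 (transition o x₁)) y v w := by
  have hnhds := (isOpen_transDomain o x₁).mem_nhds hy
  have hτ : ContDiffAt ℝ ∞ (transition o x₁) y := (contDiffOn_transition o x₁).contDiffAt hnhds
  have hz := transition_mem hy
  set τ := transition (n := n) o x₁ with hτdef
  have hdτ : DifferentiableAt ℝ τ y := hτ.differentiableAt (by simp)
  have hdτ' : DifferentiableAt ℝ (𝐃 τ) y :=
    (hτ.fderiv_right (m := 1) (by norm_cast)).differentiableAt (by simp)
  have hG1 : DifferentiableAt ℝ (coordForm g x₁) (τ y) :=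
    ((hg.contDiffOn_coordForm x₁).contDiffAt ((isOpen_domain x₁).mem_nhds
      hz)).differentiableAt (by simp)
  have hG0 : DifferentiableAt ℝ (coordForm g o) y :=
    ((hg.contDiffOn_coordForm o).contDiffAt ((isOpen_domain o).mem_nhds
      hy.1)).differentiableAt (by simp)
  set a := 𝐃 τ y with ha
  set b := 𝐃 (𝐃 τ) y with hb
  have hbs : ∀ x w, b x w = b w x := fun x w => (hτ.isSymmSndFDerivAt (by simp; norm_cast)) x w
  have hD : ∀ x v w, 𝐃 (coordForm g o) y x v w =
      𝐃 (coordForm g x₁) (τ y) (a x) (a v) (a w) + coordForm g x₁ (τ y) (b x v) (a w)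
        + coordForm g x₁ (τ y) (a v) (b x w) := by
    refine fderiv_of_eventually_eq_pullback hG0 hG1 hdτ hdτ' ?_
    filter_upwards [hnhds] with z hz v w
    rw [coordForm_eq_bilinearComp g hz]; rfl
  obtain ⟨e, he⟩ := isInvertible_fderiv_transition hy
  -- The difference of the two sides has the form `a u`, because `a` is invertible. The Koszul
  -- formulas in the two charts show that its pairing with `a u` vanishes, which contradicts
  -- positivity unless the difference is zero.
  refine sub_eq_zero.1 ?_
  by_contra hne
  refine (hg.coordForm_pos hz hne).ne' ?_
  obtain ⟨u, hu⟩ : ∃ u, a u = a (gammaForm g o y v w) - (gammaForm g x₁ (τ y) (a v) (a w) + b v w)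
      := ⟨e.symm _, by rw [ha, hτdef, ← he]; exact e.apply_symm_apply _⟩
  rw [← hu]
  conv_lhs => enter [1]; rw [hu]
  have k0 := hg.koszul hy.1 v w u
  have k1 := hg.koszul hz (a v) (a w) (a u)
  have hG : coordForm g o y (gammaForm g o y v w) u =
      coordForm g x₁ (τ y) (a (gammaForm g o y v w)) (a u) := by
    rw [coordForm_eq_bilinearComp g hy]; rfl
  rw [hG, hD, hD, hD] at k0
  have s := fun v w => hg.coordForm_symm hz v w
  rw [map_sub, map_add, sub_apply, add_apply, k0, k1, s (a w) (b v u), s (a v) (b w u),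
    s (a v) (b u w), hbs w v, hbs u v, hbs u w]
  ring

/-- A `C²` metric has `C¹` Christoffel symbols, so their transformation rule can be differentiated
once. The second and third derivatives of the change of coordinates that appear are symmetric, as
`curvEnd_transform` requires. -/
lemma IsC2Metric.curvEnd_transition (hg : IsC2Metric g) (hy : y ∈ transDomain o x₁) (w u x : 𝔼 n) :
    𝐃 (transition o x₁) y (curvEnd (gammaForm g o y) (𝐃 (gammaForm g o) y) w u x) =
    curvEnd (gammaForm g x₁ (transition o x₁ y)) (𝐃 (gammaForm g x₁) (transition o x₁ y))
    (𝐃 (transition o x₁) y w) (𝐃 (transition o x₁) y u) (𝐃 (transition o x₁) y x) := by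
  have hnhds := (isOpen_transDomain o x₁).mem_nhds hy
  have hτ : ContDiffAt ℝ ∞ (transition o x₁) y := (contDiffOn_transition o x₁).contDiffAt hnhds
  have hz := transition_mem hy
  have hdτ : DifferentiableAt ℝ (transition o x₁) y := hτ.differentiableAt (by simp)
  have hτ1 : ContDiffAt ℝ 2 (𝐃 (transition o x₁)) y := hτ.fderiv_right (m := 2) (by norm_cast)
  have hdτ' : DifferentiableAt ℝ (𝐃 (transition o x₁)) y := hτ1.differentiableAt (by simp)
  have hdτ'' : DifferentiableAt ℝ (𝐃 (𝐃 (transition o x₁))) y :=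
    (hτ1.fderiv_right (m := 1) (by norm_num)).differentiableAt (by simp)
  have hG1 : DifferentiableAt ℝ (gammaForm g x₁) (transition o x₁ y) :=
    ((hg.contDiffOn_gammaForm x₁).contDiffAt ((isOpen_domain x₁).mem_nhds
      hz)).differentiableAt (by simp)
  have hG0 : DifferentiableAt ℝ (gammaForm g o) y :=
    ((hg.contDiffOn_gammaForm o).contDiffAt ((isOpen_domain o).mem_nhds
      hy.1)).differentiableAt (by simp)
  refine curvEnd_transform (b := 𝐃 (𝐃 (transition o x₁)) y)
    (c := 𝐃 (𝐃 (𝐃 (transition o x₁))) y)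
    (fun x w => (hτ.isSymmSndFDerivAt (by simp; norm_cast)) x w)
    (fun x w u => congrArg (fun L => L u) ((hτ1.isSymmSndFDerivAt (by simp)) x w))
    (fun w u => hg.gammaForm_transition hy w u)
    (fderiv_of_eventually_eq_connection hG0 hG1 hdτ hdτ' hdτ'' ?_) w u x
  filter_upwards [hnhds] with z hz
  exact hg.gammaForm_transition hz

/-! ### The scalar curvature of a metric of class `C²` -/

lemma IsC2Metric.bilinCoord_symm (hg : IsC2Metric g) (hy : y ∈ coordDomain o) (i j : Fin n) :
    bilinCoord g o i j y = bilinCoord g o j i y := hg.symm _ (symm_mem_interior hy) _ _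

lemma IsC2Metric.fderiv_bilinCoord_symm (hg : IsC2Metric g) (hy : y ∈ coordDomain o) (i j : Fin n) :
    𝐃 (bilinCoord g o i j) y = 𝐃 (bilinCoord g o j i) y := by
  refine Filter.EventuallyEq.fderiv_eq ?_
  filter_upwards [(isOpen_domain o).mem_nhds hy] with z hz
  exact hg.bilinCoord_symm hz i j

lemma IsC2Metric.chris_symm (hg : IsC2Metric g) (hy : y ∈ coordDomain o) (k i j : Fin n) :
    chris g o k i j y = chris g o k j i y := by
  rw [chris, chris]
  congr 1
  refine sum_congr rfl fun l _ => ?_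
  rw [hg.fderiv_bilinCoord_symm hy i j]
  ring

lemma IsC2Metric.fderiv_chris_symm (hg : IsC2Metric g) (hy : y ∈ coordDomain o) (k i j : Fin n) :
    𝐃 (chris g o k i j) y = 𝐃 (chris g o k j i) y := by
  refine Filter.EventuallyEq.fderiv_eq ?_
  filter_upwards [(isOpen_domain o).mem_nhds hy] with z hz
  exact hg.chris_symm hz k i j

lemma IsC2Metric.fderiv_gammaForm (hg : IsC2Metric g) (hy : y ∈ coordDomain o) (k i j : Fin n)
    (x : 𝔼 n) : 𝐃 (gammaForm g o) y x (ê i) (ê j) k = 𝐃 (chris g o k i j) y x := by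
  have hd : DifferentiableAt ℝ (gammaForm g o) y :=
    ((hg.contDiffOn_gammaForm o).contDiffAt ((isOpen_domain o).mem_nhds
      hy)).differentiableAt (by simp)
  have h1 := hasFDerivAt_bilin_apply hd (ê i) (ê j)
  have h2 := ((EuclideanSpace.proj k : 𝔼 n →L[ℝ] ℝ).hasFDerivAt.comp y h1).fderiv
  have h3 : chris g o k i j = (EuclideanSpace.proj k : 𝔼 n →L[ℝ] ℝ) ∘
      fun y => gammaForm g o y (ê i) (ê j) := funext fun z => (gammaForm_stdVec g o z i j k).symm
  rw [h3, h2]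
  rfl

lemma gammaForm_gammaForm (g : BilinField n M) (o : M) (y : 𝔼 n) (a b c k : Fin n) : gammaForm g o y
    (ê a) (gammaForm g o y (ê b) (ê c)) k = ∑ l, chris g o k a l y * chris g o l b c y := by
  rw [eq_sum_stdVec (gammaForm g o y (ê b) (ê c))]
  simp only [gammaForm_stdVec, map_sum, map_smul]
  rw [WithLp.ofLp_sum, Finset.sum_apply]
  refine sum_congr rfl fun l _ => ?_
  rw [PiLp.smul_apply, gammaForm_stdVec, smul_eq_mul, mul_comm]

lemma IsC2Metric.ric_eq (hg : IsC2Metric g) (hy : y ∈ coordDomain o) (i j : Fin n) :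
    ric g o i j y = curvTrace (gammaForm g o y) (𝐃 (gammaForm g o) y) (ê i) (ê j) := by
  rw [ric, curvTrace, ← sum_add_distrib]
  refine sum_congr rfl fun k _ => ?_
  rw [curvEnd_apply]
  simp only [PiLp.sub_apply, PiLp.add_apply]
  rw [hg.fderiv_gammaForm hy, hg.fderiv_gammaForm hy, gammaForm_gammaForm, gammaForm_gammaForm,
    hg.fderiv_chris_symm hy k j i, hg.fderiv_chris_symm hy k k i, sum_sub_distrib]
  simp only [hg.chris_symm hy _ j i, hg.chris_symm hy _ k i]
  ring

/-- The Ricci tensor in the chart around `x`, as a bilinear form. -/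
def ricForm (g : BilinField n M) (x : M) (y : 𝔼 n) : 𝔹 n :=
  ∑ i, ∑ j, curvTrace (gammaForm g x y) (𝐃 (gammaForm g x) y) (ê i) (ê j)
      • dualForm i j

lemma ricForm_apply (g : BilinField n M) (x : M) (y u v : 𝔼 n) :
    ricForm g x y u v = curvTrace (gammaForm g x y) (𝐃 (gammaForm g x) y) u v :=
  (curvTrace_eq_sum _ _ _ _).symm

lemma IsC2Metric.scalChart_eq (hg : IsC2Metric g) (hy : y ∈ coordDomain o) :
    scalChart g o y = bilinTrace (coordForm g o y) (ricForm g o y) := by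
  rw [scalChart, bilinTrace]
  refine sum_congr rfl fun i _ => sum_congr rfl fun j _ => ?_
  rw [ricForm_apply, hg.ric_eq hy, metricMatrix_eq]

lemma IsC2Metric.ricForm_transition (hg : IsC2Metric g) (hy : y ∈ transDomain o x₁) (u v : 𝔼 n) :
    ricForm g o y u v = ricForm g x₁ (transition o x₁ y) (𝐃 (transition o x₁) y u)
    (𝐃 (transition o x₁) y v) := by
  rw [ricForm_apply, ricForm_apply, curvTrace, curvTrace]
  exact sum_apply_stdVec_conj (isInvertible_fderiv_transition hy)
    fun x => hg.curvEnd_transition hy _ _ x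

/-- The scalar curvature does not depend on the chart. -/
lemma IsC2Metric.scalChart_transition (hg : IsC2Metric g) (hy : y ∈ transDomain o x₁) :
    scalChart g o y = scalChart g x₁ (transition o x₁ y) := by
  rw [hg.scalChart_eq hy.1, hg.scalChart_eq (transition_mem hy),
    ← bilinTrace_bilinearComp (coordForm g x₁ (transition o x₁ y))
      (ricForm g x₁ (transition o x₁ y)) (isInvertible_fderiv_transition hy),
    ← coordForm_eq_bilinearComp g hy]
  refine sum_congr rfl fun i _ => sum_congr rfl fun j _ => ?_
  rw [hg.ricForm_transition hy, ContinuousLinearMap.bilinearComp_apply]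

lemma IsC2Metric.weakPartial_bilinCoord (hg : IsC2Metric g) (o : M) (k i j : Fin n) :
    HasWeakPartial (coordDomain o) k (bilinCoord g o i j) (fun y => 𝐃 (bilinCoord g o i j) y (ê k))
    :=
  hasWeakPartial_of_contDiffOn (isOpen_domain o) ((hg.contDiffOn o i j).of_le (by norm_num))

/-- Weak derivatives of the coefficients are classical ones up to a null set, so the computations
can be made with genuine functions. -/
lemma IsC2Metric.christoffel_ae_eq (hg : IsC2Metric g) (o : M) :
    ∀ᵐ y ∂𝔳 n o, ∀ k i j, christoffel g o k i j y = chris g o k i j y := by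
  have h : ∀ᵐ y ∂𝔳 n o, ∀ k i j, weakPartial (coordDomain o) k (bilinCoord g o i j) y =
        𝐃 (bilinCoord g o i j) y (ê k) := by
    simp only [ae_all_iff]
    exact fun k i j => (hg.weakPartial_bilinCoord o k i j).weakPartial_ae_eq
      (isOpen_domain o)
  filter_upwards [h] with y hy k i j
  simp only [christoffel, chris, hy]

lemma IsC2Metric.weakPartial_christoffel (hg : IsC2Metric g) (o : M) (k i j l : Fin n) :
    HasWeakPartial (coordDomain o) l (christoffel g o k i j) (fun y => 𝐃 (chris g o k i j) y (ê l))
    := by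
  refine (hasWeakPartial_of_contDiffOn (isOpen_domain o)
    (hg.contDiffOn_chris o k i j)).congr (isOpen_domain o).measurableSet ?_
    (.of_forall fun y => rfl)
  filter_upwards [hg.christoffel_ae_eq o] with y hy
  exact (hy k i j).symm

lemma IsC2Metric.ricciCoord_ae_eq (hg : IsC2Metric g) (o : M) :
    ∀ᵐ y ∂𝔳 n o, ∀ i j, ricciCoord g o i j y = ric g o i j y := by
  have h : ∀ᵐ y ∂𝔳 n o, ∀ k i j l, weakPartial (coordDomain o) l (christoffel g o k i j) y =
        𝐃 (chris g o k i j) y (ê l) := by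
    simp only [ae_all_iff]
    exact fun k i j l => (hg.weakPartial_christoffel o k i j l).weakPartial_ae_eq
      (isOpen_domain o)
  filter_upwards [h, hg.christoffel_ae_eq o] with y hy hy' i j
  simp only [ricciCoord, ric, hy, hy']

/-- At each point the chart centred at that point is used; invariance under changes of coordinates
makes the resulting function satisfy the formula in every other chart. -/
lemma IsC2Metric.isScalarCurvature (hg : IsC2Metric g) :
    IsScalarCurvature g fun x => scalChart g x (𝔠 n x x) := by
  refine fun o => ⟨fun i j k => ⟨_, hg.weakPartial_bilinCoord o k i j⟩,
    fun k i j l => ⟨_, hg.weakPartial_christoffel o k i j l⟩, ?_⟩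
  filter_upwards [hg.ricciCoord_ae_eq o, ae_mem_domain o] with y hy hyD
  have hx : y ∈ transDomain o ((𝔠 n o).symm y) := by
    refine ⟨hyD, ?_⟩
    rw [mem_preimage, coordImage_eq_inter_interior]
    exact ⟨mem_extChartAt_source _, symm_mem_interior hyD⟩
  simp only [hy]
  exact (hg.scalChart_transition hx).symm

lemma IsScalarCurvature.ae_eq {S₁ S₂ : M → ℝ} (h1 : IsScalarCurvature g S₁)
    (h2 : IsScalarCurvature g S₂) (o : M) :
    ∀ᵐ y ∂𝔳 n o, S₁ ((𝔠 n o).symm y) = S₂ ((𝔠 n o).symm y) := by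
  filter_upwards [(h1 o).2.2, (h2 o).2.2] with y hy1 hy2
  rw [hy1, hy2]

lemma IsScalarCurvature.scal {S : M → ℝ} (h : IsScalarCurvature g S) :
    IsScalarCurvature g (scal g) := by
  have hex : HasScalarCurvature g := ⟨S, h⟩
  rw [LocalYamabe.scal, dif_pos hex]
  exact hex.choose_spec

lemma IsC2Metric.scal_ae_eq (hg : IsC2Metric g) (o : M) :
    ∀ᵐ y ∂𝔳 n o, scal g ((𝔠 n o).symm y) = scalChart g o y := by
  filter_upwards [(hg.isScalarCurvature.scal o).2.2, hg.ricciCoord_ae_eq o] with y h1 h2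
  simp only [h1, h2]
  rfl

/-- The inverse metric has weight `ρ²`, while `∂Γ` and `Γ Γ` have weight `ρ⁻²`: the powers of `ρ`
cancel. -/
lemma IsPatch.abs_scalChart_le (hP : IsPatch ρ g r o R C ε) (hy : y ∈ halfBall o (3 * R)) :
    |scalChart g o y| ≤ (n : ℝ) ^ 2 * (C * (n * (2 * C) + n ^ 2 * (2 * (C * C)))) := by
  have hp := hP.rho_pos y hy
  have hC : 0 ≤ C := zero_le_one.trans hP.one_le_C
  set q := (funCoord ρ o y ^ 2)⁻¹ with hq
  have hq0 : 0 < q := by positivity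
  have hΓΓ : ∀ a b c d e f, |chris g o a b c y * chris g o d e f y| ≤ C * C * q := by
    intro a b c d e f
    rw [abs_mul]
    calc _ ≤ (C * (funCoord ρ o y)⁻¹) * (C * (funCoord ρ o y)⁻¹) :=
          mul_le_mul (hP.chris_le y hy _ _ _) (hP.chris_le y hy _ _ _) (abs_nonneg _)
            (by positivity)
      _ = C * C * q := by rw [hq, pow_two, mul_inv]; ring
  have hric : ∀ i j, |ric g o i j y| ≤ (n * (2 * C) + n ^ 2 * (2 * (C * C))) * q := by
    intro i j
    rw [ric]
    refine (abs_add_le _ _).trans ?_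
    have h1 : |∑ k, (𝐃 (chris g o k i j) y (ê k)
        - 𝐃 (chris g o k i k) y (ê j))| ≤ ∑ _k : Fin n, 2 * C * q := by
      refine (Finset.abs_sum_le_sum_abs _ _).trans (sum_le_sum fun k _ => ?_)
      refine (abs_sub _ _).trans ?_
      have e1 := hP.dchris_le y hy k i j k
      have e2 := hP.dchris_le y hy k i k j
      linarith only [e1, e2]
    have h2 : |∑ k, ∑ l, (chris g o k k l y * chris g o l i j y
        - chris g o k j l y * chris g o l i k y)| ≤
        ∑ _k : Fin n, ∑ _l : Fin n, 2 * (C * C) * q := by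
      refine (Finset.abs_sum_le_sum_abs _ _).trans (sum_le_sum fun k _ => ?_)
      refine (Finset.abs_sum_le_sum_abs _ _).trans (sum_le_sum fun l _ => ?_)
      refine (abs_sub _ _).trans ?_
      have e1 := hΓΓ k k l l i j
      have e2 := hΓΓ k j l l i k
      linarith only [e1, e2]
    simp only [Finset.sum_const, Finset.card_univ, Fintype.card_fin, nsmul_eq_mul] at h1 h2
    linarith only [h1, h2]
  rw [scalChart]
  calc _ ≤ ∑ _i : Fin n, ∑ _j : Fin n, C * (n * (2 * C) + n ^ 2 * (2 * (C * C))) := by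
        refine (Finset.abs_sum_le_sum_abs _ _).trans (sum_le_sum fun i _ => ?_)
        refine (Finset.abs_sum_le_sum_abs _ _).trans (sum_le_sum fun j _ => ?_)
        rw [abs_mul]
        calc _ ≤ (C * funCoord ρ o y ^ 2) * ((n * (2 * C) + n ^ 2 * (2 * (C * C))) * q) :=
              mul_le_mul (hP.inv_le y hy i j) (hric i j) (abs_nonneg _) (by positivity)
          _ = _ := by rw [hq]; field_simp
    _ = _ := by simp only [Finset.sum_const, Finset.card_univ, Fintype.card_fin, nsmul_eq_mul]; ring

/-! ### Volume densities, finite covers and rescaled charts -/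

lemma IsC2Metric.det_pos (hg : IsC2Metric g) (hy : y ∈ coordDomain o) :
    0 < (metricMatrix g o y).det := (hg.posDef_metricMatrix hy).det_pos

lemma IsC2Metric.volDensity_pos (hg : IsC2Metric g) (hy : y ∈ coordDomain o) :
    0 < volDensity g o y := Real.sqrt_pos.2 (hg.det_pos hy)

lemma IsC2Metric.contDiffOn_volDensity (hg : IsC2Metric g) (o : M) :
    ContDiffOn ℝ 2 (volDensity g o) (coordDomain o) :=
  ContDiffOn.sqrt (contDiffOn_matrix_det fun i j => hg.contDiffOn o i j)
    fun _ hy => (hg.det_pos hy).ne'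

lemma IsC2Metric.aemeasurable_volDensity (hg : IsC2Metric g) (o : M) :
    AEMeasurable (volDensity g o) (𝔳 n o) :=
  (hg.contDiffOn_volDensity o).continuousOn.aemeasurable (isOpen_domain o).measurableSet

/-- The images of half balls of positive radii, one in each chart, contain a finite cover of the
interior. -/
lemma exists_finset_halfBall_cover [CompactSpace M] {R : M → ℝ} (hR : ∀ x, 0 < R x) : ∃ t :
    Finset M, (𝓡∂ n).interior M ⊆ ⋃ x ∈ t, (𝔠 n x).symm '' ℍ n x (R x) := by
  obtain ⟨t, -, ht⟩ := isCompact_univ.elim_nhds_subcover (fun x : M =>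
    (𝔠 n x).source ∩ 𝔠 n x ⁻¹' ball (𝔠 n x x) (R x))
    (fun x _ => Filter.inter_mem (extChartAt_source_mem_nhds x)
      ((continuousAt_extChartAt x).preimage_mem_nhds (Metric.ball_mem_nhds _ (hR x))))
  refine ⟨t, fun x hx => ?_⟩
  obtain ⟨o, hx₀, hxs, hxb⟩ := mem_iUnion₂.1 (ht (mem_univ x))
  refine mem_iUnion₂.2 ⟨o, hx₀, 𝔠 n o x, ⟨hxb, ?_⟩, (𝔠 n o).left_inv hxs⟩
  have := mem_coordDomain hxs hx
  rw [coordDomain_eq] at this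
  exact this.2

/-- The chart around `o`, read at the scale `ε ρ` around the point of coordinates `y`. -/
def zoom (ρ : M → ℝ) (ε : ℝ) (o : M) (y z : 𝔼 n) : M :=
  (𝔠 n o).symm (dilate y (ε * funCoord ρ o y) z)

lemma IsPatch.scale_pos (hP : IsPatch ρ g r o R C ε) (hy : y ∈ halfBall o (2 * R)) :
    0 < ε * funCoord ρ o y :=
  mul_pos hP.ε_pos (hP.rho_pos y (halfBall_mono o (by linarith [hP.R_pos]) hy))

lemma IsPatch.dilate_mem (hP : IsPatch ρ g r o R C ε) {y z : 𝔼 n} (hy : y ∈ halfBall o (2 * R))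
    (hz : z ∈ ball 0 1) : dilate y (ε * funCoord ρ o y) z ∈ ball y (ε * funCoord ρ o y) := by
  have := (dilate_mem_ball y (hP.scale_pos hy) 1 z).2 hz
  rwa [mul_one] at this

/-! ### Norms of tensor fields in coordinates -/

lemma covectorNormSq_coord (g : BilinField n M) (α : CovectorField n M) (hy : y ∈ coordDomain o) :
    covectorNormSq (g ((𝔠 n o).symm y)) (α ((𝔠 n o).symm y)) = ∑ i, ∑ j, 𝔾 g o y i j *
    covectorCoord α o i y * covectorCoord α o j y := covectorInner_coord g α α hy

lemma tensorNormSq_coord (g T : BilinField n M) (hy : y ∈ coordDomain o) :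
    tensorNormSq (g ((𝔠 n o).symm y)) (T ((𝔠 n o).symm y)) = ∑ i, ∑ j, ∑ k, ∑ l, 𝔾 g o y i k *
    𝔾 g o y j l * bilinCoord T o i j y * bilinCoord T o k l y :=
  (tensorNormSq_bilinearComp _ _ (isInvertible_coordLin hy)).symm

lemma covectorNorm_nonneg (g : BilinField n M) (α : CovectorField n M) (x : M) :
    0 ≤ covectorNorm g α x := Real.sqrt_nonneg _

lemma tensorNorm_nonneg (g T : BilinField n M) (x : M) : 0 ≤ tensorNorm g T x := Real.sqrt_nonneg _

lemma IsC2Metric.sq_covectorNorm (hg : IsC2Metric g) (α : CovectorField n M)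
    (hx : x ∈ (𝓡∂ n).interior M) : covectorNorm g α x ^ 2 = covectorNormSq (g x) (α x) :=
  Real.sq_sqrt (covectorNormSq_nonneg (B := g x) (hg.symm x hx) (hg.pos x hx) (α x))

lemma IsC2Metric.abs_covectorCoord_le (hg : IsC2Metric g) (α : CovectorField n M)
    (hy : y ∈ coordDomain o) (i : Fin n) :
    |covectorCoord α o i y| ≤ covectorNorm g α ((𝔠 n o).symm y) * √(bilinCoord g o i i y) := by
  have hx := symm_mem_interior hy
  exact abs_apply_le (B := g ((𝔠 n o).symm y)) (hg.symm _ hx) (hg.pos _ hx) _ _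

lemma IsC2Metric.abs_bilinCoord_le (hg : IsC2Metric g) (T : BilinField n M) (hy : y ∈ coordDomain o)
    (i j : Fin n) : |bilinCoord T o i j y| ≤ tensorNorm g T ((𝔠 n o).symm y) *
    √(bilinCoord g o i i y * bilinCoord g o j j y) := by
  have hx := symm_mem_interior hy
  exact abs_apply_apply_le (B := g ((𝔠 n o).symm y)) (hg.symm _ hx)
    (hg.pos _ hx) _ _ _

lemma IsPatch.covectorCoord_le (hP : IsPatch ρ g r o R C ε) (hg : IsC2Metric g)
    (α : CovectorField n M) (hy : y ∈ halfBall o (3 * R)) (i : Fin n) :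
    |covectorCoord α o i y| ≤ C * (funCoord ρ o y)⁻¹ * covectorNorm g α ((𝔠 n o).symm y) := by
  have hp := hP.rho_pos y hy
  have hC := hP.one_le_C
  have h1 : √(bilinCoord g o i i y) ≤ C * (funCoord ρ o y)⁻¹ := by
    refine (Real.sqrt_le_sqrt ((le_abs_self _).trans (hP.metric_le y hy i i))).trans ?_
    refine Real.sqrt_le_iff.2 ⟨by positivity, ?_⟩
    rw [mul_pow, inv_pow]
    gcongr
    nlinarith
  calc _ ≤ _ := hg.abs_covectorCoord_le α (hP.dom hy) i
    _ ≤ _ := by rw [mul_comm]; exact mul_le_mul_of_nonneg_right h1 (covectorNorm_nonneg _ _ _)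

lemma IsPatch.bilinCoord_le (hP : IsPatch ρ g r o R C ε) (hg : IsC2Metric g) (T : BilinField n M)
    (hy : y ∈ halfBall o (3 * R)) (i j : Fin n) :
    |bilinCoord T o i j y| ≤ C * (funCoord ρ o y ^ 2)⁻¹ * tensorNorm g T ((𝔠 n o).symm y) := by
  have hp := hP.rho_pos y hy
  have hC := hP.one_le_C
  have h0 : 0 < bilinCoord g o j j y := (hg.posDef_metricMatrix (hP.dom hy)).diag_pos
  have h1 : √(bilinCoord g o i i y * bilinCoord g o j j y) ≤ C * (funCoord ρ o y ^ 2)⁻¹ := by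
    refine Real.sqrt_le_iff.2 ⟨by positivity, ?_⟩
    rw [pow_two (C * _)]
    exact mul_le_mul ((le_abs_self _).trans (hP.metric_le y hy i i))
      ((le_abs_self _).trans (hP.metric_le y hy j j)) h0.le (by positivity)
  calc _ ≤ _ := hg.abs_bilinCoord_le T (hP.dom hy) i j
    _ ≤ _ := by rw [mul_comm]; exact mul_le_mul_of_nonneg_right h1 (tensorNorm_nonneg _ _ _)

lemma IsPatch.covectorNorm_le (hP : IsPatch ρ g r o R C ε) (α : CovectorField n M)
    (hy : y ∈ halfBall o (3 * R)) :
    covectorNorm g α ((𝔠 n o).symm y) ≤ C * funCoord ρ o y * ∑ i, |covectorCoord α o i y| := by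
  have hp := hP.rho_pos y hy
  have hC := hP.one_le_C
  have hs : 0 ≤ ∑ i, |covectorCoord α o i y| := Finset.sum_nonneg fun i _ => abs_nonneg _
  rw [covectorNorm, covectorNormSq_coord g α (hP.dom hy)]
  refine Real.sqrt_le_iff.2 ⟨by positivity, ?_⟩
  calc _ ≤ ∑ i, ∑ j, C * funCoord ρ o y ^ 2 *
        (|covectorCoord α o i y| * |covectorCoord α o j y|) := by
        refine sum_le_sum fun i _ => sum_le_sum fun j _ => ?_
        refine (le_abs_self _).trans ?_
        rw [abs_mul, abs_mul, mul_assoc]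
        exact mul_le_mul_of_nonneg_right (hP.inv_le y hy i j) (by positivity)
    _ = C * funCoord ρ o y ^ 2 * (∑ i, |covectorCoord α o i y|) ^ 2 := by
        rw [pow_two (∑ i, _), Finset.sum_mul_sum, mul_sum]
        exact sum_congr rfl fun i _ => (mul_sum _ _ _).symm
    _ ≤ _ := by
        rw [mul_pow, mul_pow]
        gcongr
        nlinarith

lemma IsC2Metric.aestronglyMeasurable_inv (hg : IsC2Metric g) (o : M) (i j : Fin n) :
    AEStronglyMeasurable (fun y => 𝔾 g o y i j) (𝔳 n o) :=
  ((hg.contDiffOn_inv o i j).continuousOn).aestronglyMeasurable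
    (isOpen_domain o).measurableSet

/-- Measurability of a field of covectors, in coordinates. -/
def IsMeasurableCovector (α : CovectorField n M) : Prop :=
  ∀ (o : M) (i : Fin n), AEStronglyMeasurable (covectorCoord α o i)
    (𝔳 n o)

/-- Measurability of a field of bilinear forms, in coordinates. -/
def IsMeasurableBilin (T : BilinField n M) : Prop :=
  ∀ (o : M) (i j : Fin n), AEStronglyMeasurable (bilinCoord T o i j)
    (𝔳 n o)

lemma IsWeakDifferential.isMeasurable (h : IsWeakDifferential u α) :
    IsMeasurableCovector α := fun o i => (h o i).2.1.aestronglyMeasurable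

/-- A potential which is uniformly in `L^{n/2}` at the scale of the patch is bounded relatively to
the `W^{1,2}` norm. -/
lemma IsPatch.lintegral_mul_sq_lt_top (hn : 3 ≤ n) (hP : IsPatch ρ g r o R C ε)
    (hρ : ContinuousOn (funCoord ρ o) (𝔻 n o)) {F : 𝔼 n → ℝ≥0∞}
    (hF : AEMeasurable F (volume.restrict (ℍ n o (3 * R)))) {A : ℝ≥0∞} (hA : A ≠ ⊤) (hFA : ∀ y ∈
    ℍ n o (2 * R), ∫⁻ z in ball 0 (1 / 2), F (dilate y (ε * funCoord ρ o y) z) ^ ((n : ℝ) / 2) ≤ A)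
    {u : 𝔼 n → ℝ} {u' : Fin n → 𝔼 n → ℝ} (hu : ∀ i, HasWeakPartial (halfBall o (3 * R)) i u (u' i))
    (hfin : ∫⁻ x in halfBall o (3 * R), ofReal (funCoord ρ o x ^ n)⁻¹ * (‖u x‖ₑ ^ 2 +
    ofReal (funCoord ρ o x ^ 2) * ∑ i, ‖u' i x‖ₑ ^ 2) < ⊤) : ∫⁻ x in halfBall o R,
    ofReal (funCoord ρ o x ^ n)⁻¹ * (F x * ‖u x‖ₑ ^ 2) < ⊤ := by
  have hR := hP.R_pos
  have hε := hP.ε_pos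
  have h12 : ℍ n o R ⊆ halfBall o (2 * R) := halfBall_mono o (by linarith)
  have h23 : ℍ n o (2 * R) ⊆ halfBall o (3 * R) := halfBall_mono o (by linarith)
  have hm : ∀ t, MeasurableSet (ℍ n o t) := fun t => (isOpen_halfBall o t).measurableSet
  -- The averaging lemma asks for a radius function measurable on all of `ℝⁿ`, whereas `ρ` is
  -- controlled only in the chart.
  obtain ⟨w, hw⟩ : ∃ w, w = (halfBall o (3 * R)).indicator (funCoord (n := n) ρ o) := ⟨_, rfl⟩
  have hwm : Measurable w := by
    classical
    rw [hw, ← piecewise_eq_indicator]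
    exact (hρ.mono hP.dom).measurable_piecewise continuousOn_const (hm (3 * R))
  have hw3 : ∀ y ∈ halfBall o (3 * R), w y = funCoord ρ o y := fun y hy => by
    rw [hw, indicator_of_mem hy]
  have hw2 : ∀ y ∈ halfBall o (2 * R), w y = funCoord ρ o y := fun y hy => hw3 y (h23 hy)
  obtain ⟨K, hK, HK⟩ := exists_lintegral_const_of_variable_balls (hm R) (hm (2 * R)) (hm (3 * R))
    h12 h23 hε hwm (fun y hy => by rw [hw3 y hy]; exact hP.rho_pos y hy)
    (fun y hy => by rw [hw2 y (h12 hy)]; exact hP.ball_subset' y hy)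
    (fun y hy => by rw [hw2 y hy]; exact hP.ball_subset y hy)
    (fun y hy z hz => by
      rw [hw2 y hy] at hz ⊢
      rw [hw3 z (hP.ball_subset y hy hz)]
      exact hP.compar y hy z hz)
  obtain ⟨C₀, hC₀, H⟩ := exists_interior_mul_sq_const hn
  have hum : AEMeasurable u (volume.restrict (halfBall o (3 * R))) :=
    (hu 0).1.aestronglyMeasurable.aemeasurable
  have hu'm : ∀ i, AEMeasurable (u' i) (volume.restrict (halfBall o (3 * R))) := fun i =>
    (hu i).2.1.aestronglyMeasurable.aemeasurable
  have ha : AEMeasurable (fun x => F x * ‖u x‖ₑ ^ 2) (volume.restrict (halfBall o (3 * R))) :=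
    hF.mul (hum.enorm.pow_const 2)
  have hb : AEMeasurable (fun x => ‖u x‖ₑ ^ 2 + ofReal (w x ^ 2) * ∑ i, ‖u' i x‖ₑ ^ 2)
      (volume.restrict (halfBall o (3 * R))) :=
    (hum.enorm.pow_const 2).add ((hwm.pow_const 2).ennreal_ofReal.aemeasurable.mul
      (Finset.aemeasurable_fun_sum _ fun i _ => (hu'm i).enorm.pow_const 2))
  -- The term `4 ε²` comes from `s = ε ρ(y) ≤ 2 ε ρ(x)` on the ball, which trades the factor `s²` of
  -- the rescaled gradient for `ρ(x)²`.
  obtain ⟨c, hc⟩ : ∃ c, c = C₀ * A ^ (2 / (n : ℝ)) * (1 + ofReal (4 * ε ^ 2)) := ⟨_, rfl⟩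
  have hct : c ≠ ⊤ := by
    rw [hc]
    refine ENNReal.mul_ne_top (ENNReal.mul_ne_top hC₀ (ENNReal.rpow_ne_top_of_nonneg
      (by positivity) hA)) (by finiteness)
  have main := HK (ha.mk _) (hb.mk _) ha.measurable_mk hb.measurable_mk c hct ?_
  · have e1 : ∫⁻ x in halfBall o R, ofReal (funCoord ρ o x ^ n)⁻¹ * (F x * ‖u x‖ₑ ^ 2) =
        ∫⁻ x in halfBall o R, ofReal (w x ^ n)⁻¹ * ha.mk _ x := by
      refine lintegral_congr_ae ?_
      filter_upwards [ae_restrict_mem (hm R), ae_mono (Measure.restrict_mono (h12.trans h23) le_rfl)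
        ha.ae_eq_mk] with x hx hx2
      rw [hw2 x (h12 hx), ← hx2]
    have e2 : ∫⁻ x in halfBall o (3 * R), ofReal (funCoord ρ o x ^ n)⁻¹ *
        (‖u x‖ₑ ^ 2 + ofReal (funCoord ρ o x ^ 2) * ∑ i, ‖u' i x‖ₑ ^ 2) =
        ∫⁻ x in halfBall o (3 * R), ofReal (w x ^ n)⁻¹ * hb.mk _ x := by
      refine lintegral_congr_ae ?_
      filter_upwards [ae_restrict_mem (hm (3 * R)), hb.ae_eq_mk] with x hx hx2
      rw [← hx2, hw3 x hx]
    rw [e1]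
    rw [e2] at hfin
    exact main.trans_lt (ENNReal.mul_lt_top (ENNReal.mul_lt_top hK.lt_top hct.lt_top) hfin)
  · intro y hy
    obtain ⟨s, hs⟩ : ∃ s, s = ε * funCoord ρ o y := ⟨_, rfl⟩
    have hs0 : 0 < s := hs ▸ hP.scale_pos hy
    have hB : ball y s ⊆ halfBall o (3 * R) := hs ▸ hP.ball_subset y hy
    have hB2 : ball y (s * (1 / 2)) ⊆ halfBall o (3 * R) :=
      (Metric.ball_subset_ball (by linarith)).trans hB
    have hball : ball 0 1 ⊆ dilate y s ⁻¹' halfBall o (3 * R) := fun z hz =>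
      hB (by simpa using (dilate_mem_ball y hs0 1 z).2 hz)
    have hFd : AEMeasurable (fun z => F (dilate y s z)) (volume.restrict (ball 0 (1 / 2))) := by
      have h1 : AEMeasurable F (Measure.map (dilate y s) (volume.restrict (ball 0 (1 / 2)))) := by
        rw [map_dilate_restrict y hs0]
        exact (hF.mono_measure (Measure.restrict_mono hB2 le_rfl)).smul_measure _
      exact h1.comp_measurable (continuous_dilate y s).measurable
    -- The estimate on the unit ball is applied to the dilated functions. When it is scaled back,
    -- both integrals carry the same factor `s ^ (-n)`, which is cancelled below.
    have key := H (fun z => F (dilate y s z)) (fun z => u (dilate y s z))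
      (fun i z => s * u' i (dilate y s z))
      (fun i => ((hu i).comp_dilate (isOpen_halfBall o _) y hs0).mono hball) hFd
    have k1 := setLIntegral_dilate (fun x => F x * ‖u x‖ₑ ^ 2) y hs0 (1 / 2)
    have k2 := setLIntegral_dilate (fun x => ‖u x‖ₑ ^ 2 + ∑ i, ‖s * u' i x‖ₑ ^ 2) y hs0 1
    rw [k1, k2] at key
    have hσ0 : ofReal (s ^ n)⁻¹ ≠ 0 := by rw [ne_eq, ENNReal.ofReal_eq_zero, not_le]; positivity
    have key2 : ∫⁻ x in ball y (s * (1 / 2)), F x * ‖u x‖ₑ ^ 2 ≤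
        C₀ * A ^ (2 / (n : ℝ)) * ∫⁻ x in ball y (s * 1), (‖u x‖ₑ ^ 2 + ∑ i, ‖s * u' i x‖ₑ ^ 2) := by
      have h1 : C₀ * (∫⁻ z in ball 0 (1 / 2), F (dilate y s z) ^ ((n : ℝ) / 2)) ^ (2 / (n : ℝ)) ≤
          C₀ * A ^ (2 / (n : ℝ)) := by
        gcongr
        rw [hs]; exact hFA y hy
      rw [mul_left_comm] at key
      exact (ENNReal.mul_le_mul_iff_right hσ0 ofReal_ne_top).1 (key.trans (by gcongr))
    have l1 : ∫⁻ x in ball y (ε / 2 * w y), ha.mk _ x =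
        ∫⁻ x in ball y (s * (1 / 2)), F x * ‖u x‖ₑ ^ 2 := by
      rw [hw2 y hy, show ε / 2 * funCoord ρ o y = s * (1 / 2) by rw [hs]; ring]
      exact lintegral_congr_ae (ae_mono (Measure.restrict_mono hB2 le_rfl) ha.ae_eq_mk.symm)
    have l2 : ∫⁻ x in ball y (ε * w y), hb.mk _ x = ∫⁻ x in ball y s,
        (‖u x‖ₑ ^ 2 + ofReal (w x ^ 2) * ∑ i, ‖u' i x‖ₑ ^ 2) := by
      rw [hw2 y hy, ← hs]
      exact lintegral_congr_ae (ae_mono (Measure.restrict_mono hB le_rfl) hb.ae_eq_mk.symm)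
    rw [l1, l2, hc, mul_assoc (C₀ * _)]
    refine key2.trans (mul_le_mul_right ?_ _)
    rw [mul_one, ← lintegral_const_mul' _ _ (by finiteness)]
    refine setLIntegral_mono' measurableSet_ball fun x hx => ?_
    rw [add_mul, one_mul, mul_add, add_assoc]
    refine add_le_add le_rfl (le_trans ?_ le_add_self |>.trans le_add_self)
    rw [← mul_assoc, mul_sum]
    refine sum_le_sum fun i _ => ?_
    rw [enorm_mul, mul_pow]
    gcongr
    have h := (hP.compar y hy x (hs ▸ hx)).1
    have hp := hP.rho_pos y (h23 hy)
    rw [hw3 x (hB hx), ← ENNReal.ofReal_mul (by positivity), Real.enorm_eq_ofReal hs0.le,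
      ← ENNReal.ofReal_pow hs0.le]
    refine ENNReal.ofReal_le_ofReal ?_
    calc s ^ 2 ≤ (ε * (2 * funCoord ρ o x)) ^ 2 := by rw [hs]; gcongr
      _ = _ := by ring

lemma lintegral_enorm_sq_lt_top {X : Type*} [MeasurableSpace X] {μ : Measure X} {f : X → ℝ}
    (h : MemLp f 2 μ) : ∫⁻ x, ‖f x‖ₑ ^ 2 ∂μ < ⊤ := by
  have := h.integrable_sq.2
  simpa only [HasFiniteIntegral, enorm_pow] using this

/-- The `L^{n/2}` norms of `F` at the scales of the patches are uniformly bounded. -/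
def IsScaleBounded (ρ : M → ℝ) (g : BilinField n M) (r : ℝ) (F : M → ℝ≥0∞) : Prop :=
  ∀ (o : M) (R C ε : ℝ), IsPatch ρ g r o R C ε → ∃ A : ℝ≥0∞, A ≠ ⊤ ∧ ∀ y ∈ ℍ n o (2 * R),
      ∫⁻ z in ball 0 (1 / 2), F (zoom ρ ε o y z) ^ ((n : ℝ) / 2) ≤ A

lemma IsConfCompact.continuousOn_rho (H : IsConfCompact ρ g gbar) (o : M) :
    ContinuousOn (funCoord ρ o) (𝔻 n o) :=
  (contDiffOn_funCoord H.rho.smooth o).continuousOn.mono (domain_subset_target o)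

lemma mem_halfBall_self (hx : x ∈ (𝓡∂ n).interior M) (hR : 0 < R) : 𝔠 n x x ∈ ℍ n x R := by
  have := mem_coordDomain (mem_extChartAt_source x) hx
  rw [coordDomain_eq] at this
  exact ⟨Metric.mem_ball_self hR, this.2⟩

lemma isOpen_symm_image {D : Set (𝔼 n)} (hD : D ⊆ coordDomain o) (hDo : IsOpen D) :
    IsOpen ((𝔠 n o).symm '' D) := by
  rw [PartialEquiv.symm_image_eq_source_inter_preimage _ (hD.trans (domain_subset_target o))]
  exact (continuousOn_extChartAt o).isOpen_inter_preimage (isOpen_extChartAt_source o) hDo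

lemma IsC2Metric.sum_mul_inv (hg : IsC2Metric g) (hy : y ∈ coordDomain o) (i l : Fin n) :
    ∑ k, bilinCoord g o i k y * 𝔾 g o y k l = if i = l then 1 else 0 := by
  have := congrFun (congrFun (Matrix.mul_nonsing_inv _ (hg.isUnit_det hy)) i) l
  rwa [Matrix.mul_apply, Matrix.one_apply] at this

lemma IsC2Metric.sum_inv_mul (hg : IsC2Metric g) (hy : y ∈ coordDomain o) (i l : Fin n) :
    ∑ k, 𝔾 g o y i k * bilinCoord g o k l y = if i = l then 1 else 0 := by
  have := congrFun (congrFun (Matrix.nonsing_inv_mul _ (hg.isUnit_det hy)) i) l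
  rwa [Matrix.mul_apply, Matrix.one_apply] at this

lemma IsC2Metric.inv_symm (hg : IsC2Metric g) (hy : y ∈ coordDomain o) (i j : Fin n) :
    𝔾 g o y i j = 𝔾 g o y j i := by
  have := (hg.posDef_metricMatrix hy).isHermitian.inv.apply i j
  simpa using this.symm

/-- Compatibility of the connection with the metric: the sum of two Koszul formulas. -/
lemma IsC2Metric.fderiv_bilinCoord_eq (hg : IsC2Metric g) (hy : y ∈ coordDomain o) (m i j : Fin n) :
    𝐃 (bilinCoord g o i j) y (ê m) = ∑ a,
    (chris g o a m i y * bilinCoord g o a j y + chris g o a m j y * bilinCoord g o a i y) := by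
  have h : ∀ p q l, ∑ a, chris g o a p q y * bilinCoord g o a l y =
      (1 / 2) * (𝐃 (bilinCoord g o q l) y (ê p) + 𝐃 (bilinCoord g o p l) y (ê q)
        - 𝐃 (bilinCoord g o p q) y (ê l)) := by
    intro p q l
    have := hg.koszul hy (ê p) (ê q) (ê l)
    rw [eq_sum_stdVec (gammaForm g o y (ê p) (ê q))] at this
    simp only [gammaForm_stdVec, map_sum, map_smul, sum_apply, smul_apply, smul_eq_mul] at this
    simp only [hg.fderiv_bilinCoord hy]
    exact this
  rw [sum_add_distrib, h, h, hg.fderiv_bilinCoord_symm hy j i]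
  ring

lemma IsC2Metric.sum_fderiv_mul_inv (hg : IsC2Metric g) (hy : y ∈ coordDomain o) (m i l : Fin n) :
    ∑ k, (𝐃 (bilinCoord g o i k) y (ê m) * 𝔾 g o y k l + bilinCoord g o i k y *
    𝐃 (fun y => 𝔾 g o y k l) y (ê m)) = 0 := by
  have hnhds := (isOpen_domain o).mem_nhds hy
  have h1 : ∀ k, HasFDerivAt (bilinCoord g o i k) (𝐃 (bilinCoord g o i k) y) y := fun k =>
    (((hg.contDiffOn o i k).contDiffAt hnhds).differentiableAt (by norm_num)).hasFDerivAt
  have h2 : ∀ k, HasFDerivAt (fun y => 𝔾 g o y k l) (𝐃 (fun y => 𝔾 g o y k l) y) y := fun k =>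
    (((hg.contDiffOn_inv o k l).contDiffAt hnhds).differentiableAt (by norm_num)).hasFDerivAt
  have h3 := HasFDerivAt.fun_sum (u := Finset.univ) fun k _ => (h1 k).mul (h2 k)
  have h4 : (fun y => ∑ k, bilinCoord g o i k y * 𝔾 g o y k l) =ᶠ[𝓝 y]
      fun _ => if i = l then 1 else 0 := by
    filter_upwards [hnhds] with z hz using hg.sum_mul_inv hz i l
  have h5 := h3.unique ((hasFDerivAt_const _ y).congr_of_eventuallyEq h4)
  have h6 := congrArg (fun L : 𝔼 n →L[ℝ] ℝ => L (ê m)) h5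
  simp only [sum_apply, add_apply, smul_apply, smul_eq_mul, zero_apply] at h6
  rw [← h6]
  exact sum_congr rfl fun k _ => by ring

/-! ### The divergence in coordinates -/

/-- The matrix of the linear map `v ↦ ∇_{∂_m} v - ∂_m v`. -/
def chrisMatrix (g : BilinField n M) (o : M) (y : 𝔼 n) (m : Fin n) : Matrix (Fin n) (Fin n) ℝ :=
  Matrix.of fun a i => chris g o a m i y

lemma IsC2Metric.fderiv_metricMatrix (hg : IsC2Metric g) (hy : y ∈ coordDomain o) (m : Fin n) :
    Matrix.of (fun i j => 𝐃 (bilinCoord g o i j) y (ê m)) = (chrisMatrix g o y m).transpose *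
    metricMatrix g o y + metricMatrix g o y * chrisMatrix g o y m := by
  ext i j
  rw [Matrix.of_apply, hg.fderiv_bilinCoord_eq hy, sum_add_distrib, Matrix.add_apply,
    Matrix.mul_apply, Matrix.mul_apply]
  congr 1
  refine sum_congr rfl fun a _ => ?_
  rw [mul_comm, hg.bilinCoord_symm hy a i]
  rfl

/-- From `∂(g g⁻¹) = 0` and `∂g = Γᵀ g + g Γ`. -/
lemma IsC2Metric.fderiv_inv_metricMatrix (hg : IsC2Metric g) (hy : y ∈ coordDomain o)
    (m p l : Fin n) : 𝐃 (fun y => 𝔾 g o y p l) y (ê m) = -∑ a,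
    (𝔾 g o y p a * chris g o l m a y + chris g o p m a y * 𝔾 g o y a l) := by
  obtain ⟨dI, hdI⟩ : ∃ dI : Matrix (Fin n) (Fin n) ℝ, dI = Matrix.of fun p l =>
    𝐃 (fun y => 𝔾 g o y p l) y (ê m) := ⟨_, rfl⟩
  obtain ⟨dG, hdG⟩ : ∃ dG : Matrix (Fin n) (Fin n) ℝ, dG = Matrix.of fun i j =>
    𝐃 (bilinCoord g o i j) y (ê m) := ⟨_, rfl⟩
  have h1 := hg.fderiv_metricMatrix hy m
  rw [← hdG] at h1
  have h2 : dG * 𝔾 g o y + metricMatrix g o y * dI = 0 := by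
    ext i l
    rw [Matrix.add_apply, Matrix.mul_apply, Matrix.mul_apply, ← sum_add_distrib, hdG, hdI]
    exact hg.sum_fderiv_mul_inv hy m i l
  have hu := hg.isUnit_det hy
  have h3 : dI = -(𝔾 g o y * (chrisMatrix g o y m).transpose + chrisMatrix g o y m * 𝔾 g o y) := by
    have e1 := Matrix.nonsing_inv_mul _ hu
    have e2 := Matrix.mul_nonsing_inv _ hu
    calc dI = (𝔾 g o y * metricMatrix g o y) * dI := by rw [e1, Matrix.one_mul]
      _ = -(𝔾 g o y * (dG * 𝔾 g o y)) := by
        rw [Matrix.mul_assoc, eq_neg_of_add_eq_zero_right h2, Matrix.mul_neg]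
      _ = -(𝔾 g o y * (chrisMatrix g o y m).transpose *
            (metricMatrix g o y * 𝔾 g o y)
          + (𝔾 g o y * metricMatrix g o y) * chrisMatrix g o y m * 𝔾 g o y) := by
        rw [h1]; noncomm_ring
      _ = _ := by rw [e1, e2, Matrix.mul_one, Matrix.one_mul]
  have h4 := congrFun (congrFun h3 p) l
  rw [hdI, Matrix.of_apply, Matrix.neg_apply, Matrix.add_apply, Matrix.mul_apply,
    Matrix.mul_apply, ← sum_add_distrib] at h4
  exact h4

/-- Jacobi's formula, in which metric compatibility turns the trace of `g⁻¹ ∂_m g` into twice the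
contracted Christoffel symbol. -/
lemma IsC2Metric.fderiv_volDensity (hg : IsC2Metric g) (hy : y ∈ coordDomain o) (m : Fin n) :
    𝐃 (volDensity g o) y (ê m) = volDensity g o y * ∑ a, chris g o a m a y := by
  have hnhds := (isOpen_domain o).mem_nhds hy
  have h1 := hasFDerivAt_matrix_det (A := metricMatrix g o) (y := y)
    (A' := fun i j => 𝐃 (bilinCoord g o i j) y) fun i j =>
    (((hg.contDiffOn o i j).contDiffAt hnhds).differentiableAt (by norm_num)).hasFDerivAt
  have hdet := hg.det_pos hy
  have h2 := h1.sqrt hdet.ne'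
  have h3 : 𝐃 (volDensity g o) y = _ := h2.fderiv
  have hu := hg.isUnit_det hy
  have h4 : ∑ i, ∑ j, (metricMatrix g o y).adjugate j i * 𝐃 (bilinCoord g o i j) y (ê m) =
      (metricMatrix g o y).det * (2 * ∑ a, chris g o a m a y) := by
    have e : ∑ i, ∑ j, (metricMatrix g o y).adjugate j i *
        𝐃 (bilinCoord g o i j) y (ê m) = ((metricMatrix g o y).adjugate *
          Matrix.of (fun i j => 𝐃 (bilinCoord g o i j) y (ê m))).trace := by
      rw [Matrix.trace, sum_comm]
      simp only [Matrix.diag_apply, Matrix.mul_apply, Matrix.of_apply]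
    rw [e, hg.fderiv_metricMatrix hy, Matrix.mul_add, Matrix.trace_add, ← Matrix.mul_assoc,
      Matrix.trace_mul_comm, ← Matrix.mul_assoc, ← Matrix.mul_assoc, Matrix.mul_adjugate,
      Matrix.adjugate_mul, Matrix.smul_mul, Matrix.smul_mul, Matrix.one_mul, Matrix.one_mul,
      Matrix.trace_smul, Matrix.trace_smul, Matrix.trace_transpose]
    simp only [Matrix.trace, Matrix.diag_apply, chrisMatrix, Matrix.of_apply, smul_eq_mul]
    ring
  rw [h3]
  simp only [smul_apply, sum_apply, smul_eq_mul]
  rw [h4, volDensity]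
  have h5 : √(metricMatrix g o y).det ≠ 0 := (Real.sqrt_pos.2 hdet).ne'
  field_simp
  rw [Real.sq_sqrt hdet.le]

lemma IsC2Metric.contDiffOn_volDensity_mul_inv (hg : IsC2Metric g) (k l : Fin n) :
    ContDiffOn ℝ 1 (fun y => volDensity g o y * 𝔾 g o y k l) (coordDomain o) :=
  ((hg.contDiffOn_volDensity o).of_le (by norm_num)).mul
    ((hg.contDiffOn_inv o k l).of_le (by norm_num))

/-- The derivative of the density cancels one of the two Christoffel terms in the derivative of
`g⁻¹`, by symmetry of the symbols. -/
lemma IsC2Metric.sum_fderiv_volDensity_mul_inv (hg : IsC2Metric g) (hy : y ∈ coordDomain o)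
    (l : Fin n) : ∑ k, 𝐃 (fun y => volDensity g o y * 𝔾 g o y k l) y (ê k) =
    -(volDensity g o y * ∑ a, ∑ b, 𝔾 g o y a b * chris g o l a b y) := by
  have hnhds := (isOpen_domain o).mem_nhds hy
  have h1 : ∀ k, 𝐃 (fun y => volDensity g o y * 𝔾 g o y k l) y (ê k) =
      volDensity g o y * (∑ a, (chris g o a k a y * 𝔾 g o y k l - 𝔾 g o y k a * chris g o l k a y
        - chris g o k k a y * 𝔾 g o y a l)) := by
    intro k
    have e := fderiv_fun_mul
      (((hg.contDiffOn_volDensity o).contDiffAt hnhds).differentiableAt (by norm_num))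
      (((hg.contDiffOn_inv o k l).contDiffAt hnhds).differentiableAt (by norm_num))
    rw [e]
    simp only [add_apply, smul_apply, smul_eq_mul]
    rw [hg.fderiv_inv_metricMatrix hy, hg.fderiv_volDensity hy]
    simp only [sum_sub_distrib, sum_add_distrib, ← sum_mul]
    ring
  simp only [h1]
  rw [← mul_sum, ← mul_neg]
  congr 1
  simp only [sum_sub_distrib]
  have h2 : ∑ k, ∑ a, chris g o k k a y * 𝔾 g o y a l =
      ∑ k, ∑ a, chris g o a k a y * 𝔾 g o y k l := by
    rw [sum_comm]
    refine sum_congr rfl fun k _ => sum_congr rfl fun a _ => ?_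
    rw [hg.chris_symm hy]
  rw [h2]
  ring

/-- The divergence theorem in a chart. -/
lemma IsC2Metric.integral_bilinTrace_mul_chart (hg : IsC2Metric g)
    (hS : IsWeakCovariantDerivative g β S) {ψ : 𝔼 n → ℝ} (hψ : ContDiff ℝ ∞ ψ)
    (hc : HasCompactSupport ψ) (hs : tsupport ψ ⊆ coordDomain o) :
    ∫ y, (volDensity g o y * ∑ i, ∑ j, 𝔾 g o y i j * bilinCoord S o i j y) * ψ y = -∫ y,
    volDensity g o y * ∑ k, ∑ l, 𝔾 g o y k l * 𝐃 ψ y (ê k) * covectorCoord β o l y := by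
  have hDo := isOpen_domain (n := n) o
  have hw := fun k l => (hS o l k).mul_contDiffOn hDo (hg.contDiffOn_volDensity_mul_inv k l)
  have hψ' := fun k : Fin n => continuous_fderiv_const hψ (ê k)
  -- The weak derivative of `β_l` in the direction `k`, multiplied by the `C¹` function `√det g ·
  -- g^{kl}`, is tested against `ψ` and summed over `k` and `l`.
  have hsum := sum_congr rfl fun k (_ : k ∈ Finset.univ) =>
    sum_congr rfl fun l (_ : l ∈ Finset.univ) => (hw k l).2.2 ψ hψ hc hs
  have i1 := fun k l => integrable_mul_test (hw k l).1 (hψ' k)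
    (hc.fderiv_apply ℝ (ê k)) ((tsupport_fderiv_apply_subset ℝ (ê k)).trans hs)
  have i2 := fun k l => integrable_mul_test (hw k l).2.1 hψ.continuous hc hs
  simp only [Finset.sum_neg_distrib] at hsum
  simp only [← integral_finsetSum _ fun l _ => i1 _ l] at hsum
  rw [← integral_finsetSum _ fun k _ => integrable_finsetSum _ fun l _ => i1 k l] at hsum
  simp only [← integral_finsetSum _ fun l _ => i2 _ l] at hsum
  rw [← integral_finsetSum _ fun k _ => integrable_finsetSum _ fun l _ => i2 k l] at hsum
  rw [eq_neg_iff_add_eq_zero, add_comm, ← eq_neg_iff_add_eq_zero]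
  have e1 : ∫ y, volDensity g o y * ∑ k, ∑ l, 𝔾 g o y k l * 𝐃 ψ y (ê k) * covectorCoord β o l y =
      ∫ y, ∑ k, ∑ l, covectorCoord β o l y * (volDensity g o y * 𝔾 g o y k l) * 𝐃 ψ y (ê k) := by
    congr 1; ext y
    simp only [mul_sum]
    exact sum_congr rfl fun k _ => sum_congr rfl fun l _ => by ring
  rw [e1, hsum]
  congr 1
  refine integral_congr_ae ?_
  filter_upwards [(ae_restrict_iff' hDo.measurableSet).1 (hg.christoffel_ae_eq o)] with y h1
  by_cases hy : y ∈ coordDomain o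
  swap
  · have : ψ y = 0 := image_eq_zero_of_notMem_tsupport fun h => hy (hs h)
    simp [this]
  simp only [← sum_mul]
  congr 1
  have h2 : ∀ k l, (bilinCoord S o l k y + ∑ m, christoffel g o m l k y * covectorCoord β o m y) *
      (volDensity g o y * 𝔾 g o y k l) + covectorCoord β o l y *
        𝐃 (fun y => volDensity g o y * 𝔾 g o y k l) y (ê k) =
      volDensity g o y * (𝔾 g o y l k * bilinCoord S o l k y)
      + ∑ m, volDensity g o y * (𝔾 g o y k l * chris g o m k l y * covectorCoord β o m y)
      + covectorCoord β o l y * 𝐃 (fun y => volDensity g o y * 𝔾 g o y k l) y (ê k) := by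
    intro k l
    rw [hg.inv_symm hy k l]
    simp only [h1 hy, ← mul_sum, hg.chris_symm hy _ l k]
    rw [add_mul]
    congr 2
    · ring
    · rw [sum_mul, mul_sum]
      exact sum_congr rfl fun m _ => by ring
  simp only [h2, sum_add_distrib]
  -- The derivatives of `√det g · g^{kl}` cancel the Christoffel terms of the covariant derivative,
  -- so that only the trace of `S` remains.
  have h3 : ∑ k, ∑ l, covectorCoord β o l y * 𝐃 (fun y => volDensity g o y * 𝔾 g o y k l) y (ê k) =
      -∑ k, ∑ l, ∑ m, volDensity g o y * (𝔾 g o y k l * chris g o m k l y *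
          covectorCoord β o m y) := by
    rw [sum_comm]
    simp only [← mul_sum, hg.sum_fderiv_volDensity_mul_inv hy]
    simp only [mul_sum, ← Finset.sum_neg_distrib]
    rw [sum_comm]
    refine sum_congr rfl fun k _ => ?_
    rw [sum_comm]
    exact sum_congr rfl fun l _ => sum_congr rfl fun m _ => by ring
  rw [h3, add_neg_cancel_right, sum_comm]
  simp only [mul_sum]

/-! ### Differentials of smooth functions and cutoffs near the boundary -/

/-- The differential of a smooth function. -/
def dform (f : M → ℝ) : CovectorField n M := fun x => mfderiv (𝓡∂ n) 𝓘(ℝ, ℝ) f x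

lemma covectorCoord_dform (hf : ContMDiff (𝓡∂ n) 𝓘(ℝ, ℝ) ∞ f) (hy : y ∈ coordDomain o) (i : Fin n) :
    covectorCoord (dform f) o i y = 𝐃 (funCoord f o) y (ê i) := by
  have h := mfderiv_comp y (hf.mdifferentiable (by simp) _) (mdifferentiableAt_symm hy)
  rw [← mfderiv_eq_fderiv]
  change _ = mfderiv 𝓘(ℝ, 𝔼 n) 𝓘(ℝ, ℝ) (f ∘ (𝔠 n o).symm) y _
  rw [h]
  rfl

lemma contDiffOn_funCoord_coordDomain (hf : ContMDiff (𝓡∂ n) 𝓘(ℝ, ℝ) ∞ f) (o : M) :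
    ContDiffOn ℝ ∞ (funCoord (n := n) f o) (coordDomain o) :=
  (contDiffOn_funCoord hf o).mono (domain_subset_target o)

lemma isMeasurableCovector_dform (hf : ContMDiff (𝓡∂ n) 𝓘(ℝ, ℝ) ∞ f) :
    IsMeasurableCovector (n := n) (dform f) := by
  intro o i
  have hD := isOpen_domain (n := n) o
  have h1 : ContinuousOn (fun y => 𝐃 (funCoord f o) y (ê i)) (𝔻 n o) :=
    ((contDiffOn_funCoord_coordDomain hf o).continuousOn_fderiv_of_isOpen hD (by simp)).clm_apply
      continuousOn_const
  refine (h1.aestronglyMeasurable hD.measurableSet).congr ?_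
  filter_upwards [ae_restrict_mem hD.measurableSet] with y hy
  exact (covectorCoord_dform hf hy i).symm

/-- The components of `df` are bounded up to the boundary and the dual metric is `O(ρ²)` on a patch;
finitely many patches suffice. The factor `ρ` in the bound makes cutoff functions of `k ρ` have
bounded gradient. -/
lemma IsConfCompact.exists_covectorNorm_dform_le [CompactSpace M] (H : IsConfCompact ρ g gbar)
    (hf : ContMDiff (𝓡∂ n) 𝓘(ℝ, ℝ) ∞ f) :
    ∃ C, 0 ≤ C ∧ ∀ x ∈ (𝓡∂ n).interior M, covectorNorm g (dform f) x ≤ C * ρ x := by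
  choose R C ε hP using fun x : M => H.exists_isPatch one_pos x
  have hb : ∀ o : M, ∃ R' K : ℝ, 0 < R' ∧ 0 ≤ K ∧ ∀ y ∈ ball (𝔠 n o o) R' ∩ (𝔠 n o).target,
        ∑ i, |fderivWithin ℝ (funCoord f o) (𝔠 n o).target y (ê i)| ≤ K := by
    intro o
    have hc : ContinuousOn (fun y => ∑ i, |fderivWithin ℝ (funCoord f o)
        (𝔠 n o).target y (ê i)|) (𝔠 n o).target :=
      continuousOn_finsetSum _ fun i _ => (contDiffOn_fderivWithin_funCoord hf o i).continuousOn.abs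
    have h1 := hc _ (mem_extChartAt_target o)
    obtain ⟨R', hR', hsub⟩ := Metric.mem_nhdsWithin_iff.1 (h1 (Iio_mem_nhds (lt_add_one _)))
    refine ⟨R', _, hR', ?_, fun y hy => (mem_Iio.1 (hsub hy)).le⟩
    exact add_nonneg (Finset.sum_nonneg fun i _ => abs_nonneg _) zero_le_one
  choose R' K hR' hK hb using hb
  obtain ⟨t, ht⟩ := exists_finset_halfBall_cover (n := n) (M := M) (R := fun x => min (R x) (R' x))
    fun x => lt_min (hP x).R_pos (hR' x)
  have hC : ∀ x, 0 ≤ C x := fun x => zero_le_one.trans (hP x).one_le_C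
  refine ⟨∑ x ∈ t, C x * K x, Finset.sum_nonneg fun x _ => mul_nonneg (hC x) (hK x), fun x hx => ?_⟩
  obtain ⟨o, hx₀, y, hy, rfl⟩ := mem_iUnion₂.1 (ht hx)
  have hy3 : y ∈ halfBall o (3 * R o) := halfBall_mono o
    ((min_le_left _ _).trans (by linarith [(hP o).R_pos])) hy
  have hyD := (hP o).dom hy3
  have hyt := domain_subset_target o hyD
  have hρ0 := (hP o).rho_pos y hy3
  have h1 := hb o y ⟨Metric.ball_subset_ball (min_le_right _ _) hy.1, hyt⟩
  rw [fderivWithin_of_mem_nhds (mem_interior_iff_mem_nhds.1 hyD)] at h1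
  simp only [← covectorCoord_dform hf hyD] at h1
  calc _ ≤ _ := (hP o).covectorNorm_le (dform f) hy3
    _ ≤ C o * funCoord ρ o y * K o := mul_le_mul_of_nonneg_left h1 (mul_nonneg (hC o) hρ0.le)
    _ = C o * K o * funCoord ρ o y := by ring
    _ ≤ _ := mul_le_mul_of_nonneg_right (Finset.single_le_sum
      (f := fun x => C x * K x) (fun x _ => mul_nonneg (hC x) (hK x)) hx₀) hρ0.le

/-- A smooth function supported in the domain of a chart, read in that chart. -/
lemma exists_chart_test_function [CompactSpace M] (hη : ContMDiff (𝓡∂ n) 𝓘(ℝ, ℝ) ∞ η)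
    (hs : tsupport η ⊆ 𝕌 n o) : ContDiff ℝ ∞ ((𝔻 n o).indicator (funCoord η o)) ∧
    HasCompactSupport ((𝔻 n o).indicator (funCoord η o)) ∧
    tsupport ((𝔻 n o).indicator (funCoord η o)) ⊆ 𝔻 n o := by
  have hDo := isOpen_domain (n := n) o
  rw [coordImage_eq] at hs
  obtain ⟨K, hKdef⟩ : ∃ K, K = 𝔠 n o '' tsupport η := ⟨_, rfl⟩
  have hK : IsCompact K := by
    rw [hKdef]
    exact (isClosed_tsupport η).isCompact.image_of_continuousOn
      ((continuousOn_extChartAt o).mono fun x hx => (hs hx).1)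
  have hKD : K ⊆ coordDomain o := by rw [hKdef]; rintro _ ⟨x, hx, rfl⟩; exact (hs hx).2
  have h0 : ∀ y ∉ K, (𝔻 n o).indicator (funCoord η o) y = 0 := by
    intro y hy
    by_cases hyD : y ∈ coordDomain o
    · rw [indicator_of_mem hyD]
      refine image_eq_zero_of_notMem_tsupport (f := η) fun h => hy ?_
      rw [hKdef]
      exact ⟨_, h, extChartAt_symm_apply hyD⟩
    · exact indicator_of_notMem hyD _
  have hsupp : Function.support ((𝔻 n o).indicator (funCoord η o)) ⊆ K :=
    fun y hy => by_contra fun h => hy (h0 y h)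
  refine ⟨contDiff_iff_contDiffAt.2 fun y => ?_, HasCompactSupport.of_support_subset_isCompact hK
    hsupp, (closure_minimal hsupp hK.isClosed).trans hKD⟩
  by_cases hy : y ∈ coordDomain o
  · refine ((contDiffOn_funCoord_coordDomain hη o).contDiffAt (hDo.mem_nhds hy)).congr_of_eventuallyEq ?_
    filter_upwards [hDo.mem_nhds hy] with z hz using indicator_of_mem hz _
  · refine (contDiffAt_const (c := (0 : ℝ))).congr_of_eventuallyEq ?_
    filter_upwards [hK.isClosed.isOpen_compl.mem_nhds fun h => hy (hKD h)] with z hz using h0 z hz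

/-- The function `f`, cut off near the boundary. -/
def cutoff (ρ f : M → ℝ) (k : ℕ) (x : M) : ℝ := f x * smoothStep (k * ρ x)

lemma contMDiff_cutoff (hρ : ContMDiff (𝓡∂ n) 𝓘(ℝ, ℝ) ∞ ρ) (hf : ContMDiff (𝓡∂ n) 𝓘(ℝ, ℝ) ∞ f)
    (k : ℕ) : ContMDiff (𝓡∂ n) 𝓘(ℝ, ℝ) ∞ (cutoff ρ f k) :=
  hf.mul ((contDiff_smoothStep.comp (contDiff_const.mul contDiff_id)).contMDiff.comp hρ :
    ContMDiff (𝓡∂ n) 𝓘(ℝ, ℝ) ∞ fun x => smoothStep (k * ρ x))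

lemma dform_cutoff (hρ : ContMDiff (𝓡∂ n) 𝓘(ℝ, ℝ) ∞ ρ) (hf : ContMDiff (𝓡∂ n) 𝓘(ℝ, ℝ) ∞ f) (k : ℕ)
    (x : M) : dform (n := n) (cutoff ρ f k) x =
    (f x * (k * deriv smoothStep (k * ρ x))) • dform ρ x + smoothStep (k * ρ x) • dform f x := by
  have h1 : HasDerivAt (fun s => smoothStep (k * s)) (deriv smoothStep (k * ρ x) * k) (ρ x) := by
    have e := ((contDiff_smoothStep.differentiable (by simp)) (k * ρ x)).hasDerivAt
    have e2 : HasDerivAt (fun s : ℝ => (k : ℝ) * s) k (ρ x) := by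
      simpa using (hasDerivAt_id (ρ x)).const_mul (k : ℝ)
    exact e.comp (ρ x) e2
  have h2 := h1.hasFDerivAt.hasMFDerivAt.comp x
    (hρ.mdifferentiable (by simp) x).hasMFDerivAt
  have h3 := (hf.mdifferentiable (by simp) x).hasMFDerivAt.mul h2
  refine h3.mfderiv.trans ?_
  ext v
  change f x * (dform ρ x v * (deriv smoothStep (k * ρ x) * k)) + _ =
    f x * (k * deriv smoothStep (k * ρ x)) * dform ρ x v + _
  congr 1
  ring

/-- The profile vanishes up to the value `1`, so the support lies in the closed set `1 ≤ k ρ`, which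
does not meet the boundary. -/
lemma tsupport_cutoff_subset (hρ : IsDefiningFunction n ρ) (hs : tsupport f ⊆ (𝔠 n o).source)
    (k : ℕ) : tsupport (cutoff ρ f k) ⊆ 𝕌 n o := by
  rw [coordImage_eq_inter_interior]
  refine subset_inter ((tsupport_mul_subset_left (f := f)).trans hs) ?_
  have hc : IsClosed {x | 1 ≤ k * ρ x} :=
    isClosed_le continuous_const (continuous_const.mul hρ.smooth.continuous)
  refine ((tsupport_mul_subset_right (f := f)).trans (closure_minimal ?_ hc)).trans fun x hx => ?_
  · intro x hx
    change (1 : ℝ) ≤ k * ρ x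
    by_contra! h
    exact hx (Real.smoothTransition.zero_of_nonpos (by linarith))
  · rw [← (𝓡∂ n).compl_boundary]
    intro h
    rw [mem_ofPred_eq, (hρ.eq_zero_iff x).2 h, mul_zero] at hx
    linarith

lemma IsWeakDifferential.congr (h : IsWeakDifferential u α)
    (hu : ∀ x ∈ (𝓡∂ n).interior M, u x = u' x) : IsWeakDifferential u' α := fun o i =>
  (h o i).congr (isOpen_domain o).measurableSet
    ((ae_mem_domain o).mono fun _ hy => hu _ (symm_mem_interior hy)) (.of_forall fun _ => rfl)

lemma IsC2Metric.continuousOn_scalChart (hg : IsC2Metric g) (o : M) :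
    ContinuousOn (scalChart (n := n) g o) (coordDomain o) := by
  have h1 := fun k i j => (hg.contDiffOn_chris o k i j).continuousOn
  have h2 := fun k i j l => ((hg.contDiffOn_chris o k i j).continuousOn_fderiv_of_isOpen
    (isOpen_domain o) le_rfl).clm_apply (continuousOn_const (c := ê l))
  refine continuousOn_finsetSum _ fun i _ => continuousOn_finsetSum _ fun j _ =>
    (hg.contDiffOn_inv o i j).continuousOn.mul (ContinuousOn.add ?_ ?_)
  · exact continuousOn_finsetSum _ fun k _ => (h2 k i j k).sub (h2 k i k j)
  · exact continuousOn_finsetSum _ fun k _ => continuousOn_finsetSum _ fun l _ =>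
      ((h1 k k l).mul (h1 l i j)).sub ((h1 k j l).mul (h1 l i k))

variable [MeasurableSpace M] [BorelSpace M]

/-! ### The Riemannian measure in charts -/

/-- Change of variables: the Jacobian of the transition map is the ratio of the two densities. -/
lemma chartVolume_inter (k : BilinField n M) (o x₁ : M) {S : Set M} (hS : MeasurableSet S) :
    chartVolume k o (S ∩ 𝕌 n x₁) = chartVolume k x₁ (S ∩ 𝕌 n o) := by
  rw [chartVolume_apply k o (hS.inter (isOpen_coordImage x₁).measurableSet),
    chartVolume_apply k x₁ (hS.inter (isOpen_coordImage o).measurableSet)]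
  set A := coordDomain o ∩ (𝔠 n o).symm ⁻¹' (S ∩ 𝕌 n x₁) with hA
  have hAm : MeasurableSet A := measurableSet_inter_preimage_symm (n := n) o
    (hS.inter (isOpen_coordImage x₁).measurableSet)
  have hAt : A ⊆ transDomain o x₁ := fun y hy => ⟨hy.1, hy.2.2⟩
  have himg : coordDomain x₁ ∩ (𝔠 n x₁).symm ⁻¹' (S ∩ 𝕌 n o) = transition o x₁ '' A := by
    ext z
    constructor
    · intro hz
      have hz' : z ∈ transDomain x₁ o := ⟨hz.1, hz.2.2⟩
      refine ⟨transition x₁ o z, ⟨transition_mem hz', ?_⟩, transition_transition hz'⟩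
      rw [mem_preimage, symm_transition hz']
      exact ⟨hz.2.1, ⟨z, hz.1, rfl⟩⟩
    · rintro ⟨y, hy, rfl⟩
      refine ⟨transition_mem (hAt hy), ?_⟩
      rw [mem_preimage, symm_transition (hAt hy)]
      exact ⟨hy.2.1, ⟨y, hy.1, rfl⟩⟩
  have hinj : InjOn (transition o x₁) A := fun y hy z hz h => by
    rw [← transition_transition (hAt hy), h, transition_transition (hAt hz)]
  have hd : ∀ y ∈ A, HasFDerivWithinAt (transition o x₁) (𝐃 (transition o x₁) y) A y :=
    fun y hy => (((contDiffOn_transition o x₁).differentiableOn (by simp)).differentiableAt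
      ((isOpen_transDomain o x₁).mem_nhds (hAt hy))).hasFDerivAt.hasFDerivWithinAt
  rw [himg, lintegral_image_eq_lintegral_abs_det_fderiv_mul volume hAm hd hinj]
  refine setLIntegral_congr_fun hAm fun y hy => ?_
  rw [volDensity_transition k (hAt hy), ENNReal.ofReal_mul (abs_nonneg _)]

/-- Each chart measure is at most `chartVolume k o` plus the part of the supremum outside `𝕌 n o`,
because chart measures agree on overlaps. Restriction to `𝕌 n o` removes the second summand; the
converse inequality is the definition of the supremum. -/
lemma riemVolume_restrict (k : BilinField n M) (o : M) :
    (riemVolume k).restrict (𝕌 n o) = chartVolume k o := by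
  have hW := (isOpen_coordImage (n := n) o).measurableSet
  apply le_antisymm
  · have hle : riemVolume k ≤ chartVolume k o + (riemVolume k).restrict (𝕌 n o)ᶜ := by
      refine iSup_le fun x₁ => ?_
      refine Measure.le_iff.2 fun S hS => ?_
      rw [← measure_inter_add_sdiff S hW, Measure.add_apply, Measure.restrict_apply hS]
      refine add_le_add ?_ ?_
      · rw [chartVolume_inter k x₁ o hS]
        exact measure_mono inter_subset_left
      · exact (le_iSup (fun x₁ => chartVolume k x₁) x₁) _
    refine Measure.le_iff.2 fun S hS => ?_
    rw [Measure.restrict_apply hS]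
    refine (hle _).trans ?_
    rw [Measure.add_apply, Measure.restrict_apply (hS.inter hW)]
    have : S ∩ 𝕌 n o ∩ (𝕌 n o)ᶜ = ∅ := by rw [inter_assoc, inter_compl_self, inter_empty]
    rw [this, measure_empty, add_zero]
    exact measure_mono inter_subset_left
  · refine Measure.le_iff.2 fun S hS => ?_
    rw [Measure.restrict_apply hS, ← measure_inter_add_sdiff S hW]
    have h0 : chartVolume k o (S \ 𝕌 n o) = 0 :=
      measure_mono_null (fun x hx => hx.2) (chartVolume_compl_coordImage k o)
    rw [h0, add_zero]
    exact (le_iSup (fun x₁ => chartVolume k x₁) o) _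

lemma riemVolume_compl_interior (k : BilinField n M) : riemVolume k ((𝓡∂ n).interior M)ᶜ = 0 := by
  have hI : MeasurableSet ((𝓡∂ n).interior M) :=
    ((𝓡∂ n).isOpen_interior (M := M) (n := ∞) (by simp)).measurableSet
  have hle : riemVolume k ≤ (riemVolume k).restrict ((𝓡∂ n).interior M) := by
    refine iSup_le fun x₁ => ?_
    rw [← riemVolume_restrict k x₁]
    refine Measure.restrict_mono ?_ le_rfl
    rw [coordImage_eq_inter_interior]
    exact inter_subset_right
  refine le_antisymm ((hle _).trans ?_) zero_le
  rw [Measure.restrict_apply hI.compl]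
  simp

lemma restrict_iUnion_eq [CompactSpace M] (k : BilinField n M) {t : Finset M}
    (ht : (𝓡∂ n).interior M ⊆ ⋃ o ∈ t, 𝕌 n o) :
    (riemVolume k).restrict (⋃ o ∈ t, 𝕌 n o) = riemVolume k :=
  Measure.restrict_eq_self_of_ae_mem (by
    rw [ae_iff]
    exact measure_mono_null (fun x hx h => hx (ht h)) (riemVolume_compl_interior k))

lemma ae_riemVolume_of_ae [CompactSpace M] (k : BilinField n M) {P : M → Prop}
    (h : ∀ o : M, ∀ᵐ y ∂𝔳 n o, P ((𝔠 n o).symm y)) : ∀ᵐ x ∂riemVolume k, P x := by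
  obtain ⟨t, ht⟩ := exists_finset_cover n M
  rw [← restrict_iUnion_eq k ht, ae_restrict_biUnion_finset_iff]
  intro o _
  rw [riemVolume_restrict]
  exact ae_chartVolume_of_ae k o (h o)

lemma aestronglyMeasurable_riemVolume [CompactSpace M] {F : M → ℝ} (k : BilinField n M)
    (h : ∀ o : M, AEStronglyMeasurable (fun y => F ((𝔠 n o).symm y)) (𝔳 n o)) :
    AEStronglyMeasurable F (riemVolume k) := by
  obtain ⟨t, ht⟩ := exists_finset_cover n M
  have e : ⋃ o ∈ t, 𝕌 n o = ⋃ o : t, 𝕌 n (o : M) := by ext; simp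
  rw [← restrict_iUnion_eq k ht, e, aestronglyMeasurable_iUnion_iff]
  intro o
  rw [riemVolume_restrict]
  exact aestronglyMeasurable_chartVolume k _ (h _)

lemma setLIntegral_coordImage (k : BilinField n M) (o : M)
    (hd : AEMeasurable (volDensity k o) (𝔳 n o)) {F : M → ℝ≥0∞}
    (hF : AEMeasurable F (chartVolume k o)) : ∫⁻ x in 𝕌 n o, F x ∂riemVolume k =
    ∫⁻ y in coordDomain o, ofReal (volDensity k o y) * F ((𝔠 n o).symm y) := by
  have hac := withDensity_absolutelyContinuous (𝔳 n o)
    (fun y => ofReal (volDensity k o y))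
  rw [riemVolume_restrict, chartVolume_eq_map,
    lintegral_map' (by rwa [chartVolume_eq_map] at hF) ((aemeasurable_symm o).mono_ac hac)]
  exact lintegral_withDensity_eq_lintegral_mul₀' hd.ennreal_ofReal
    (AEMeasurable.comp_aemeasurable (g := F) (by rwa [chartVolume_eq_map] at hF)
      ((aemeasurable_symm o).mono_ac hac))

lemma setIntegral_coordImage (k : BilinField n M) (o : M)
    (hd : AEMeasurable (volDensity k o) (𝔳 n o)) {F : M → ℝ}
    (hF : AEStronglyMeasurable F (chartVolume k o)) : ∫ x in 𝕌 n o, F x ∂riemVolume k =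
    ∫ y in coordDomain o, volDensity k o y * F ((𝔠 n o).symm y) := by
  have hac := withDensity_absolutelyContinuous (𝔳 n o)
    (fun y => ofReal (volDensity k o y))
  rw [riemVolume_restrict, chartVolume_eq_map, integral_map ((aemeasurable_symm o).mono_ac hac)
    (by rwa [chartVolume_eq_map] at hF), integral_withDensity_eq_integral_toReal_smul₀ hd.ennreal_ofReal
      (.of_forall fun y => ENNReal.ofReal_lt_top)]
  congr 1; ext y
  rw [ENNReal.toReal_ofReal (show 0 ≤ volDensity k o y from Real.sqrt_nonneg _), smul_eq_mul]

lemma ae_of_ae_riemVolume (k : BilinField n M) (o : M) (hd : AEMeasurable (volDensity k o) (𝔳 n o))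
    (hpos : ∀ y ∈ 𝔻 n o, 0 < volDensity k o y) {P : M → Prop} (h : ∀ᵐ x ∂riemVolume k, P x) :
    ∀ᵐ y ∂𝔳 n o, P ((𝔠 n o).symm y) := by
  have hac := withDensity_absolutelyContinuous (𝔳 n o)
    (fun y => ofReal (volDensity k o y))
  have h1 : ∀ᵐ x ∂(chartVolume k o), P x := by rw [← riemVolume_restrict]; exact ae_restrict_of_ae h
  rw [chartVolume_eq_map] at h1
  have h2 := ae_of_ae_map ((aemeasurable_symm o).mono_ac hac) h1
  rw [ae_withDensity_iff' hd.ennreal_ofReal] at h2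
  filter_upwards [h2, ae_mem_domain o] with y hy hyD
  exact hy (by simpa using hpos y hyD)

/-! ### Covering by finitely many patches, and comparison of measures at small scales -/

lemma IsC2Metric.ae_coord (hg : IsC2Metric g) (o : M) {P : M → Prop} (h : ∀ᵐ x ∂riemVolume g, P x) :
    ∀ᵐ y ∂𝔳 n o, P ((𝔠 n o).symm y) :=
  ae_of_ae_riemVolume g o (hg.aemeasurable_volDensity o) (fun _ hy => hg.volDensity_pos hy) h

lemma IsC2Metric.aestronglyMeasurable_coord (hg : IsC2Metric g) {F : M → ℝ}
    (hF : AEStronglyMeasurable F (riemVolume g)) (o : M) :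
    AEStronglyMeasurable (fun y => F ((𝔠 n o).symm y)) (𝔳 n o) := by
  obtain ⟨G, hG, hFG⟩ := hF
  exact (hG.measurable.comp_aemeasurable (aemeasurable_symm o)).aestronglyMeasurable.congr
    ((hg.ae_coord o hFG).mono fun y hy => hy.symm)

lemma ae_riemVolume_of_cover (g : BilinField n M) {t : Finset M} {D : M → Set (𝔼 n)}
    (hD : ∀ x, D x ⊆ coordDomain x) (hDm : ∀ x, MeasurableSet (D x))
    (ht : (𝓡∂ n).interior M ⊆ ⋃ x ∈ t, (𝔠 n x).symm '' D x) {P : M → Prop}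
    (h : ∀ x ∈ t, ∀ᵐ y ∂(volume.restrict (D x)), P ((𝔠 n x).symm y)) : ∀ᵐ x ∂riemVolume g, P x := by
  have h1 : ∀ x ∈ t, ∀ᵐ z ∂riemVolume g, z ∈ 𝕌 n x → 𝔠 n x z ∈ D x → P z := by
    intro x hx
    rw [← ae_restrict_iff' (isOpen_coordImage x).measurableSet, riemVolume_restrict]
    refine ae_chartVolume_of_ae g x ?_
    have := h x hx
    rw [ae_restrict_iff' (hDm x)] at this
    filter_upwards [ae_restrict_of_ae this, ae_mem_domain x] with y hy hyD hyd
    rw [extChartAt_symm_apply hyD] at hyd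
    exact hy hyd
  have h2 : ∀ᵐ z ∂riemVolume g, z ∈ (𝓡∂ n).interior M := by
    rw [ae_iff]; exact riemVolume_compl_interior g
  filter_upwards [h2, (Finset.eventually_all t).2 h1] with z hz hz1
  obtain ⟨x, hx, y, hy, rfl⟩ := mem_iUnion₂.1 (ht hz)
  exact hz1 x hx ⟨y, hD x hy, rfl⟩ (by rwa [extChartAt_symm_apply (hD x hy)])

lemma IsC2Metric.setLIntegral_image (hg : IsC2Metric g) {D : Set (𝔼 n)} (hD : D ⊆ coordDomain o)
    (hDo : IsOpen D) {F : M → ℝ≥0∞} (hF : AEMeasurable F (riemVolume g)) :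
    ∫⁻ x in (𝔠 n o).symm '' D, F x ∂riemVolume g = ∫⁻ y in D, ofReal (volDensity g o y) *
    F ((𝔠 n o).symm y) := by
  have e : (𝔠 n o).symm '' D = (𝔠 n o).source ∩ 𝔠 n o ⁻¹' D := by
    rw [PartialEquiv.symm_image_eq_source_inter_preimage _ (hD.trans (domain_subset_target o))]
  have hm : MeasurableSet ((𝔠 n o).symm '' D) := by
    rw [e]
    exact ((continuousOn_extChartAt o).isOpen_inter_preimage
      (isOpen_extChartAt_source o) hDo).measurableSet
  have hsub : (𝔠 n o).symm '' D ⊆ 𝕌 n o := image_mono hD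
  have h1 : ∫⁻ x in (𝔠 n o).symm '' D, F x ∂riemVolume g = ∫⁻ x in 𝕌 n o,
        ((𝔠 n o).symm '' D).indicator F x ∂riemVolume g := by
    rw [lintegral_indicator hm, Measure.restrict_restrict hm, inter_eq_left.2 hsub]
  rw [h1, setLIntegral_coordImage g o (hg.aemeasurable_volDensity o)
    (by rw [← riemVolume_restrict]; exact (hF.indicator hm).restrict)]
  have h2 : (𝔳 n o).restrict D = volume.restrict D := by
    rw [Measure.restrict_restrict hDo.measurableSet, inter_eq_left.2 hD]
  rw [← h2, ← lintegral_indicator hDo.measurableSet]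
  refine setLIntegral_congr_fun (isOpen_domain o).measurableSet fun y hy => ?_
  by_cases hyD : y ∈ D
  · rw [indicator_of_mem hyD]
    rw [indicator_of_mem (mem_image_of_mem _ hyD)]
  · rw [indicator_of_notMem hyD]
    rw [indicator_of_notMem, mul_zero]
    rintro ⟨z, hz, hzy⟩
    refine hyD ?_
    have := congrArg (𝔠 n o) hzy
    rw [extChartAt_symm_apply (hD hz), extChartAt_symm_apply hy] at this
    exact this ▸ hz

/-- An integral over `M` is finite if it is so over finitely many coordinate domains that cover
the interior. -/
lemma IsC2Metric.lintegral_lt_top_of_cover (hg : IsC2Metric g) {t : Finset M} {D : M → Set (𝔼 n)}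
    (hD : ∀ x, D x ⊆ coordDomain x) (hDo : ∀ x, IsOpen (D x))
    (ht : (𝓡∂ n).interior M ⊆ ⋃ x ∈ t, (𝔠 n x).symm '' D x) {F : M → ℝ≥0∞}
    (hF : AEMeasurable F (riemVolume g))
    (h : ∀ x ∈ t, ∫⁻ y in D x, ofReal (volDensity g x y) * F ((𝔠 n x).symm y) < ⊤) :
    ∫⁻ x, F x ∂riemVolume g < ⊤ := by
  have h1 : (riemVolume g).restrict (⋃ x ∈ t, (𝔠 n x).symm '' D x) =
      riemVolume g := Measure.restrict_eq_self_of_ae_mem (by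
    rw [ae_iff]
    exact measure_mono_null (fun x hx h => hx (ht h)) (riemVolume_compl_interior g))
  have h2 : ⋃ x ∈ t, (𝔠 n x).symm '' D x =
      ⋃ x : t, (𝔠 n (x : M)).symm '' D x := by ext; simp
  rw [← h1, h2]
  refine (lintegral_iUnion_le _ _).trans_lt ?_
  rw [tsum_fintype]
  refine ENNReal.sum_lt_top.2 fun x _ => ?_
  rw [hg.setLIntegral_image (hD x) (hDo x) hF]
  exact h x x.2

lemma IsPatch.aemeasurable_zoom (hP : IsPatch ρ g r o R C ε) (hy : y ∈ halfBall o (2 * R)) :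
    AEMeasurable (zoom ρ ε o y) (volume.restrict (ball 0 1)) := by
  refine ContinuousOn.aemeasurable ?_ Metric.isOpen_ball.measurableSet
  exact (continuousOn_symm_coordDomain o).comp (continuous_dilate _ _).continuousOn
    fun z hz => hP.dom (hP.ball_subset y hy (hP.dilate_mem hy hz))

/-- At the scale of the patch, the Lebesgue measure is controlled by the Riemannian measure on
Riemannian balls. -/
lemma IsPatch.map_zoom_le (hP : IsPatch ρ g r o R C ε) (hy : y ∈ halfBall o (2 * R)) :
    Measure.map (zoom ρ ε o y) (volume.restrict (ball 0 1)) ≤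
    ofReal (C * 2 ^ n * (ε ^ n)⁻¹) • (riemVolume g).restrict (riemBall g ((𝔠 n o).symm y) r) := by
  have hs := hP.scale_pos hy
  have hC : 0 ≤ C := zero_le_one.trans hP.one_le_C
  obtain ⟨s, hsdef⟩ : ∃ s, s = ε * funCoord ρ o y := ⟨_, rfl⟩
  have hρy : 0 < funCoord ρ o y := by have := hP.ε_pos; exact pos_of_mul_pos_right hs this.le
  refine Measure.le_iff.2 fun S hS => ?_
  obtain ⟨e, he⟩ : ∃ e, e = (𝔠 n o).symm := ⟨_, rfl⟩
  have hB : ∀ x ∈ ball y s, x ∈ halfBall o (3 * R) := by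
    rw [hsdef]; exact fun x hx => hP.ball_subset y hy hx
  have hBS : MeasurableSet (ball y s ∩ e ⁻¹' S) := by
    have := (Metric.isOpen_ball (x := y) (ε := s)).measurableSet.inter
      (measurableSet_inter_preimage_symm o hS)
    rwa [← inter_assoc, inter_eq_left.2 (fun x hx => hP.dom (hB x hx)), ← he] at this
  have h1 : Measure.map (zoom ρ ε o y) (volume.restrict (ball 0 1)) S =
      ofReal (s ^ n)⁻¹ * volume (ball y s ∩ e ⁻¹' S) := by
    rw [Measure.map_apply_of_aemeasurable (hP.aemeasurable_zoom hy) hS]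
    have hz : zoom ρ ε o y ⁻¹' S = dilate y s ⁻¹' (e ⁻¹' S) := by rw [hsdef, he]; rfl
    have h2 := congrArg (fun μ => μ (ball y s ∩ e ⁻¹' S))
      (map_dilate_restrict y (hsdef ▸ hs) 1)
    simp only [mul_one] at h2
    rw [Measure.map_apply (continuous_dilate y s).measurable hBS, Measure.smul_apply,
      Measure.restrict_apply hBS, smul_eq_mul, inter_eq_left.2 inter_subset_left] at h2
    rw [hz, ← h2, preimage_inter]
    refine measure_congr ?_
    filter_upwards [ae_restrict_mem Metric.isOpen_ball.measurableSet] with z hz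
    have := (dilate_mem_ball y (hsdef ▸ hs) 1 z).2 hz
    rw [mul_one] at this
    exact propext ⟨fun h => ⟨this, h⟩, fun h => h.2⟩
  -- The density is at least `C⁻¹ ρ(x)^(-n)`, and `ρ(x) ≤ 2 ρ(y)` on the ball. Multiplied by
  -- `s^(-n)` with `s = ε ρ(y)`, the resulting power of `ρ(y)` disappears.
  have h3 : volume (ball y s ∩ e ⁻¹' S) ≤ ofReal (C * (2 * funCoord ρ o y) ^ n) *
      ∫⁻ x in ball y s ∩ e ⁻¹' S, ofReal (volDensity g o x) := by
    rw [← lintegral_const_mul' _ _ ofReal_ne_top, ← setLIntegral_one]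
    refine setLIntegral_mono' hBS fun x hx => ?_
    rw [← ENNReal.ofReal_mul (by positivity), ← ENNReal.ofReal_one]
    refine ENNReal.ofReal_le_ofReal ?_
    have hx3 := hB x hx.1
    have hp := hP.rho_pos x hx3
    have e1 := hP.le_dens x hx3
    have e2 := (hP.compar y hy x (hsdef ▸ hx.1)).2
    have e3 : 0 ≤ volDensity g o x := Real.sqrt_nonneg _
    calc (1 : ℝ) = funCoord ρ o x ^ n * (funCoord ρ o x ^ n)⁻¹ := by field_simp
      _ ≤ (2 * funCoord ρ o y) ^ n * (C * volDensity g o x) :=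
          mul_le_mul (pow_le_pow_left₀ hp.le e2 n) e1 (by positivity) (by positivity)
      _ = _ := by ring
  have h4 : ∫⁻ x in ball y s ∩ e ⁻¹' S, ofReal (volDensity g o x) ≤
      (riemVolume g).restrict (riemBall g ((𝔠 n o).symm y) r) S := by
    rw [Measure.restrict_apply hS]
    calc _ = ∫⁻ x in ball y s ∩ e ⁻¹' S, ofReal (volDensity g o x)
            ∂𝔳 n o := by
          have hsub : ball y s ∩ e ⁻¹' S ⊆ coordDomain o := fun x hx => hP.dom (hB x hx.1)
          rw [Measure.restrict_restrict hBS, inter_eq_left.2 hsub]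
      _ ≤ ((𝔳 n o).withDensity fun y =>
            ofReal (volDensity g o y)) (ball y s ∩ e ⁻¹' S) := withDensity_apply_le _ _
      _ ≤ ((𝔳 n o).withDensity fun y => ofReal
            (volDensity g o y)) (e ⁻¹' (S ∩ riemBall g ((𝔠 n o).symm y) r)) := by
          refine measure_mono fun x hx => ⟨hx.2, ?_⟩
          have hx1 : x ∈ ball y (ε * funCoord ρ o y) := hsdef ▸ hx.1
          rw [he]; exact hP.riem y hy x hx1
      _ ≤ chartVolume g o (S ∩ riemBall g ((𝔠 n o).symm y) r) := by
          rw [chartVolume_eq_map, he]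
          exact Measure.le_map_apply ((aemeasurable_symm o).mono_ac
            (withDensity_absolutelyContinuous _ _)) _
      _ ≤ _ := by
          rw [← riemVolume_restrict]
          exact Measure.restrict_le_self _
  rw [h1, Measure.smul_apply, smul_eq_mul]
  calc _ ≤ ofReal (s ^ n)⁻¹ * (ofReal (C * (2 * funCoord ρ o y) ^ n) *
        (riemVolume g).restrict (riemBall g ((𝔠 n o).symm y) r) S) := by
        gcongr; exact h3.trans (by gcongr)
    _ = _ := by
        rw [← mul_assoc, ← ENNReal.ofReal_mul (by rw [hsdef]; positivity)]
        congr 2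
        have := hP.ε_pos
        rw [hsdef, mul_pow, mul_pow]
        field_simp

/-- Norms at the scale of the patch are controlled by norms on Riemannian balls. -/
lemma IsPatch.eLpNorm_zoom_le (hP : IsPatch ρ g r o R C ε) (hy : y ∈ halfBall o (2 * R))
    {F : M → ℝ} (hF : AEStronglyMeasurable F (riemVolume g)) (p : ℝ≥0∞) : eLpNorm
    (fun z => F (zoom ρ ε o y z)) p (volume.restrict (ball 0 1)) ≤ ofReal (C * 2 ^ n * (ε ^ n)⁻¹) ^
    (1 / p).toReal * eLpNorm F p ((riemVolume g).restrict (riemBall g ((𝔠 n o).symm y) r)) := by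
  have hle := hP.map_zoom_le hy
  have hc : ofReal (C * 2 ^ n * (ε ^ n)⁻¹) ≠ 0 := by
    have := hP.ε_pos
    have := hP.one_le_C
    rw [ne_eq, ENNReal.ofReal_eq_zero, not_le]
    positivity
  have hF' : AEStronglyMeasurable F (Measure.map (zoom ρ ε o y) (volume.restrict (ball 0 1))) :=
    AEStronglyMeasurable.mono_measure ((hF.mono_measure Measure.restrict_le_self).smul_measure _)
      hle
  have h1 := eLpNorm_map_measure (p := p) hF' (hP.aemeasurable_zoom hy)
  rw [show (fun z => F (zoom ρ ε o y z)) = F ∘ zoom ρ ε o y from rfl, ← h1]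
  refine (eLpNorm_mono_measure F hle).trans ?_
  rw [eLpNorm_smul_measure_of_ne_zero hc, smul_eq_mul]

/-- The comparison of measures handles the exponent `p`; Hölder's inequality on the unit ball then
lowers it to `q`. The constant does not depend on the centre `y`. -/
lemma IsPatch.memLp_zoom_le (hP : IsPatch ρ g r o R C ε) {F : M → ℝ}
    (hF : AEStronglyMeasurable F (riemVolume g))
      (hK : ⨆ x ∈ (𝓡∂ n).interior M, eLpNorm F p ((riemVolume g).restrict (riemBall g x r)) < ⊤)
    {q : ℝ≥0∞} (hq : q ≤ p) (hq0 : q ≠ 0) : ∃ K : ℝ≥0∞, K ≠ ⊤ ∧ ∀ y ∈ ℍ n o (2 * R),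
    eLpNorm (fun z => F (zoom ρ ε o y z)) q (volume.restrict (ball 0 1)) ≤ K := by
  obtain ⟨K, hKdef⟩ : ∃ K, K = ⨆ x ∈ ((𝓡∂ n).interior M : Set M),
    eLpNorm F p ((riemVolume g).restrict (riemBall g x r)) := ⟨_, rfl⟩
  obtain ⟨V, hV⟩ : ∃ V, V = (volume.restrict (ball (0 : 𝔼 n) 1)) univ := ⟨_, rfl⟩
  have hVt : V ≠ ⊤ := by rw [hV, Measure.restrict_apply_univ]; exact measure_ball_lt_top.ne
  have hV0 : V ≠ 0 := by
    rw [hV, Measure.restrict_apply_univ]; exact (Metric.measure_ball_pos _ _ one_pos).ne'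
  have hp0 : p ≠ 0 := fun h => hq0 (by simpa [h] using hq)
  refine ⟨ofReal (C * 2 ^ n * (ε ^ n)⁻¹) ^ (1 / p).toReal * K *
    V ^ (1 / q.toReal - 1 / p.toReal), ?_, fun y hy => ?_⟩
  · refine ENNReal.mul_ne_top (ENNReal.mul_ne_top (ENNReal.rpow_ne_top_of_nonneg
      ENNReal.toReal_nonneg ofReal_ne_top) (hKdef ▸ hK.ne)) ?_
    exact ENNReal.rpow_ne_top_of_ne_zero hV0 hVt
  · have hF' : AEStronglyMeasurable (fun z => F (zoom ρ ε o y z)) (volume.restrict (ball 0 1)) :=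
      AEStronglyMeasurable.comp_aemeasurable (AEStronglyMeasurable.mono_measure
        ((hF.mono_measure Measure.restrict_le_self).smul_measure _) (hP.map_zoom_le hy))
        (hP.aemeasurable_zoom hy)
    refine (eLpNorm_le_eLpNorm_mul_rpow_measure_univ hq hF').trans ?_
    rw [← hV]
    gcongr
    refine (hP.eLpNorm_zoom_le hy hF p).trans ?_
    gcongr
    rw [hKdef]
    exact le_iSup₂_of_le _ (symm_mem_interior (hP.dom
      (halfBall_mono o (by linarith [hP.R_pos]) hy))) le_rfl

lemma IsWeakDifferential.aestronglyMeasurable [CompactSpace M] (k : BilinField n M) (h :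
    IsWeakDifferential u α) : AEStronglyMeasurable u (riemVolume k) :=
  aestronglyMeasurable_riemVolume k fun o => (h o 0).1.aestronglyMeasurable

lemma IsWeakCovariantDerivative.isMeasurable (hg : IsC2Metric g) (hα : IsMeasurableCovector α)
    (h : IsWeakCovariantDerivative g α T) : IsMeasurableBilin T := by
  intro o i j
  have h1 : AEStronglyMeasurable (fun y => ∑ k, chris g o k i j y * covectorCoord α o k y)
      (𝔳 n o) := Finset.aestronglyMeasurable_fun_sum _ fun k _ =>
      ((hg.contDiffOn_chris o k i j).continuousOn.aestronglyMeasurable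
        (isOpen_domain o).measurableSet).mul (hα o k)
  refine ((h o i j).2.1.aestronglyMeasurable.sub h1).congr ?_
  filter_upwards [hg.christoffel_ae_eq o] with y hy
  simp only [Pi.sub_apply, hy, add_sub_cancel_right]

lemma IsC2Metric.aestronglyMeasurable_covectorInner [CompactSpace M] (k : BilinField n M)
    (hg : IsC2Metric g) (hα : IsMeasurableCovector α) (hβ : IsMeasurableCovector β) :
    AEStronglyMeasurable (fun x => covectorInner (g x) (α x) (β x)) (riemVolume k) := by
  refine aestronglyMeasurable_riemVolume k fun o => ?_
  refine AEStronglyMeasurable.congr (f := fun y => ∑ i, ∑ j, 𝔾 g o y i j *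
    covectorCoord α o i y * covectorCoord β o j y) ?_ ?_
  · exact Finset.aestronglyMeasurable_fun_sum _ fun i _ =>
      Finset.aestronglyMeasurable_fun_sum _ fun j _ =>
        ((hg.aestronglyMeasurable_inv o i j).mul (hα o i)).mul (hβ o j)
  · filter_upwards [ae_mem_domain o] with y hy
    exact (covectorInner_coord g α β hy).symm

lemma IsC2Metric.aestronglyMeasurable_covectorNorm [CompactSpace M] (k : BilinField n M)
    (hg : IsC2Metric g) (hα : IsMeasurableCovector α) :
    AEStronglyMeasurable (covectorNorm g α) (riemVolume k) :=
  Real.continuous_sqrt.comp_aestronglyMeasurable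
    (hg.aestronglyMeasurable_covectorInner k hα hα)

lemma IsC2Metric.aestronglyMeasurable_bilinTrace [CompactSpace M] (k : BilinField n M)
    (hg : IsC2Metric g) (hT : IsMeasurableBilin T) :
    AEStronglyMeasurable (fun x => bilinTrace (g x) (T x)) (riemVolume k) := by
  refine aestronglyMeasurable_riemVolume k fun o => ?_
  refine AEStronglyMeasurable.congr (f := fun y => ∑ i, ∑ j, 𝔾 g o y i j *
    bilinCoord T o i j y) ?_ ?_
  · exact Finset.aestronglyMeasurable_fun_sum _ fun i _ =>
      Finset.aestronglyMeasurable_fun_sum _ fun j _ =>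
        (hg.aestronglyMeasurable_inv o i j).mul (hT o i j)
  · filter_upwards [ae_mem_domain o] with y hy
    exact (bilinTrace_coord g T hy).symm

lemma IsC2Metric.aestronglyMeasurable_tensorNorm [CompactSpace M] (k : BilinField n M)
    (hg : IsC2Metric g) (hT : IsMeasurableBilin T) :
    AEStronglyMeasurable (tensorNorm g T) (riemVolume k) := by
  refine Real.continuous_sqrt.comp_aestronglyMeasurable
    (aestronglyMeasurable_riemVolume k fun o => ?_)
  refine AEStronglyMeasurable.congr (f := fun y => ∑ i, ∑ j, ∑ k, ∑ l, 𝔾 g o y i k * 𝔾 g o y j l *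
        bilinCoord T o i j y * bilinCoord T o k l y) ?_ ?_
  · exact Finset.aestronglyMeasurable_fun_sum _ fun i _ =>
      Finset.aestronglyMeasurable_fun_sum _ fun j _ =>
      Finset.aestronglyMeasurable_fun_sum _ fun k _ =>
      Finset.aestronglyMeasurable_fun_sum _ fun l _ =>
        (((hg.aestronglyMeasurable_inv o i k).mul (hg.aestronglyMeasurable_inv o j l)).mul
          (hT o i j)).mul (hT o k l)
  · filter_upwards [ae_mem_domain o] with y hy
    exact (tensorNormSq_coord g T hy).symm

lemma IsC2Metric.aemeasurable_coord (hg : IsC2Metric g) {F : M → ℝ≥0∞}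
    (hF : AEMeasurable F (riemVolume g)) (o : M) :
    AEMeasurable (fun y => F ((𝔠 n o).symm y)) (𝔳 n o) :=
  (hF.measurable_mk.comp_aemeasurable (aemeasurable_symm o)).congr
    (hg.ae_coord o hF.ae_eq_mk.symm)

/-- Local integrability on the interior of `M`, read in a chart. -/
lemma IsC2Metric.locallyIntegrableOn_coord (hg : IsC2Metric g)
    (hf : AEStronglyMeasurable f (riemVolume g))
    (h : ∀ x ∈ (𝓡∂ n).interior M, ∃ U, IsOpen U ∧ x ∈ U ∧ ∫⁻ x in U, ‖f x‖ₑ ∂riemVolume g < ⊤)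
    (o : M) : LocallyIntegrableOn (fun y => f ((𝔠 n o).symm y)) (𝔻 n o) := by
  intro y hy
  obtain ⟨U, hUo, hyU, hU⟩ := h _ (symm_mem_interior hy)
  have hv := hg.volDensity_pos hy
  have hDo : IsOpen (𝔻 n o ∩ (𝔠 n o).symm ⁻¹' U) :=
    (continuousOn_symm_coordDomain o).isOpen_inter_preimage (isOpen_domain o) hUo
  have hDo2 : IsOpen (𝔻 n o ∩ volDensity g o ⁻¹' Ioi (volDensity g o y / 2)) :=
    (hg.contDiffOn_volDensity o).continuousOn.isOpen_inter_preimage (isOpen_domain o)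
      isOpen_Ioi
  obtain ⟨D, hD⟩ : ∃ D, D = (𝔻 n o ∩ (𝔠 n o).symm ⁻¹' U) ∩
    (𝔻 n o ∩ volDensity g o ⁻¹' Ioi (volDensity g o y / 2)) := ⟨_, rfl⟩
  have hDo3 : IsOpen D := hD ▸ hDo.inter hDo2
  have hDc : D ⊆ coordDomain o := hD ▸ fun x hx => hx.1.1
  refine ⟨D, mem_nhdsWithin_of_mem_nhds (hDo3.mem_nhds ?_), ?_, ?_⟩
  · rw [hD]; exact ⟨⟨hy, hyU⟩, hy, by simpa using hv⟩
  · exact (hg.aestronglyMeasurable_coord hf o).mono_measure (Measure.restrict_mono hDc le_rfl)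
  · have h1 := hg.setLIntegral_image hDc hDo3 hf.aemeasurable.enorm
    have h2 : ∫⁻ x in (𝔠 n o).symm '' D, ‖f x‖ₑ ∂riemVolume g < ⊤ := by
      refine (lintegral_mono_set ?_).trans_lt hU
      rintro _ ⟨z, hz, rfl⟩
      rw [hD] at hz
      exact hz.1.2
    rw [h1] at h2
    have hc : ofReal (volDensity g o y / 2) ≠ 0 := by simpa using hv
    refine lt_of_mul_lt_mul_left' (a := ofReal (volDensity g o y / 2)) ?_
    rw [ENNReal.mul_top hc, ← lintegral_const_mul' _ _ ofReal_ne_top]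
    refine lt_of_le_of_lt (setLIntegral_mono' hDo3.measurableSet fun z hz => ?_) h2
    gcongr
    rw [hD] at hz
    exact (mem_Ioi.1 hz.2.2).le

lemma IsC2Metric.locallyIntegrableOn_coord_of_integrable (hg : IsC2Metric g)
    (hf : Integrable f (riemVolume g)) (o : M) :
    LocallyIntegrableOn (fun y => f ((𝔠 n o).symm y)) (𝔻 n o) :=
  hg.locallyIntegrableOn_coord hf.1 (fun _ _ => ⟨univ, isOpen_univ, mem_univ _, by
    rw [Measure.restrict_univ]; exact hf.2⟩) o

/-- On one rescaled ball around `x`, the elementary bound `F ≤ 1 + F ^ (n/2)` suffices, since `n/2 ≥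
1`. -/
lemma IsConfCompact.exists_open_lintegral_lt_top (hn : 3 ≤ n) (H : IsConfCompact ρ g gbar)
    (hr : 0 < r) {F : M → ℝ≥0∞} (hF : AEMeasurable F (riemVolume g)) (hFb : IsScaleBounded ρ g r F)
    (hx : x ∈ (𝓡∂ n).interior M) : ∃ U, IsOpen U ∧ x ∈ U ∧ ∫⁻ x in U, F x ∂riemVolume g < ⊤ := by
  obtain ⟨R, C, ε, hP⟩ := H.exists_isPatch hr x
  obtain ⟨A, hA, hAb⟩ := hFb x R C ε hP
  have hR := hP.R_pos
  have hy := mem_halfBall_self hx (R := 2 * R) (by linarith)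
  have hs := hP.scale_pos hy
  have hs2 : 0 < ε * funCoord ρ x (𝔠 n x x) * (1 / 2) := by positivity
  have hg := H.isC2Metric
  have hB : ball (𝔠 n x x) (ε * funCoord ρ x (𝔠 n x x) * (1 / 2)) ⊆
        ball (𝔠 n x x) (ε * funCoord ρ x (𝔠 n x x)) :=
    Metric.ball_subset_ball (by linarith)
  have hB3 := hB.trans (hP.ball_subset _ hy)
  refine ⟨_, isOpen_symm_image (hB3.trans hP.dom) Metric.isOpen_ball,
    ⟨_, Metric.mem_ball_self hs2, extChartAt_to_inv x⟩, ?_⟩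
  rw [hg.setLIntegral_image (hB3.trans hP.dom) Metric.isOpen_ball hF]
  obtain ⟨y, hydef⟩ : ∃ y, y = 𝔠 n x x := ⟨_, rfl⟩
  rw [← hydef] at hy hs hs2 hB hB3 ⊢
  have hC := hP.one_le_C
  have hρy : 0 < funCoord ρ x y := hP.rho_pos _ (halfBall_mono x (by linarith) hy)
  have h1 : ∀ z ∈ ball y (ε * funCoord ρ x y * (1 / 2)),
      ofReal (volDensity g x z) * F ((𝔠 n x).symm z) ≤ ofReal (C * ((funCoord ρ x y / 2) ^ n)⁻¹) *
        (1 + F ((𝔠 n x).symm z) ^ ((n : ℝ) / 2)) := by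
    intro z hz
    have hρz := hP.rho_pos z (hB3 hz)
    gcongr
    · refine (hP.dens_le z (hB3 hz)).trans ?_
      have := (hP.compar y hy z (hB hz)).1
      gcongr
      linarith
    · rcases le_total (F ((𝔠 n x).symm z)) 1 with h | h
      · exact h.trans le_self_add
      · refine le_trans ?_ le_add_self
        have h3 : (3 : ℝ) ≤ n := by exact_mod_cast hn
        calc _ = F ((𝔠 n x).symm z) ^ (1 : ℝ) := (ENNReal.rpow_one _).symm
          _ ≤ _ := ENNReal.rpow_le_rpow_of_exponent_le h (by linarith)
  refine (setLIntegral_mono' measurableSet_ball h1).trans_lt ?_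
  rw [lintegral_const_mul' _ _ ofReal_ne_top, lintegral_add_left measurable_const]
  refine ENNReal.mul_lt_top ENNReal.ofReal_lt_top (ENNReal.add_lt_top.2 ⟨?_, ?_⟩)
  · rw [setLIntegral_one]; exact measure_ball_lt_top
  · have h2 := setLIntegral_dilate
      (fun z => F ((𝔠 n x).symm z) ^ ((n : ℝ) / 2)) y hs (1 / 2)
    have h3 := h2 ▸ hAb y hy
    have hc : ofReal ((ε * funCoord ρ x y) ^ n)⁻¹ ≠ 0 := by
      rw [ne_eq, ENNReal.ofReal_eq_zero, not_le]; positivity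
    by_contra hcon
    rw [not_lt, top_le_iff] at hcon
    rw [hcon, ENNReal.mul_top hc, top_le_iff] at h3
    exact hA h3

/-! ### Conformal change of the scalar curvature -/

/-- Data of a function of class `W^{1,2}`. -/
structure IsW12 (g : BilinField n M) (u : M → ℝ) (α : CovectorField n M) : Prop where
  diff : IsWeakDifferential u α
  memLp : MemLp u 2 (riemVolume g)
  memLp' : MemLp (covectorNorm g α) 2 (riemVolume g)

/-- A conformal factor that is bounded from above and from below, together with its differential
and its Hessian, which act on `W^{1,2}`. -/
structure IsConfFactor (g : BilinField n M) (φ : M → ℝ) (w : CovectorField n M) (T : BilinField n M)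
    (a b : ℝ) : Prop where
  regular : IsC2Metric g
  a_pos : 0 < a
  pos : ∀ x ∈ (𝓡∂ n).interior M, 0 < φ x
  mem_Icc : ∀ᵐ x ∂riemVolume g, φ x ∈ Icc a b
  diff : IsWeakDifferential φ w
  cov : IsWeakCovariantDerivative g w T
  locSq : ∀ (o : M) (i j : Fin n), LocallyIntegrableOn
    (fun y => covectorCoord w o i y * covectorCoord w o j y) (coordDomain o)
  mulSq : ∀ u α, IsW12 g u α → MemLp (fun x => covectorNorm g w x * u x) 2 (riemVolume g)
  mulT : ∀ u α, IsW12 g u α → Integrable (fun x => tensorNorm g T x * u x ^ 2) (riemVolume g)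

namespace IsConfFactor

lemma pos_coord (hφ : IsConfFactor g φ w T a b) (hy : y ∈ coordDomain o) :
    0 < funCoord φ o y := hφ.pos _ (symm_mem_interior hy)

lemma mem_Icc_coord (hφ : IsConfFactor g φ w T a b) (o : M) :
    ∀ᵐ y ∂𝔳 n o, funCoord φ o y ∈ Icc a b := hφ.regular.ae_coord o hφ.mem_Icc

/-- A power is monotone or antitone according to the sign of `s`; the sum of the two endpoint values
bounds it in both cases. -/
lemma rpow_le (hφ : IsConfFactor g φ w T a b) (s : ℝ) {t : ℝ} (ht : t ∈ Icc a b) :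
    |t ^ s| ≤ a ^ s + b ^ s := by
  have ha := hφ.a_pos
  have ht0 := ha.trans_le ht.1
  have hb := ht0.trans_le ht.2
  rw [abs_of_pos (Real.rpow_pos_of_pos ht0 s)]
  rcases le_total 0 s with h | h
  · exact (Real.rpow_le_rpow ht0.le ht.2 h).trans (by simpa using (Real.rpow_pos_of_pos ha s).le)
  · exact (Real.rpow_le_rpow_of_nonpos ha ht.1 h).trans
      (by simpa using (Real.rpow_pos_of_pos hb s).le)

lemma hasWeakPartial_rpow (hφ : IsConfFactor g φ w T a b) (s : ℝ) (o : M) (i : Fin n) :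
    HasWeakPartial (coordDomain o) i (fun y => funCoord φ o y ^ s)
    (fun y => s * funCoord φ o y ^ (s - 1) * covectorCoord w o i y) := by
  -- A null coordinate domain contains no witness of `a ≤ b`; every identity almost everywhere is
  -- then trivial.
  obtain hz | hz := eq_zero_or_neZero
    (𝔳 n o : Measure (𝔼 n))
  · refine ((hφ.diff o i).const_mul 0).congr (isOpen_domain o).measurableSet ?_ ?_ <;>
    simp [hz]
  have hab : a ≤ b := by
    obtain ⟨y, hy⟩ := (hφ.mem_Icc_coord o).exists
    exact hy.1.trans hy.2
  have hne : ∀ t ∈ Icc a b, t ≠ 0 := fun t ht => (hφ.a_pos.trans_le ht.1).ne'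
  exact (hφ.diff o i).comp_Icc (isOpen_domain o) (F := fun t => t ^ s)
    (F' := fun t => s * t ^ (s - 1)) hab
    (fun t ht => Real.hasDerivAt_rpow_const (Or.inl (hne t ht)))
    (continuousOn_const.mul (continuousOn_id.rpow_const fun t ht => Or.inl (hne t ht)))
    (hφ.mem_Icc_coord o)

lemma aestronglyMeasurable_rpow (hφ : IsConfFactor g φ w T a b) (s : ℝ) (o : M) :
    AEStronglyMeasurable (fun y => funCoord φ o y ^ s) (𝔳 n o) :=
  (hφ.hasWeakPartial_rpow s o 0).1.aestronglyMeasurable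

lemma ae_abs_rpow_le (hφ : IsConfFactor g φ w T a b) (s : ℝ) (o : M) :
    ∀ᵐ y ∂𝔳 n o, |funCoord φ o y ^ s| ≤ a ^ s + b ^ s :=
  (hφ.mem_Icc_coord o).mono fun _ hy => hφ.rpow_le s hy

end IsConfFactor

/-- The components of `(2 / (n - 2)) d(log φ)`. -/
def logCoord (φ : M → ℝ) (w : CovectorField n M) (o : M) (i : Fin n) (y : 𝔼 n) : ℝ :=
  2 / (n - 2) * (funCoord φ o y ^ (-1 : ℝ) * covectorCoord w o i y)

/-- The derivatives of the components of `(2 / (n - 2)) d(log φ)`. -/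
def dlogCoord (g : BilinField n M) (φ : M → ℝ) (w : CovectorField n M) (T : BilinField n M) (o : M)
    (i m : Fin n) (y : 𝔼 n) : ℝ :=
  2 / (n - 2) * (-1 * funCoord φ o y ^ (-1 - 1 : ℝ) * covectorCoord w o m y *
    covectorCoord w o i y + funCoord φ o y ^ (-1 : ℝ) * (bilinCoord T o i m y +
      ∑ k, christoffel g o k i m y * covectorCoord w o k y))

namespace IsConfFactor

/-- Product rule for `φ⁻¹ · dφ`. The derivative of `φ⁻¹` brings the quadratic term `w_m w_i`, whose
local integrability is the condition `locSq`. -/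
lemma hasWeakPartial_logCoord (hφ : IsConfFactor g φ w T a b) (o : M) (i m : Fin n) :
    HasWeakPartial (coordDomain o) m (logCoord φ w o i) (dlogCoord g φ w T o i m) := by
  have hm := hφ.aestronglyMeasurable_rpow
  have hl := hφ.ae_abs_rpow_le
  refine HasWeakPartial.const_mul (HasWeakPartial.mul (isOpen_domain o)
    (hφ.hasWeakPartial_rpow (-1) o m) (hφ.cov o i m) ?_ ?_ ?_) _
  · exact LocallyIntegrableOn.bdd_mul (hφ.cov o i m).1 (hm _ o) (hl _ o)
  · have := (LocallyIntegrableOn.bdd_mul (hφ.locSq o m i) (hm (-1 - 1) o) (hl _ o)).smul (-1 : ℝ)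
    refine locallyIntegrableOn_congr (.of_forall fun y => ?_) this
    simp only [Pi.smul_apply, smul_eq_mul]; ring
  · exact LocallyIntegrableOn.bdd_mul (hφ.cov o i m).2.1 (hm _ o) (hl _ o)

/-- The components of the gradient of `(2 / (n - 2)) log φ`. -/
def logUp (g : BilinField n M) (φ : M → ℝ) (w : CovectorField n M) (o : M) (k : Fin n) (y : 𝔼 n) :
    ℝ := ∑ l, logCoord φ w o l y * 𝔾 g o y k l

/-- The derivatives of the components of the gradient of `(2 / (n - 2)) log φ`. -/
def dlogUp (g : BilinField n M) (φ : M → ℝ) (w : CovectorField n M) (T : BilinField n M) (o : M)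
    (k m : Fin n) (y : 𝔼 n) : ℝ :=
  ∑ l, (dlogCoord g φ w T o l m y * 𝔾 g o y k l + logCoord φ w o l y *
    𝐃 (fun y => 𝔾 g o y k l) y (ê m))

lemma inv_metricMatrix_conformal (hφ : IsConfFactor g φ w T a b) (hy : y ∈ coordDomain o)
    (i j : Fin n) : (metricMatrix (conformal φ g) o y)⁻¹ i j =
    (funCoord φ o y ^ (critExp n - 2))⁻¹ * 𝔾 g o y i j := by
  have hp := Real.rpow_pos_of_pos (hφ.pos_coord hy) (critExp n - 2)
  let := invertibleOfNonzero hp.ne'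
  have e : metricMatrix (conformal φ g) o y =
      funCoord φ o y ^ (critExp n - 2) • metricMatrix g o y := rfl
  rw [e, Matrix.inv_smul _ _ (hφ.regular.isUnit_det hy), Matrix.smul_apply, invOf_eq_inv,
    smul_eq_mul]

lemma hasWeakPartial_conformal (hφ : IsConfFactor g φ w T a b) (o : M) (i j k : Fin n) :
    HasWeakPartial (coordDomain o) k (bilinCoord (conformal φ g) o i j) (fun y => (critExp n - 2) *
    funCoord φ o y ^ (critExp n - 2 - 1) * covectorCoord w o k y * bilinCoord g o i j y +
    funCoord φ o y ^ (critExp n - 2) * 𝐃 (bilinCoord g o i j) y (ê k)) :=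
  (hφ.hasWeakPartial_rpow _ o k).mul_contDiffOn (isOpen_domain o)
    ((hφ.regular.contDiffOn o i j).of_le (by norm_num))

/-- Since `N - 2 = 4/(n-2)`, the logarithmic derivative of `φ^(N-2)` is twice `logCoord`, and the
factor `φ^(N-2)` itself is cancelled by the inverse metric. -/
lemma christoffel_conformal (hn : 3 ≤ n) (hφ : IsConfFactor g φ w T a b) (o : M) :
    ∀ᵐ y ∂𝔳 n o, ∀ k i j, christoffel (conformal φ g) o k i j y = chris g o k i j y +
    confDiff (fun i j => bilinCoord g o i j y) (fun i => logCoord φ w o i y)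
    (fun k => logUp g φ w o k y) k i j := by
  have h := ae_all_iff.2 fun i => ae_all_iff.2 fun j => ae_all_iff.2 fun k =>
    (hφ.hasWeakPartial_conformal o i j k).weakPartial_ae_eq (isOpen_domain o)
  have hnR : (3 : ℝ) ≤ n := by exact_mod_cast hn
  filter_upwards [h, ae_mem_domain o]
    with y hy hyD k i j
  have hp := hφ.pos_coord hyD
  have hpp := Real.rpow_pos_of_pos hp (critExp n - 2)
  obtain ⟨c, hc⟩ : ∃ c, c = funCoord φ o y ^ (critExp n - 2) := ⟨_, rfl⟩
  have hd : ∀ i j k, weakPartial (coordDomain o) k (bilinCoord (conformal φ g) o i j) y =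
      c * (2 * logCoord φ w o k y * bilinCoord g o i j y + 𝐃 (bilinCoord g o i j) y (ê k)) := by
    intro i j k
    rw [hy, logCoord, Real.rpow_sub_one hp.ne', Real.rpow_neg_one, ← hc, critExp]
    have : (n : ℝ) - 2 ≠ 0 := by linarith
    field_simp
    ring
  have hδ : ∀ i, ∑ l, 𝔾 g o y k l * bilinCoord g o i l y = if k = i then 1 else 0 := fun i => by
    rw [← hφ.regular.sum_inv_mul hyD]
    exact sum_congr rfl fun l _ => by rw [hφ.regular.bilinCoord_symm hyD]
  have e1 : christoffel (conformal φ g) o k i j y = chris g o k i j y +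
      (logCoord φ w o i y * ∑ l, 𝔾 g o y k l * bilinCoord g o j l y
      + logCoord φ w o j y * ∑ l, 𝔾 g o y k l * bilinCoord g o i l y
      - bilinCoord g o i j y * logUp g φ w o k y) := by
    rw [christoffel, chris, logUp]
    simp only [hd, hφ.inv_metricMatrix_conformal hyD, ← hc, mul_sum,
      ← sum_add_distrib, ← sum_sub_distrib]
    refine sum_congr rfl fun l _ => ?_
    have : c ≠ 0 := hc ▸ hpp.ne'
    field_simp
    ring
  rw [e1, hδ, hδ, confDiff]
  simp only [mul_ite, mul_one, mul_zero]

/-- The symbols of the conformal metric are `C¹` functions plus products of `C¹` functions with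
`logCoord`. This is the regularity that allows its curvature to be defined. -/
lemma hasWeakPartial_christoffel (hn : 3 ≤ n) (hφ : IsConfFactor g φ w T a b) (o : M)
    (k i j m : Fin n) : HasWeakPartial (coordDomain o) m (christoffel (conformal φ g) o k i j) fun y
    => 𝐃 (chris g o k i j) y (ê m) + ((if k = j then dlogCoord g φ w T o i m y else 0) + (if k =
    i then dlogCoord g φ w T o j m y else 0) - (𝐃 (bilinCoord g o i j) y (ê m) * logUp g φ w o k y +
    bilinCoord g o i j y * dlogUp g φ w T o k m y)) := by
  have hD := isOpen_domain (n := n) o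
  have hg := hφ.regular
  have hlog := fun l => hφ.hasWeakPartial_logCoord o l m
  have h1 : ∀ (p : Prop) [Decidable p] (l : Fin n), HasWeakPartial (coordDomain o) m
      (fun y => if p then logCoord φ w o l y else 0)
      (fun y => if p then dlogCoord g φ w T o l m y else 0) := by
    intro p _ l
    split_ifs
    · exact hlog l
    · exact hasWeakPartial_zero
  have h2 := (HasWeakPartial.sum Finset.univ fun l _ => (hlog l).mul_contDiffOn hD
    ((hg.contDiffOn_inv o k l).of_le (by norm_num))).mul_contDiffOn hD
      ((hg.contDiffOn o i j).of_le (by norm_num))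
  refine ((hasWeakPartial_of_contDiffOn hD (hg.contDiffOn_chris o k i j)).add
    (((h1 (k = j) i).add (h1 (k = i) j)).sub h2)).congr hD.measurableSet ?_
    (.of_forall fun y => ?_)
  · filter_upwards [hφ.christoffel_conformal hn o] with y hy
    rw [hy, confDiff, mul_comm (bilinCoord g o i j y)]
    rfl
  · simp only [logUp, dlogUp]; ring

/-- The conformal change of the scalar curvature. -/
lemma isScalarCurvature (hn : 3 ≤ n) (hφ : IsConfFactor g φ w T a b) :
    IsScalarCurvature (conformal φ g) fun x => (φ x ^ (critExp n - 2))⁻¹ *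
    (scal g x - 4 * ((n : ℝ) - 1) / (n - 2) * ((φ x)⁻¹ * bilinTrace (g x) (T x))) := by
  have hg := hφ.regular
  refine fun o => ⟨fun i j k => ⟨_, hφ.hasWeakPartial_conformal o i j k⟩,
    fun k i j l => ⟨_, hφ.hasWeakPartial_christoffel hn o k i j l⟩, ?_⟩
  have h := ae_all_iff.2 fun k => ae_all_iff.2 fun i => ae_all_iff.2 fun j =>
    ae_all_iff.2 fun l => (hφ.hasWeakPartial_christoffel hn o k i j l).weakPartial_ae_eq
      (isOpen_domain o)
  have hnR : (3 : ℝ) ≤ n := by exact_mod_cast hn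
  filter_upwards [h, hφ.christoffel_conformal hn o, hg.christoffel_ae_eq o, hg.scal_ae_eq o,
    ae_mem_domain o] with y h1 h2 h3 h4 hy
  have hp := hφ.pos_coord hy
  -- All quantities are frozen at the point `y`, so that the algebraic identities for the Ricci
  -- tensor apply to them.
  obtain ⟨G, hG⟩ : ∃ G : Fin n → Fin n → ℝ, G = fun i j => bilinCoord g o i j y := ⟨_, rfl⟩
  obtain ⟨I, hI⟩ : ∃ I : Fin n → Fin n → ℝ, I = fun i j => 𝔾 g o y i j := ⟨_, rfl⟩
  obtain ⟨f, hf⟩ : ∃ f : Fin n → ℝ, f = fun i => logCoord φ w o i y := ⟨_, rfl⟩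
  obtain ⟨F, hF⟩ : ∃ F : Fin n → ℝ, F = fun k => logUp g φ w o k y := ⟨_, rfl⟩
  obtain ⟨Γ, hΓ⟩ : ∃ Γ : Fin n → Fin n → Fin n → ℝ, Γ = fun k i j => chris g o k i j y := ⟨_, rfl⟩
  obtain ⟨dG, hdG⟩ : ∃ dG : Fin n → Fin n → Fin n → ℝ, dG = fun m i j =>
    𝐃 (bilinCoord g o i j) y (ê m) := ⟨_, rfl⟩
  obtain ⟨df, hdf⟩ : ∃ df : Fin n → Fin n → ℝ, df = fun i m => dlogCoord g φ w T o i m y := ⟨_, rfl⟩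
  obtain ⟨dF, hdF⟩ : ∃ dF : Fin n → Fin n → ℝ, dF = fun k m => dlogUp g φ w T o k m y := ⟨_, rfl⟩
  have aG : ∀ i j, G i j = G j i := fun i j => by rw [hG]; exact hg.bilinCoord_symm hy i j
  have aI : ∀ i j, I i j = I j i := fun i j => by rw [hI]; exact hg.inv_symm hy i j
  have aΓ : ∀ k i j, Γ k i j = Γ k j i := fun k i j => by rw [hΓ]; exact hg.chris_symm hy k i j
  have aIG : ∀ i k, ∑ j, I i j * G j k = if i = k then 1 else 0 := fun i k => by
    rw [hI, hG]; exact hg.sum_inv_mul hy i k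
  have adG : ∀ m i j, dG m i j = ∑ a, (Γ a m i * G a j + Γ a m j * G a i) := fun m i j => by
    rw [hdG, hΓ, hG]; exact hg.fderiv_bilinCoord_eq hy m i j
  have af : ∀ i, F i = ∑ k, I i k * f k := fun i => by
    rw [hF, hI, hf]; exact sum_congr rfl fun l _ => mul_comm _ _
  have aGI : ∀ i l, ∑ k, G i k * I k l = if i = l then 1 else 0 := fun i l => by
    rw [hG, hI]; exact hg.sum_mul_inv hy i l
  have aF : ∀ i, ∑ k, G i k * F k = f i := fun i => by
    simp only [af, mul_sum]
    rw [sum_comm]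
    simp only [← mul_assoc, ← sum_mul, aGI, ite_mul, one_mul, zero_mul, Finset.sum_ite_eq,
      Finset.mem_univ, if_true]
  have adF : ∀ i m, ∑ k, (dG m i k * F k + G i k * dF k m) = df i m := fun i m => by
    have e : ∀ k, dG m i k * F k + G i k * dF k m = ∑ l, (df l m * (G i k * I k l) +
        f l * (dG m i k * I k l + G i k * 𝐃 (fun y => 𝔾 g o y k l) y (ê m))) := by
      intro k
      rw [af, hdF, hdf, hf, hI]
      simp only [dlogUp, mul_sum, ← sum_add_distrib]
      exact sum_congr rfl fun l _ => by ring
    simp only [e]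
    rw [sum_comm]
    have e2 : ∀ l, ∑ k, (df l m * (G i k * I k l) + f l * (dG m i k * I k l + G i k *
          𝐃 (fun y => 𝔾 g o y k l) y (ê m))) = df l m * (if i = l then 1 else 0) := by
      intro l
      rw [sum_add_distrib, ← mul_sum, ← mul_sum, aGI]
      have := hg.sum_fderiv_mul_inv hy m i l
      rw [hdG, hG, hI]
      rw [this, mul_zero, add_zero]
    simp [e2]
  have hric : ∀ i j, ricciCoord (conformal φ g) o i j y = ric g o i j y +
      (df i j + df j i - n * df i j + (n - 2) * ∑ l, Γ l i j * f l
        - G i j * (∑ k, dF k k + ∑ l, (∑ k, Γ k k l) * F l)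
        + (n - 2) * (f i * f j - G i j * ∑ l, f l * F l)) := by
    intro i j
    have key := ricci_confDiff aG aΓ adG aF adF i j
    rw [ricciCoord, ric]
    simp only [h1, h2]
    rw [hG, hf, hF, hΓ, hdG, hdf, hdF] at key
    rw [hG, hf, hF, hΓ, hdf, hdF]
    simp only [if_true, mul_add, add_mul, sum_add_distrib, sum_sub_distrib] at key ⊢
    linarith
  have htr := trace_ricci_confDiff aI aIG aG aΓ adG af aF adF
  have hsum : ∑ i, ∑ j, (metricMatrix (conformal φ g) o y)⁻¹ i j *
      ricciCoord (conformal φ g) o i j y = (funCoord φ o y ^ (critExp n - 2))⁻¹ *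
        (scalChart g o y + (-(2 * (n - 1)) * ∑ i, ∑ j, I i j * (df i j - ∑ k, Γ k i j * f k)
        - (n - 1) * (n - 2) * ∑ i, ∑ j, I i j * f i * f j)) := by
    rw [← htr, scalChart, mul_add, mul_sum, mul_sum, ← sum_add_distrib]
    refine sum_congr rfl fun i _ => ?_
    rw [mul_sum, mul_sum, ← sum_add_distrib]
    refine sum_congr rfl fun j _ => ?_
    rw [hric, hφ.inv_metricMatrix_conformal hy, hI]
    ring
  rw [hsum, h4, bilinTrace_coord g T hy]
  change (funCoord φ o y ^ _)⁻¹ * (_ - _ * ((funCoord φ o y)⁻¹ * _)) = _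
  congr 1
  rw [sub_eq_add_neg]
  congr 1
  -- With the coefficient `2/(n-2)` in `f = d(log φ^{2/(n-2)})`, the terms quadratic in `dφ` cancel
  -- and only the Hessian of `φ` remains.
  have hterm : ∀ i j, -(2 * ((n : ℝ) - 1)) * (I i j * (df i j - ∑ k, Γ k i j * f k))
      - (n - 1) * (n - 2) * (I i j * f i * f j) = -(4 * ((n : ℝ) - 1) / (n - 2) *
        ((funCoord φ o y)⁻¹ * (𝔾 g o y i j * bilinCoord T o i j y))) := by
    intro i j
    have e : ∑ k, Γ k i j * f k = 2 / (n - 2) * ((funCoord φ o y)⁻¹ *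
        ∑ k, chris g o k i j y * covectorCoord w o k y) := by
      rw [hΓ, hf]
      simp only [logCoord, Real.rpow_neg_one, mul_sum]
      exact sum_congr rfl fun k _ => by ring
    rw [e, hdf, hf, hI]
    simp only [dlogCoord, logCoord, h3, Real.rpow_sub_one hp.ne', Real.rpow_neg_one]
    have h2' : (n : ℝ) - 2 ≠ 0 := by linarith
    have hp' := hp.ne'
    generalize ∑ k, chris g o k i j y * covectorCoord w o k y = S
    field_simp
    ring
  simp only [mul_sum, ← sum_sub_distrib, ← Finset.sum_neg_distrib] at hterm ⊢
  exact sum_congr rfl fun i _ => sum_congr rfl fun j _ => (hterm i j).symm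

end IsConfFactor

lemma ae_mem_interior (k : BilinField n M) [CompactSpace M] :
    ∀ᵐ x ∂riemVolume k, x ∈ (𝓡∂ n).interior M := by
  rw [ae_iff]; exact riemVolume_compl_interior k

lemma IsC2Metric.locallyIntegrableOn_coord_of_memLp (hg : IsC2Metric g)
    (hf : MemLp f 2 (riemVolume g)) (o : M) :
    LocallyIntegrableOn (fun y => f ((𝔠 n o).symm y)) (𝔻 n o) := by
  have h1 := hg.locallyIntegrableOn_coord_of_integrable hf.integrable_sq o
  have h2 : LocallyIntegrableOn (fun _ => (1 : ℝ)) (𝔻 n o) :=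
    (locallyIntegrable_const 1).locallyIntegrableOn _
  refine LocallyIntegrableOn.of_abs_le (h2.add h1) (hg.aestronglyMeasurable_coord hf.1 o)
    (.of_forall fun y => ?_)
  simp only [Pi.add_apply]
  generalize f ((𝔠 n o).symm y) = t
  rw [abs_of_nonneg (by positivity : 0 ≤ 1 + t ^ 2), abs_le]
  constructor <;> nlinarith [sq_nonneg (t - 1), sq_nonneg (t + 1)]

/-- Products of square integrable tensors are locally integrable in coordinates. -/
lemma IsC2Metric.locallyIntegrableOn_mul (hg : IsC2Metric g) {A B : M → ℝ}
    (hA : MemLp A 2 (riemVolume g)) (hB : MemLp B 2 (riemVolume g)) {c d f h : 𝔼 n → ℝ}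
    (hc : ContinuousOn c (coordDomain o)) (hd : ContinuousOn d (coordDomain o))
    (hf : AEStronglyMeasurable f (𝔳 n o)) (hh : AEStronglyMeasurable h (𝔳 n o))
    (h1 : ∀ y ∈ coordDomain o, |f y| ≤ |A ((𝔠 n o).symm y)| * c y)
    (h2 : ∀ y ∈ coordDomain o, |h y| ≤ |B ((𝔠 n o).symm y)| * d y) :
    LocallyIntegrableOn (fun y => f y * h y) (coordDomain o) := by
  have hD := isOpen_domain (n := n) o
  have hi : Integrable (fun x => |A x * B x|) (riemVolume g) := (hA.integrable_mul hB).abs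
  refine LocallyIntegrableOn.of_abs_le ((hg.locallyIntegrableOn_coord_of_integrable hi
    o).mul_continuousOn (hc.mul hd) hD.isLocallyClosed) (hf.mul hh) ?_
  filter_upwards [ae_restrict_mem hD.measurableSet] with y hy
  rw [abs_mul]
  refine (mul_le_mul (h1 y hy) (h2 y hy) (abs_nonneg _)
    ((abs_nonneg _).trans (h1 y hy))).trans (le_trans (le_of_eq ?_) (le_abs_self _))
  simp only [Pi.mul_apply, abs_mul]
  ring

variable [CompactSpace M]

/-! ### Uniform estimates at the scale of a patch -/

/-- In the variable `z` with `y + s z` and `s = ε ρ(y)`, the metric is uniformly comparable with a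
constant multiple of the Euclidean one and its Christoffel symbols are bounded. The bounds on
Riemannian balls thus become `W^{2,q}` bounds on the unit ball, and the interior estimate applies
with a constant independent of `y`. -/
lemma IsPatch.exists_scale_bound (hn : 3 ≤ n) (hP : IsPatch ρ g r o R C ε) (hg : IsC2Metric g)
    (hu : IsWeakDifferential u α) (hT : IsWeakCovariantDerivative g α T) (hp : (n : ℝ≥0∞) / 2 < p)
    (h0 : ⨆ x ∈ (𝓡∂ n).interior M, eLpNorm u p ((riemVolume g).restrict (riemBall g x r)) < ⊤) (h1 :
    ⨆ x ∈ (𝓡∂ n).interior M, eLpNorm (covectorNorm g α) p ((riemVolume g).restrict (riemBall g x r))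
    < ⊤) (h2 : ⨆ x ∈ (𝓡∂ n).interior M, eLpNorm (tensorNorm g T) p ((riemVolume g).restrict
    (riemBall g x r)) < ⊤) : ∃ K : ℝ≥0∞, K ≠ ⊤ ∧ ∀ y ∈ ℍ n o (2 * R),
    (∀ᵐ z ∂(volume.restrict (ball 0 (1 / 2))), ‖u (zoom ρ ε o y z)‖ₑ ≤ K) ∧
    eLpNorm (fun z => covectorNorm g α (zoom ρ ε o y z)) n (volume.restrict (ball 0 (1 / 2))) ≤
    K := by
  have hn2 : (1 : ℝ≥0∞) ≤ n / 2 := by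
    rw [ENNReal.le_div_iff_mul_le (by simp) (by simp)]
    norm_num; omega
  have hnn : (n : ℝ≥0∞) / 2 < n := ENNReal.half_lt_self (by simp; omega) (by simp)
  -- The Sobolev step requires `q < n`, whereas `p` may be large or infinite; only `q > n/2` matters
  -- afterwards.
  obtain ⟨q, hq1, hq2⟩ := ENNReal.lt_iff_exists_nnreal_btwn.1 (lt_min hp hnn)
  have hqp : (q : ℝ≥0∞) ≤ p := (hq2.trans_le (min_le_left _ _)).le
  have hqn : (q : ℝ) < n := by
    have := hq2.trans_le (min_le_right _ _)
    exact_mod_cast this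
  have hq1' : (n : ℝ) / 2 < q := by
    have h := (ENNReal.toReal_lt_toReal (ENNReal.div_ne_top (by simp) (by simp))
      ENNReal.coe_ne_top).2 hq1
    simpa using h
  have hqone : (1 : ℝ≥0∞) ≤ q := hn2.trans hq1.le
  have hq0 : (q : ℝ≥0∞) ≠ 0 := (zero_lt_one.trans_le hqone).ne'
  obtain ⟨C₀, hC₀, H⟩ := exists_interior_second_order_const (by omega : 2 ≤ n) hq1' hqn
  have mα := hg.aestronglyMeasurable_covectorNorm g hu.isMeasurable
  have mT := hg.aestronglyMeasurable_tensorNorm g (hT.isMeasurable hg hu.isMeasurable)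
  obtain ⟨K0, hK0, B0⟩ := hP.memLp_zoom_le (hu.aestronglyMeasurable g) h0 hqp hq0
  obtain ⟨K1, hK1, B1⟩ := hP.memLp_zoom_le mα h1 hqp hq0
  obtain ⟨K2, hK2, B2⟩ := hP.memLp_zoom_le mT h2 hqp hq0
  have hε := hP.ε_pos
  have hC := hP.one_le_C
  -- The three terms bound, in order, the rescaled first derivatives, the tensor `T`, and the
  -- product of Christoffel symbols with first derivatives. The factors `2 ε` and `4 ε²` come from
  -- `s ≤ 2 ε ρ`.
  obtain ⟨L, hL⟩ : ∃ L, L = 2 * ε * C + 4 * ε ^ 2 * C + 4 * ε ^ 2 * (n * C ^ 2) := ⟨_, rfl⟩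
  obtain ⟨K, hK⟩ : ∃ K, K = K0 + ofReal |L| * (K1 + K2) := ⟨_, rfl⟩
  have hKt : K ≠ ⊤ := by rw [hK]; finiteness
  refine ⟨C₀ * K + ofReal |2 * C * ε⁻¹| * (n * (C₀ * K)), by finiteness, fun y hy => ?_⟩
  have hs := hP.scale_pos hy
  obtain ⟨s, hsdef⟩ : ∃ s, s = ε * funCoord ρ o y := ⟨_, rfl⟩
  have hs' : 0 < s := hsdef ▸ hs
  have hball : ball 0 1 ⊆ dilate y s ⁻¹' 𝔻 n o := fun z hz =>
    hP.dom (hP.ball_subset y hy (by rw [hsdef]; exact hP.dilate_mem hy hz))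
  have hz3 : ∀ z ∈ ball 0 1, dilate y s z ∈ halfBall o (3 * R) := fun z hz =>
    hP.ball_subset y hy (by rw [hsdef]; exact hP.dilate_mem hy hz)
  have hzs : ∀ z ∈ ball 0 1, s * (funCoord ρ o (dilate y s z))⁻¹ ≤ 2 * ε := by
    intro z hz
    have h := (hP.compar y hy (dilate y s z) (by rw [hsdef]; exact hP.dilate_mem hy hz)).1
    have hpos := hP.rho_pos _ (hz3 z hz)
    rw [← div_eq_mul_inv, div_le_iff₀ hpos]
    calc s ≤ ε * (2 * funCoord ρ o (dilate y s z)) := by rw [hsdef]; gcongr; rwa [← hsdef]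
      _ = _ := by ring
  have hzoom : ∀ z, zoom ρ ε o y z = (𝔠 n o).symm (dilate y s z) := by intro z; rw [hsdef]; rfl
  have hmem := ae_restrict_mem (μ := volume)
    (Metric.isOpen_ball (x := (0 : 𝔼 n)) (ε := 1)).measurableSet
  have meas : ∀ {F : M → ℝ}, AEStronglyMeasurable F (riemVolume g) → AEStronglyMeasurable
      (fun z => F (zoom ρ ε o y z)) (volume.restrict (ball 0 1)) := fun hF =>
    AEStronglyMeasurable.comp_aemeasurable (AEStronglyMeasurable.mono_measure
      ((hF.mono_measure Measure.restrict_le_self).smul_measure _) (hP.map_zoom_le hy))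
      (hP.aemeasurable_zoom hy)
  have b1 : ∀ z ∈ ball 0 1, ∀ i, |s * covectorCoord α o i (dilate y s z)| ≤
      2 * ε * C * covectorNorm g α (zoom ρ ε o y z) := by
    intro z hz i
    have e := hP.covectorCoord_le hg α (hz3 z hz) i
    rw [abs_mul, abs_of_pos hs', hzoom]
    calc _ ≤ s * _ := mul_le_mul_of_nonneg_left e hs'.le
      _ = s * (funCoord ρ o (dilate y s z))⁻¹ * C * covectorNorm g α
          ((𝔠 n o).symm (dilate y s z)) := by ring
      _ ≤ _ := by
          exact mul_le_mul_of_nonneg_right (mul_le_mul_of_nonneg_right (hzs z hz) (by positivity))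
            (covectorNorm_nonneg _ _ _)
  have b2 : ∀ᵐ z ∂(volume.restrict (ball 0 1)), ∀ i j,
      |s * (s * (bilinCoord T o i j (dilate y s z) + ∑ k, christoffel g o k i j (dilate y s z) *
        covectorCoord α o k (dilate y s z)))| ≤
      L * (covectorNorm g α (zoom ρ ε o y z) + tensorNorm g T (zoom ρ ε o y z)) := by
    have hch : ∀ᵐ z ∂(volume.restrict (ball 0 1)), ∀ k i j,
        christoffel g o k i j (dilate y s z) = chris g o k i j (dilate y s z) := by
      refine (ae_dilate (P := fun x => ∀ k i j, christoffel g o k i j x = chris g o k i j x)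
        y hs' 1).2 (ae_mono (Measure.restrict_mono ?_ le_rfl) (hg.christoffel_ae_eq o))
      rw [mul_one, hsdef]
      exact (hP.ball_subset y hy).trans hP.dom
    filter_upwards [hmem, hch] with z hz hchz i j
    have hpos := hP.rho_pos _ (hz3 z hz)
    have e1 := hP.bilinCoord_le hg T (hz3 z hz) i j
    have e2 : ∀ k, |christoffel g o k i j (dilate y s z) * covectorCoord α o k (dilate y s z)| ≤
        C * (funCoord ρ o (dilate y s z))⁻¹ * (C * (funCoord ρ o (dilate y s z))⁻¹ *
          covectorNorm g α (zoom ρ ε o y z)) := by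
      intro k
      rw [hchz, abs_mul, hzoom]
      exact mul_le_mul (hP.chris_le _ (hz3 z hz) k i j) (hP.covectorCoord_le hg α (hz3 z hz) k)
        (abs_nonneg _) (by positivity)
    have e3 : |∑ k, christoffel g o k i j (dilate y s z) * covectorCoord α o k (dilate y s z)| ≤
        n * (C ^ 2 * (funCoord ρ o (dilate y s z) ^ 2)⁻¹ * covectorNorm g α (zoom ρ ε o y z)) := by
      refine (Finset.abs_sum_le_sum_abs _ _).trans ((sum_le_sum fun k _ => e2 k).trans ?_)
      rw [Finset.sum_const, Finset.card_univ, Fintype.card_fin, nsmul_eq_mul, ← inv_pow]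
      exact le_of_eq (by ring)
    have e4 : s ^ 2 * (funCoord ρ o (dilate y s z) ^ 2)⁻¹ ≤ 4 * ε ^ 2 := by
      calc _ = (s * (funCoord ρ o (dilate y s z))⁻¹) ^ 2 := by rw [mul_pow, inv_pow]
        _ ≤ (2 * ε) ^ 2 := by have := hzs z hz; gcongr
        _ = _ := by ring
    have n1 := covectorNorm_nonneg g α (zoom ρ ε o y z)
    have n2 := tensorNorm_nonneg g T (zoom ρ ε o y z)
    rw [← mul_assoc, abs_mul, abs_of_pos (mul_pos hs' hs')]
    rw [← hzoom] at e1
    calc _ ≤ s * s * (C * (funCoord ρ o (dilate y s z) ^ 2)⁻¹ * tensorNorm g T (zoom ρ ε o y z)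
          + n * (C ^ 2 * (funCoord ρ o (dilate y s z) ^ 2)⁻¹ *
          covectorNorm g α (zoom ρ ε o y z))) := by
          gcongr; exact (abs_add_le _ _).trans (add_le_add e1 e3)
      _ = s ^ 2 * (funCoord ρ o (dilate y s z) ^ 2)⁻¹ * (C * tensorNorm g T (zoom ρ ε o y z) +
          n * C ^ 2 * covectorNorm g α (zoom ρ ε o y z)) := by ring
      _ ≤ 4 * ε ^ 2 * (C * tensorNorm g T (zoom ρ ε o y z) +
          n * C ^ 2 * covectorNorm g α (zoom ρ ε o y z)) :=
          mul_le_mul_of_nonneg_right e4 (by positivity)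
      _ ≤ _ := by
          rw [hL]
          have i1 : 0 ≤ (2 * ε * C + 4 * ε ^ 2 * (n * C ^ 2)) * tensorNorm g T (zoom ρ ε o y z) :=
              by
            positivity
          have i2 : 0 ≤ (2 * ε * C + 4 * ε ^ 2 * C) * covectorNorm g α (zoom ρ ε o y z) := by
            positivity
          linarith only [i1, i2]
  have hKle : ofReal |L| * (K1 + K2) ≤ K := hK ▸ le_add_self
  have key := H (fun z => u ((𝔠 n o).symm (dilate y s z)))
    (fun i z => s * covectorCoord α o i (dilate y s z))
    (fun i j z => s * (s * (bilinCoord T o i j (dilate y s z) +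
      ∑ k, christoffel g o k i j (dilate y s z) * covectorCoord α o k (dilate y s z)))) K
    (fun i => ((hu o i).comp_dilate (isOpen_domain o) y hs').mono hball)
    (fun i j => (((hT o i j).comp_dilate (isOpen_domain o) y hs').mono hball).const_mul s)
    (by simp only [← hzoom]; exact (B0 y hy).trans (hK ▸ le_self_add))
    (fun i => by
      refine (eLpNorm_le_of_abs_le (c := L) hqone (meas mα) (meas mT) ?_).trans
        ((mul_le_mul_right (add_le_add (B1 y hy) (B2 y hy)) _).trans hKle)
      filter_upwards [hmem] with z hz
      refine (b1 z hz i).trans ?_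
      have n1 := covectorNorm_nonneg g α (zoom ρ ε o y z)
      have n2 := tensorNorm_nonneg g T (zoom ρ ε o y z)
      rw [hL]
      have i1 : 0 ≤ (2 * ε * C + 4 * ε ^ 2 * C + 4 * ε ^ 2 * (n * C ^ 2)) *
        tensorNorm g T (zoom ρ ε o y z) := by positivity
      have i2 : 0 ≤ (4 * ε ^ 2 * C + 4 * ε ^ 2 * (n * C ^ 2)) *
        covectorNorm g α (zoom ρ ε o y z) := by positivity
      linarith only [i1, i2])
    (fun i j => (eLpNorm_le_of_abs_le (c := L) hqone (meas mα) (meas mT)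
        (b2.mono fun z hz => hz i j)).trans
        ((mul_le_mul_right (add_le_add (B1 y hy) (B2 y hy)) _).trans hKle))
  refine ⟨?_, ?_⟩
  · filter_upwards [key.1] with z hz
    rw [hzoom]; exact hz.trans le_self_add
  · refine le_trans ?_ le_add_self
    have hsub : ball (0 : 𝔼 n) (1 / 2) ⊆ ball 0 1 := Metric.ball_subset_ball (by norm_num)
    -- The norm is at most `C ρ` times the sum of the components, and `ρ ≤ 2 ρ(y) = 2 ε⁻¹ s` on the
    -- ball.
    refine (eLpNorm_mono_ae (g := (2 * C * ε⁻¹) • ∑ i, fun z =>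
      |s * covectorCoord α o i (dilate y s z)|) ?_).trans ?_
    · filter_upwards [ae_restrict_mem Metric.isOpen_ball.measurableSet] with z hz
      have hz := hsub hz
      have hpos := hP.rho_pos _ (hz3 z hz)
      rw [Real.norm_eq_abs, Real.norm_eq_abs, abs_of_nonneg (covectorNorm_nonneg _ _ _), hzoom]
      refine ((hP.covectorNorm_le α (hz3 z hz)).trans ?_).trans (le_abs_self _)
      rw [Pi.smul_apply, Finset.sum_apply, smul_eq_mul]
      simp only [abs_mul, abs_of_pos hs', ← mul_sum]
      rw [← mul_assoc]
      have h := (hP.compar y hy (dilate y s z) (by rw [hsdef]; exact hP.dilate_mem hy hz)).2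
      refine mul_le_mul_of_nonneg_right ?_ (Finset.sum_nonneg fun i _ => abs_nonneg _)
      calc _ ≤ C * (2 * funCoord ρ o y) := by gcongr
        _ = _ := by rw [hsdef]; field_simp
    · rw [eLpNorm_const_smul, ← Real.norm_eq_abs, ofReal_norm]
      gcongr
      have hm : ∀ i, AEStronglyMeasurable (fun z => s * covectorCoord α o i (dilate y s z))
          (volume.restrict (ball 0 (1 / 2))) := fun i =>
        (((hu o i).comp_dilate (isOpen_domain o) y hs').mono
          (hsub.trans hball)).2.1.aestronglyMeasurable
      refine (eLpNorm_sum_le (fun i _ => (hm i).norm) (by exact_mod_cast (by omega : 1 ≤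
        n))).trans ?_
      calc _ ≤ ∑ _i : Fin n, C₀ * K := sum_le_sum fun i _ => by
            refine le_trans (le_of_eq ?_) (key.2 i)
            exact eLpNorm_norm _
        _ = _ := by simp

/-! ### Potentials that are uniformly bounded at small scales -/

/-- Finitely many patches cover the interior. On each of them the density is comparable with
`ρ^(-n)`, and `ρ²` times the sum of the squared components of `du` is bounded by a multiple of
`|du|_g²`, so the finiteness hypothesis of the patch estimate is the `W^{1,2}` condition. -/
lemma IsConfCompact.lintegral_mul_sq_lt_top (hn : 3 ≤ n) (H : IsConfCompact ρ g gbar) (hr : 0 < r)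
    {F : M → ℝ≥0∞} (hF : AEMeasurable F (riemVolume g)) (hFb : IsScaleBounded ρ g r F)
    (hu : IsWeakDifferential u α) (h0 : MemLp u 2 (riemVolume g))
    (h1 : MemLp (covectorNorm g α) 2 (riemVolume g)) :
    ∫⁻ x, F x * ‖u x‖ₑ ^ 2 ∂riemVolume g < ⊤ := by
  have hg := H.isC2Metric
  choose R C ε hP using fun x : M => H.exists_isPatch hr x
  obtain ⟨t, ht⟩ := exists_finset_halfBall_cover (n := n) (M := M) fun x => (hP x).R_pos
  have hR := fun x => (hP x).R_pos
  have hsub : ∀ x, ℍ n x (R x) ⊆ halfBall x (3 * R x) := fun x =>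
    halfBall_mono x (by linarith [hR x])
  have hum : AEMeasurable (fun x => F x * ‖u x‖ₑ ^ 2) (riemVolume g) :=
    hF.mul (h0.1.aemeasurable.enorm.pow_const 2)
  refine hg.lintegral_lt_top_of_cover (fun x => (hsub x).trans (hP x).dom)
    (fun x => isOpen_halfBall x _) ht hum fun x _ => ?_
  obtain ⟨A, hA, hAb⟩ := hFb x _ _ _ (hP x)
  have hC := (hP x).one_le_C
  have hm3 : MeasurableSet (ℍ n x (3 * R x)) := (isOpen_halfBall x _).measurableSet
  have key := (hP x).lintegral_mul_sq_lt_top hn (H.continuousOn_rho x)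
    ((hg.aemeasurable_coord hF x).mono_measure (Measure.restrict_mono (hP x).dom le_rfl)) hA hAb
    (fun i => (hu x i).mono (hP x).dom) ?_
  · have hle : ∫⁻ y in halfBall x (R x), ofReal (volDensity g x y) *
        (F ((𝔠 n x).symm y) * ‖u ((𝔠 n x).symm y)‖ₑ ^ 2) ≤ ofReal (C x) * ∫⁻ y in halfBall x (R x),
          ofReal (funCoord ρ x y ^ n)⁻¹ * (F ((𝔠 n x).symm y) * ‖(u ∘ (𝔠 n x).symm) y‖ₑ ^ 2) := by
      rw [← lintegral_const_mul' _ _ ofReal_ne_top]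
      refine setLIntegral_mono' (isOpen_halfBall x _).measurableSet fun y hy => ?_
      rw [← mul_assoc (ofReal (C x)), ← ENNReal.ofReal_mul (by linarith)]
      gcongr
      · exact (hP x).dens_le y (hsub x hy)
      · exact le_rfl
    exact hle.trans_lt (ENNReal.mul_lt_top ENNReal.ofReal_lt_top key)
  · obtain ⟨c, hc⟩ : ∃ c, c = (n : ℝ) * C x ^ 2 := ⟨_, rfl⟩
    have hfin : ∫⁻ x, (‖u x‖ₑ ^ 2 + ofReal c * ‖covectorNorm g α x‖ₑ ^ 2) ∂riemVolume g < ⊤ := by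
      rw [lintegral_add_left' (h0.1.aemeasurable.enorm.pow_const 2),
        lintegral_const_mul' _ _ ofReal_ne_top]
      exact ENNReal.add_lt_top.2 ⟨lintegral_enorm_sq_lt_top h0,
        ENNReal.mul_lt_top ENNReal.ofReal_lt_top (lintegral_enorm_sq_lt_top h1)⟩
    have m1 : AEMeasurable (fun x => ‖u x‖ₑ ^ 2) (riemVolume g) :=
      h0.1.aemeasurable.enorm.pow_const 2
    have m2 : AEMeasurable (fun x => ofReal c * ‖covectorNorm g α x‖ₑ ^ 2)
      (riemVolume g) := (h1.1.aemeasurable.enorm.pow_const 2).const_mul _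
    have m3 : AEMeasurable (fun x => ‖u x‖ₑ ^ 2 + ofReal c * ‖covectorNorm g α x‖ₑ ^ 2)
      (riemVolume g) := m1.add m2
    have himg := hg.setLIntegral_image (hP x).dom (isOpen_halfBall x _) m3
    have hfin2 := himg ▸ ((setLIntegral_le_lintegral _ _).trans_lt hfin)
    refine lt_of_le_of_lt ?_ (ENNReal.mul_lt_top (ENNReal.ofReal_lt_top (r := C x)) hfin2)
    rw [← lintegral_const_mul' _ _ ofReal_ne_top]
    refine setLIntegral_mono' hm3 fun y hy => ?_
    have hρ := (hP x).rho_pos y hy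
    rw [← mul_assoc (ofReal (C x)), ← ENNReal.ofReal_mul (by linarith)]
    refine mul_le_mul' (ENNReal.ofReal_le_ofReal ((hP x).le_dens y hy)) (add_le_add le_rfl ?_)
    have hi : ∀ i, ofReal (funCoord ρ x y ^ 2) * ‖covectorCoord α x i y‖ₑ ^ 2 ≤
        ofReal (C x ^ 2) * ‖covectorNorm g α ((𝔠 n x).symm y)‖ₑ ^ 2 := by
      intro i
      have h := (hP x).covectorCoord_le hg α hy i
      rw [← enorm_pow, ← enorm_pow, Real.enorm_eq_ofReal (sq_nonneg _),
        Real.enorm_eq_ofReal (sq_nonneg _), ← ENNReal.ofReal_mul (by positivity),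
        ← ENNReal.ofReal_mul (by positivity)]
      refine ENNReal.ofReal_le_ofReal ?_
      rw [← mul_pow, ← mul_pow, ← sq_abs, abs_mul, abs_of_pos hρ]
      refine pow_le_pow_left₀ (by positivity) ?_ 2
      calc _ ≤ funCoord ρ x y * _ := mul_le_mul_of_nonneg_left h hρ.le
        _ = _ := by field_simp
    rw [mul_sum]
    refine (sum_le_sum fun i _ => hi i).trans (le_of_eq ?_)
    rw [Finset.sum_const, Finset.card_univ, Fintype.card_fin, nsmul_eq_mul, hc,
      ENNReal.ofReal_mul (by positivity), ENNReal.ofReal_natCast, mul_assoc]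

/-- Data of a function of class `X^{2,p}`. -/
structure IsX2 (g : BilinField n M) (r : ℝ) (p : ℝ≥0∞) (u : M → ℝ) (α : CovectorField n M)
    (T : BilinField n M) : Prop where
  diff : IsWeakDifferential u α
  cov : IsWeakCovariantDerivative g α T
  bound₀ : ⨆ x ∈ (𝓡∂ n).interior M, eLpNorm u p ((riemVolume g).restrict (riemBall g x r)) < ⊤
  bound₁ : ⨆ x ∈ (𝓡∂ n).interior M,
    eLpNorm (covectorNorm g α) p ((riemVolume g).restrict (riemBall g x r)) < ⊤
  bound₂ : ⨆ x ∈ (𝓡∂ n).interior M,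
    eLpNorm (tensorNorm g T) p ((riemVolume g).restrict (riemBall g x r)) < ⊤

lemma IsWeaklyDifferentiable.spec (h : IsWeaklyDifferentiable n u) :
    IsWeakDifferential u (weakDifferential n u) := by
  rw [weakDifferential, dif_pos h]; exact h.choose_spec

lemma MemX2.exists_isX2 (h : MemX2 g r p u) : ∃ T, IsX2 g r p u (weakDifferential n u) T := by
  obtain ⟨h1, T, hT, hb⟩ := h
  refine ⟨T, h1.spec, hT, lt_of_le_of_lt ?_ hb, lt_of_le_of_lt ?_ hb, lt_of_le_of_lt ?_ hb⟩
  · exact iSup₂_mono fun x _ => le_self_add.trans le_self_add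
  · exact iSup₂_mono fun x _ => le_add_self.trans le_self_add
  · exact iSup₂_mono fun x _ => le_add_self

/-- The power `n/2` of the square is the power `n`: this is the gradient part of
`IsPatch.exists_scale_bound`. -/
lemma IsX2.isScaleBounded_covectorNorm (hn : 3 ≤ n) (hg : IsC2Metric g) (hp : (n : ℝ≥0∞) / 2 < p)
    (h : IsX2 g r p u α T) : IsScaleBounded ρ g r fun x => ‖covectorNorm g α x‖ₑ ^ 2 := by
  intro o R C ε hP
  obtain ⟨K, hK, hb⟩ := hP.exists_scale_bound hn hg h.diff h.cov hp h.bound₀ h.bound₁ h.bound₂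
  refine ⟨K ^ (n : ℝ), ENNReal.rpow_ne_top_of_nonneg (by positivity) hK, fun y hy => ?_⟩
  have h1 := (hb y hy).2
  have hn0 : (n : ℝ≥0∞) ≠ 0 := by simp; omega
  have hnR : (0 : ℝ) < n := by exact_mod_cast (by omega : 0 < n)
  rw [eLpNorm_eq_lintegral_rpow_enorm_toReal hn0 (by simp), ENNReal.toReal_natCast, one_div (n : ℝ),
    ENNReal.rpow_inv_le_iff hnR] at h1
  refine le_trans (le_of_eq ?_) h1
  congr 1; ext z
  beta_reduce
  rw [← ENNReal.rpow_natCast, ← ENNReal.rpow_mul]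
  congr 1; push_cast; ring

/-- No gain of integrability is needed for the Hessian: `p > n/2` and Hölder's inequality suffice.
-/
lemma IsX2.isScaleBounded_tensorNorm (hn : 3 ≤ n) (hg : IsC2Metric g) (hp : (n : ℝ≥0∞) / 2 < p)
    (h : IsX2 g r p u α T) : IsScaleBounded ρ g r fun x => ‖tensorNorm g T x‖ₑ := by
  intro o R C ε hP
  have hn0 : (n : ℝ≥0∞) / 2 ≠ 0 := by simp; omega
  have hnt : (n : ℝ≥0∞) / 2 ≠ ⊤ := ENNReal.div_ne_top (by simp) (by simp)
  have hnR : (0 : ℝ) < n / 2 := by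
    have : (0 : ℝ) < n := by exact_mod_cast (by omega : 0 < n)
    positivity
  obtain ⟨K, hK, hb⟩ := hP.memLp_zoom_le (hg.aestronglyMeasurable_tensorNorm g
    (h.cov.isMeasurable hg h.diff.isMeasurable)) h.bound₂ hp.le hn0
  refine ⟨K ^ ((n : ℝ) / 2), ENNReal.rpow_ne_top_of_nonneg hnR.le hK, fun y hy => ?_⟩
  have h1 := hb y hy
  have e : ((n : ℝ≥0∞) / 2).toReal = n / 2 := by simp
  rw [eLpNorm_eq_lintegral_rpow_enorm_toReal hn0 hnt, e, one_div ((n : ℝ) / 2),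
    ENNReal.rpow_inv_le_iff hnR] at h1
  exact (lintegral_mono_set (Metric.ball_subset_ball (by norm_num))).trans h1

/-- Functions of class `X^{2,p}` are bounded. -/
lemma IsX2.exists_ae_le (hn : 3 ≤ n) (H : IsConfCompact ρ g gbar) (hr : 0 < r) (hp : (n : ℝ≥0∞)
    / 2 < p) (h : IsX2 g r p u α T) : ∃ K : ℝ, ∀ᵐ x ∂riemVolume g, |u x| ≤ K := by
  have hg := H.isC2Metric
  choose R C ε hP using fun x : M => H.exists_isPatch hr x
  obtain ⟨t, ht⟩ := exists_finset_halfBall_cover (n := n) (M := M) fun x => (hP x).R_pos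
  have hR := fun x => (hP x).R_pos
  choose K hK hb using fun x => (hP x).exists_scale_bound hn hg h.diff h.cov hp h.bound₀ h.bound₁
    h.bound₂
  refine ⟨∑ x ∈ t, (K x).toReal, ae_riemVolume_of_cover g (fun x => (halfBall_mono x
    (by linarith [hR x])).trans (hP x).dom) (fun x => (isOpen_halfBall x (R x)).measurableSet)
    ht fun x hx => ?_⟩
  rw [ae_restrict_iff' (isOpen_halfBall x (R x)).measurableSet, ae_iff]
  -- The bound is known almost everywhere on a small ball around each point; there are uncountably
  -- many such balls, so null sets are glued by second countability.
  refine measure_null_of_locally_null _ fun y hy => ?_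
  have hyR : y ∈ halfBall x (2 * R x) := by
    by_contra hcon
    exact hy fun hyR => absurd (halfBall_mono x (by linarith [hR x]) hyR) hcon
  have hs := (hP x).scale_pos hyR
  refine ⟨ball y (ε x * funCoord ρ x y * (1 / 2)) ∩
    {a | ¬(a ∈ halfBall x (R x) → |u ((𝔠 n x).symm a)| ≤ ∑ x ∈ t, (K x).toReal)},
    Filter.inter_mem (mem_nhdsWithin_of_mem_nhds (Metric.ball_mem_nhds y (by positivity)))
      self_mem_nhdsWithin, ?_⟩
  have h1 := (ae_dilate (P := fun z => ‖u ((𝔠 n x).symm z)‖ₑ ≤ K x) y hs (1 / 2)).1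
    (hb x y hyR).1
  rw [ae_restrict_iff' measurableSet_ball, ae_iff] at h1
  refine measure_mono_null ?_ h1
  rintro z ⟨hz, hz2⟩ hcon
  refine hz2 fun _ => ?_
  have h2 : |u ((𝔠 n x).symm z)| ≤ (K x).toReal := by
    rw [← Real.norm_eq_abs, ← toReal_enorm]
    exact ENNReal.toReal_mono (hK x) (hcon hz)
  exact h2.trans (Finset.single_le_sum (f := fun x => (K x).toReal)
    (fun _ _ => ENNReal.toReal_nonneg) hx)

/-! ### Multiplication of functions of class `W^{1,2}` -/

/-- In `d(ζ u) = u dζ + ζ du` the first term is the delicate one: it is square integrable by the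
hypothesis on `|κ| u`, which is also what makes it locally integrable in coordinates. -/
lemma IsW12.mul (hg : IsC2Metric g) (hζ : IsWeakDifferential ζ κ)
    (hb : ∀ᵐ x ∂riemVolume g, |ζ x| ≤ K) (hu : IsW12 g u α)
    (hκ : MemLp (fun x => covectorNorm g κ x * u x) 2 (riemVolume g)) :
    IsW12 g (fun x => ζ x * u x) (fun x => u x • κ x + ζ x • α x) := by
  have mζ := hζ.aestronglyMeasurable g
  have hd : IsWeakDifferential (fun x => ζ x * u x) (fun x => u x • κ x + ζ x • α x) := by
    intro o i
    have hc : ContinuousOn (fun y => √(bilinCoord g o i i y)) (coordDomain o) :=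
      Real.continuous_sqrt.comp_continuousOn (hg.contDiffOn o i i).continuousOn
    have hbc := hg.ae_coord o hb
    have l2 : LocallyIntegrableOn (fun y => covectorCoord κ o i y *
        (u ∘ (𝔠 n o).symm) y) (coordDomain o) := by
      refine LocallyIntegrableOn.of_abs_le ((hg.locallyIntegrableOn_coord_of_memLp hκ
        o).mul_continuousOn hc (isOpen_domain o).isLocallyClosed)
        ((hζ.isMeasurable o i).mul (hu.diff o i).1.aestronglyMeasurable) ?_
      filter_upwards [ae_mem_domain o] with y hy
      rw [abs_mul, abs_mul, abs_mul, abs_of_nonneg (covectorNorm_nonneg _ _ _),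
        abs_of_nonneg (Real.sqrt_nonneg _), mul_right_comm]
      exact mul_le_mul_of_nonneg_right (hg.abs_covectorCoord_le κ hy i) (abs_nonneg _)
    refine ((hζ o i).mul (isOpen_domain o) (hu.diff o i)
      (LocallyIntegrableOn.bdd_mul (hu.diff o i).1 (hζ o i).1.aestronglyMeasurable hbc) l2
      (LocallyIntegrableOn.bdd_mul (hu.diff o i).2.1 (hζ o i).1.aestronglyMeasurable
        hbc)).congr (isOpen_domain o).measurableSet (.of_forall fun y => rfl)
        (.of_forall fun y => ?_)
    change _ = u _ * κ _ _ + ζ _ * α _ _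
    rw [mul_comm (u _)]
    rfl
  refine ⟨hd, ?_, ?_⟩
  · refine (hu.memLp.const_mul K).mono (mζ.mul hu.memLp.1) ?_
    filter_upwards [hb] with x hx
    rw [norm_mul, norm_mul, Real.norm_eq_abs, Real.norm_eq_abs K]
    exact mul_le_mul_of_nonneg_right (hx.trans (le_abs_self K)) (norm_nonneg _)
  · have hm := hg.aestronglyMeasurable_covectorNorm g hd.isMeasurable
    rw [memLp_two_iff_integrable_sq hm]
    refine ((hκ.integrable_sq.const_mul 2).add ((hu.memLp'.integrable_sq.const_mul
      (2 * K ^ 2)))).mono' (hm.pow 2) ?_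
    filter_upwards [hb, ae_mem_interior g] with x hx hi
    rw [Real.norm_of_nonneg (by positivity), Pi.add_apply, mul_pow]
    refine (hg.sq_covectorNorm _ hi).le.trans ?_
    rw [hg.sq_covectorNorm κ hi, hg.sq_covectorNorm α hi]
    have h1 := two_mul_abs_covectorInner_le (B := g x) (hg.symm x hi) (hg.pos x hi) (u x) (ζ x)
      (κ x) (α x)
    have h2 := covectorNormSq_smul_add_smul (B := g x) (hg.symm x hi) (u x) (ζ x) (κ x) (α x)
    have h3 : ζ x ^ 2 * covectorNormSq (g x) (α x) ≤ K ^ 2 * covectorNormSq (g x) (α x) :=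
      mul_le_mul_of_nonneg_right (sq_le_sq' (abs_le.1 hx).1 (abs_le.1 hx).2)
        (covectorNormSq_nonneg (B := g x) (hg.symm x hi) (hg.pos x hi) _)
    refine h2.le.trans ?_
    have h4 := le_abs_self (u x * ζ x * covectorInner (g x) (κ x) (α x))
    linarith

lemma IsX2.memLp_covectorNorm_mul (hn : 3 ≤ n) (H : IsConfCompact ρ g gbar) (hr : 0 < r)
    (hp : (n : ℝ≥0∞) / 2 < p) (h : IsX2 g r p φ w T) (hu : IsW12 g u α) :
    MemLp (fun x => covectorNorm g w x * u x) 2 (riemVolume g) := by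
  have hg := H.isC2Metric
  have m := hg.aestronglyMeasurable_covectorNorm g h.diff.isMeasurable
  have h1 := H.lintegral_mul_sq_lt_top hn hr (m.aemeasurable.enorm.pow_const 2)
    (h.isScaleBounded_covectorNorm hn hg hp) hu.diff hu.memLp hu.memLp'
  refine (memLp_two_iff_integrable_sq (m.mul hu.memLp.1)).2 ⟨(m.mul hu.memLp.1).pow 2, ?_⟩
  simpa only [HasFiniteIntegral, Pi.mul_apply, enorm_pow, enorm_mul, mul_pow] using h1

lemma IsX2.integrable_tensorNorm_mul_sq (hn : 3 ≤ n) (H : IsConfCompact ρ g gbar) (hr : 0 < r)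
    (hp : (n : ℝ≥0∞) / 2 < p) (h : IsX2 g r p φ w T) (hu : IsW12 g u α) :
    Integrable (fun x => tensorNorm g T x * u x ^ 2) (riemVolume g) := by
  have hg := H.isC2Metric
  have m := hg.aestronglyMeasurable_tensorNorm g (h.cov.isMeasurable hg h.diff.isMeasurable)
  have h1 := H.lintegral_mul_sq_lt_top hn hr m.aemeasurable.enorm
    (h.isScaleBounded_tensorNorm hn hg hp) hu.diff hu.memLp hu.memLp'
  refine ⟨m.mul (hu.memLp.1.pow 2), ?_⟩
  simpa only [HasFiniteIntegral, enorm_pow, enorm_mul] using h1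

lemma IsX2.exists_isConfFactor (hn : 3 ≤ n) (H : IsConfCompact ρ g gbar) (hr : 0 < r)
    (hp : (n : ℝ≥0∞) / 2 < p) (hpos : ∀ x ∈ (𝓡∂ n).interior M, 0 < φ x) (h : IsX2 g r p φ w T)
    {w' : CovectorField n M} {T' : BilinField n M} (h' : IsX2 g r p (fun x => (φ x)⁻¹) w' T') :
    ∃ a b, IsConfFactor g φ w T a b := by
  have hg := H.isC2Metric
  obtain ⟨K, hK⟩ := h.exists_ae_le hn H hr hp
  obtain ⟨L, hL⟩ := h'.exists_ae_le hn H hr hp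
  -- The lower bound of `φ` comes from the upper bound `L` of `φ⁻¹`; the form `|L| + 1` makes it
  -- positive without information on `L`.
  refine ⟨(|L| + 1)⁻¹, K, hg, by positivity, hpos, ?_, h.diff, h.cov, fun o i j => ?_,
    fun u α hu => h.memLp_covectorNorm_mul hn H hr hp hu,
    fun u α hu => h.integrable_tensorNorm_mul_sq hn H hr hp hu⟩
  · filter_upwards [hK, hL, ae_mem_interior g] with x h1 h2 hx
    have hp := hpos x hx
    refine ⟨inv_le_of_inv_le₀ hp ?_, (le_abs_self _).trans h1⟩
    linarith [le_abs_self (φ x)⁻¹, le_abs_self L]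
  · have m := hg.aestronglyMeasurable_covectorNorm g h.diff.isMeasurable
    have h1 := hg.locallyIntegrableOn_coord (m.pow 2) (fun x hx => by
      have := H.exists_open_lintegral_lt_top hn hr (m.aemeasurable.enorm.pow_const 2)
        (h.isScaleBounded_covectorNorm hn hg hp) hx
      simpa only [enorm_pow, Pi.pow_apply] using this) o
    have hc : ∀ i, ContinuousOn (fun y => √(bilinCoord g o i i y)) (coordDomain o) := fun i =>
      Real.continuous_sqrt.comp_continuousOn (hg.contDiffOn o i i).continuousOn
    refine LocallyIntegrableOn.of_abs_le (h1.mul_continuousOn ((hc i).mul (hc j))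
      (isOpen_domain o).isLocallyClosed)
      ((h.diff.isMeasurable o i).mul (h.diff.isMeasurable o j)) ?_
    filter_upwards [ae_mem_domain o] with y hy
    have e := mul_le_mul (hg.abs_covectorCoord_le w hy i) (hg.abs_covectorCoord_le w hy j)
      (abs_nonneg _) (mul_nonneg (covectorNorm_nonneg _ _ _) (Real.sqrt_nonneg _))
    rw [abs_mul]
    refine e.trans (le_trans (le_of_eq ?_) (le_abs_self _))
    simp only [Pi.mul_apply, Pi.pow_apply]
    ring

lemma IsWeakCovariantDerivative.isMeasurable_left (hS : IsWeakCovariantDerivative g β S) :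
    IsMeasurableCovector β := fun o i => (hS o i 0).1.aestronglyMeasurable

lemma IsC2Metric.integral_mul_bilinTrace (hg : IsC2Metric g) (hS : IsWeakCovariantDerivative g β S)
    (hη : ContMDiff (𝓡∂ n) 𝓘(ℝ, ℝ) ∞ η) (hs : tsupport η ⊆ 𝕌 n o) : ∫ x, η x * bilinTrace (g x)
    (S x) ∂riemVolume g = -∫ x, covectorInner (g x) (dform η x) (β x) ∂riemVolume g := by
  have hDo := isOpen_domain (n := n) o
  have hβ := hS.isMeasurable_left
  obtain ⟨h1, h2, h3⟩ := exists_chart_test_function hη hs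
  have key := hg.integral_bilinTrace_mul_chart hS h1 h2 h3
  have hd0 : ∀ x ∉ 𝕌 n o, covectorInner (g x) (dform η x) (β x) = 0 := by
    intro x hx
    have e : η =ᶠ[𝓝 x] fun _ => 0 := notMem_tsupport_iff_eventuallyEq.1 fun h => hx (hs h)
    have e2 : dform (n := n) η x = (0 : 𝔼 n →L[ℝ] ℝ) := by
      rw [dform, e.mfderiv_eq, mfderiv_const]; rfl
    rw [e2]
    simp [covectorInner]
  have m1 : AEStronglyMeasurable (fun x => η x * bilinTrace (g x) (S x)) (riemVolume g) :=
    hη.continuous.aestronglyMeasurable.mul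
      (hg.aestronglyMeasurable_bilinTrace g (hS.isMeasurable hg hβ))
  have m2 := hg.aestronglyMeasurable_covectorInner g (isMeasurableCovector_dform hη) hβ
  rw [← setIntegral_eq_integral_of_forall_compl_eq_zero (s := 𝕌 n o) fun x hx => by
      rw [image_eq_zero_of_notMem_tsupport fun h => hx (hs h), zero_mul],
    ← setIntegral_eq_integral_of_forall_compl_eq_zero (s := 𝕌 n o) hd0,
    setIntegral_coordImage g o (hg.aemeasurable_volDensity o)
      (by rw [← riemVolume_restrict]; exact m1.restrict),
    setIntegral_coordImage g o (hg.aemeasurable_volDensity o)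
      (by rw [← riemVolume_restrict]; exact m2.restrict)]
  have hfd : ∀ y ∉ 𝔻 n o, ∀ k, 𝐃 ((𝔻 n o).indicator (funCoord η o)) y (ê k) = 0 := by
    intro y hy k
    have := notMem_tsupport_iff_eventuallyEq.1 fun h => hy (h3 h)
    rw [this.fderiv_eq]
    simp
  refine Eq.trans ?_ (key.trans (congrArg Neg.neg ?_))
  · refine Eq.trans (setIntegral_congr_fun hDo.measurableSet fun y hy => ?_)
      (setIntegral_eq_integral_of_forall_compl_eq_zero (s := 𝔻 n o)
        fun y hy => by rw [indicator_of_notMem hy, mul_zero])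
    rw [indicator_of_mem hy, bilinTrace_coord g S hy, funCoord]
    ring
  · refine Eq.trans (setIntegral_eq_integral_of_forall_compl_eq_zero (s := 𝔻 n o)
      fun y hy => by simp [hfd y hy]).symm (setIntegral_congr_fun hDo.measurableSet fun y hy => ?_)
    beta_reduce
    rw [covectorInner_coord g (dform η) β hy]
    have e : (𝔻 n o).indicator (funCoord η o) =ᶠ[𝓝 y] funCoord η o := by
      filter_upwards [hDo.mem_nhds hy] with z hz using indicator_of_mem hz _
    simp only [covectorCoord_dform hη hy, e.fderiv_eq]

/-! ### The divergence theorem -/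

/-- The dangerous term is `f k χ'(k ρ) dρ`. Since `|dρ|_g ≤ C₁ ρ`, its norm is at most `C₁` times
the bounded quantity `|t χ'(t)|` at `t = k ρ`, whatever `k`. -/
lemma IsConfCompact.exists_covectorNorm_dform_cutoff_le (H : IsConfCompact ρ g gbar)
    (hf : ContMDiff (𝓡∂ n) 𝓘(ℝ, ℝ) ∞ f) (hf1 : ∀ x, |f x| ≤ 1) :
    ∃ L, ∀ (k : ℕ), ∀ x ∈ (𝓡∂ n).interior M, covectorNorm g (dform (cutoff ρ f k)) x ≤ L := by
  have hg := H.isC2Metric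
  obtain ⟨A, hA⟩ := exists_abs_mul_deriv_smoothStep_le
  obtain ⟨C₁, hC₁, h1⟩ := H.exists_covectorNorm_dform_le H.rho.smooth
  obtain ⟨C₂, hC₂, h2⟩ := H.exists_covectorNorm_dform_le hf
  obtain ⟨P, hP⟩ := isCompact_univ.bddAbove_image H.rho.smooth.continuous.continuousOn
  refine ⟨√(2 * (A * C₁) ^ 2 + 2 * (C₂ * P) ^ 2), fun k x hx => Real.sqrt_le_sqrt ?_⟩
  have hρ0 := H.rho.nonneg x
  have hρP : ρ x ≤ P := hP ⟨x, mem_univ _, rfl⟩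
  have e1 := two_mul_abs_covectorInner_le (B := g x) (hg.symm x hx) (hg.pos x hx)
    (f x * (k * deriv smoothStep (k * ρ x))) (smoothStep (k * ρ x)) (dform ρ x) (dform f x)
  have e2 := covectorNormSq_smul_add_smul (B := g x) (hg.symm x hx)
    (f x * (k * deriv smoothStep (k * ρ x))) (smoothStep (k * ρ x)) (dform ρ x) (dform f x)
  have e3 : (f x * (k * deriv smoothStep (k * ρ x))) ^ 2 * covectorNormSq (g x) (dform ρ x) ≤
      (A * C₁) ^ 2 := by
    rw [← hg.sq_covectorNorm (dform ρ) hx, ← mul_pow]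
    refine sq_le_sq.2 ?_
    have hA0 : 0 ≤ A := (abs_nonneg _).trans (hA 0)
    rw [abs_of_nonneg (mul_nonneg hA0 hC₁), abs_mul, abs_of_nonneg (covectorNorm_nonneg _ _ _)]
    calc _ ≤ |f x * (k * deriv smoothStep (k * ρ x))| * (C₁ * ρ x) :=
          mul_le_mul_of_nonneg_left (h1 x hx) (abs_nonneg _)
      _ = |f x| * |k * ρ x * deriv smoothStep (k * ρ x)| * C₁ := by
          simp only [abs_mul, abs_of_nonneg hρ0]; ring
      _ ≤ 1 * A * C₁ := mul_le_mul_of_nonneg_right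
          (mul_le_mul (hf1 x) (hA _) (abs_nonneg _) zero_le_one) hC₁
      _ = A * C₁ := by ring
  have e4 : smoothStep (k * ρ x) ^ 2 * covectorNormSq (g x) (dform f x) ≤ (C₂ * P) ^ 2 := by
    rw [← hg.sq_covectorNorm (dform f) hx, ← mul_pow]
    refine pow_le_pow_left₀ (mul_nonneg (Real.smoothTransition.nonneg _)
      (covectorNorm_nonneg _ _ _)) ?_ 2
    calc _ ≤ 1 * (C₂ * ρ x) := mul_le_mul (Real.smoothTransition.le_one _) (h2 x hx)
          (covectorNorm_nonneg _ _ _) zero_le_one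
      _ ≤ C₂ * P := by rw [one_mul]; exact mul_le_mul_of_nonneg_left hρP hC₂
  rw [dform_cutoff H.rho.smooth hf]
  refine e2.le.trans ?_
  have e5 := le_abs_self (f x * (k * deriv smoothStep (k * ρ x)) * smoothStep (k * ρ x) *
    covectorInner (g x) (dform ρ x) (dform f x))
  linarith

/-- The identity holds for the cutoffs of `f`, which are supported in the interior part of one
chart. At a given interior point they and their differentials eventually coincide with those of `f`,
and the uniform gradient bound allows dominated convergence. -/
lemma IsConfCompact.integral_mul_bilinTrace (H : IsConfCompact ρ g gbar)
    (hS : IsWeakCovariantDerivative g β S) (h1 : Integrable (covectorNorm g β) (riemVolume g))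
    (h2 : Integrable (fun x => bilinTrace (g x) (S x)) (riemVolume g))
    (hf : ContMDiff (𝓡∂ n) 𝓘(ℝ, ℝ) ∞ f) (hf1 : ∀ x, |f x| ≤ 1) (hs : tsupport f ⊆ (𝔠 n o).source) :
    Integrable (fun x => covectorInner (g x) (dform f x) (β x)) (riemVolume g) ∧ ∫ x, f x *
    bilinTrace (g x) (S x) ∂riemVolume g = -∫ x, covectorInner (g x) (dform f x)
    (β x) ∂riemVolume g := by
  have hg := H.isC2Metric
  obtain ⟨L, hL⟩ := H.exists_covectorNorm_dform_cutoff_le hf hf1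
  have hβ := hS.isMeasurable_left
  have hcm := fun k => contMDiff_cutoff H.rho.smooth hf k
  have hev : ∀ x ∈ (𝓡∂ n).interior M, ∀ᶠ k : ℕ in Filter.atTop, 2 < k * ρ x := fun x hx => by
    have hp := rho_pos_of_mem_interior H.rho hx
    filter_upwards [Filter.eventually_gt_atTop ⌈2 / ρ x⌉₊] with k hk
    rw [← div_lt_iff₀ hp]
    exact (Nat.le_ceil _).trans_lt (by exact_mod_cast hk)
  have hstep : ∀ {t : ℝ}, 2 < t → smoothStep t = 1 := fun h =>
    Real.smoothTransition.one_of_one_le (by linarith)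
  have hCS : ∀ (k : ℕ), ∀ᵐ x ∂riemVolume g,
      ‖covectorInner (g x) (dform (cutoff ρ f k) x) (β x)‖ ≤ L * covectorNorm g β x := fun k => by
    filter_upwards [ae_mem_interior g] with x hx
    exact (abs_covectorInner_le (B := g x) (hg.symm x hx) (hg.pos x hx) _ _).trans
      (mul_le_mul_of_nonneg_right (hL k x hx) (Real.sqrt_nonneg _))
  have hlim : ∀ᵐ x ∂riemVolume g, Filter.Tendsto
      (fun k : ℕ => covectorInner (g x) (dform (cutoff ρ f k) x) (β x)) Filter.atTop
      (𝓝 (covectorInner (g x) (dform f x) (β x))) := by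
    filter_upwards [ae_mem_interior g] with x hx
    refine tendsto_const_nhds.congr' ?_
    filter_upwards [hev x hx] with k hk
    have e : dform (n := n) (cutoff ρ f k) x = dform f x := by
      rw [dform_cutoff H.rho.smooth hf, deriv_smoothStep_of_lt hk, hstep hk, mul_zero, mul_zero,
        zero_smul, zero_add, one_smul]
    rw [e]
  have hm := fun k => hg.aestronglyMeasurable_covectorInner g (isMeasurableCovector_dform (hcm k))
      hβ
  have t1 := tendsto_integral_of_dominated_convergence (fun x => L * covectorNorm g β x)
    hm (h1.const_mul L) hCS hlim
  have t2 : Filter.Tendsto (fun k : ℕ => ∫ x, cutoff ρ f k x * bilinTrace (g x) (S x)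
      ∂riemVolume g) Filter.atTop (𝓝 (∫ x, f x * bilinTrace (g x) (S x) ∂riemVolume g)) := by
    refine tendsto_integral_of_dominated_convergence (fun x => |bilinTrace (g x) (S x)|)
      (fun k => (hcm k).continuous.aestronglyMeasurable.mul h2.1) h2.abs
      (fun k => .of_forall fun x => ?_) ?_
    · rw [norm_mul]
      refine mul_le_of_le_one_left (abs_nonneg (bilinTrace (g x) (S x))) ?_
      rw [cutoff, norm_mul]
      refine mul_le_one₀ (hf1 x) (norm_nonneg _) ?_
      rw [smoothStep, Real.norm_of_nonneg (Real.smoothTransition.nonneg _)]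
      exact Real.smoothTransition.le_one _
    · filter_upwards [ae_mem_interior g] with x hx
      refine tendsto_const_nhds.congr' ?_
      filter_upwards [hev x hx] with k hk
      rw [cutoff, hstep hk, mul_one]
  refine ⟨?_, ?_⟩
  · refine (h1.const_mul L).mono'
      (hg.aestronglyMeasurable_covectorInner g (isMeasurableCovector_dform hf) hβ) ?_
    filter_upwards [hlim, ae_all_iff.2 hCS] with x hx hb
    exact le_of_tendsto hx.norm (.of_forall hb)
  · refine tendsto_nhds_unique t2 (t1.neg.congr fun k => ?_)
    exact (hg.integral_mul_bilinTrace hS (hcm k) (tsupport_cutoff_subset H.rho hs k)).symm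

/-- The divergence theorem for integrable vector fields with integrable divergence; there is no
boundary term since the metric is complete. -/
lemma IsConfCompact.integral_bilinTrace_eq_zero [T2Space M] (H : IsConfCompact ρ g gbar)
    (hS : IsWeakCovariantDerivative g β S) (h1 : Integrable (covectorNorm g β) (riemVolume g))
    (h2 : Integrable (fun x => bilinTrace (g x) (S x)) (riemVolume g)) :
    ∫ x, bilinTrace (g x) (S x) ∂riemVolume g = 0 := by
  -- The function `1` is split into finitely many pieces supported in charts.
  obtain ⟨f, hf⟩ := SmoothPartitionOfUnity.exists_isSubordinate_chartAt_source (I := 𝓡∂ n) M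
  have hfin : {i : M | (Function.support (f i)).Nonempty}.Finite :=
    f.locallyFinite.finite_nonempty_of_compact
  obtain ⟨s, hs⟩ : ∃ s : Finset M, s = hfin.toFinset := ⟨_, rfl⟩
  have hsum : ∀ x, ∑ i ∈ s, f i x = 1 := fun x => by
    rw [← f.sum_eq_one (mem_univ x)]
    refine (finsum_eq_sum_of_support_subset _ fun i hi => ?_).symm
    rw [hs, Finite.coe_toFinset]
    exact ⟨x, hi⟩
  have key := fun i : M => H.integral_mul_bilinTrace hS h1 h2 (f i).contMDiff (fun x => by
      rw [abs_of_nonneg (f.nonneg i x)]; exact f.le_one i x)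
    (o := i) (by rw [extChartAt_source]; exact hf i)
  have hi : ∀ i, Integrable (fun x => f i x * bilinTrace (g x) (S x)) (riemVolume g) := fun i =>
    h2.bdd_mul (c := 1) (f i).contMDiff.continuous.aestronglyMeasurable
      (.of_forall fun x => by rw [Real.norm_of_nonneg (f.nonneg i x)]; exact f.le_one i x)
  have e1 : ∫ x, bilinTrace (g x) (S x) ∂riemVolume g =
      ∑ i ∈ s, ∫ x, f i x * bilinTrace (g x) (S x) ∂riemVolume g := by
    rw [← integral_finsetSum _ fun i _ => hi i]
    congr 1; ext x
    rw [← sum_mul, hsum, one_mul]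
  rw [e1, sum_congr rfl fun i _ => (key i).2, Finset.sum_neg_distrib,
    ← integral_finsetSum _ fun i _ => (key i).1, neg_eq_zero]
  -- The differentials of the pieces add up to the differential of the constant `1`, so the
  -- boundary-free identities sum to zero.
  refine integral_eq_zero_of_ae (ae_riemVolume_of_ae g fun o => ?_)
  filter_upwards [ae_mem_domain o] with y hy
  have hnhds := (isOpen_domain o).mem_nhds hy
  have e2 : ∀ a : Fin n, ∑ i ∈ s, 𝐃 (funCoord (f i) o) y (ê a) = 0 := by
    intro a
    have h3 := HasFDerivAt.fun_sum (u := s) fun i _ =>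
      (((contDiffOn_funCoord_coordDomain (f i).contMDiff o).contDiffAt hnhds).differentiableAt
        (by simp)).hasFDerivAt
    have h4 : (fun z => ∑ i ∈ s, funCoord (n := n) (f i) o z) = fun _ => 1 := by ext z; exact hsum _
    rw [h4] at h3
    have h5 := h3.unique (hasFDerivAt_const (1 : ℝ) y)
    have h6 := congrArg (fun L : 𝔼 n →L[ℝ] ℝ => L (ê a)) h5
    simpa only [sum_apply, zero_apply] using h6
  rw [Pi.zero_apply]
  simp only [covectorInner_coord g _ β hy, covectorCoord_dform (ContMDiffMap.contMDiff _) hy]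
  rw [sum_comm]
  refine Finset.sum_eq_zero fun a _ => ?_
  rw [sum_comm]
  refine Finset.sum_eq_zero fun b _ => ?_
  rw [← sum_mul, ← mul_sum, e2, mul_zero, zero_mul]

/-! ### Conformal change of the measure and of the Sobolev space -/

lemma IsWeakDifferential.ae_eq (k : BilinField n M) (h1 : IsWeakDifferential u α)
    (h2 : IsWeakDifferential u β) : ∀ᵐ x ∂riemVolume k, α x = β x := by
  refine ae_riemVolume_of_ae k fun o => ?_
  have h := ae_all_iff.2 fun i => (h1 o i).ae_eq (isOpen_domain o) (h2 o i)
  filter_upwards [h, ae_mem_domain o] with y hy hyD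
  have hJ : ∀ A B : 𝔼 n →L[ℝ] ℝ,
      (∀ i, A.comp (coordLin o y) (ê i) = B.comp (coordLin o y) (ê i)) → A = B := by
    intro A B h
    obtain ⟨e, he⟩ := isInvertible_coordLin hyD
    ext v
    have := eq_of_stdVec h (e.symm v)
    simpa [← he] using this
  exact hJ _ _ hy

lemma MemW12.isW12 (h : MemW12 k u) : IsW12 k u (weakDifferential n u) := ⟨h.1.spec, h.2.1, h.2.2⟩

lemma IsW12.covectorNorm_ae_eq (h : IsW12 k u α) :
    covectorNorm k (weakDifferential n u) =ᵐ[riemVolume k] covectorNorm k α := by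
  filter_upwards [IsWeakDifferential.ae_eq k
    (IsWeaklyDifferentiable.spec ⟨α, h.diff⟩) h.diff] with x hx
  rw [covectorNorm, covectorNorm, hx]

lemma IsW12.memW12 (h : IsW12 k u α) : MemW12 k u :=
  ⟨⟨α, h.diff⟩, h.memLp, h.memLp'.ae_eq h.covectorNorm_ae_eq.symm⟩

lemma critExp_pos (hn : 3 ≤ n) : 0 < critExp n := by
  have : (3 : ℝ) ≤ n := by exact_mod_cast hn
  exact div_pos (by linarith) (by linarith)

namespace IsConfFactor

/-- The determinant scales by `φ^((N-2) n)`, and `(N - 2) n = 2 N`. -/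
lemma volDensity_conformal (hn : 3 ≤ n) (hφ : IsConfFactor g φ w T a b) (hy : y ∈ coordDomain o) :
    volDensity (conformal φ g) o y = funCoord φ o y ^ critExp n * volDensity g o y := by
  have hp := hφ.pos_coord hy
  have e : metricMatrix (conformal φ g) o y =
      funCoord φ o y ^ (critExp n - 2) • metricMatrix g o y := rfl
  have hnR : (3 : ℝ) ≤ n := by exact_mod_cast hn
  have e2 : (funCoord φ o y ^ (critExp n - 2)) ^ n = (funCoord φ o y ^ critExp n) ^ 2 := by
    rw [← Real.rpow_mul_natCast hp.le, ← Real.rpow_mul_natCast hp.le]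
    congr 1
    have h2' : (n : ℝ) - 2 ≠ 0 := by linarith
    rw [critExp]
    push_cast
    field_simp
    ring
  rw [volDensity, e, Matrix.det_smul, Fintype.card_fin, e2,
    Real.sqrt_mul (sq_nonneg _), Real.sqrt_sq (Real.rpow_pos_of_pos hp _).le, volDensity]

lemma aestronglyMeasurable (hφ : IsConfFactor g φ w T a b) (s : ℝ) :
    AEStronglyMeasurable (fun x => φ x ^ s) (riemVolume g) :=
  aestronglyMeasurable_riemVolume g fun o => hφ.aestronglyMeasurable_rpow s o

lemma riemVolume_conformal (hn : 3 ≤ n) (hφ : IsConfFactor g φ w T a b) :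
    riemVolume (conformal φ g) = (riemVolume g).withDensity fun x => ofReal (φ x ^ critExp n) := by
  have hm := (hφ.aestronglyMeasurable (critExp n)).aemeasurable.ennreal_ofReal
  obtain ⟨t, ht⟩ := exists_finset_cover n M
  have e1 : ((riemVolume g).withDensity fun x => ofReal (φ x ^ critExp n)).restrict
      (⋃ o ∈ t, 𝕌 n o) = (riemVolume g).withDensity fun x => ofReal (φ x ^ critExp n) := by
    rw [restrict_withDensity (Finset.measurableSet_biUnion _ fun x _ =>
      (isOpen_coordImage x).measurableSet), restrict_iUnion_eq g ht]
  rw [← restrict_iUnion_eq (conformal φ g) ht, ← e1, Measure.restrict_biUnion_finset_congr]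
  intro o _
  have hI := (isOpen_coordImage (n := n) o).measurableSet
  rw [riemVolume_restrict]
  ext S hS
  rw [chartVolume_apply _ _ hS, Measure.restrict_apply hS, withDensity_apply _ (hS.inter hI),
    ← setLIntegral_indicator hS, setLIntegral_coordImage g o
      (hφ.regular.aemeasurable_volDensity o) (by
        rw [← riemVolume_restrict]; exact (hm.indicator hS).restrict),
    ← Measure.restrict_restrict_of_subset inter_subset_left,
    ← lintegral_indicator (measurableSet_inter_preimage_symm (n := n) o hS)]
  refine setLIntegral_congr_fun (isOpen_domain o).measurableSet fun y hy => ?_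
  by_cases hyS : (𝔠 n o).symm y ∈ S
  · rw [indicator_of_mem hyS, indicator_of_mem (show y ∈ coordDomain o ∩ _ from ⟨hy, hyS⟩),
      hφ.volDensity_conformal hn hy, mul_comm,
      ENNReal.ofReal_mul' (Real.rpow_pos_of_pos (hφ.pos_coord hy) _).le]
    rfl
  · rw [indicator_of_notMem hyS, indicator_of_notMem fun h => hyS h.2, mul_zero]

lemma riemVolume_conformal_le (hn : 3 ≤ n) (hφ : IsConfFactor g φ w T a b) :
    riemVolume (conformal φ g) ≤ ofReal (a ^ critExp n + b ^ critExp n) • riemVolume g := by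
  rw [hφ.riemVolume_conformal hn, ← withDensity_const]
  refine withDensity_mono ?_
  filter_upwards [hφ.mem_Icc] with x hx
  exact ENNReal.ofReal_le_ofReal ((le_abs_self _).trans (hφ.rpow_le _ hx))

lemma le_riemVolume_conformal (hn : 3 ≤ n) (hφ : IsConfFactor g φ w T a b) :
    riemVolume g ≤ ofReal (a ^ (-critExp n) + b ^ (-critExp n)) • riemVolume (conformal φ g) := by
  rw [hφ.riemVolume_conformal hn, ← withDensity_smul' _ _ ofReal_ne_top]
  conv_lhs => rw [← withDensity_one (μ := riemVolume g)]
  refine withDensity_mono ?_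
  filter_upwards [hφ.mem_Icc] with x hx
  have hp := hφ.a_pos.trans_le hx.1
  have h1 := (le_abs_self _).trans (hφ.rpow_le (-critExp n) hx)
  rw [Pi.smul_apply, smul_eq_mul, ← ENNReal.ofReal_mul' (Real.rpow_pos_of_pos hp _).le,
    Pi.one_apply,
    ← ENNReal.ofReal_one]
  refine ENNReal.ofReal_le_ofReal (le_trans (le_of_eq ?_)
    (mul_le_mul_of_nonneg_right h1 (Real.rpow_pos_of_pos hp _).le))
  rw [← Real.rpow_add hp, neg_add_cancel, Real.rpow_zero]

lemma memLp_conformal_iff (hn : 3 ≤ n) (hφ : IsConfFactor g φ w T a b) :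
    MemLp u p (riemVolume (conformal φ g)) ↔ MemLp u p (riemVolume g) :=
  ⟨fun h => h.of_measure_le_smul ofReal_ne_top (hφ.le_riemVolume_conformal hn),
    fun h => h.of_measure_le_smul ofReal_ne_top (hφ.riemVolume_conformal_le hn)⟩

lemma ae_conformal_iff (hn : 3 ≤ n) (hφ : IsConfFactor g φ w T a b) {P : M → Prop} :
    (∀ᵐ x ∂(riemVolume (conformal φ g)), P x) ↔ ∀ᵐ x ∂riemVolume g, P x :=
  ⟨fun h => (Measure.absolutelyContinuous_of_le_smul (hφ.le_riemVolume_conformal hn)).ae_le h,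
    fun h => (Measure.absolutelyContinuous_of_le_smul (hφ.riemVolume_conformal_le hn)).ae_le h⟩

lemma sq_covectorNorm_conformal (hφ : IsConfFactor g φ w T a b) (hx : x ∈ (𝓡∂ n).interior M)
    (α : CovectorField n M) : covectorNormSq (conformal φ g x) (α x) = (φ x ^ (critExp n - 2))⁻¹ *
    covectorNormSq (g x) (α x) := by
  have hs : x ∈ (𝔠 n x).source := mem_extChartAt_source x
  have hy := mem_coordDomain hs hx
  have e1 := covectorNormSq_coord (conformal φ g) α hy
  have e2 := covectorNormSq_coord g α hy
  simp only [hφ.inv_metricMatrix_conformal hy] at e1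
  rw [(𝔠 n x).left_inv hs] at e1 e2
  rw [e1, e2, funCoord, (𝔠 n x).left_inv hs]
  simp only [mul_sum, mul_assoc]

lemma covectorNorm_conformal (hφ : IsConfFactor g φ w T a b) (hx : x ∈ (𝓡∂ n).interior M)
    (α : CovectorField n M) :
    covectorNorm (conformal φ g) α x = √(φ x ^ (critExp n - 2))⁻¹ * covectorNorm g α x := by
  rw [covectorNorm, covectorNorm, ← Real.sqrt_mul (inv_nonneg.2
    (Real.rpow_pos_of_pos (hφ.pos x hx) _).le), ← hφ.sq_covectorNorm_conformal hx α]

/-- As `φ` lies between two positive constants almost everywhere, the measures and the covector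
norms of the two metrics are equivalent; the weak differential does not involve the metric. -/
lemma isW12_conformal_iff (hn : 3 ≤ n) (hφ : IsConfFactor g φ w T a b) :
    IsW12 (conformal φ g) u α ↔ IsW12 g u α := by
  have key : IsWeakDifferential u α → (MemLp (covectorNorm (conformal φ g) α) 2 (riemVolume g) ↔
      MemLp (covectorNorm g α) 2 (riemVolume g)) := by
    intro hd
    have m1 := hφ.regular.aestronglyMeasurable_covectorNorm g hd.isMeasurable
    have m2 := Real.continuous_sqrt.comp_aestronglyMeasurable
      (hφ.aestronglyMeasurable (critExp n - 2)).inv₀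
    have e : covectorNorm (conformal φ g) α =ᵐ[riemVolume g]
        fun x => √(φ x ^ (critExp n - 2))⁻¹ * covectorNorm g α x :=
      (ae_mem_interior g).mono fun x hx => hφ.covectorNorm_conformal hx α
    have hs : ∀ᵐ x ∂riemVolume g, (φ x ^ (critExp n - 2))⁻¹ ≤ a ^ (-(critExp n - 2)) +
        b ^ (-(critExp n - 2)) ∧ φ x ^ (critExp n - 2) ≤ a ^ (critExp n - 2) + b ^ (critExp n - 2) ∧
        0 < φ x ^ (critExp n - 2) := by
      filter_upwards [hφ.mem_Icc] with x hx
      have hp := hφ.a_pos.trans_le hx.1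
      refine ⟨?_, (le_abs_self _).trans (hφ.rpow_le _ hx), Real.rpow_pos_of_pos hp _⟩
      rw [← Real.rpow_neg hp.le]
      exact (le_abs_self _).trans (hφ.rpow_le _ hx)
    refine ⟨fun h => ?_, fun h => ?_⟩
    · refine (h.const_mul √(a ^ (critExp n - 2) + b ^ (critExp n - 2))).mono m1 ?_
      filter_upwards [e, hs] with x hx hs
      rw [norm_mul, hx, norm_mul, ← mul_assoc, Real.norm_of_nonneg (Real.sqrt_nonneg _),
        Real.norm_of_nonneg (Real.sqrt_nonneg _), Real.sqrt_inv]
      refine le_mul_of_one_le_left (norm_nonneg _) ?_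
      rw [← div_eq_mul_inv, one_le_div (Real.sqrt_pos.2 hs.2.2)]
      exact Real.sqrt_le_sqrt hs.2.1
    · refine (h.const_mul √(a ^ (-(critExp n - 2)) + b ^ (-(critExp n - 2)))).mono
        ((m2.mul m1).congr e.symm) ?_
      filter_upwards [e, hs] with x hx hs
      rw [hx, norm_mul, norm_mul, Real.norm_of_nonneg (Real.sqrt_nonneg _),
        Real.norm_of_nonneg (Real.sqrt_nonneg _)]
      exact mul_le_mul_of_nonneg_right (Real.sqrt_le_sqrt hs.1) (norm_nonneg _)
  exact ⟨fun h => ⟨h.diff, (hφ.memLp_conformal_iff hn).1 h.memLp,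
      (key h.diff).1 ((hφ.memLp_conformal_iff hn).1 h.memLp')⟩,
    fun h => ⟨h.diff, (hφ.memLp_conformal_iff hn).2 h.memLp,
      (hφ.memLp_conformal_iff hn).2 ((key h.diff).2 h.memLp')⟩⟩

/-- The density of the conformal measure is `φ^N`, and `φ^N |u|^N = |φ u|^N`: this is where the
exponent `N` is critical. -/
lemma eLpNorm_conformal (hn : 3 ≤ n) (hφ : IsConfFactor g φ w T a b)
    (hu : AEStronglyMeasurable u (riemVolume g)) :
    eLpNorm u (ofReal (critExp n)) (riemVolume (conformal φ g)) = eLpNorm (fun x => φ x * u x)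
    (ofReal (critExp n)) (riemVolume g) := by
  have hN := critExp_pos hn
  have hN0 : ofReal (critExp n) ≠ 0 := by simpa using hN
  rw [eLpNorm_eq_lintegral_rpow_enorm_toReal hN0 ofReal_ne_top,
    eLpNorm_eq_lintegral_rpow_enorm_toReal hN0 ofReal_ne_top,
    ENNReal.toReal_ofReal hN.le, hφ.riemVolume_conformal hn, lintegral_withDensity_eq_lintegral_mul₀
      (hφ.aestronglyMeasurable (critExp n)).aemeasurable.ennreal_ofReal
      (hu.aemeasurable.enorm.pow_const _)]
  congr 1
  refine lintegral_congr_ae ?_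
  filter_upwards [hφ.mem_Icc] with x hx
  have hp := hφ.a_pos.trans_le hx.1
  rw [Pi.mul_apply, enorm_mul, ENNReal.mul_rpow_of_nonneg _ _ hN.le, Real.enorm_of_nonneg hp.le,
    ENNReal.ofReal_rpow_of_pos hp]

end IsConfFactor

/-! ### Conformal invariance of the Yamabe functional -/

lemma IsC2Metric.aestronglyMeasurable_scal (hg : IsC2Metric g) :
    AEStronglyMeasurable (scal g) (riemVolume g) :=
  aestronglyMeasurable_riemVolume g fun o => ((hg.continuousOn_scalChart o).aestronglyMeasurable
    (isOpen_domain o).measurableSet).congr ((hg.scal_ae_eq o).mono fun _ h => h.symm)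

lemma IsConfCompact.exists_abs_scal_le (H : IsConfCompact ρ g gbar) :
    ∃ K, ∀ᵐ x ∂riemVolume g, |scal g x| ≤ K := by
  choose R C ε hP using fun x : M => H.exists_isPatch one_pos x
  obtain ⟨t, ht⟩ := exists_finset_halfBall_cover (n := n) (M := M) fun x => (hP x).R_pos
  have hR := fun x => (hP x).R_pos
  have hsub : ∀ x, ℍ n x (R x) ⊆ halfBall x (3 * R x) := fun x =>
    halfBall_mono x (by linarith [hR x])
  choose K hK using fun x : M => (⟨_, fun _ hy => (hP x).abs_scalChart_le hy⟩ :
    ∃ K, ∀ y ∈ ℍ n x (3 * R x), |scalChart g x y| ≤ K)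
  refine ⟨∑ x ∈ t, |K x|, ae_riemVolume_of_cover g (fun x => (hsub x).trans (hP x).dom)
    (fun x => (isOpen_halfBall x (R x)).measurableSet) ht fun x hx => ?_⟩
  filter_upwards [ae_restrict_of_ae_restrict_of_subset ((hsub x).trans (hP x).dom)
    (H.isC2Metric.scal_ae_eq x), ae_restrict_mem (isOpen_halfBall x (R x)).measurableSet]
    with y h1 hy
  rw [h1]
  exact ((hK x y (hsub x hy)).trans (le_abs_self _)).trans
    (Finset.single_le_sum (f := fun x => |K x|) (fun _ _ => abs_nonneg _) hx)

lemma IsW12.energyDensity_ae_eq (h : IsW12 k u α) : energyDensity k u =ᵐ[riemVolume k] fun x => 4 *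
    ((n : ℝ) - 1) / (n - 2) * covectorNorm k α x ^ 2 + scal k x * u x ^ 2 := by
  filter_upwards [h.covectorNorm_ae_eq] with x hx
  rw [energyDensity, hx]

lemma IsW12.integrable_energy (H : IsConfCompact ρ g gbar) (h : IsW12 g u α) :
    Integrable (fun x => 4 * ((n : ℝ) - 1) / (n - 2) * covectorNorm g α x ^ 2 + scal g x * u x ^ 2)
    (riemVolume g) := by
  obtain ⟨K, hK⟩ := H.exists_abs_scal_le
  exact (h.memLp'.integrable_sq.const_mul _).add
    (h.memLp.integrable_sq.bdd_mul H.isC2Metric.aestronglyMeasurable_scal hK)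

/-- Needed for `φ (φ⁻¹ v) = v`, which is guaranteed only in the interior, where `φ` is positive. -/
lemma IsW12.yamabeQuotient_congr (h : IsW12 k u α) (huv : ∀ x ∈ (𝓡∂ n).interior M, u x = v x) :
    yamabeQuotient k u = yamabeQuotient k v := by
  have hae : u =ᵐ[riemVolume k] v := (ae_mem_interior k).mono fun x hx => huv x hx
  have h' : IsW12 k v α := ⟨h.diff.congr huv, h.memLp.ae_eq hae, h.memLp'⟩
  rw [yamabeQuotient, yamabeQuotient, eLpNorm_congr_ae hae, energy, energy,
    integral_congr_ae h.energyDensity_ae_eq, integral_congr_ae h'.energyDensity_ae_eq]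
  congr 1
  exact integral_congr_ae (hae.mono fun x hx => by simp only [hx])

namespace IsConfFactor

/-- Product rule for the covector field `v u dφ`. The products are grouped so that `|dφ| u` or `|dφ|
v`, which is in `L²`, always meets another square integrable factor; the Hessian term is bounded by
`(u² + v²) |T|`. -/
lemma isWeakCovariantDerivative_mul_smul (hφ : IsConfFactor g φ w T a b) (hu : IsW12 g u α)
    (hv : IsW12 g v κ) : IsWeakCovariantDerivative g (fun x => (v x * u x) • w x) fun x => mulForm
    (w x) (α x) (κ x) (T x) (u x) (v x) := by
  have hg := hφ.regular
  intro o i j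
  have hD := isOpen_domain (n := n) o
  have hsc : ∀ i, ContinuousOn (fun y => √(bilinCoord g o i i y)) (coordDomain o) := fun i =>
    Real.continuous_sqrt.comp_continuousOn (hg.contDiffOn o i i).continuousOn
  have c1 : ContinuousOn (fun _ => (1 : ℝ)) (𝔻 n o) := continuousOn_const
  have hb : ∀ (α : CovectorField n M) (i : Fin n), ∀ y ∈ coordDomain o,
      |covectorCoord α o i y| ≤ |covectorNorm g α ((𝔠 n o).symm y)| *
        √(bilinCoord g o i i y) := fun α i y hy => by
    rw [abs_of_nonneg (covectorNorm_nonneg _ _ _)]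
    exact hg.abs_covectorCoord_le α hy i
  have hb1 : ∀ (u : M → ℝ), ∀ y ∈ 𝔻 n o, |funCoord u o y| ≤
      |u ((𝔠 n o).symm y)| * 1 := fun u y _ => by rw [mul_one]; rfl
  have hb2 : ∀ (u : M → ℝ) (i : Fin n), ∀ y ∈ coordDomain o,
      |funCoord u o y * covectorCoord w o i y| ≤
        |covectorNorm g w ((𝔠 n o).symm y) * u ((𝔠 n o).symm y)| *
          √(bilinCoord g o i i y) := fun u i y hy => by
    rw [abs_mul, abs_mul, mul_comm, mul_right_comm]
    exact mul_le_mul_of_nonneg_right (hb w i y hy) (abs_nonneg _)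
  have mu := (hu.diff o 0).1.aestronglyMeasurable
  have mv := (hv.diff o 0).1.aestronglyMeasurable
  have mα := hu.diff.isMeasurable o j
  have mκ := hv.diff.isMeasurable o j
  have mw := hφ.diff.isMeasurable o
  have WU := hφ.mulSq u α hu
  have WV := hφ.mulSq v κ hv
  have huv := (hv.diff o j).mul hD (hu.diff o j)
    (hg.locallyIntegrableOn_mul hv.memLp hu.memLp c1 c1 mv mu (hb1 v) (hb1 u))
    (hg.locallyIntegrableOn_mul hv.memLp' hu.memLp (hsc j) c1 mκ mu (hb κ j) (hb1 u))
    (hg.locallyIntegrableOn_mul hv.memLp hu.memLp' c1 (hsc j) mv mα (hb1 v) (hb α j))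
  have lw : ∀ i, LocallyIntegrableOn (fun y => funCoord v o y * (funCoord u o y *
      covectorCoord w o i y)) (coordDomain o) := fun i =>
    hg.locallyIntegrableOn_mul hv.memLp WU c1 (hsc i) mv (mu.mul (mw i)) (hb1 v) (hb2 u i)
  have l2 := (hg.locallyIntegrableOn_mul hv.memLp' WU (hsc j) (hsc i) mκ (mu.mul (mw i)) (hb κ j)
    (hb2 u i)).add (hg.locallyIntegrableOn_mul hu.memLp' WV (hsc j) (hsc i) mα (mv.mul (mw i))
    (hb α j) (hb2 v i))
  have lT : LocallyIntegrableOn (fun y => funCoord v o y * funCoord u o y * bilinCoord T o i j y)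
      (coordDomain o) := by
    have hi := (hφ.mulT u α hu).add (hφ.mulT v κ hv)
    refine LocallyIntegrableOn.of_abs_le ((hg.locallyIntegrableOn_coord_of_integrable hi
      o).mul_continuousOn (Real.continuous_sqrt.comp_continuousOn ((hg.contDiffOn o i
        i).continuousOn.mul (hg.contDiffOn o j j).continuousOn)) hD.isLocallyClosed)
      ((mv.mul mu).mul (hφ.cov.isMeasurable hg hφ.diff.isMeasurable o i j)) ?_
    filter_upwards [ae_restrict_mem hD.measurableSet] with y hy
    refine le_trans ?_ (le_abs_self _)
    have h1 := hg.abs_bilinCoord_le T hy i j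
    rw [abs_mul, abs_mul]
    refine (mul_le_mul_of_nonneg_left h1 (mul_nonneg (abs_nonneg _) (abs_nonneg _))).trans ?_
    have h2 : |funCoord v o y| * |funCoord u o y| ≤ funCoord u o y ^ 2 + funCoord v o y ^ 2 := by
      rw [← sq_abs (funCoord u o y), ← sq_abs (funCoord v o y)]
      nlinarith [sq_nonneg (|funCoord v o y| - |funCoord u o y|), abs_nonneg (funCoord v o y),
        abs_nonneg (funCoord u o y)]
    refine (mul_le_mul_of_nonneg_right h2 (mul_nonneg (tensorNorm_nonneg _ _ _)
      (Real.sqrt_nonneg _))).trans (le_of_eq ?_)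
    simp only [Pi.add_apply, funCoord, Function.comp_apply, Pi.mul_apply]
    ring
  have l3 : LocallyIntegrableOn (fun y => funCoord v o y * funCoord u o y * (bilinCoord T o i j y +
      ∑ k, christoffel g o k i j y * covectorCoord w o k y)) (coordDomain o) := by
    have hs : LocallyIntegrableOn (fun y => ∑ k, funCoord v o y * (funCoord u o y *
        covectorCoord w o k y) * chris g o k i j y) (coordDomain o) :=
      LocallyIntegrableOn.sum Finset.univ fun k _ => (lw k).mul_continuousOn
        (hg.contDiffOn_chris o k i j).continuousOn hD.isLocallyClosed
    refine locallyIntegrableOn_congr ?_ (lT.add hs)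
    filter_upwards [hg.christoffel_ae_eq o] with y hy
    simp only [Pi.add_apply, hy, mul_add, mul_sum]
    congr 1
    exact sum_congr rfl fun k _ => by ring
  refine (huv.mul hD (hφ.cov o i j) ?_ ?_ l3).congr hD.measurableSet
    (.of_forall fun y => rfl) (.of_forall fun y => ?_)
  · exact locallyIntegrableOn_congr (.of_forall fun y => (mul_assoc _ _ _).symm)
      (lw i)
  · refine locallyIntegrableOn_congr (.of_forall fun y => ?_) l2
    simp only [Pi.add_apply, Pi.mul_apply, Function.comp_apply]
    ring
  · have e1 : bilinCoord (n := n) (fun x => mulForm (w x) (α x) (κ x) (T x) (u x) (v x))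
        o i j y = covectorCoord w o i y * (funCoord u o y * covectorCoord κ o j y +
          funCoord v o y * covectorCoord α o j y) +
          funCoord v o y * funCoord u o y * bilinCoord T o i j y := rfl
    have e2 : ∀ l, covectorCoord (fun x => (v x * u x) • w x) o l y =
        funCoord v o y * funCoord u o y * covectorCoord w o l y := fun l => rfl
    rw [e1]
    simp only [e2, funCoord, Function.comp_apply, mul_add, mul_sum, mul_left_comm
      (christoffel _ _ _ _ _ _)]
    ring

/-- The field `v u dφ` is integrable as the product of `|dφ| u` and `v`, both in `L²`; its
divergence is integrable by the same grouping, the Hessian being controlled by `mulT`. -/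
lemma integral_divergence_eq_zero [T2Space M] (H : IsConfCompact ρ g gbar)
    (hφ : IsConfFactor g φ w T a b) (hu : IsW12 g u α) (hv : IsW12 g v κ) :
    Integrable (fun x => u x * covectorInner (g x) (w x) (κ x) + v x * covectorInner (g x) (w x)
    (α x) + v x * u x * bilinTrace (g x) (T x)) (riemVolume g) ∧ ∫ x, (u x * covectorInner (g x)
    (w x) (κ x) + v x * covectorInner (g x) (w x) (α x) + v x * u x * bilinTrace (g x)
    (T x)) ∂riemVolume g = 0 := by
  have hg := hφ.regular
  have hS := hφ.isWeakCovariantDerivative_mul_smul hu hv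
  have WU := hφ.mulSq u α hu
  have WV := hφ.mulSq v κ hv
  have mT := hg.aestronglyMeasurable_bilinTrace g (hφ.cov.isMeasurable hg hφ.diff.isMeasurable)
  have hI : ∀ {u : M → ℝ} {κ : CovectorField n M}, AEStronglyMeasurable u (riemVolume g) →
      IsMeasurableCovector κ → MemLp (fun x => covectorNorm g w x * u x) 2 (riemVolume g) →
      MemLp (covectorNorm g κ) 2 (riemVolume g) →
      Integrable (fun x => u x * covectorInner (g x) (w x) (κ x)) (riemVolume g) := by
    intro u κ mu mκ h1 h2
    refine (h1.integrable_mul h2).mono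
      (mu.mul (hg.aestronglyMeasurable_covectorInner g hφ.diff.isMeasurable mκ)) ?_
    filter_upwards [ae_mem_interior g] with x hx
    have := abs_covectorInner_le (B := g x) (hg.symm x hx) (hg.pos x hx) (w x) (κ x)
    simp only [Pi.mul_apply, norm_mul, Real.norm_of_nonneg (covectorNorm_nonneg _ _ _)]
    refine (mul_le_mul_of_nonneg_left this (norm_nonneg (u x))).trans (le_of_eq ?_)
    simp only [covectorNorm]
    ring
  have i1 := hI hu.memLp.1 hv.diff.isMeasurable WU hv.memLp'
  have i2 := hI hv.memLp.1 hu.diff.isMeasurable WV hu.memLp'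
  have i3 : Integrable (fun x => v x * u x * bilinTrace (g x) (T x)) (riemVolume g) := by
    refine (((hφ.mulT u α hu).add (hφ.mulT v κ hv)).const_mul n).mono'
      ((hv.memLp.1.mul hu.memLp.1).mul mT) ?_
    filter_upwards [ae_mem_interior g] with x hx
    have h1 := abs_bilinTrace_le (B := g x) (hg.symm x hx) (hg.pos x hx) (T x)
    have h2 : ‖v x * u x‖ ≤ u x ^ 2 + v x ^ 2 := by
      rw [Real.norm_eq_abs, abs_le]
      constructor <;> nlinarith [sq_nonneg (v x - u x), sq_nonneg (v x + u x)]
    rw [norm_mul]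
    refine (mul_le_mul h2 h1 (abs_nonneg _) (by positivity)).trans (le_of_eq ?_)
    simp only [Pi.add_apply, tensorNorm]
    ring
  have hsum := (i1.add i2).add i3
  refine ⟨hsum, ?_⟩
  have e := fun x => bilinTrace_mulForm (g x) (w x) (α x) (κ x) (T x) (u x) (v x)
  rw [← H.integral_bilinTrace_eq_zero hS ?_ (hsum.congr (.of_forall fun x => (e x).symm))]
  · exact integral_congr_ae (.of_forall fun x => (e x).symm)
  · refine (WU.integrable_mul hv.memLp).mono
      (hg.aestronglyMeasurable_covectorNorm g hS.isMeasurable_left) ?_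
    filter_upwards [ae_mem_interior g] with x hx
    have h2 : covectorNorm g (fun x => (v x * u x) • w x) x = |v x * u x| * covectorNorm g w x := by
      rw [covectorNorm, covectorNorm, ← Real.sqrt_sq_eq_abs, ← Real.sqrt_mul (sq_nonneg _)]
      exact congrArg _ (covectorNormSq_smul (g x) _ (w x))
    rw [h2, Pi.mul_apply]
    simp only [norm_mul, Real.norm_eq_abs, abs_abs, abs_mul]
    exact le_of_eq (by ring)

lemma isW12_mul (hφ : IsConfFactor g φ w T a b) (hu : IsW12 g u α) :
    IsW12 g (fun x => φ x * u x) (fun x => u x • w x + φ x • α x) :=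
  hu.mul hφ.regular hφ.diff (K := b) (hφ.mem_Icc.mono fun x hx => by
    rw [abs_of_pos (hφ.a_pos.trans_le hx.1)]; exact hx.2) (hφ.mulSq u α hu)

/-- The two energy densities, read with respect to `μ^g`, differ by a multiple of the divergence of
`φ u² ∇φ`, that is, of `v u dφ` with `v = φ u`. -/
lemma energy_conformal [T2Space M] (hn : 3 ≤ n) (H : IsConfCompact ρ g gbar)
    (hφ : IsConfFactor g φ w T a b) (hu : IsW12 g u α) :
    Integrable (energyDensity (conformal φ g) u) (riemVolume (conformal φ g)) ∧
    energy (conformal φ g) u = energy g fun x => φ x * u x := by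
  have hg := hφ.regular
  have hv := hφ.isW12_mul hu
  obtain ⟨d1, d2⟩ := hφ.integral_divergence_eq_zero H hu hv
  have hE := hv.integrable_energy H
  obtain ⟨c, hc⟩ : ∃ c : ℝ, c = 4 * ((n : ℝ) - 1) / (n - 2) := ⟨_, rfl⟩
  have hS := hφ.isScalarCurvature hn
  have s1 : ∀ᵐ x ∂riemVolume g, scal (conformal φ g) x = (φ x ^ (critExp n - 2))⁻¹ *
      (scal g x - 4 * ((n : ℝ) - 1) / (n - 2) * ((φ x)⁻¹ * bilinTrace (g x) (T x))) :=
    ae_riemVolume_of_ae g fun o => hS.scal.ae_eq hS o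
  -- The square `|d(φ u)|²` contains `u² |dφ|² + 2 φ u ⟨dφ, du⟩`, absent from the energy of the
  -- conformal metric. With the term `φ u² Δφ` of the scalar curvature this is exactly the
  -- divergence of `φ u² ∇φ`.
  have key : (fun x => (ofReal (φ x ^ critExp n)).toReal • energyDensity (conformal φ g) u x)
      =ᵐ[riemVolume g] fun x => (4 * ((n : ℝ) - 1) / (n - 2) *
        covectorNorm g (fun x => u x • w x + φ x • α x) x ^ 2 + scal g x * (φ x * u x) ^ 2) -
        c * (u x * covectorInner (g x) (w x) (u x • w x + φ x • α x) +
          φ x * u x * covectorInner (g x) (w x) (α x) +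
            φ x * u x * u x * bilinTrace (g x) (T x)) := by
    filter_upwards [ae_mem_interior g, s1, (hφ.ae_conformal_iff hn).1
      ((hφ.isW12_conformal_iff hn).2 hu).energyDensity_ae_eq] with x hx h1 h2
    have hp := hφ.pos x hx
    have e1 : covectorNorm (conformal φ g) α x ^ 2 = (φ x ^ (critExp n - 2))⁻¹ *
        covectorNormSq (g x) (α x) := by
      rw [hφ.covectorNorm_conformal hx, mul_pow, hg.sq_covectorNorm α hx,
        Real.sq_sqrt (inv_nonneg.2 (Real.rpow_pos_of_pos hp _).le)]
    have e2 : φ x ^ critExp n * (φ x ^ (critExp n - 2))⁻¹ = φ x ^ 2 := by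
      rw [← Real.rpow_neg hp.le, ← Real.rpow_add hp, ← Real.rpow_natCast]
      congr 1
      push_cast
      ring
    have e3 := covectorNormSq_smul_add_smul (B := g x) (hg.symm x hx) (u x) (φ x) (w x) (α x)
    have e4 := covectorInner_smul_add_smul (g x) (w x) (α x) (u x) (φ x)
    have e5 := hg.sq_covectorNorm (fun x => u x • w x + φ x • α x) hx
    have e6 : φ x ^ 2 * (φ x)⁻¹ = φ x := by field_simp
    rw [ENNReal.toReal_ofReal (Real.rpow_pos_of_pos hp _).le, smul_eq_mul, h2, h1, e1, e5]
    refine Eq.trans ?_ (congrArg₂ (fun A B => 4 * ((n : ℝ) - 1) / (n - 2) * A + scal g x *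
      (φ x * u x) ^ 2 - c * (u x * B + φ x * u x * covectorInner (g x) (w x) (α x) +
            φ x * u x * u x * bilinTrace (g x) (T x))) e3 e4).symm
    rw [← hc]
    linear_combination (c * covectorNormSq (g x) (α x) + (scal g x - c * ((φ x)⁻¹ *
      bilinTrace (g x) (T x))) * u x ^ 2) * e2 - c * bilinTrace (g x) (T x) * u x ^ 2 * e6
  have hm := (hφ.aestronglyMeasurable (critExp n)).aemeasurable.ennreal_ofReal
  have hlt : ∀ᵐ x ∂riemVolume g, ofReal (φ x ^ critExp n) < ⊤ :=
    .of_forall fun _ => ENNReal.ofReal_lt_top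
  constructor
  · rw [hφ.riemVolume_conformal hn, integrable_withDensity_iff_integrable_smul₀' hm hlt]
    exact (hE.sub (d1.const_mul c)).congr key.symm
  · rw [energy, energy, hφ.riemVolume_conformal hn,
      integral_withDensity_eq_integral_toReal_smul₀ hm hlt, integral_congr_ae key,
      integral_congr_ae hv.energyDensity_ae_eq, integral_sub hE (d1.const_mul c),
      integral_const_mul, d2, mul_zero, sub_zero]

lemma yamabeQuotient_conformal [T2Space M] (hn : 3 ≤ n) (H : IsConfCompact ρ g gbar)
    (hφ : IsConfFactor g φ w T a b) (hu : IsW12 g u α) :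
    yamabeQuotient (conformal φ g) u = yamabeQuotient g fun x => φ x * u x := by
  rw [yamabeQuotient, yamabeQuotient, (hφ.energy_conformal hn H hu).2,
    hφ.eLpNorm_conformal hn hu.memLp.1]

end IsConfFactor

end LocalYamabe

end

/-! ### Equality of the local Yamabe invariants -/

open LocalYamabe

open MeasureTheory Set in
open scoped Manifold ContDiff ENNReal in
theorem proposition3p4 {n : ℕ} [NeZero n] (hn : 3 ≤ n)
    {M : Type*} [TopologicalSpace M] [ChartedSpace (EuclideanHalfSpace n) M]
    [IsManifold (𝓡∂ n) ∞ M] [T2Space M] [CompactSpace M] [MeasurableSpace M] [BorelSpace M]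
    (ρ : M → ℝ) (hρ : LocalYamabe.IsDefiningFunction n ρ)
    (g : LocalYamabe.BilinField n M) (hg : LocalYamabe.IsAsymptoticallyHyperbolic ρ g)
    (r : ℝ) (hr : 0 < r) (p : ℝ≥0∞) (hp : (n : ℝ≥0∞) / 2 < p)
    (φ : M → ℝ) (hφpos : ∀ x ∈ (𝓡∂ n).interior M, 0 < φ x)
    (hφ : LocalYamabe.MemX2 g r p φ) (hφinv : LocalYamabe.MemX2 g r p fun x => (φ x)⁻¹)
    (h : LocalYamabe.BilinField n M) (hh : h = LocalYamabe.conformal φ g) :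
    LocalYamabe.HasScalarCurvature h ∧
    (∀ u : M → ℝ, LocalYamabe.MemW12 h u →
      Integrable (LocalYamabe.energyDensity h u) (LocalYamabe.riemVolume h)) ∧
    ∀ V : Set M, V ⊆ (𝓡∂ n).interior M → NullMeasurableSet V (LocalYamabe.riemVolume g) →
      LocalYamabe.localYamabe g V = LocalYamabe.localYamabe h V := by
  obtain ⟨gbar, heq, -⟩ := hg
  have H : IsConfCompact ρ g gbar := ⟨hρ, heq⟩
  obtain ⟨T, hT⟩ := hφ.exists_isX2
  obtain ⟨T', hT'⟩ := hφinv.exists_isX2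
  obtain ⟨a, b, hF⟩ := hT.exists_isConfFactor hn H hr hp hφpos hT'
  obtain ⟨K, hK⟩ := hT'.exists_ae_le hn H hr hp
  subst hh
  have hne : ∀ᵐ x ∂riemVolume g, φ x ≠ 0 := (ae_mem_interior g).mono fun x hx => (hφpos x hx).ne'
  refine ⟨⟨_, hF.isScalarCurvature hn⟩, fun u hu =>
    (hF.energy_conformal hn H ((hF.isW12_conformal_iff hn).1 hu.isW12)).1, fun V _ _ =>
    le_antisymm (le_iInf₂ fun u hu => ?_) (le_iInf₂ fun v hv => ?_)⟩
  -- A competitor `u` for the conformal metric gives the competitor `φ u` for `g`, with the same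
  -- quotient; it is not zero almost everywhere because `φ` has no zero in the interior.
  · have hu' := (hF.isW12_conformal_iff hn).1 hu.1.1.isW12
    rw [hF.yamabeQuotient_conformal hn H hu']
    refine iInf₂_le _ ⟨⟨(hF.isW12_mul hu').memW12, ?_⟩, fun h0 => hu.2 ?_⟩
    · filter_upwards [(hF.ae_conformal_iff hn).1 hu.1.2] with x hx hxV
      rw [hx hxV, mul_zero]
    · refine (hF.ae_conformal_iff hn).2 ?_
      filter_upwards [h0, hne] with x hx hx0
      exact (mul_eq_zero.1 hx).resolve_left hx0
  -- Conversely `v` gives `φ⁻¹ v`. It belongs to `W^{1,2}` because `φ⁻¹` is itself of class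
  -- `X^{2,p}`, hence bounded, with a differential that maps `W^{1,2}` to `L²`.
  · have hv' := hv.1.1.isW12
    have hu := hv'.mul H.isC2Metric hT'.diff hK (hT'.memLp_covectorNorm_mul hn H hr hp hv')
    have e : yamabeQuotient (conformal φ g) (fun x => (φ x)⁻¹ * v x) = yamabeQuotient g v := by
      rw [hF.yamabeQuotient_conformal hn H hu]
      exact (hF.isW12_mul hu).yamabeQuotient_congr fun x hx =>
        mul_inv_cancel_left₀ (hφpos x hx).ne' _
    rw [← e]
    refine iInf₂_le (fun x => (φ x)⁻¹ * v x)
      ⟨⟨((hF.isW12_conformal_iff hn).2 hu).memW12, ?_⟩, fun h0 => hv.2 ?_⟩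
    · refine (hF.ae_conformal_iff hn).2 ?_
      filter_upwards [hv.1.2] with x hx hxV
      rw [hx hxV, mul_zero]
    · filter_upwards [(hF.ae_conformal_iff hn).1 h0, hne] with x hx hx0
      exact (mul_eq_zero.1 hx).resolve_left (inv_ne_zero hx0)
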